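/- Let $(X^{2n},\omega)$ be a compact symplectic manifold with a real structure, i.e. a smooth involution $c$ with $c^*\omega=-\omega$; let $J$ be an almost complex structure compatible with $\omega$ (so that $g=\omega(\cdot,J\cdot)$ is a Riemannian metric) with $dc\circ J=-J\circ dc$. Let $L\to X$ be a Hermitian line bundle with a unitary connection $\nabla$ of curvature $-i\omega$, and let $\hat c:L\to L$ be an antilinear involution lifting $c$ and preserving the Hermitian metric and $\nabla$. Give each $L^k$ the induced metric, connection and lift of $c$ (still denoted $\hat c$), and call a section $s$ of $L^k$ symmetric if $s\circ c=\hat c\circ s$. A sequence $(s_k)_{k\ge1}$ of smooth sections of $L^k$ is asymptotically holomorphic (AH) if there is a constant $C$ independent of $k$ with $|\nabla^{0,1}s_k|\le C$, $|\nabla s_k|\le C\sqrt k$, $|\nabla\nabla s_k|\le Ck$ (norms for $g$; $\nabla\nabla$ is formed with the Levi-Civita connection of $g$). A section $s$ of $L^k\oplus L^k$ is $\eta$-transverse if at every $x$ with $|s(x)|\le\eta$ the operator $\nabla s(x)$ has a right inverse of norm at most $(\eta\sqrt k)^{-1}$. Let $s_0=(s_{0,k})_k$ and $s_1=(s_{1,k})_k$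 be AH sequences of symmetric sections such that, for some $\eta>0$, $s_{0,k}\oplus s_{1,k}$ is $\eta$-transverse for all large $k$. Then for every $\delta>0$ there are AH sequences of symmetric sections $\tilde s_0,\tilde s_1$ such that $\tilde s_{0,k}\oplus\tilde s_{1,k}$ is $\eta'$-transverse for all large $k$, for some $\eta'>0$ independent of $k$; there is a constant $C$ independent of $k$ such that, for all large $k$, with $s=s_{0,k}\oplus s_{1,k}$ and $\tilde s=\tilde s_{0,k}\oplus\tilde s_{1,k}$, $$|\tilde s-s|\le C/\sqrt k,\qquad |\nabla\tilde s-\nabla s|\le C\qquad\text{on } X;$$ and, for all large $k$: 1. $\tilde s=s$ at all points where $|s|\ge\delta$, and $\tilde s$ and $s$ have the same zero set $N$; 2. $F=\tilde s_{1,k}/\tilde s_{0,k}:X\setminus N\to\mathbb P^1$ is symmetric: $c(X\setminus N)\subset X\setminus N$ and $F\circ c=\overline F$; 3. at every $x\in N$, put $D_x=\nabla\tilde s(x):T_xX\to L^k_x\oplus L^k_x$, whose kernel is $T_xN$, and let $N_0$ be the $\omega$-orthogonal of $T_xN$ in $T_xX$. Then $D_x$ restricts to a real isomorphism from $N_0$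 onto $L^k_x\oplus L^k_x$, and, for the complex structure $j=j(D)$ on $N_0$ pulled back by it, $\omega|_{N_0}$ is of type $(1,1)$ and positive: $\omega(ju,jv)=\omega(u,v)$ for all $u,v\in N_0$, and $\omega(u,ju)>0$ for $0\ne u\in N_0$. -/

import Mathlib

open Bundle Manifold Filter
open scoped ContDiff Topology TensorProduct

noncomputable section RealPencil

/-- The Euclidean model `ℝ^{2n}` of a `2n`-dimensional manifold. -/
abbrev RModel (n : ℕ) : Type := EuclideanSpace ℝ (Fin (2 * n))

section Base

variable {n : ℕ} {X : Type*} [TopologicalSpace X] [ChartedSpace (RModel n) X]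

/-- A smooth 2-form `Ω` on `X` (a smooth field of bilinear forms) that is alternating, closed and
nondegenerate. Closedness is the vanishing of `dΩ(U, V, W)` for all smooth vector fields. -/
structure IsSymplecticForm [IsManifold (𝓡 (2 * n)) ∞ X]
    (Ω : ∀ x : X, TangentSpace (𝓡 (2 * n)) x →L[ℝ] TangentSpace (𝓡 (2 * n)) x →L[ℝ] ℝ) :
    Prop where
  smooth : ContMDiff (𝓡 (2 * n)) ((𝓡 (2 * n)).prod 𝓘(ℝ, RModel n →L[ℝ] RModel n →L[ℝ] ℝ)) ∞
    (fun x ↦ TotalSpace.mk' (RModel n →L[ℝ] RModel n →L[ℝ] ℝ) x (Ω x))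
  alternating : ∀ (x : X) (u : TangentSpace (𝓡 (2 * n)) x), Ω x u u = 0
  nondegenerate : ∀ (x : X) (u : TangentSpace (𝓡 (2 * n)) x), (∀ v, Ω x u v = 0) → u = 0
  closed : ∀ U V W : (∀ x : X, TangentSpace (𝓡 (2 * n)) x),
    ContMDiff (𝓡 (2 * n)) (𝓡 (2 * n)).tangent ∞
      (fun x ↦ (⟨x, U x⟩ : TangentBundle (𝓡 (2 * n)) X)) →
    ContMDiff (𝓡 (2 * n)) (𝓡 (2 * n)).tangent ∞
      (fun x ↦ (⟨x, V x⟩ : TangentBundle (𝓡 (2 * n)) X)) →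
    ContMDiff (𝓡 (2 * n)) (𝓡 (2 * n)).tangent ∞
      (fun x ↦ (⟨x, W x⟩ : TangentBundle (𝓡 (2 * n)) X)) →
    ∀ x : X,
      mvfderiv (𝓡 (2 * n)) (fun y ↦ Ω y (V y) (W y)) x (U x)
        - mvfderiv (𝓡 (2 * n)) (fun y ↦ Ω y (U y) (W y)) x (V x)
        + mvfderiv (𝓡 (2 * n)) (fun y ↦ Ω y (U y) (V y)) x (W x)
        - Ω x (VectorField.mlieBracket (𝓡 (2 * n)) U V x) (W x)
        + Ω x (VectorField.mlieBracket (𝓡 (2 * n)) U W x) (V x)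
        - Ω x (VectorField.mlieBracket (𝓡 (2 * n)) V W x) (U x) = 0

/-- A smooth almost complex structure `J` compatible with `Ω`: `g = Ω(·, J·)` is a Riemannian
metric. -/
structure IsCompatibleComplexStructure [IsManifold (𝓡 (2 * n)) ∞ X]
    (Ω : ∀ x : X, TangentSpace (𝓡 (2 * n)) x →L[ℝ] TangentSpace (𝓡 (2 * n)) x →L[ℝ] ℝ)
    (J : ∀ x : X, TangentSpace (𝓡 (2 * n)) x →L[ℝ] TangentSpace (𝓡 (2 * n)) x) : Prop where
  smooth : ContMDiff (𝓡 (2 * n)) ((𝓡 (2 * n)).prod 𝓘(ℝ, RModel n →L[ℝ] RModel n)) ∞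
    (fun x ↦ TotalSpace.mk' (RModel n →L[ℝ] RModel n) x (J x))
  sq : ∀ (x : X) (u : TangentSpace (𝓡 (2 * n)) x), J x (J x u) = -u
  symm : ∀ (x : X) (u v : TangentSpace (𝓡 (2 * n)) x), Ω x u (J x v) = Ω x v (J x u)
  pos : ∀ (x : X) (u : TangentSpace (𝓡 (2 * n)) x), u ≠ 0 → 0 < Ω x u (J x u)

/-- A real structure: a smooth involution `c` with `c^* Ω = -Ω` and `dc ∘ J = - J ∘ dc`. -/
structure IsRealStructure
    (Ω : ∀ x : X, TangentSpace (𝓡 (2 * n)) x →L[ℝ] TangentSpace (𝓡 (2 * n)) x →L[ℝ] ℝ)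
    (J : ∀ x : X, TangentSpace (𝓡 (2 * n)) x →L[ℝ] TangentSpace (𝓡 (2 * n)) x)
    (c : X → X) : Prop where
  smooth : ContMDiff (𝓡 (2 * n)) (𝓡 (2 * n)) ∞ c
  involutive : Function.Involutive c
  antisymplectic : ∀ (x : X) (u v : TangentSpace (𝓡 (2 * n)) x),
    Ω (c x) (mfderiv (𝓡 (2 * n)) (𝓡 (2 * n)) c x u)
      (mfderiv (𝓡 (2 * n)) (𝓡 (2 * n)) c x v) = -Ω x u v
  antiholomorphic : ∀ (x : X) (u : TangentSpace (𝓡 (2 * n)) x),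
    mfderiv (𝓡 (2 * n)) (𝓡 (2 * n)) c x (J x u)
      = -J (c x) (mfderiv (𝓡 (2 * n)) (𝓡 (2 * n)) c x u)

/-- The norm of a tangent vector for the metric `g = Ω(·, J·)`. -/
def gNorm (Ω : ∀ x : X, TangentSpace (𝓡 (2 * n)) x →L[ℝ] TangentSpace (𝓡 (2 * n)) x →L[ℝ] ℝ)
    (J : ∀ x : X, TangentSpace (𝓡 (2 * n)) x →L[ℝ] TangentSpace (𝓡 (2 * n)) x)
    (x : X) (u : TangentSpace (𝓡 (2 * n)) x) : ℝ :=
  Real.sqrt (Ω x u (J x u))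

/-- `D` is the Levi-Civita connection of the metric `g = Ω(·, J·)`: it is torsion free and
preserves `g`. -/
structure IsLeviCivita [IsManifold (𝓡 (2 * n)) ∞ X]
    (Ω : ∀ x : X, TangentSpace (𝓡 (2 * n)) x →L[ℝ] TangentSpace (𝓡 (2 * n)) x →L[ℝ] ℝ)
    (J : ∀ x : X, TangentSpace (𝓡 (2 * n)) x →L[ℝ] TangentSpace (𝓡 (2 * n)) x)
    (D : CovariantDerivative (𝓡 (2 * n)) (RModel n)
      (TangentSpace (𝓡 (2 * n)) : X → Type _)) : Prop where
  torsion_free : D.torsion = 0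
  metric : ∀ (V W : ∀ x : X, TangentSpace (𝓡 (2 * n)) x) (x : X),
    MDifferentiableAt (𝓡 (2 * n)) (𝓡 (2 * n)).tangent
      (fun y ↦ (⟨y, V y⟩ : TangentBundle (𝓡 (2 * n)) X)) x →
    MDifferentiableAt (𝓡 (2 * n)) (𝓡 (2 * n)).tangent
      (fun y ↦ (⟨y, W y⟩ : TangentBundle (𝓡 (2 * n)) X)) x →
    ∀ u : TangentSpace (𝓡 (2 * n)) x,
      mvfderiv (𝓡 (2 * n)) (fun y ↦ Ω y (V y) (J y (W y))) x u
        = Ω x (D V x u) (J x (W x)) + Ω x (V x) (J x (D W x u))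

end Base

section LineBundle

variable {n : ℕ} {X : Type*} [TopologicalSpace X] [ChartedSpace (RModel n) X]
  {L : X → Type*} [TopologicalSpace (TotalSpace ℂ L)]
  [∀ x, NormedAddCommGroup (L x)] [∀ x, InnerProductSpace ℂ (L x)]
  [FiberBundle ℂ L]

variable (L) in
/-- The local frame of `L` near `x₀` given by the trivialization at `x₀`. -/
def lFrame (x₀ y : X) : L y := (trivializationAt ℂ L x₀).symm y 1

variable (L) in
/-- The Hermitian metric of the line bundle `L` is smooth: `|e|²` is smooth for the local frames
`e` of `L`. -/
def IsSmoothHermitian (n : ℕ) [ChartedSpace (RModel n) X] : Prop :=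
  ∀ x₀ : X, ContMDiffAt (𝓡 (2 * n)) 𝓘(ℝ, ℝ) ∞ (fun y ↦ ‖lFrame L x₀ y‖ ^ 2) x₀

/-- `cov` is a smooth unitary connection of curvature `-iΩ` on the Hermitian line bundle `L`. -/
structure IsPrequantumConnection [VectorBundle ℝ ℂ L] [IsManifold (𝓡 (2 * n)) ∞ X]
    (Ω : ∀ x : X, TangentSpace (𝓡 (2 * n)) x →L[ℝ] TangentSpace (𝓡 (2 * n)) x →L[ℝ] ℝ)
    (cov : CovariantDerivative (𝓡 (2 * n)) ℂ L) : Prop where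
  smooth : cov.ContMDiffCovariantDerivative ∞
  complex_linear : ∀ (e : ∀ x, L x) (x : X),
    MDifferentiableAt (𝓡 (2 * n)) ((𝓡 (2 * n)).prod 𝓘(ℝ, ℂ))
      (fun y ↦ TotalSpace.mk' ℂ y (e y)) x →
    ∀ u : TangentSpace (𝓡 (2 * n)) x,
      cov (fun y ↦ Complex.I • e y) x u = Complex.I • cov e x u
  unitary : ∀ (e f : ∀ x, L x) (x : X),
    MDifferentiableAt (𝓡 (2 * n)) ((𝓡 (2 * n)).prod 𝓘(ℝ, ℂ))
      (fun y ↦ TotalSpace.mk' ℂ y (e y)) x →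
    MDifferentiableAt (𝓡 (2 * n)) ((𝓡 (2 * n)).prod 𝓘(ℝ, ℂ))
      (fun y ↦ TotalSpace.mk' ℂ y (f y)) x →
    ∀ u : TangentSpace (𝓡 (2 * n)) x,
      mvfderiv (𝓡 (2 * n)) (fun y ↦ inner ℂ (e y) (f y)) x u
        = inner ℂ (cov e x u) (f x) + inner ℂ (e x) (cov f x u)
  curvature : ∀ (U V : ∀ x : X, TangentSpace (𝓡 (2 * n)) x) (e : ∀ x, L x),
    ContMDiff (𝓡 (2 * n)) (𝓡 (2 * n)).tangent ∞
      (fun x ↦ (⟨x, U x⟩ : TangentBundle (𝓡 (2 * n)) X)) →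
    ContMDiff (𝓡 (2 * n)) (𝓡 (2 * n)).tangent ∞
      (fun x ↦ (⟨x, V x⟩ : TangentBundle (𝓡 (2 * n)) X)) →
    ContMDiff (𝓡 (2 * n)) ((𝓡 (2 * n)).prod 𝓘(ℝ, ℂ)) ∞ (fun x ↦ TotalSpace.mk' ℂ x (e x)) →
    ∀ x : X,
      cov (fun y ↦ cov e y (V y)) x (U x) - cov (fun y ↦ cov e y (U y)) x (V x)
          - cov e x (VectorField.mlieBracket (𝓡 (2 * n)) U V x)
        = (-(Complex.I * (Ω x (U x) (V x) : ℂ))) • e x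

/-- A real structure on `(L, cov)` over `c`: a smooth antilinear involution `chat` of `L` lifting
`c`, preserving the Hermitian metric and the connection. Preservation of the connection is
stated for pairs `e, e'` with `e' ∘ c = chat ∘ e`, that is `e' = κ(e)`. -/
structure IsRealLineStructure
    (cov : CovariantDerivative (𝓡 (2 * n)) ℂ L) (c : X → X)
    (chat : ∀ x, L x →ₛₗ[starRingEnd ℂ] L (c x)) : Prop where
  smooth : ContMDiff ((𝓡 (2 * n)).prod 𝓘(ℝ, ℂ)) ((𝓡 (2 * n)).prod 𝓘(ℝ, ℂ)) ∞
    (fun p : TotalSpace ℂ L ↦ (⟨c p.1, chat p.1 p.2⟩ : TotalSpace ℂ L))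
  involutive : ∀ (x : X) (v : L x),
    (⟨c (c x), chat (c x) (chat x v)⟩ : TotalSpace ℂ L) = ⟨x, v⟩
  isometric : ∀ (x : X) (v : L x), ‖chat x v‖ = ‖v‖
  invariant : ∀ e e' : (∀ x, L x),
    ContMDiff (𝓡 (2 * n)) ((𝓡 (2 * n)).prod 𝓘(ℝ, ℂ)) ∞ (fun x ↦ TotalSpace.mk' ℂ x (e x)) →
    ContMDiff (𝓡 (2 * n)) ((𝓡 (2 * n)).prod 𝓘(ℝ, ℂ)) ∞ (fun x ↦ TotalSpace.mk' ℂ x (e' x)) →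
    (∀ x, e' (c x) = chat x (e x)) →
    ∀ (x : X) (u : TangentSpace (𝓡 (2 * n)) x),
      cov e' (c x) (mfderiv (𝓡 (2 * n)) (𝓡 (2 * n)) c x u) = chat x (cov e x u)

/-! ### The powers `L^k` -/

variable (L) in
/-- The fibre at `x` of the `k`-th tensor power `L^k`. -/
abbrev LPow (k : ℕ) (x : X) : Type _ := ⨂[ℂ]^k (L x)

/-- The frame `e^{⊗k}` of `L^k` at the point `x`, where `e = lFrame L x`. -/
def powFrame (k : ℕ) (x : X) : LPow L k x := PiTensorProduct.tprod ℂ (fun _ ↦ lFrame L x x)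

variable [VectorBundle ℂ ℂ L]

/-- The coordinate of an element of `L^k_y` in the frame `e^{⊗k}`, where `e = lFrame L x₀` is the
frame near `x₀`: it sends `v₁ ⊗ ⋯ ⊗ v_k` to the product of the coordinates of the `v_i`. -/
def powCoord (k : ℕ) (x₀ y : X) : LPow L k y →ₗ[ℂ] ℂ :=
  PiTensorProduct.lift ((MultilinearMap.mkPiAlgebra ℂ (Fin k) ℂ).compLinearMap
    (fun _ ↦ (trivializationAt ℂ L x₀).linearMapAt ℂ y))

/-- The Hermitian norm of `L^k_x` : `|a e^{⊗k}| = |a| |e|^k`. -/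
def powNorm (k : ℕ) (x : X) (t : LPow L k x) : ℝ :=
  ‖powCoord k x x t‖ * ‖lFrame L x x‖ ^ k

/-- The norm of `L^k_x ⊕ L^k_x`. -/
def pairNorm (k : ℕ) (x : X) (w : LPow L k x × LPow L k x) : ℝ :=
  Real.sqrt (powNorm k x w.1 ^ 2 + powNorm k x w.2 ^ 2)

/-- The antilinear lift of `c` to `L^k` : `a e^{⊗k} ↦ ā (chat e)^{⊗k}`. -/
def chatPow {c : X → X} (chat : ∀ x, L x →ₛₗ[starRingEnd ℂ] L (c x)) (k : ℕ) (x : X)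
    (t : LPow L k x) : LPow L k (c x) :=
  (starRingEnd ℂ (powCoord k x x t)) • PiTensorProduct.tprod ℂ (fun _ ↦ chat x (lFrame L x x))

/-- A section of `L^k` is smooth if its coordinates in the local frames are smooth. -/
def IsSmoothSection (n k : ℕ) [ChartedSpace (RModel n) X] (s : ∀ x, LPow L k x) : Prop :=
  ∀ x₀ : X, ContMDiffAt (𝓡 (2 * n)) 𝓘(ℝ, ℂ) ∞ (fun y ↦ powCoord k x₀ y (s y)) x₀

/-- A section `s` is symmetric if `κ(s) = s`, i.e. if `s (c x) = ĉ (s x)`. -/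
def IsSymmetricSection {c : X → X} (chat : ∀ x, L x →ₛₗ[starRingEnd ℂ] L (c x)) (k : ℕ)
    (s : ∀ x, LPow L k x) : Prop :=
  ∀ x, s (c x) = chatPow chat k x (s x)

/-- The connection form `θ` of `cov` at `x` in the frame `e = lFrame L x` : `∇e = θ ⊗ e`. -/
def connForm (cov : CovariantDerivative (𝓡 (2 * n)) ℂ L) (x : X) :
    TangentSpace (𝓡 (2 * n)) x →ₗ[ℝ] ℂ :=
  ((trivializationAt ℂ L x).linearMapAt ℂ x).restrictScalars ℝ ∘ₗ
    (cov (lFrame L x) x : TangentSpace (𝓡 (2 * n)) x →ₗ[ℝ] L x)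

/-- The covariant derivative induced on `L^k` : `∇(f e^{⊗k}) = (df + k f θ) e^{⊗k}`. -/
def nabla (cov : CovariantDerivative (𝓡 (2 * n)) ℂ L) (k : ℕ) (s : ∀ x, LPow L k x) (x : X) :
    TangentSpace (𝓡 (2 * n)) x →ₗ[ℝ] LPow L k x :=
  ((mvfderiv (𝓡 (2 * n)) (fun y ↦ powCoord k x y (s y)) x :
      TangentSpace (𝓡 (2 * n)) x →ₗ[ℝ] ℂ)
    + ((k : ℂ) * powCoord k x x (s x)) • connForm cov x).smulRight (powFrame k x)

/-- The `(0,1)` part of the covariant derivative, `∇^{0,1} s = (∇s + i ∇s ∘ J) / 2`. -/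
def dbar (J : ∀ x : X, TangentSpace (𝓡 (2 * n)) x →L[ℝ] TangentSpace (𝓡 (2 * n)) x)
    (cov : CovariantDerivative (𝓡 (2 * n)) ℂ L) (k : ℕ) (s : ∀ x, LPow L k x) (x : X)
    (u : TangentSpace (𝓡 (2 * n)) x) : LPow L k x :=
  (2⁻¹ : ℂ) • (nabla cov k s x u + Complex.I • nabla cov k s x (J x u))

/-- The second covariant derivative `(∇∇s)(u, v) = ∇_u (∇_V s) - ∇_{D_u V} s` at `x`, where `D` is
a connection on `TX` and `V` is a smooth local extension of `v`. -/
def nablaTwo [IsManifold (𝓡 (2 * n)) ∞ X]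
    (D : CovariantDerivative (𝓡 (2 * n)) (RModel n) (TangentSpace (𝓡 (2 * n)) : X → Type _))
    (cov : CovariantDerivative (𝓡 (2 * n)) ℂ L) (k : ℕ) (s : ∀ x, LPow L k x) (x : X)
    (u v : TangentSpace (𝓡 (2 * n)) x) : LPow L k x :=
  nabla cov k (fun y ↦ nabla cov k s y (FiberBundle.extend (RModel n) v y)) x u
    - nabla cov k s x (D (FiberBundle.extend (RModel n) v) x u)

/-- Asymptotically holomorphic (AH) sequences of sections of `L^k`. -/
def IsAH [IsManifold (𝓡 (2 * n)) ∞ X]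
    (Ω : ∀ x : X, TangentSpace (𝓡 (2 * n)) x →L[ℝ] TangentSpace (𝓡 (2 * n)) x →L[ℝ] ℝ)
    (J : ∀ x : X, TangentSpace (𝓡 (2 * n)) x →L[ℝ] TangentSpace (𝓡 (2 * n)) x)
    (D : CovariantDerivative (𝓡 (2 * n)) (RModel n) (TangentSpace (𝓡 (2 * n)) : X → Type _))
    (cov : CovariantDerivative (𝓡 (2 * n)) ℂ L) (s : ∀ (k : ℕ) (x : X), LPow L k x) : Prop :=
  ∃ C : ℝ, ∀ k : ℕ, 1 ≤ k → ∀ x : X,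
    (∀ u, powNorm k x (dbar J cov k (s k) x u) ≤ C * gNorm Ω J x u) ∧
    (∀ u, powNorm k x (nabla cov k (s k) x u) ≤ C * Real.sqrt k * gNorm Ω J x u) ∧
    (∀ u v, powNorm k x (nablaTwo D cov k (s k) x u v)
      ≤ C * k * (gNorm Ω J x u * gNorm Ω J x v))

/-! ### Pairs of sections -/

/-- The operator `D_x = ∇s₀ ⊕ ∇s₁ : T_xX → L^k_x ⊕ L^k_x`. -/
def pairNabla (cov : CovariantDerivative (𝓡 (2 * n)) ℂ L) (k : ℕ) (s₀ s₁ : ∀ x, LPow L k x)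
    (x : X) : TangentSpace (𝓡 (2 * n)) x →ₗ[ℝ] LPow L k x × LPow L k x :=
  (nabla cov k s₀ x).prod (nabla cov k s₁ x)

/-- `η`-transversality of `s₀ ⊕ s₁` : wherever `|s₀ ⊕ s₁| ≤ η`, the covariant derivative has a right
inverse of norm at most `(η √k)⁻¹`. -/
def IsPairTransverse
    (Ω : ∀ x : X, TangentSpace (𝓡 (2 * n)) x →L[ℝ] TangentSpace (𝓡 (2 * n)) x →L[ℝ] ℝ)
    (J : ∀ x : X, TangentSpace (𝓡 (2 * n)) x →L[ℝ] TangentSpace (𝓡 (2 * n)) x)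
    (cov : CovariantDerivative (𝓡 (2 * n)) ℂ L) (η : ℝ) (k : ℕ) (s₀ s₁ : ∀ x, LPow L k x) :
    Prop :=
  ∀ x : X, pairNorm k x (s₀ x, s₁ x) ≤ η →
    ∃ R : LPow L k x × LPow L k x →ₗ[ℝ] TangentSpace (𝓡 (2 * n)) x,
      (∀ w, pairNabla cov k s₀ s₁ x (R w) = w) ∧
      ∀ w, gNorm Ω J x (R w) ≤ (η * Real.sqrt k)⁻¹ * pairNorm k x w

/-- The symplectic normal space `N₀` at `x` : the `Ω`-orthogonal of `ker D_x` (`= T_xN`). -/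
def sympNormal
    (Ω : ∀ x : X, TangentSpace (𝓡 (2 * n)) x →L[ℝ] TangentSpace (𝓡 (2 * n)) x →L[ℝ] ℝ)
    (cov : CovariantDerivative (𝓡 (2 * n)) ℂ L) (k : ℕ) (s₀ s₁ : ∀ x, LPow L k x) (x : X) :
    Submodule ℝ (TangentSpace (𝓡 (2 * n)) x) where
  carrier := {u | ∀ v, pairNabla cov k s₀ s₁ x v = 0 → Ω x u v = 0}
  add_mem' := by
    intro a b ha hb v hv
    simp [ha v hv, hb v hv]
  zero_mem' := by
    intro v _
    simp
  smul_mem' := by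
    intro r a ha v hv
    simp [ha v hv]

/-- `D_x` restricts to an isomorphism of `N₀` onto `L^k_x ⊕ L^k_x`, and `Ω` restricted to `N₀` is
`(1,1)` and positive for the complex structure `j = j(D)` on `N₀` pulled back by it. -/
def IsNormalPositive
    (Ω : ∀ x : X, TangentSpace (𝓡 (2 * n)) x →L[ℝ] TangentSpace (𝓡 (2 * n)) x →L[ℝ] ℝ)
    (cov : CovariantDerivative (𝓡 (2 * n)) ℂ L) (k : ℕ) (s₀ s₁ : ∀ x, LPow L k x) (x : X) :
    Prop :=
  Function.Bijective ((pairNabla cov k s₀ s₁ x).domRestrict (sympNormal Ω cov k s₀ s₁ x)) ∧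
  ∃ j : sympNormal Ω cov k s₀ s₁ x →ₗ[ℝ] sympNormal Ω cov k s₀ s₁ x,
    (∀ u : sympNormal Ω cov k s₀ s₁ x,
      pairNabla cov k s₀ s₁ x (j u) = Complex.I • pairNabla cov k s₀ s₁ x u) ∧
    (∀ u v : sympNormal Ω cov k s₀ s₁ x, Ω x (j u) (j v) = Ω x u v) ∧
    (∀ u : sympNormal Ω cov k s₀ s₁ x, u ≠ 0 → 0 < Ω x u (j u))

open Classical in
/-- The map `F = s₁ / s₀` with values in `ℙ¹ = ℂ ∪ {∞}`, meaningful off `N = {s₀ = s₁ = 0}`. -/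
def pencil (k : ℕ) (s₀ s₁ : ∀ x, LPow L k x) (x : X) : OnePoint ℂ :=
  if s₀ x = 0 then OnePoint.infty
  else ((powCoord k x x (s₁ x) / powCoord k x x (s₀ x) : ℂ) : OnePoint ℂ)

/-- `F` is symmetric: off `N`, `F ∘ c` is the complex conjugate of `F`. -/
def IsSymmetricPencil (c : X → X) (k : ℕ) (s₀ s₁ : ∀ x, LPow L k x) : Prop :=
  ∀ x, ¬(s₀ x = 0 ∧ s₁ x = 0) →
    ¬(s₀ (c x) = 0 ∧ s₁ (c x) = 0) ∧
    pencil k s₀ s₁ (c x) = OnePoint.map (starRingEnd ℂ) (pencil k s₀ s₁ x)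

end LineBundle

end RealPencil

/-! The obstruction at a point of `N` is a single complex number. Let Π be the complex bilinear
Poisson pairing of complex-valued 1-forms dual to `Ω`. If `l` is a real functional on `L^k ⊕ L^k`,
the Hamiltonian vector of `l ∘ D_x` lies in `N₀`, and these vectors fill `N₀`. Tested on them,
invariance of `Ω` under `j` becomes the vanishing of Π on the complex span of `∇s₀` and `∇s₁`, that
is, by antisymmetry, the one equation Π(∇s₀, ∇s₁) = 0. The isomorphism and the positivity come for
free when `k` is large: `D_x` is complex linear up to O(1), while its right inverse has norm
O(k^{-1/2}) (`CompatiblePair.normal_positive`, `isNormalPositive_of_poisson`).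

Only `s₁` is changed. Π vanishes on pairs of complex linear forms and pairs a nonzero one
nontrivially with its conjugate. Asymptotic holomorphicity and transversality therefore give Π(∇s₀,
∇s₁) = O(√k) and |Π(∇s₀, conj ∇s₀)| ≥ ck wherever |s| ≤ k^{-1/2} (`hasPairingBounds`). Put b =
-Π(∇s₀, ∇s₁) / Π(∇s₀, conj ∇s₀), of size O(k^{-1/2}), and f = χ(k|s|²) b conj(s₀). Along `N` one has
∇f = b conj(∇s₀), so Π(∇s₀, ∇(s₁ + f)) = 0. Since `f` is a multiple of conj(s₀), the zero set does
not move. Since `f` lives where |s|² < 1/k, it is O(1/k), and its derivative is O(1), which is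
harmless for transversality and for ∂̄.

The difficulty is the bound ∇∇f = O(k): `b` contains `∇s₀` and `∇s₁`, so its second derivative
contains third derivatives of the sections, and nothing uniform in `k` is known about them. The
derivatives in `b` are therefore replaced by covariant difference quotients with the variable step
(√(|s|² + κ²) - κ)/√k. This step vanishes exactly on the common zeros, where the quotient is the
true derivative, and it is of order |s|/√k when |s| ≥ κ. The second derivative of the quotient is
then O(k^{3/2}/|s|), and the factor conj(s₀) in `f` pays for the division by |s|. Where |s| < κ,
plain smoothness gives some bound M without control in `k`; choosing κ with κM ≤ k makes |s|M
harmless too. `WeightedBound` records such estimates; `weightedBound_regDeriv`, `corr_bounds` and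
`jetBound_cutPert` carry them to `f`. The estimates are made point by point, in the gauge where the
connection form vanishes at the point considered.

The equation imposed on `f` along `N` is linear in `f`, so local solutions are glued by a partition
of unity (`exists_isCorrection`). It is also preserved by the real structure, so averaging a
solution with its conjugate makes it symmetric (`exists_symmetric_isCorrection`). -/

set_option linter.unusedSectionVars false

/-! ### Calculus of pointwise bounds on 2-jets. -/

noncomputable section TwoJets

variable {V W G : Type*} [NormedAddCommGroup V] [NormedSpace ℝ V]
  [NormedAddCommGroup W] [NormedSpace ℝ W] [NormedAddCommGroup G] [NormedSpace ℝ G]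

/-- Pointwise bounds `a₀, a₁, a₂` on the value and the first two derivatives of `h` at `x`. -/
structure JetBound (h : V → G) (x : V) (a₀ a₁ a₂ : ℝ) : Prop where
  contDiffAt : ContDiffAt ℝ 2 h x
  zero : ‖h x‖ ≤ a₀
  one : ‖fderiv ℝ h x‖ ≤ a₁
  nonneg₂ : 0 ≤ a₂
  two (u v : V) : ‖fderiv ℝ (fderiv ℝ h) x u v‖ ≤ a₂ * ‖u‖ * ‖v‖

namespace JetBound

variable {h h' : V → G} {x : V} {a₀ a₁ a₂ b₀ b₁ b₂ : ℝ}

theorem nonneg₀ (H : JetBound h x a₀ a₁ a₂) : 0 ≤ a₀ := (norm_nonneg _).trans H.zero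
theorem nonneg₁ (H : JetBound h x a₀ a₁ a₂) : 0 ≤ a₁ := (norm_nonneg _).trans H.one

theorem mono (H : JetBound h x a₀ a₁ a₂) (h₀ : a₀ ≤ b₀) (h₁ : a₁ ≤ b₁) (h₂ : a₂ ≤ b₂) :
    JetBound h x b₀ b₁ b₂ :=
  ⟨H.contDiffAt, H.zero.trans h₀, H.one.trans h₁, H.nonneg₂.trans h₂,
    fun u v ↦ (H.two u v).trans (by gcongr)⟩

theorem eventually_differentiableAt (H : ContDiffAt ℝ 2 h x) :
    ∀ᶠ y in 𝓝 x, DifferentiableAt ℝ h y := by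
  filter_upwards [H.eventually (by simp)] with y (hy : ContDiffAt ℝ 2 h y) using hy.differentiableAt (by norm_num)

theorem fderiv_differentiableAt (H : ContDiffAt ℝ 2 h x) :
    DifferentiableAt ℝ (fderiv ℝ h) x :=
  (H.fderiv_right (m := 1) (by norm_num)).differentiableAt (by norm_num)

theorem congr (H : JetBound h x a₀ a₁ a₂) (e : h' =ᶠ[𝓝 x] h) : JetBound h' x a₀ a₁ a₂ :=
  ⟨H.contDiffAt.congr_of_eventuallyEq e, e.eq_of_nhds ▸ H.zero, e.fderiv_eq (𝕜 := ℝ) ▸ H.one,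
    H.nonneg₂, (e.fderiv (𝕜 := ℝ)).fderiv_eq (𝕜 := ℝ) ▸ H.two⟩

theorem add (H : JetBound h x a₀ a₁ a₂) (H' : JetBound h' x b₀ b₁ b₂) :
    JetBound (fun y ↦ h y + h' y) x (a₀ + b₀) (a₁ + b₁) (a₂ + b₂) := by
  have e : fderiv ℝ (fun y ↦ h y + h' y) =ᶠ[𝓝 x] fun y ↦ fderiv ℝ h y + fderiv ℝ h' y := by
    filter_upwards [eventually_differentiableAt H.contDiffAt,
      eventually_differentiableAt H'.contDiffAt] with y h₁ h₂ using fderiv_fun_add h₁ h₂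
  refine ⟨H.contDiffAt.add H'.contDiffAt, (norm_add_le _ _).trans (add_le_add H.zero H'.zero),
    ?_, add_nonneg H.nonneg₂ H'.nonneg₂, fun u v ↦ ?_⟩
  · rw [e.eq_of_nhds]
    exact (norm_add_le _ _).trans (add_le_add H.one H'.one)
  · rw [e.fderiv_eq, fderiv_fun_add (fderiv_differentiableAt H.contDiffAt)
      (fderiv_differentiableAt H'.contDiffAt)]
    refine (norm_add_le _ _).trans ((add_le_add (H.two u v) (H'.two u v)).trans_eq ?_)
    ring

theorem neg (H : JetBound h x a₀ a₁ a₂) : JetBound (fun y ↦ -h y) x a₀ a₁ a₂ := by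
  have e : fderiv ℝ (fun y ↦ -h y) = fun y ↦ -fderiv ℝ h y := by
    ext1 y; exact fderiv_fun_neg
  refine ⟨H.contDiffAt.neg, by simpa using H.zero, by simpa [e] using H.one, H.nonneg₂,
    fun u v ↦ ?_⟩
  rw [e, fderiv_fun_neg, neg_apply, neg_apply, norm_neg]
  exact H.two u v

theorem sub (H : JetBound h x a₀ a₁ a₂) (H' : JetBound h' x b₀ b₁ b₂) :
    JetBound (fun y ↦ h y - h' y) x (a₀ + b₀) (a₁ + b₁) (a₂ + b₂) := by
  simpa only [sub_eq_add_neg] using H.add H'.neg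

theorem sum {ι : Type*} (s : Finset ι) {f : ι → V → G} {a b c : ι → ℝ}
    (H : ∀ i ∈ s, JetBound (f i) x (a i) (b i) (c i)) :
    JetBound (fun y ↦ ∑ i ∈ s, f i y) x (∑ i ∈ s, a i) (∑ i ∈ s, b i) (∑ i ∈ s, c i) := by
  classical
  induction s using Finset.induction_on with
  | empty =>
    simp only [Finset.sum_empty]
    have : (fun _ : V ↦ (0 : G)) = fun _ ↦ 0 := rfl
    refine ⟨contDiffAt_const, by simp, by simp, by simp, ?_⟩
    have : fderiv ℝ (fun _ : V ↦ (0 : G)) = fun _ ↦ 0 := by ext1 y; simp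
    simp [this]
  | insert i s hi ih =>
    simp only [Finset.sum_insert hi]
    exact (H i (by simp)).add (ih fun j hj ↦ H j (by simp [hj]))

/-- Chain rule D²(f ∘ g) = D²f(Dg, Dg) + Df(D²g). The size of `g` itself plays no role, so `g` comes
with bounds on its derivatives only instead of a `JetBound`. -/
theorem comp {g : V → W} {f : W → G} {x : V} {f₀ f₁ f₂ g₁ g₂ : ℝ}
    (Hf : JetBound f (g x) f₀ f₁ f₂) (hg : ContDiffAt ℝ 2 g x)
    (h₁ : ‖fderiv ℝ g x‖ ≤ g₁) (hg₂ : 0 ≤ g₂)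
    (h₂ : ∀ u v, ‖fderiv ℝ (fderiv ℝ g) x u v‖ ≤ g₂ * ‖u‖ * ‖v‖) :
    JetBound (fun y ↦ f (g y)) x f₀ (f₁ * g₁) (f₂ * g₁ ^ 2 + f₁ * g₂) := by
  have hg₁ : 0 ≤ g₁ := (norm_nonneg _).trans h₁
  have e : fderiv ℝ (fun y ↦ f (g y)) =ᶠ[𝓝 x]
      fun y ↦ (fderiv ℝ f (g y)).comp (fderiv ℝ g y) := by
    filter_upwards [eventually_differentiableAt hg,
      hg.continuousAt.eventually (eventually_differentiableAt Hf.contDiffAt)] with y h₁ h₂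
    exact fderiv_comp (g := f) (f := g) y h₂ h₁
  have := Hf.nonneg₁
  have := Hf.nonneg₂
  refine ⟨Hf.contDiffAt.comp x hg, Hf.zero, ?_, by positivity, fun u v ↦ ?_⟩
  · rw [e.eq_of_nhds]
    exact (ContinuousLinearMap.opNorm_comp_le _ _).trans
      (mul_le_mul Hf.one h₁ (norm_nonneg _) Hf.nonneg₁)
  · have d₁ : HasFDerivAt (fun y ↦ fderiv ℝ f (g y))
        ((fderiv ℝ (fderiv ℝ f) (g x)).comp (fderiv ℝ g x)) x :=
      (fderiv_differentiableAt Hf.contDiffAt).hasFDerivAt.comp x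
        (hg.differentiableAt (by norm_num)).hasFDerivAt
    have d₂ := (fderiv_differentiableAt hg).hasFDerivAt
    rw [e.fderiv_eq, (d₁.clm_comp d₂).fderiv]
    have k₁ : ‖fderiv ℝ f (g x) (fderiv ℝ (fderiv ℝ g) x u v)‖ ≤ f₁ * (g₂ * ‖u‖ * ‖v‖) := by
      refine (ContinuousLinearMap.le_of_opNorm_le _ Hf.one _).trans ?_
      refine mul_le_mul_of_nonneg_left ?_ Hf.nonneg₁
      exact h₂ u v
    have k₂ : ‖fderiv ℝ (fderiv ℝ f) (g x) (fderiv ℝ g x u) (fderiv ℝ g x v)‖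
        ≤ f₂ * (g₁ * ‖u‖) * (g₁ * ‖v‖) := by
      refine (Hf.two _ _).trans ?_
      have hu := ContinuousLinearMap.le_of_opNorm_le _ h₁ u
      have hv := ContinuousLinearMap.le_of_opNorm_le _ h₁ v
      gcongr
    simp only [add_apply, ContinuousLinearMap.comp_apply,
      ContinuousLinearMap.compL_apply, ContinuousLinearMap.flip_apply]
    refine (norm_add_le _ _).trans ((add_le_add k₁ k₂).trans (le_of_eq ?_))
    ring

theorem mul {f g : V → ℂ} (H : JetBound f x a₀ a₁ a₂) (H' : JetBound g x b₀ b₁ b₂) :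
    JetBound (fun y ↦ f y * g y) x (a₀ * b₀) (a₀ * b₁ + a₁ * b₀)
      (a₀ * b₂ + 2 * (a₁ * b₁) + a₂ * b₀) := by
  have := H.nonneg₀; have := H.nonneg₁; have := H.nonneg₂
  have := H'.nonneg₀; have := H'.nonneg₁; have := H'.nonneg₂
  have e : fderiv ℝ (fun y ↦ f y * g y) =ᶠ[𝓝 x]
      fun y ↦ f y • fderiv ℝ g y + g y • fderiv ℝ f y := by
    filter_upwards [eventually_differentiableAt H.contDiffAt,
      eventually_differentiableAt H'.contDiffAt] with y h₁ h₂ using fderiv_fun_mul h₁ h₂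
  have df := (H.contDiffAt.differentiableAt (by norm_num)).hasFDerivAt
  have dg := (H'.contDiffAt.differentiableAt (by norm_num)).hasFDerivAt
  have ddf := (fderiv_differentiableAt H.contDiffAt).hasFDerivAt
  have ddg := (fderiv_differentiableAt H'.contDiffAt).hasFDerivAt
  have hb {q : V → ℂ} {c₀ c₁ c₂} (Hq : JetBound q x c₀ c₁ c₂) (u v : V) :
      ‖q x‖ ≤ c₀ ∧ ‖fderiv ℝ q x u‖ ≤ c₁ * ‖u‖ ∧
        ‖fderiv ℝ (fderiv ℝ q) x u v‖ ≤ c₂ * ‖u‖ * ‖v‖ :=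
    ⟨Hq.zero, ContinuousLinearMap.le_of_opNorm_le _ Hq.one u, Hq.two u v⟩
  refine ⟨H.contDiffAt.mul H'.contDiffAt, ?_, ?_, by positivity, fun u v ↦ ?_⟩
  · rw [norm_mul]; exact mul_le_mul H.zero H'.zero (norm_nonneg _) H.nonneg₀
  · rw [e.eq_of_nhds]
    refine (norm_add_le _ _).trans ?_
    rw [norm_smul, norm_smul, mul_comm a₁]
    have := H.zero; have := H'.zero; have := H.one; have := H'.one
    gcongr
  · have key : HasFDerivAt (fun y ↦ f y • fderiv ℝ g y + g y • fderiv ℝ f y) _ x :=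
      (df.smul ddg).add (dg.smul ddf)
    rw [e.fderiv_eq, key.fderiv]
    obtain ⟨p₀, p₁, p₂⟩ := hb H u v
    obtain ⟨q₀, q₁, q₂⟩ := hb H' u v
    obtain ⟨-, p₁', -⟩ := hb H v v
    obtain ⟨-, q₁', -⟩ := hb H' v v
    simp only [add_apply, smul_apply,
      ContinuousLinearMap.smulRight_apply, smul_eq_mul]
    calc _ ≤ ‖f x‖ * ‖fderiv ℝ (fderiv ℝ g) x u v‖ + ‖fderiv ℝ f x u‖ * ‖fderiv ℝ g x v‖
          + (‖g x‖ * ‖fderiv ℝ (fderiv ℝ f) x u v‖ + ‖fderiv ℝ g x u‖ * ‖fderiv ℝ f x v‖) := by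
            simp only [← norm_mul]
            exact (norm_add_le _ _).trans (add_le_add (norm_add_le _ _) (norm_add_le _ _))
      _ ≤ a₀ * (b₂ * ‖u‖ * ‖v‖) + (a₁ * ‖u‖) * (b₁ * ‖v‖)
          + (b₀ * (a₂ * ‖u‖ * ‖v‖) + (b₁ * ‖u‖) * (a₁ * ‖v‖)) := by gcongr
      _ = _ := by ring

theorem inv {d : V → ℂ} {δ : ℝ} (H : JetBound d x a₀ a₁ a₂) (hδ : 0 < δ) (hd : δ ≤ ‖d x‖) :
    JetBound (fun y ↦ (d y)⁻¹) x (δ⁻¹) (a₁ * (δ⁻¹) ^ 2)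
      (a₂ * (δ⁻¹) ^ 2 + 2 * a₁ ^ 2 * (δ⁻¹) ^ 3) := by
  have hd0 : d x ≠ 0 := fun h ↦ by simp [h] at hd; linarith
  have n₁ := H.nonneg₁; have n₂ := H.nonneg₂
  have hne : ∀ᶠ y in 𝓝 x, d y ≠ 0 := H.contDiffAt.continuousAt.eventually_ne hd0
  -- The derivative is expressed through the inverse itself, so that the second differentiation only
  -- needs the first-order bound `p₁` again.
  have e : fderiv ℝ (fun y ↦ (d y)⁻¹) =ᶠ[𝓝 x]
      fun y ↦ (-((d y)⁻¹ * (d y)⁻¹)) • fderiv ℝ d y := by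
    filter_upwards [eventually_differentiableAt H.contDiffAt, hne] with y h₁ h₂
    have := (hasFDerivAt_inv (𝕜 := ℂ) h₂).restrictScalars ℝ |>.comp y h₁.hasFDerivAt
    rw [show (fun y ↦ (d y)⁻¹) = (fun z ↦ z⁻¹) ∘ d from rfl, this.fderiv]
    ext v
    simp [pow_two]
    ring
  have dd := (H.contDiffAt.differentiableAt (by norm_num)).hasFDerivAt
  have ddd := (fderiv_differentiableAt H.contDiffAt).hasFDerivAt
  have hci : ContDiffAt ℝ 2 (fun y ↦ (d y)⁻¹) x := H.contDiffAt.inv hd0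
  have di := (hci.differentiableAt (by norm_num)).hasFDerivAt
  have hinv : ‖(d x)⁻¹‖ ≤ δ⁻¹ := by
    rw [norm_inv]; exact inv_anti₀ hδ hd
  have p₁ : ‖fderiv ℝ (fun y ↦ (d y)⁻¹) x‖ ≤ a₁ * (δ⁻¹) ^ 2 := by
    rw [e.eq_of_nhds, norm_smul, norm_neg, norm_mul, ← pow_two, mul_comm]
    gcongr
    exact H.one
  refine ⟨hci, hinv, p₁, by positivity, fun u v ↦ ?_⟩
  · have key : HasFDerivAt (fun y ↦ (-((d y)⁻¹ * (d y)⁻¹)) • fderiv ℝ d y) _ x :=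
      ((di.mul di).neg).smul ddd
    rw [e.fderiv_eq, key.fderiv]
    have q₁ := ContinuousLinearMap.le_of_opNorm_le _ H.one v
    have q₂ := H.two u v
    have p₂ := ContinuousLinearMap.le_of_opNorm_le _ p₁ u
    simp only [add_apply, smul_apply,
      ContinuousLinearMap.smulRight_apply, smul_eq_mul, neg_apply, Pi.neg_apply, Pi.mul_apply]
    calc _ ≤ ‖(d x)⁻¹‖ * ‖(d x)⁻¹‖ * ‖fderiv ℝ (fderiv ℝ d) x u v‖
          + (‖(d x)⁻¹‖ * ‖fderiv ℝ (fun y ↦ (d y)⁻¹) x u‖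
            + ‖(d x)⁻¹‖ * ‖fderiv ℝ (fun y ↦ (d y)⁻¹) x u‖) * ‖fderiv ℝ d x v‖ := by
            refine (norm_add_le _ _).trans ?_
            rw [norm_mul, norm_mul, norm_neg, norm_neg, norm_mul]
            gcongr
            exact (norm_add_le _ _).trans (by rw [norm_mul])
      _ ≤ δ⁻¹ * δ⁻¹ * (a₂ * ‖u‖ * ‖v‖)
          + (δ⁻¹ * (a₁ * (δ⁻¹) ^ 2 * ‖u‖) + δ⁻¹ * (a₁ * (δ⁻¹) ^ 2 * ‖u‖)) * (a₁ * ‖v‖) := by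
            gcongr
      _ = _ := by ring

theorem conj {f : V → ℂ} (H : JetBound f x a₀ a₁ a₂) :
    JetBound (fun y ↦ (starRingEnd ℂ) (f y)) x a₀ a₁ a₂ := by
  have e : fderiv ℝ (fun y ↦ (starRingEnd ℂ) (f y))
      = fun y ↦ (Complex.conjCLE : ℂ →L[ℝ] ℂ).comp (fderiv ℝ f y) := by
    ext1 y
    exact Complex.conjCLE.comp_fderiv (f := f) (x := y)
  have hn {U : Type _} [NormedAddCommGroup U] [NormedSpace ℝ U] (T : U →L[ℝ] ℂ) :
      ‖(Complex.conjCLE : ℂ →L[ℝ] ℂ).comp T‖ ≤ ‖T‖ :=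
    ContinuousLinearMap.opNorm_le_bound _ (norm_nonneg _) fun u ↦ by
      simpa using T.le_opNorm u
  refine ⟨(Complex.conjCLE : ℂ →L[ℝ] ℂ).contDiff.contDiffAt.comp x H.contDiffAt,
    by simpa using H.zero, ?_, H.nonneg₂, fun u v ↦ ?_⟩
  · rw [e]; exact (hn _).trans H.one
  · have key : HasFDerivAt (fun y ↦ (Complex.conjCLE : ℂ →L[ℝ] ℂ).comp (fderiv ℝ f y)) _ x :=
      (ContinuousLinearMap.compL ℝ V ℂ ℂ (Complex.conjCLE : ℂ →L[ℝ] ℂ)).hasFDerivAt.comp x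
        (fderiv_differentiableAt H.contDiffAt).hasFDerivAt
    rw [e, key.fderiv]
    simpa using H.two u v

end JetBound

end TwoJets

/-! ### Smooth difference quotients by Hadamard's lemma. -/

noncomputable section Hadamard

theorem two_le_infty : (2 : ℕ∞ω) ≤ ∞ :=
  WithTop.coe_le_coe.2 (le_top : (2 : ℕ∞) ≤ ⊤)

/-- Differentiation under the integral sign; the dominating constant comes from compactness of a
ball times `[0, 1]`. -/
theorem hasFDerivAt_parametric_intervalIntegral {P G : Type*} [NormedAddCommGroup P]
    [NormedSpace ℝ P] [FiniteDimensional ℝ P] [NormedAddCommGroup G] [NormedSpace ℝ G]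
    [CompleteSpace G] {h : P × ℝ → G} (hh : ContDiff ℝ ∞ h) (p : P) :
    HasFDerivAt (fun q ↦ ∫ t in (0 : ℝ)..1, h (q, t))
      (∫ t in (0 : ℝ)..1, (fderiv ℝ h (p, t)).comp (ContinuousLinearMap.inl ℝ P ℝ)) p := by
  have hc : Continuous fun z ↦ (fderiv ℝ h z).comp (ContinuousLinearMap.inl ℝ P ℝ) :=
    (hh.continuous_fderiv (by simp)).clm_comp continuous_const
  obtain ⟨C, hC⟩ := ((isCompact_closedBall p 1).prod (isCompact_Icc (a := (0 : ℝ)) (b := 1))).bddAbove_image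
    (f := fun z ↦ ‖(fderiv ℝ h z).comp (ContinuousLinearMap.inl ℝ P ℝ)‖) hc.norm.continuousOn
  refine intervalIntegral.hasFDerivAt_integral_of_dominated_of_fderiv_le
    (F := fun q t ↦ h (q, t)) (bound := fun _ ↦ C) (s := Metric.closedBall p 1)
    (F' := fun q t ↦ (fderiv ℝ h (q, t)).comp (ContinuousLinearMap.inl ℝ P ℝ))
    (Metric.closedBall_mem_nhds p one_pos) ?_ ?_ ?_ ?_ ?_ ?_
  · exact Eventually.of_forall fun q ↦
      (hh.continuous.comp (Continuous.prodMk_right q)).aestronglyMeasurable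
  · exact (hh.continuous.comp (Continuous.prodMk_right p)).intervalIntegrable _ _
  · exact (hc.comp (Continuous.prodMk_right p)).aestronglyMeasurable
  · refine Eventually.of_forall fun t ht q hq ↦ hC ⟨(q, t), ⟨hq, ?_⟩, rfl⟩
    rw [Set.uIoc_of_le zero_le_one] at ht
    exact ⟨ht.1.le, ht.2⟩
  · exact continuous_const.intervalIntegrable _ _
  · refine Eventually.of_forall fun t _ q _ ↦ ?_
    exact (hh.differentiable (by simp) (q, t)).hasFDerivAt.comp q
      (hasFDerivAt_prodMk_left q t)

/-- The derivative is an integral of the same kind with values in a space of linear maps. The target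
is therefore quantified inside the induction, and everything lives in `Type` so that this space is
again an admissible target. -/
theorem contDiff_parametric_intervalIntegral {P : Type} [NormedAddCommGroup P]
    [NormedSpace ℝ P] [FiniteDimensional ℝ P] (m : ℕ) :
    ∀ {G : Type} [NormedAddCommGroup G] [NormedSpace ℝ G] [CompleteSpace G] {h : P × ℝ → G},
      ContDiff ℝ ∞ h → ContDiff ℝ m (fun q ↦ ∫ t in (0 : ℝ)..1, h (q, t)) := by
  induction m with
  | zero =>
    intro G _ _ _ h hh
    exact contDiff_zero.2 (continuous_iff_continuousAt.2 fun p ↦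
      (hasFDerivAt_parametric_intervalIntegral hh p).continuousAt)
  | succ m ih =>
    intro G _ _ _ h hh
    have e : fderiv ℝ (fun q ↦ ∫ t in (0 : ℝ)..1, h (q, t)) = fun q ↦
        ∫ t in (0 : ℝ)..1, (fun z ↦ (fderiv ℝ h z).comp (ContinuousLinearMap.inl ℝ P ℝ)) (q, t) :=
      funext fun p ↦ (hasFDerivAt_parametric_intervalIntegral hh p).fderiv
    push_cast
    refine contDiff_succ_iff_fderiv.2 ⟨fun p ↦
      (hasFDerivAt_parametric_intervalIntegral hh p).differentiableAt, by simp, ?_⟩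
    rw [e]
    exact ih ((hh.fderiv_right (m := ∞) (by simp)).clm_comp contDiff_const)

/-- The smooth quotient `(F (x, r) - F (x, 0)) / r`. -/
def hadamardQuotient {E : Type} [NormedAddCommGroup E] [NormedSpace ℝ E]
    (F : E × ℝ → ℂ) (p : E × ℝ) : ℂ :=
  ∫ t in (0 : ℝ)..1, fderiv ℝ F (p.1, t * p.2) (0, 1)

variable {E : Type} [NormedAddCommGroup E] [NormedSpace ℝ E]

theorem contDiff_hadamard_integrand {F : E × ℝ → ℂ} (hF : ContDiff ℝ ∞ F) :
    ContDiff ℝ ∞ fun z : (E × ℝ) × ℝ ↦ fderiv ℝ F (z.1.1, z.2 * z.1.2) (0, 1) := by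
  have : ContDiff ℝ ∞ (fderiv ℝ F) := hF.fderiv_right (by simp)
  refine (this.comp ?_).clm_apply contDiff_const
  fun_prop

theorem contDiff_hadamardQuotient [FiniteDimensional ℝ E] {F : E × ℝ → ℂ}
    (hF : ContDiff ℝ ∞ F) : ContDiff ℝ ∞ (hadamardQuotient F) :=
  contDiff_infty.2 fun m ↦
    contDiff_parametric_intervalIntegral m (contDiff_hadamard_integrand hF)

/-- Fundamental theorem of calculus along the vertical segment. The integral form of the quotient,
unlike the division, remains smooth at `r = 0`. -/
theorem smul_hadamardQuotient {F : E × ℝ → ℂ} (hF : ContDiff ℝ ∞ F) (x : E) (r : ℝ) :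
    (r : ℂ) * hadamardQuotient F (x, r) = F (x, r) - F (x, 0) := by
  have hd (t : ℝ) : HasDerivAt (fun t : ℝ ↦ F (x, t * r)) (fderiv ℝ F (x, t * r) (0, r)) t := by
    have h₁ : HasDerivAt (fun t : ℝ ↦ ((x, t * r) : E × ℝ)) (0, r) t := by
      simpa using (hasDerivAt_const t x).prodMk ((hasDerivAt_id t).mul_const r)
    exact (hF.differentiable (by simp) (x, t * r)).hasFDerivAt.comp_hasDerivAt t h₁
  have hcont : Continuous fun t : ℝ ↦ fderiv ℝ F (x, t * r) (0, r) :=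
    ((hF.continuous_fderiv (by simp)).comp (by fun_prop)).clm_apply continuous_const
  have := intervalIntegral.integral_eq_sub_of_hasDerivAt (a := 0) (b := 1)
    (fun t _ ↦ hd t) (hcont.intervalIntegrable _ _)
  rw [one_mul, zero_mul] at this
  rw [← this, hadamardQuotient, ← intervalIntegral.integral_const_mul]
  congr 1
  ext t
  rw [show ((0, r) : E × ℝ) = r • (0, 1) by simp, map_smul]
  simp

theorem hadamardQuotient_zero (F : E × ℝ → ℂ) (x : E) :
    hadamardQuotient F (x, 0) = fderiv ℝ F (x, 0) (0, 1) := by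
  simp [hadamardQuotient]

/-- A factor that depends only on the base point is not seen by the vertical derivative. This is
what makes the difference quotient covariant under gauge changes. -/
theorem hadamardQuotient_const_mul {F G : E × ℝ → ℂ} (hF : ContDiff ℝ ∞ F) {u : E → ℂ}
    (hG : ContDiff ℝ ∞ G) (h : ∀ x r, G (x, r) = u x * F (x, r)) (x : E) (r : ℝ) :
    hadamardQuotient G (x, r) = u x * hadamardQuotient F (x, r) := by
  have e (s : ℝ) : fderiv ℝ G (x, s) (0, 1) = u x * fderiv ℝ F (x, s) (0, 1) := by
    have h₁ : HasDerivAt (fun t : ℝ ↦ ((x, t) : E × ℝ)) (0, 1) s := by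
      simpa using (hasDerivAt_const s x).prodMk (hasDerivAt_id s)
    have hG' := (hG.differentiable (by simp) (x, s)).hasFDerivAt.comp_hasDerivAt s h₁
    have hF' := (hF.differentiable (by simp) (x, s)).hasFDerivAt.comp_hasDerivAt s h₁
    refine hG'.unique ?_
    rw [show G ∘ (fun t : ℝ ↦ ((x, t) : E × ℝ)) = fun t ↦ u x * F (x, t) from
      funext fun t ↦ h x t]
    exact hF'.const_mul _
  simp [hadamardQuotient, e]

/-- Jet bounds for the Hadamard quotient from jet bounds of the function along a vertical
segment. -/
theorem jetBound_hadamardQuotient [FiniteDimensional ℝ E] {F : E × ℝ → ℂ}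
    (hF : ContDiff ℝ ∞ F) {x : E} {r a₀ a₁ a₂ B : ℝ} (hr : 0 ≤ r)
    (H : ∀ s ∈ Set.Icc 0 r, JetBound F (x, s) a₀ a₁ a₂) (hB : 0 ≤ B)
    (hrB : 0 < r → r⁻¹ * (4 * a₂) ≤ B ∨ ∀ u v,
      ‖fderiv ℝ (fderiv ℝ (hadamardQuotient F)) (x, r) u v‖ ≤ B * ‖u‖ * ‖v‖)
    (hr0 : r = 0 → ∀ u v,
      ‖fderiv ℝ (fderiv ℝ (hadamardQuotient F)) (x, r) u v‖ ≤ B * ‖u‖ * ‖v‖) :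
    JetBound (hadamardQuotient F) (x, r) a₁ a₂ B := by
  have hQ := contDiff_hadamardQuotient hF
  have hmem {t : ℝ} (ht : t ∈ Set.uIoc (0 : ℝ) 1) : t * r ∈ Set.Icc 0 r := by
    rw [Set.uIoc_of_le zero_le_one] at ht
    exact ⟨by have := ht.1; positivity, by nlinarith [ht.2]⟩
  have n₁ : 0 ≤ a₁ := (H 0 ⟨le_rfl, hr⟩).nonneg₁
  have n₂ : 0 ≤ a₂ := (H 0 ⟨le_rfl, hr⟩).nonneg₂
  have h01 : ‖((0, 1) : E × ℝ)‖ = 1 := by simp [Prod.norm_def]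
  have b₀ : ‖hadamardQuotient F (x, r)‖ ≤ a₁ := by
    have := intervalIntegral.norm_integral_le_of_norm_le_const (a := (0 : ℝ)) (b := 1)
      (f := fun t ↦ fderiv ℝ F (x, t * r) (0, 1)) (C := a₁) fun t ht ↦ by
        refine (ContinuousLinearMap.le_of_opNorm_le _ (H _ (hmem ht)).one _).trans ?_
        rw [h01, mul_one]
    simpa [hadamardQuotient] using this
  have b₁ : ‖fderiv ℝ (hadamardQuotient F) (x, r)‖ ≤ a₂ := by
    have hd := (hasFDerivAt_parametric_intervalIntegral (contDiff_hadamard_integrand hF) (x, r)).fderiv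
    have e : fderiv ℝ (hadamardQuotient F) (x, r) = _ := hd
    rw [e]
    have := intervalIntegral.norm_integral_le_of_norm_le_const (a := (0 : ℝ)) (b := 1)
      (f := fun t ↦ (fderiv ℝ (fun z : (E × ℝ) × ℝ ↦ fderiv ℝ F (z.1.1, z.2 * z.1.2) (0, 1))
        ((x, r), t)).comp (ContinuousLinearMap.inl ℝ (E × ℝ) ℝ)) (C := a₂) fun t ht ↦ by
        refine ContinuousLinearMap.opNorm_le_bound _ n₂ fun u ↦ ?_
        have h₁ : HasFDerivAt (fun z : (E × ℝ) × ℝ ↦ ((z.1.1, z.2 * z.1.2) : E × ℝ))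
            (((ContinuousLinearMap.fst ℝ E ℝ).comp (ContinuousLinearMap.fst ℝ (E × ℝ) ℝ)).prod
              (t • ((ContinuousLinearMap.snd ℝ E ℝ).comp (ContinuousLinearMap.fst ℝ (E × ℝ) ℝ))
                + r • ContinuousLinearMap.snd ℝ (E × ℝ) ℝ)) ((x, r), t) := by
          have c₁ := ((ContinuousLinearMap.snd ℝ E ℝ).comp
            (ContinuousLinearMap.fst ℝ (E × ℝ) ℝ)).hasFDerivAt (x := ((x, r), t))
          have c₂ := (ContinuousLinearMap.snd ℝ (E × ℝ) ℝ).hasFDerivAt (x := ((x, r), t))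
          exact ((ContinuousLinearMap.fst ℝ E ℝ).comp
            (ContinuousLinearMap.fst ℝ (E × ℝ) ℝ)).hasFDerivAt.prodMk (c₂.mul c₁)
        have h₂ := (JetBound.fderiv_differentiableAt (hF.contDiffAt.of_le two_le_infty : ContDiffAt ℝ 2 F (x, t * r))).hasFDerivAt
        have h₃ := (HasFDerivAt.comp ((x, r), t) h₂ h₁).clm_apply
          (hasFDerivAt_const ((0, 1) : E × ℝ) ((x, r), t))
        rw [HasFDerivAt.fderiv (f := fun z : (E × ℝ) × ℝ ↦
          fderiv ℝ F (z.1.1, z.2 * z.1.2) (0, 1)) h₃]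
        -- The integrand differentiated at (x, r) in the direction u is D²F((u₁, t u₂), (0, 1)), and
        -- 0 < t ≤ 1 makes (u₁, t u₂) no longer than u.
        have h₄ := (H _ (hmem ht)).two (u.1, t * u.2) (0, 1)
        have h₅ : ‖((u.1, t * u.2) : E × ℝ)‖ ≤ ‖u‖ := by
          rw [Set.uIoc_of_le zero_le_one] at ht
          simp only [Prod.norm_def, norm_mul, Real.norm_eq_abs, abs_of_pos ht.1]
          refine max_le_max le_rfl ?_
          have := abs_nonneg u.2
          nlinarith [ht.2]
        rw [h01, mul_one] at h₄
        refine le_trans (le_of_eq ?_) (h₄.trans (mul_le_mul_of_nonneg_left h₅ n₂))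
        simp
    simpa using this
  refine ⟨hQ.contDiffAt.of_le two_le_infty, b₀, b₁, hB, fun u v ↦ ?_⟩
  rcases hr.eq_or_lt with hr0' | hrp
  · exact hr0 hr0'.symm u v
  rcases hrB hrp with hB' | hB'
  swap
  · exact hB' u v
  have hFc {y : E × ℝ} : ContDiffAt ℝ 2 F y := hF.contDiffAt.of_le two_le_infty
  have hQc {y : E × ℝ} : ContDiffAt ℝ 2 (hadamardQuotient F) y :=
    hQ.contDiffAt.of_le two_le_infty
  -- Differentiating F - F(·, 0) = r Q twice expresses r D²Q(u, v) as the second derivative of the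
  -- left side minus the cross terms u₂ DQ(v) and v₂ DQ(u). The left side contributes 2a₂ and each
  -- cross term a₂, whence 4a₂.
  have eq₀ : (fun p : E × ℝ ↦ F p - F (p.1, 0)) = fun p ↦ p.2 • hadamardQuotient F p := by
    ext p
    rw [← smul_hadamardQuotient hF p.1 p.2]
    simp
  have j₀ : JetBound (fun p : E × ℝ ↦ F p - F (p.1, 0)) (x, r) (a₀ + a₀) (a₁ + a₁ * 1)
      (a₂ + (a₂ * 1 ^ 2 + a₁ * 0)) := by
    have c : fderiv ℝ (fun p : E × ℝ ↦ ((p.1, 0) : E × ℝ)) = fun _ ↦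
        (ContinuousLinearMap.inl ℝ E ℝ).comp (ContinuousLinearMap.fst ℝ E ℝ) := by
      ext1 p
      exact ((ContinuousLinearMap.inl ℝ E ℝ).comp (ContinuousLinearMap.fst ℝ E ℝ)).fderiv
    refine (H r ⟨hr, le_rfl⟩).sub (JetBound.comp (g := fun p : E × ℝ ↦ ((p.1, 0) : E × ℝ))
      (H 0 ⟨le_rfl, hr⟩) (by fun_prop) ?_ le_rfl ?_)
    · rw [c]
      refine ContinuousLinearMap.opNorm_le_bound _ zero_le_one fun w ↦ ?_
      simp [Prod.norm_def]
    · simp [c]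
  have e₁ : fderiv ℝ (fun p : E × ℝ ↦ F p - F (p.1, 0)) = fun p ↦
      p.2 • fderiv ℝ (hadamardQuotient F) p
        + (ContinuousLinearMap.snd ℝ E ℝ).smulRight (hadamardQuotient F p) := by
    rw [eq₀]
    ext1 p
    exact (hasFDerivAt_snd.smul
      (hQ.differentiable (by simp) p).hasFDerivAt).fderiv
  have key : HasFDerivAt (fun p : E × ℝ ↦ p.2 • fderiv ℝ (hadamardQuotient F) p
        + (ContinuousLinearMap.snd ℝ E ℝ).smulRight (hadamardQuotient F p)) _ (x, r) :=
    (hasFDerivAt_snd.smul (JetBound.fderiv_differentiableAt hQc).hasFDerivAt).add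
      ((ContinuousLinearMap.smulRightL ℝ (E × ℝ) ℂ (ContinuousLinearMap.snd ℝ E ℝ)).hasFDerivAt.comp
        (x, r) (hQ.differentiable (by simp) (x, r)).hasFDerivAt)
  have h₂ := j₀.two u v
  rw [e₁, key.fderiv] at h₂
  simp only [add_apply, smul_apply, ContinuousLinearMap.smulRight_apply,
    ContinuousLinearMap.comp_apply, ContinuousLinearMap.coe_snd',
    ContinuousLinearMap.smulRightL_apply_apply] at h₂
  have hsnd (w : E × ℝ) : ‖w.2‖ ≤ ‖w‖ := norm_snd_le w
  have hDQ (w : E × ℝ) := ContinuousLinearMap.le_of_opNorm_le _ b₁ w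
  have m₁ : ‖u.2 • fderiv ℝ (hadamardQuotient F) (x, r) v‖ ≤ ‖u‖ * (a₂ * ‖v‖) := by
    rw [norm_smul]; exact mul_le_mul (hsnd u) (hDQ v) (norm_nonneg _) (norm_nonneg _)
  have m₂ : ‖v.2 • fderiv ℝ (hadamardQuotient F) (x, r) u‖ ≤ ‖v‖ * (a₂ * ‖u‖) := by
    rw [norm_smul]; exact mul_le_mul (hsnd v) (hDQ u) (norm_nonneg _) (norm_nonneg _)
  have m₃ : ‖r • fderiv ℝ (fderiv ℝ (hadamardQuotient F)) (x, r) u v‖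
      ≤ 4 * a₂ * ‖u‖ * ‖v‖ := by
    set A := r • fderiv ℝ (fderiv ℝ (hadamardQuotient F)) (x, r) u v
    set B := u.2 • fderiv ℝ (hadamardQuotient F) (x, r) v
    set D := v.2 • fderiv ℝ (hadamardQuotient F) (x, r) u
    have : A = (A + B + D) - B - D := by ring
    rw [this]
    refine (norm_sub_le _ _).trans ?_
    refine (add_le_add (norm_sub_le _ _) le_rfl).trans ?_
    refine (add_le_add (add_le_add h₂ m₁) m₂).trans (le_of_eq ?_)
    ring
  rw [norm_smul, Real.norm_of_nonneg hr] at m₃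
  refine le_trans ?_ (mul_le_mul_of_nonneg_right
    (mul_le_mul_of_nonneg_right hB' (norm_nonneg u)) (norm_nonneg v))
  rw [mul_assoc (r⁻¹), mul_assoc (r⁻¹), le_inv_mul_iff₀ hrp]
  exact m₃

end Hadamard

/-! ### Jets under elementary operations, and second derivatives allowed to blow up like 1/y. -/

noncomputable section WeightedJets

namespace JetBound

variable {V : Type*} [NormedAddCommGroup V] [NormedSpace ℝ V]

theorem complex_exp (z : ℂ) :
    JetBound Complex.exp z ‖Complex.exp z‖ ‖Complex.exp z‖ ‖Complex.exp z‖ := by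
  have e : fderiv ℝ Complex.exp = fun z ↦ Complex.exp z • (1 : ℂ →L[ℝ] ℂ) := by
    ext1 z
    exact (Complex.hasStrictFDerivAt_exp_real z).hasFDerivAt.fderiv
  refine ⟨Complex.contDiff_exp.contDiffAt, le_rfl, ?_, norm_nonneg _,
    fun u v ↦ ?_⟩
  · rw [e, norm_smul]
    exact mul_le_of_le_one_right (norm_nonneg _) ContinuousLinearMap.norm_id_le
  · have key : HasFDerivAt (fun z ↦ Complex.exp z • (1 : ℂ →L[ℝ] ℂ)) _ z :=
      (Complex.hasStrictFDerivAt_exp_real z).hasFDerivAt.smul_const _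
    rw [e, key.fderiv]
    simp

theorem const {G : Type*} [NormedAddCommGroup G] [NormedSpace ℝ G] (x : V) (c : G) :
    JetBound (fun _ : V ↦ c) x ‖c‖ 0 0 := by
  have e : fderiv ℝ (fun _ : V ↦ c) = fun _ ↦ 0 := by ext1 y; simp
  exact ⟨contDiffAt_const, le_rfl, by simp, le_rfl, by simp [e]⟩

theorem const_mul {f : V → ℂ} {x : V} {a₀ a₁ a₂ : ℝ} (H : JetBound f x a₀ a₁ a₂) (c : ℂ) :
    JetBound (fun y ↦ c * f y) x (‖c‖ * a₀) (‖c‖ * a₁) (‖c‖ * a₂) := by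
  simpa using (const x c).mul H

theorem clm {W : Type*} [NormedAddCommGroup W] [NormedSpace ℝ W] (T : V →L[ℝ] W) {x : V}
    {t₀ t₁ : ℝ} (h₀ : ‖T x‖ ≤ t₀) (h₁ : ∀ u, ‖T u‖ ≤ t₁ * ‖u‖) (ht₁ : 0 ≤ t₁) :
    JetBound (fun y ↦ T y) x t₀ t₁ 0 := by
  have e : fderiv ℝ (fun y ↦ T y) = fun _ ↦ T := by ext1 y; exact T.fderiv
  refine ⟨T.contDiff.contDiffAt, h₀, ?_, le_rfl, by simp [e]⟩
  rw [e]
  exact ContinuousLinearMap.opNorm_le_bound _ ht₁ h₁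

/-- Composition with a contraction after `f`. -/
theorem clm_comp {W G : Type*} [NormedAddCommGroup W] [NormedSpace ℝ W] [NormedAddCommGroup G]
    [NormedSpace ℝ G] {f : V → W} {x : V} {a₀ a₁ a₂ : ℝ}
    (H : JetBound f x a₀ a₁ a₂) (T : W →L[ℝ] G) (hT : ∀ u, ‖T u‖ ≤ ‖u‖) :
    JetBound (fun y ↦ T (f y)) x a₀ a₁ a₂ := by
  have hc := (clm T (x := f x) (t₁ := 1) le_rfl (by simpa using hT) zero_le_one).comp
    (g := f) H.contDiffAt H.one H.nonneg₂ H.two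
  exact (hc.mono le_rfl (by simp) (by simp)) |> fun h ↦
    ⟨h.contDiffAt, (hT _).trans H.zero, h.one, h.nonneg₂, h.two⟩

/-- The map (x, s) ↦ x + s v is linear of norm at most 2 for the sup norm on `V × ℝ`; hence the
factors 2 and 4. -/
theorem comp_add_smul {G : Type*} [NormedAddCommGroup G] [NormedSpace ℝ G] {f : V → G} {x v : V}
    {s a₀ a₁ a₂ : ℝ} (hv : ‖v‖ ≤ 1) (H : JetBound f (x + s • v) a₀ a₁ a₂) :
    JetBound (fun p : V × ℝ ↦ f (p.1 + p.2 • v)) (x, s) a₀ (2 * a₁) (4 * a₂) := by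
  let T : V × ℝ →L[ℝ] V :=
    ContinuousLinearMap.fst ℝ V ℝ + (ContinuousLinearMap.snd ℝ V ℝ).smulRight v
  have hT (u : V × ℝ) : ‖T u‖ ≤ 2 * ‖u‖ := by
    refine (norm_add_le _ _).trans ?_
    have h₁ : ‖u.1‖ ≤ ‖u‖ := norm_fst_le u
    have h₂ : ‖u.2 • v‖ ≤ ‖u‖ := by
      rw [norm_smul]
      exact (mul_le_of_le_one_right (norm_nonneg _) hv).trans (norm_snd_le u)
    have h₃ := add_le_add h₁ h₂
    rw [two_mul]
    exact h₃
  have J := clm T (x := (x, s)) le_rfl hT (by norm_num)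
  exact (comp (g := fun p : V × ℝ ↦ p.1 + p.2 • v) H J.contDiffAt J.one le_rfl J.two).mono le_rfl
    (by linarith) (by linarith)

theorem comp_fst {G : Type*} [NormedAddCommGroup G] [NormedSpace ℝ G] {f : V → G} {x : V}
    {s a₀ a₁ a₂ : ℝ} (H : JetBound f x a₀ a₁ a₂) :
    JetBound (fun p : V × ℝ ↦ f p.1) (x, s) a₀ a₁ a₂ := by
  have J := clm (ContinuousLinearMap.fst ℝ V ℝ) (x := (x, s)) (t₁ := 1) le_rfl
    (fun u ↦ by simpa using norm_fst_le u) (by norm_num)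
  exact (comp (g := fun p : V × ℝ ↦ p.1) H J.contDiffAt J.one le_rfl J.two).mono le_rfl
    (by linarith) (by linarith)

/-- Composition with the graph of a real function. -/
theorem comp_graph {G : Type*} [NormedAddCommGroup G] [NormedSpace ℝ G] {f : V × ℝ → G} {x : V}
    {ρ : V → ℝ} {a₀ a₁ a₂ b₀ b₁ b₂ : ℝ} (H : JetBound f (x, ρ x) a₀ a₁ a₂)
    (R : JetBound ρ x b₀ b₁ b₂) :
    JetBound (fun y ↦ f (y, ρ y)) x a₀ (a₁ * (1 + b₁)) (a₂ * (1 + b₁) ^ 2 + a₁ * b₂) := by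
  have n₁ := R.nonneg₁
  have n₂ := R.nonneg₂
  have e : fderiv ℝ (fun y ↦ (y, ρ y)) =ᶠ[𝓝 x]
      fun y ↦ ContinuousLinearMap.inl ℝ V ℝ + (ContinuousLinearMap.inr ℝ V ℝ).comp (fderiv ℝ ρ y) := by
    filter_upwards [eventually_differentiableAt R.contDiffAt] with y hy
    have h : HasFDerivAt (fun y ↦ (y, ρ y)) _ y := (hasFDerivAt_id y).prodMk hy.hasFDerivAt
    rw [h.fderiv]
    ext u <;> simp
  have key : HasFDerivAt (fun y ↦ ContinuousLinearMap.inl ℝ V ℝ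
      + (ContinuousLinearMap.inr ℝ V ℝ).comp (fderiv ℝ ρ y)) _ x :=
    ((ContinuousLinearMap.compL ℝ V ℝ (V × ℝ) (ContinuousLinearMap.inr ℝ V ℝ)).hasFDerivAt.comp x
        (fderiv_differentiableAt R.contDiffAt).hasFDerivAt).const_add _
  refine comp (g := fun y ↦ (y, ρ y)) H (contDiffAt_id.prodMk R.contDiffAt) ?_ n₂ fun u v ↦ ?_
  · rw [e.eq_of_nhds]
    refine ContinuousLinearMap.opNorm_le_bound _ (by positivity) fun u ↦ ?_
    refine (norm_add_le _ _).trans ?_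
    have := ContinuousLinearMap.le_of_opNorm_le _ R.one u
    simpa [Prod.norm_def, add_mul] using this
  · rw [e.fderiv_eq, key.fderiv]
    have := R.two u v
    simpa [Prod.norm_def] using this

/-- The bounds are expressed in the inverse of S = √(w x + κ²) and never in κ⁻¹. When Dw is O(√w),
the quotient √w / S ≤ 1 makes the first-order bound uniform in κ, so κ may later be taken
arbitrarily small. -/
theorem sqrt_comp {w : V → ℝ} {x : V} {κ a₀ a₁ a₂ : ℝ} (hκ : 0 < κ) (hw : ∀ y, 0 ≤ w y)
    (H : JetBound w x a₀ a₁ a₂) :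
    JetBound (fun y ↦ Real.sqrt (w y + κ ^ 2)) x (Real.sqrt (w x + κ ^ 2))
      ((Real.sqrt (w x + κ ^ 2))⁻¹ * a₁)
      (((Real.sqrt (w x + κ ^ 2))⁻¹) ^ 3 * a₁ ^ 2 + (Real.sqrt (w x + κ ^ 2))⁻¹ * a₂) := by
  have n₁ := H.nonneg₁
  have n₂ := H.nonneg₂
  set S := Real.sqrt (w x + κ ^ 2) with hS
  have hpos (y : V) : 0 < w y + κ ^ 2 := by have := hw y; positivity
  have hSpos : 0 < S := Real.sqrt_pos.2 (hpos x)
  have hc : ContDiffAt ℝ 2 (fun y ↦ Real.sqrt (w y + κ ^ 2)) x :=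
    (H.contDiffAt.add contDiffAt_const).sqrt (hpos x).ne'
  have e : fderiv ℝ (fun y ↦ Real.sqrt (w y + κ ^ 2)) =ᶠ[𝓝 x]
      fun y ↦ (1 / (2 * Real.sqrt (w y + κ ^ 2))) • fderiv ℝ w y := by
    filter_upwards [eventually_differentiableAt H.contDiffAt] with y hy
    exact ((hy.hasFDerivAt.add_const (κ ^ 2)).sqrt (hpos y).ne').fderiv
  have d := (hc.differentiableAt (by norm_num)).hasFDerivAt
  have q₁ : ‖fderiv ℝ (fun y ↦ Real.sqrt (w y + κ ^ 2)) x‖ ≤ S⁻¹ * a₁ := by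
    rw [e.eq_of_nhds, norm_smul]
    have : ‖1 / (2 * S)‖ ≤ S⁻¹ := by
      rw [Real.norm_of_nonneg (by positivity), one_div]
      exact inv_anti₀ hSpos (by linarith)
    exact mul_le_mul this H.one (norm_nonneg _) (by positivity)
  have key : HasFDerivAt (fun y ↦ (1 / (2 * Real.sqrt (w y + κ ^ 2))) • fderiv ℝ w y) _ x :=
    ((hasDerivAt_inv (mul_pos two_pos hSpos).ne').comp_hasFDerivAt x (d.const_mul 2)
      |>.congr_of_eventuallyEq (Eventually.of_forall fun y ↦ one_div _)).smul
      (fderiv_differentiableAt H.contDiffAt).hasFDerivAt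
  refine ⟨hc, by rw [Real.norm_of_nonneg hSpos.le], q₁, by positivity, fun u v ↦ ?_⟩
  rw [e.fderiv_eq, key.fderiv]
  have r₁ := ContinuousLinearMap.le_of_opNorm_le _ q₁ u
  have r₂ := ContinuousLinearMap.le_of_opNorm_le _ H.one v
  have r₃ := H.two u v
  have hS' : Real.sqrt (w x + κ ^ 2) = S := rfl
  simp only [add_apply, smul_apply, ContinuousLinearMap.smulRight_apply, smul_eq_mul, hS']
  refine (norm_add_le _ _).trans ?_
  rw [norm_mul, norm_mul, norm_mul, norm_mul]
  have c₁ : ‖1 / (2 * S)‖ ≤ S⁻¹ := by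
    rw [Real.norm_of_nonneg (by positivity), one_div]
    exact inv_anti₀ hSpos (by linarith)
  have c₂ : ‖-((2 * S) ^ 2)⁻¹‖ * ‖(2 : ℝ)‖ ≤ (S⁻¹) ^ 2 := by
    rw [norm_neg, Real.norm_of_nonneg (by positivity), Real.norm_of_nonneg (by norm_num),
      inv_pow, mul_pow, mul_inv]
    have : 0 ≤ (S ^ 2)⁻¹ := by positivity
    nlinarith
  calc _ ≤ S⁻¹ * (a₂ * ‖u‖ * ‖v‖) + (S⁻¹) ^ 2 * (S⁻¹ * a₁ * ‖u‖) * (a₁ * ‖v‖) := by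
        rw [← mul_assoc]
        gcongr
    _ = _ := by ring

end JetBound

variable {V : Type*} [NormedAddCommGroup V] [NormedSpace ℝ V]

/-- Jet bounds at the scale `l` with a second derivative that may blow up like `1 / y`. -/
def WeightedBound (h : V → ℂ) (x : V) (y l a : ℝ) : Prop :=
  ∃ B, JetBound h x a (a * l) B ∧ y * B ≤ a * l ^ 2

namespace WeightedBound

variable {f g : V → ℂ} {x : V} {y l a b : ℝ}

theorem nonneg (H : WeightedBound f x y l a) : 0 ≤ a := by
  obtain ⟨B, h, -⟩ := H
  exact h.nonneg₀

theorem mono (H : WeightedBound f x y l a) (hab : a ≤ b) (hl : 0 ≤ l) : WeightedBound f x y l b := by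
  obtain ⟨B, h, hB⟩ := H
  exact ⟨B, h.mono hab (by gcongr) le_rfl, hB.trans (by gcongr)⟩

theorem of_jetBound {a₀ a₁ a₂ : ℝ} (H : JetBound f x a₀ a₁ a₂) (h₀ : a₀ ≤ a) (h₁ : a₁ ≤ a)
    (h₂ : a₂ ≤ a) (hl : 1 ≤ l) (hy : y ≤ 1) : WeightedBound f x y l a := by
  have ha : 0 ≤ a := H.nonneg₀.trans h₀
  have n₂ := H.nonneg₂
  refine ⟨a₂, H.mono h₀ (h₁.trans (le_mul_of_one_le_right ha hl)) le_rfl, ?_⟩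
  calc y * a₂ ≤ 1 * a₂ := by gcongr
    _ ≤ a * 1 := by linarith
    _ ≤ a * l ^ 2 := by gcongr; exact one_le_pow₀ hl

theorem sum {ι : Type*} (s : Finset ι) {f : ι → V → ℂ} {a : ι → ℝ}
    (H : ∀ i ∈ s, WeightedBound (f i) x y l (a i)) :
    WeightedBound (fun z ↦ ∑ i ∈ s, f i z) x y l (∑ i ∈ s, a i) := by
  choose! B hB hyB using H
  refine ⟨∑ i ∈ s, B i, (JetBound.sum s hB).mono le_rfl (by rw [Finset.sum_mul]) le_rfl, ?_⟩
  rw [Finset.mul_sum, Finset.sum_mul]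
  exact Finset.sum_le_sum hyB

/-- The cross term 2 (a l)(b l) carries no singularity, and y ≤ 1 absorbs the weight there. Together
with the two terms containing a second derivative it gives the factor 4. -/
theorem mul (hl : 0 ≤ l) (hy : y ≤ 1) (H : WeightedBound f x y l a)
    (H' : WeightedBound g x y l b) :
    WeightedBound (fun z ↦ f z * g z) x y l (4 * (a * b)) := by
  have ha := H.nonneg
  have hb := H'.nonneg
  obtain ⟨A, h, hA⟩ := H
  obtain ⟨B, h', hB⟩ := H'
  have hab := mul_nonneg ha hb
  refine ⟨_, (h.mul h').mono (by linarith) ?_ le_rfl, ?_⟩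
  · have := mul_nonneg hab hl
    nlinarith
  · have e₁ : a * (y * B) ≤ a * (b * l ^ 2) := by gcongr
    have e₂ : (y * A) * b ≤ (a * l ^ 2) * b := by gcongr
    have e₃ : y * (a * b * l ^ 2) ≤ 1 * (a * b * l ^ 2) := by gcongr
    nlinarith

theorem conj (H : WeightedBound f x y l a) :
    WeightedBound (fun z ↦ (starRingEnd ℂ) (f z)) x y l a := by
  obtain ⟨B, h, hB⟩ := H
  exact ⟨B, h.conj, hB⟩

/-- Writing the upper bound as β times the lower bound δ gives a constant homogeneous in δ: in the
application δ is of order `k` while β stays bounded. -/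
theorem inv {β δ : ℝ} (hl : 0 ≤ l) (hy : y ≤ 1) (hδ : 0 < δ) (hβ : 1 ≤ β) (H : WeightedBound f x y l (β * δ))
    (hf : δ ≤ ‖f x‖) : WeightedBound (fun z ↦ (f z)⁻¹) x y l (3 * β ^ 2 * δ⁻¹) := by
  obtain ⟨B, h, hB⟩ := H
  have hi : 0 < δ⁻¹ := inv_pos.2 hδ
  have hδi : δ * δ⁻¹ = 1 := mul_inv_cancel₀ hδ.ne'
  have hβ2 : β ≤ β ^ 2 := by nlinarith
  refine ⟨_, (h.inv hδ hf).mono ?_ ?_ le_rfl, ?_⟩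
  · nlinarith
  · have : β * δ * l * δ⁻¹ ^ 2 = β * (δ⁻¹ * l) := by
      calc _ = β * (δ⁻¹ * l) * (δ * δ⁻¹) := by ring
        _ = _ := by rw [hδi, mul_one]
    rw [this]
    have : 0 ≤ δ⁻¹ * l := by positivity
    nlinarith
  · have e₁ : y * B * δ⁻¹ ^ 2 ≤ β * (δ⁻¹ * l ^ 2) := by
      calc _ ≤ β * δ * l ^ 2 * δ⁻¹ ^ 2 := by gcongr
        _ = β * (δ⁻¹ * l ^ 2) * (δ * δ⁻¹) := by ring
        _ = _ := by rw [hδi, mul_one]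
    have e₂ : y * (2 * (β * δ * l) ^ 2 * δ⁻¹ ^ 3) ≤ 2 * β ^ 2 * (δ⁻¹ * l ^ 2) := by
      have : 2 * (β * δ * l) ^ 2 * δ⁻¹ ^ 3 = 2 * β ^ 2 * (δ⁻¹ * l ^ 2) := by
        calc _ = 2 * β ^ 2 * (δ⁻¹ * l ^ 2) * (δ * δ⁻¹) ^ 2 := by ring
          _ = _ := by rw [hδi]; ring
      rw [this]
      have : 0 ≤ 2 * β ^ 2 * (δ⁻¹ * l ^ 2) := by positivity
      nlinarith
    have : 0 ≤ δ⁻¹ * l ^ 2 := by positivity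
    nlinarith

end WeightedBound

end WeightedJets

/-! ### The connection d + ikθ on a vector space, gauge covariance, and bounds in an adapted gauge.
-/

noncomputable section LocalModel

variable {E : Type} [NormedAddCommGroup E] [NormedSpace ℝ E]

/-- The covariant derivative `d + i k θ` on functions. -/
def covDeriv (k : ℕ) (θ : E → E →L[ℝ] ℝ) (σ : E → ℂ) (x u : E) : ℂ :=
  fderiv ℝ σ x u + (k : ℂ) * Complex.I * (θ x u : ℂ) * σ x

/-- The value of `σ` at `x + r v`, transported back to `x` along the segment. -/
def transported (k : ℕ) (θ : E → E →L[ℝ] ℝ) (σ : E → ℂ) (v : E) (p : E × ℝ) : ℂ :=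
  σ (p.1 + p.2 • v) * Complex.exp ((k : ℂ) * ((p.2 : ℂ) * (θ p.1 v : ℂ)) * Complex.I)

/-- The difference quotient of `σ` in the direction `v` with step `ρ x`. -/
def regDeriv (k : ℕ) (θ : E → E →L[ℝ] ℝ) (σ : E → ℂ) (v : E) (ρ : E → ℝ) (x : E) : ℂ :=
  hadamardQuotient (transported k θ σ v) (x, ρ x)

/-- The unitary gauge transformation `exp (i k ℓ (x - x₀))`. -/
def gaugePhase (k : ℕ) (ℓ : E →L[ℝ] ℝ) (x₀ x : E) : ℂ :=
  Complex.exp ((k : ℂ) * (ℓ (x - x₀) : ℂ) * Complex.I)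

theorem norm_gaugePhase (k : ℕ) (ℓ : E →L[ℝ] ℝ) (x₀ x : E) : ‖gaugePhase k ℓ x₀ x‖ = 1 := by
  rw [gaugePhase, show (k : ℂ) * (ℓ (x - x₀) : ℂ) = ((k * ℓ (x - x₀) : ℝ) : ℂ) by push_cast; rfl]
  exact Complex.norm_exp_ofReal_mul_I _

theorem gaugePhase_self (k : ℕ) (ℓ : E →L[ℝ] ℝ) (x₀ : E) : gaugePhase k ℓ x₀ x₀ = 1 := by
  simp [gaugePhase]

theorem contDiff_gaugePhase (k : ℕ) (ℓ : E →L[ℝ] ℝ) (x₀ : E) :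
    ContDiff ℝ ∞ (gaugePhase k ℓ x₀) := by
  have : ContDiff ℝ ∞ fun x ↦ ((ℓ (x - x₀) : ℝ) : ℂ) :=
    Complex.ofRealCLM.contDiff.comp (ℓ.contDiff.comp (contDiff_id.sub contDiff_const))
  exact ((contDiff_const.mul this).mul contDiff_const).cexp

theorem fderiv_gaugePhase (k : ℕ) (ℓ : E →L[ℝ] ℝ) (x₀ x u : E) :
    fderiv ℝ (gaugePhase k ℓ x₀) x u
      = (k : ℂ) * Complex.I * (ℓ u : ℂ) * gaugePhase k ℓ x₀ x := by
  have h₁ : HasFDerivAt (fun x ↦ ((ℓ (x - x₀) : ℝ) : ℂ)) (Complex.ofRealCLM.comp ℓ) x :=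
    Complex.ofRealCLM.hasFDerivAt.comp x (ℓ.hasFDerivAt.comp x ((hasFDerivAt_id x).sub_const x₀))
  have h₂ := ((h₁.const_mul (k : ℂ)).mul_const Complex.I).cexp
  have h₃ : HasFDerivAt (gaugePhase k ℓ x₀) _ x := h₂
  rw [h₃.fderiv]
  simp [gaugePhase]
  ring

/-- The derivative of the phase exp(ikℓ) contributes ikℓ, which the shift of the connection form by
-ℓ removes. With ℓ = θ x₀ the new connection form vanishes at x₀. -/
theorem covDeriv_gauge (k : ℕ) (θ : E → E →L[ℝ] ℝ) (ℓ : E →L[ℝ] ℝ) (x₀ : E) {σ : E → ℂ} {x : E}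
    (hσ : DifferentiableAt ℝ σ x) (u : E) :
    covDeriv k (fun y ↦ θ y - ℓ) (fun y ↦ gaugePhase k ℓ x₀ y * σ y) x u
      = gaugePhase k ℓ x₀ x * covDeriv k θ σ x u := by
  have h : HasFDerivAt (fun y ↦ gaugePhase k ℓ x₀ y * σ y) _ x :=
    ((contDiff_gaugePhase k ℓ x₀).differentiable (by simp) x).hasFDerivAt.mul hσ.hasFDerivAt
  simp only [covDeriv, h.fderiv, add_apply, smul_apply,
    smul_eq_mul, fderiv_gaugePhase, sub_apply, Complex.ofReal_sub]
  ring

theorem contDiff_covDeriv {k : ℕ} {θ : E → E →L[ℝ] ℝ} {σ : E → ℂ} (hθ : ContDiff ℝ ∞ θ)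
    (hσ : ContDiff ℝ ∞ σ) (u : E) : ContDiff ℝ ∞ fun x ↦ covDeriv k θ σ x u := by
  have h₁ : ContDiff ℝ ∞ fun x ↦ ((θ x u : ℝ) : ℂ) :=
    Complex.ofRealCLM.contDiff.comp (hθ.clm_apply contDiff_const)
  exact ((hσ.fderiv_right (by simp)).clm_apply contDiff_const).add
    ((contDiff_const.mul h₁).mul hσ)

theorem covDeriv_covDeriv_gauge {k : ℕ} {θ : E → E →L[ℝ] ℝ} (ℓ : E →L[ℝ] ℝ) (x₀ : E) {σ : E → ℂ}
    (hθ : ContDiff ℝ ∞ θ) (hσ : ContDiff ℝ ∞ σ) (x u w : E) :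
    covDeriv k (fun y ↦ θ y - ℓ) (fun z ↦ covDeriv k (fun y ↦ θ y - ℓ)
        (fun y ↦ gaugePhase k ℓ x₀ y * σ y) z w) x u
      = gaugePhase k ℓ x₀ x * covDeriv k θ (fun z ↦ covDeriv k θ σ z w) x u := by
  rw [show (fun z ↦ covDeriv k (fun y ↦ θ y - ℓ) (fun y ↦ gaugePhase k ℓ x₀ y * σ y) z w)
    = fun z ↦ gaugePhase k ℓ x₀ z * covDeriv k θ σ z w from
    funext fun z ↦ covDeriv_gauge k θ ℓ x₀ (hσ.differentiable (by simp) z) w]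
  exact covDeriv_gauge k θ ℓ x₀ ((contDiff_covDeriv hθ hσ w).differentiable (by simp) x) u

theorem contDiff_transported {k : ℕ} {θ : E → E →L[ℝ] ℝ} {σ : E → ℂ} (hθ : ContDiff ℝ ∞ θ)
    (hσ : ContDiff ℝ ∞ σ) (v : E) : ContDiff ℝ ∞ (transported k θ σ v) := by
  have h₁ : ContDiff ℝ ∞ fun p : E × ℝ ↦ ((θ p.1 v : ℝ) : ℂ) :=
    Complex.ofRealCLM.contDiff.comp ((hθ.comp contDiff_fst).clm_apply contDiff_const)
  have h₂ : ContDiff ℝ ∞ fun p : E × ℝ ↦ ((p.2 : ℝ) : ℂ) :=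
    Complex.ofRealCLM.contDiff.comp contDiff_snd
  exact (hσ.comp (contDiff_fst.add (contDiff_snd.smul contDiff_const))).mul
    ((contDiff_const.mul (h₂.mul h₁)).mul contDiff_const).cexp

/-- As ℓ is linear, the phase at x + r v is the phase at x times exp(ikrℓ(v)); this second factor
cancels against the change of the transport along the segment. -/
theorem transported_gauge (k : ℕ) (θ : E → E →L[ℝ] ℝ) (ℓ : E →L[ℝ] ℝ) (x₀ : E) (σ : E → ℂ)
    (v x : E) (r : ℝ) :
    transported k (fun y ↦ θ y - ℓ) (fun y ↦ gaugePhase k ℓ x₀ y * σ y) v (x, r)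
      = gaugePhase k ℓ x₀ x * transported k θ σ v (x, r) := by
  simp only [transported, gaugePhase]
  have e : Complex.exp ((k : ℂ) * (ℓ (x + r • v - x₀) : ℂ) * Complex.I)
      * Complex.exp ((k : ℂ) * ((r : ℂ) * ((θ x - ℓ) v : ℂ)) * Complex.I)
      = Complex.exp ((k : ℂ) * (ℓ (x - x₀) : ℂ) * Complex.I)
        * Complex.exp ((k : ℂ) * ((r : ℂ) * (θ x v : ℂ)) * Complex.I) := by
    rw [← Complex.exp_add, ← Complex.exp_add]
    congr 1
    simp only [sub_apply, Complex.ofReal_sub, map_sub, map_add, map_smul, smul_eq_mul,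
      Complex.ofReal_add, Complex.ofReal_mul]
    ring
  linear_combination σ (x + r • v) * e

theorem hadamardQuotient_transported_gauge {k : ℕ} {θ : E → E →L[ℝ] ℝ} (ℓ : E →L[ℝ] ℝ) (x₀ : E)
    {σ : E → ℂ} (hθ : ContDiff ℝ ∞ θ) (hσ : ContDiff ℝ ∞ σ) (v x : E) (r : ℝ) :
    hadamardQuotient (transported k (fun y ↦ θ y - ℓ) (fun y ↦ gaugePhase k ℓ x₀ y * σ y) v) (x, r)
      = gaugePhase k ℓ x₀ x * hadamardQuotient (transported k θ σ v) (x, r) :=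
  hadamardQuotient_const_mul (contDiff_transported hθ hσ v)
    (contDiff_transported (hθ.sub contDiff_const) ((contDiff_gaugePhase k ℓ x₀).mul hσ) v)
    (transported_gauge k θ ℓ x₀ σ v) x r

/-- The vertical derivative of the transported section at step zero produces both dσ(v) and the
connection term. Hence the regularised derivative is the true one wherever the step vanishes, in
particular along the common zeros. -/
theorem hadamardQuotient_transported_zero {k : ℕ} {θ : E → E →L[ℝ] ℝ} {σ : E → ℂ} {x : E}
    (hσ : DifferentiableAt ℝ σ x) (hθ : ContDiff ℝ ∞ θ) (hσ' : ContDiff ℝ ∞ σ) (v : E) :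
    hadamardQuotient (transported k θ σ v) (x, 0) = covDeriv k θ σ x v := by
  rw [hadamardQuotient_zero]
  have h₁ : HasDerivAt (fun t : ℝ ↦ ((x, t) : E × ℝ)) (0, 1) 0 := by
    simpa using (hasDerivAt_const 0 x).prodMk (hasDerivAt_id 0)
  have h₂ := ((contDiff_transported (k := k) hθ hσ' v).differentiable (by simp)
    (x, 0)).hasFDerivAt.comp_hasDerivAt 0 h₁
  refine h₂.unique ?_
  have h₃ : HasDerivAt (fun t : ℝ ↦ σ (x + t • v)) (fderiv ℝ σ x v) 0 := by
    have : HasDerivAt (fun t : ℝ ↦ x + t • v) v 0 := by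
      simpa using ((hasDerivAt_id (0 : ℝ)).smul_const v).const_add x
    exact HasFDerivAt.comp_hasDerivAt_of_eq (0 : ℝ) hσ.hasFDerivAt this (by simp)
  have h₄ : HasDerivAt (fun t : ℝ ↦ Complex.exp ((k : ℂ) * ((t : ℂ) * (θ x v : ℂ)) * Complex.I))
      (Complex.exp ((k : ℂ) * (((0 : ℝ) : ℂ) * (θ x v : ℂ)) * Complex.I)
        * ((k : ℂ) * (1 * (θ x v : ℂ)) * Complex.I)) 0 := by
    have : HasDerivAt (fun t : ℝ ↦ (t : ℂ)) 1 0 := Complex.ofRealCLM.hasDerivAt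
    exact (((this.mul_const _).const_mul _).mul_const _).cexp
  refine HasDerivAt.congr_deriv (h₃.mul h₄ : HasDerivAt
    (transported k θ σ v ∘ fun t : ℝ ↦ (x, t)) _ 0) ?_
  simp [covDeriv]
  ring

/-- In a gauge where the connection form vanishes at `x₀`, covariant bounds on a ball of radius
`1 / k` give bounds on the jets. -/
theorem exists_jetBound_of_covDeriv (T C : ℝ) (hT : 0 ≤ T) (hC : 0 ≤ C) :
    ∃ A : ℝ, 1 ≤ A ∧ ∀ (k : ℕ) (θ : E → E →L[ℝ] ℝ) (σ : E → ℂ) (x₀ : E), 1 ≤ k →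
      ContDiff ℝ ∞ θ → ContDiff ℝ ∞ σ → θ x₀ = 0 → ‖σ x₀‖ ≤ 1 →
      (∀ y ∈ Metric.closedBall x₀ (k : ℝ)⁻¹, ∀ w,
        ‖fderiv ℝ (fun z ↦ θ z w) y‖ ≤ T * ‖w‖) →
      (∀ y ∈ Metric.closedBall x₀ (k : ℝ)⁻¹, ∀ u,
        ‖covDeriv k θ σ y u‖ ≤ C * Real.sqrt k * ‖u‖) →
      (∀ y ∈ Metric.closedBall x₀ (k : ℝ)⁻¹, ∀ u w,
        ‖covDeriv k θ (fun z ↦ covDeriv k θ σ z w) y u‖ ≤ C * k * (‖u‖ * ‖w‖)) →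
      ∀ y ∈ Metric.closedBall x₀ (k : ℝ)⁻¹, JetBound σ y A (A * Real.sqrt k) (A * k) := by
  -- Grönwall along the segment from x₀, run over unit time: initial value at most 1, growth rate T,
  -- forcing C.
  set A₀ := max (gronwallBound 1 T C 1) 0 with hA₀
  have nA₀ : 0 ≤ A₀ := le_max_right _ _
  set A₁ := C + T * A₀ with hA₁
  have nA₁ : 0 ≤ A₁ := by positivity
  refine ⟨1 + A₀ + A₁ + (C + T * A₀ + T * A₁ + T * C), by
    have : 0 ≤ C + T * A₀ + T * A₁ + T * C := by positivity
    linarith, ?_⟩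
  intro k θ σ x₀ hk hθ hσ hθ0 hσ0 hT' h₁ h₂
  have hk0 : (0 : ℝ) < k := by exact_mod_cast hk
  have hk1 : (1 : ℝ) ≤ k := by exact_mod_cast hk
  have hl1 : 1 ≤ Real.sqrt k := Real.one_le_sqrt.2 hk1
  have hlk : Real.sqrt k ≤ k := by
    have := Real.sq_sqrt hk0.le
    nlinarith
  -- This explains the radius 1/k: θ vanishes at x₀ and has bounded derivative, so kθ is O(1) on
  -- that ball.
  have hθb (y : E) (hy : y ∈ Metric.closedBall x₀ (k : ℝ)⁻¹) (w : E) :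
      k * ‖θ y w‖ ≤ T * ‖w‖ := by
    have := (convex_closedBall x₀ (k : ℝ)⁻¹).norm_image_sub_le_of_norm_fderiv_le (𝕜 := ℝ)
      (f := fun z ↦ θ z w) (C := T * ‖w‖) (x := x₀) (y := y)
      (fun z _ ↦ (hθ.clm_apply contDiff_const).differentiable (by simp) z)
      (fun z hz ↦ hT' z hz w) (Metric.mem_closedBall_self (by positivity)) hy
    rw [hθ0] at this
    simp only [zero_apply, sub_zero] at this
    have hyn : ‖y - x₀‖ ≤ (k : ℝ)⁻¹ := by simpa [dist_eq_norm] using hy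
    calc k * ‖θ y w‖ ≤ k * (T * ‖w‖ * (k : ℝ)⁻¹) := by gcongr; exact this.trans (by gcongr)
      _ = T * ‖w‖ := by field_simp
  have hder (y : E) (hy : y ∈ Metric.closedBall x₀ (k : ℝ)⁻¹) (u : E) :
      ‖fderiv ℝ σ y u‖ ≤ C * Real.sqrt k * ‖u‖ + T * ‖u‖ * ‖σ y‖ := by
    have e : fderiv ℝ σ y u = covDeriv k θ σ y u - (k : ℂ) * Complex.I * (θ y u : ℂ) * σ y := by
      simp [covDeriv]
    rw [e]
    refine (norm_sub_le _ _).trans (add_le_add (h₁ y hy u) ?_)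
    rw [norm_mul, norm_mul, norm_mul, Complex.norm_I, mul_one, Complex.norm_natCast,
      Complex.norm_real]
    exact mul_le_mul_of_nonneg_right (hθb y hy u) (norm_nonneg _)
  have hval (y : E) (hy : y ∈ Metric.closedBall x₀ (k : ℝ)⁻¹) : ‖σ y‖ ≤ A₀ := by
    have hyn : ‖y - x₀‖ ≤ (k : ℝ)⁻¹ := by simpa [dist_eq_norm] using hy
    have hg (t : ℝ) : HasDerivAt (fun t : ℝ ↦ σ (x₀ + t • (y - x₀)))
        (fderiv ℝ σ (x₀ + t • (y - x₀)) (y - x₀)) t := by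
      have : HasDerivAt (fun t : ℝ ↦ x₀ + t • (y - x₀)) (y - x₀) t := by
        simpa using ((hasDerivAt_id t).smul_const (y - x₀)).const_add x₀
      exact (hσ.differentiable (by simp) _).hasFDerivAt.comp_hasDerivAt t this
    have hmem {t : ℝ} (ht : t ∈ Set.Ico (0 : ℝ) 1) :
        x₀ + t • (y - x₀) ∈ Metric.closedBall x₀ (k : ℝ)⁻¹ := by
      rw [Metric.mem_closedBall, dist_eq_norm, add_sub_cancel_left, norm_smul,
        Real.norm_of_nonneg ht.1]
      nlinarith [norm_nonneg (y - x₀), ht.1, ht.2]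
    have := norm_le_gronwallBound_of_norm_deriv_right_le (a := 0) (b := 1) (δ := 1) (K := T)
      (ε := C) (f := fun t : ℝ ↦ σ (x₀ + t • (y - x₀)))
      (f' := fun t ↦ fderiv ℝ σ (x₀ + t • (y - x₀)) (y - x₀))
      (fun t _ ↦ (hg t).continuousAt.continuousWithinAt)
      (fun t _ ↦ (hg t).hasDerivWithinAt) (by simpa using hσ0) (fun t ht ↦ by
        refine (hder _ (hmem ht) _).trans ?_
        have e₁ : C * Real.sqrt k * ‖y - x₀‖ ≤ C := by
          calc _ ≤ C * k * (k : ℝ)⁻¹ := by gcongr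
            _ = C := by field_simp
        have e₂ : T * ‖y - x₀‖ * ‖σ (x₀ + t • (y - x₀))‖ ≤ T * ‖σ (x₀ + t • (y - x₀))‖ := by
          have : ‖y - x₀‖ ≤ 1 := hyn.trans (inv_le_one_of_one_le₀ hk1)
          have := mul_nonneg hT (norm_nonneg (σ (x₀ + t • (y - x₀))))
          nlinarith
        linarith) 1 ⟨zero_le_one, le_rfl⟩
    have e : x₀ + (1 : ℝ) • (y - x₀) = y := by simp
    rw [e, sub_zero] at this
    exact this.trans (le_max_left _ _)
  intro y hy
  have d₁ (u : E) : ‖fderiv ℝ σ y u‖ ≤ A₁ * Real.sqrt k * ‖u‖ := by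
    refine (hder y hy u).trans ?_
    have : T * ‖u‖ * ‖σ y‖ ≤ T * ‖u‖ * A₀ * Real.sqrt k := by
      have a : T * ‖u‖ * ‖σ y‖ ≤ T * ‖u‖ * A₀ := by gcongr; exact hval y hy
      have b : 0 ≤ T * ‖u‖ * A₀ := by positivity
      nlinarith
    rw [hA₁]
    linarith
  have d₂ (u w : E) : ‖fderiv ℝ (fderiv ℝ σ) y u w‖
      ≤ (C + T * A₀ + T * A₁ + T * C) * k * ‖u‖ * ‖w‖ := by
    have hθw : HasFDerivAt (fun z ↦ ((θ z w : ℝ) : ℂ))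
        (Complex.ofRealCLM.comp (fderiv ℝ (fun z ↦ θ z w) y)) y :=
      Complex.ofRealCLM.hasFDerivAt.comp y
        ((hθ.clm_apply contDiff_const).differentiable (by simp) y).hasFDerivAt
    have hσd := (hσ.differentiable (by simp) y).hasFDerivAt
    have hdd : HasFDerivAt (fderiv ℝ σ) (fderiv ℝ (fderiv ℝ σ) y) y :=
      (JetBound.fderiv_differentiableAt (hσ.contDiffAt.of_le two_le_infty)).hasFDerivAt
    have key : HasFDerivAt (fun z ↦ covDeriv k θ σ z w) _ y :=
      (hdd.clm_apply (hasFDerivAt_const w y)).add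
        ((hθw.const_mul ((k : ℂ) * Complex.I)).mul hσd)
    -- The iterated covariant derivative is expanded and solved for the plain second derivative. The
    -- term containing Dθ is O(k) because σ is O(1); the two terms containing kθ are O(√k).
    have e : fderiv ℝ (fderiv ℝ σ) y u w
        = covDeriv k θ (fun z ↦ covDeriv k θ σ z w) y u
          - (k : ℂ) * Complex.I * ((fderiv ℝ (fun z ↦ θ z w) y u : ℝ) : ℂ) * σ y
          - (k : ℂ) * Complex.I * (θ y w : ℂ) * fderiv ℝ σ y u
          - (k : ℂ) * Complex.I * (θ y u : ℂ) * covDeriv k θ σ y w := by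
      rw [covDeriv, key.fderiv]
      simp
      ring
    have n₁ : ‖(k : ℂ) * Complex.I * ((fderiv ℝ (fun z ↦ θ z w) y u : ℝ) : ℂ) * σ y‖
        ≤ k * (T * ‖w‖ * ‖u‖) * A₀ := by
      rw [norm_mul, norm_mul, norm_mul, Complex.norm_I, mul_one, Complex.norm_natCast,
        Complex.norm_real]
      have a := ContinuousLinearMap.le_of_opNorm_le _ (hT' y hy w) u
      have b := hval y hy
      gcongr
    have n₂ : ‖(k : ℂ) * Complex.I * (θ y w : ℂ) * fderiv ℝ σ y u‖
        ≤ T * ‖w‖ * (A₁ * Real.sqrt k * ‖u‖) := by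
      rw [norm_mul, norm_mul, norm_mul, Complex.norm_I, mul_one, Complex.norm_natCast,
        Complex.norm_real]
      have a := hθb y hy w
      have b := d₁ u
      gcongr
    have n₃ : ‖(k : ℂ) * Complex.I * (θ y u : ℂ) * covDeriv k θ σ y w‖
        ≤ T * ‖u‖ * (C * Real.sqrt k * ‖w‖) := by
      rw [norm_mul, norm_mul, norm_mul, Complex.norm_I, mul_one, Complex.norm_natCast,
        Complex.norm_real]
      have a := hθb y hy u
      have b := h₁ y hy w
      gcongr
    have n₄ := h₂ y hy u w
    rw [e]
    have m₂ : T * ‖w‖ * (A₁ * Real.sqrt k * ‖u‖) ≤ T * ‖w‖ * (A₁ * k * ‖u‖) := by gcongr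
    have m₃ : T * ‖u‖ * (C * Real.sqrt k * ‖w‖) ≤ T * ‖u‖ * (C * k * ‖w‖) := by gcongr
    calc _ ≤ C * k * (‖u‖ * ‖w‖) + k * (T * ‖w‖ * ‖u‖) * A₀
          + T * ‖w‖ * (A₁ * k * ‖u‖) + T * ‖u‖ * (C * k * ‖w‖) := by
          refine (norm_sub_le _ _).trans (add_le_add ?_ (n₃.trans m₃))
          refine (norm_sub_le _ _).trans (add_le_add ?_ (n₂.trans m₂))
          exact (norm_sub_le _ _).trans (add_le_add n₄ n₁)
      _ = _ := by ring
  have nn : 0 ≤ C + T * A₀ + T * A₁ + T * C := by positivity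
  refine ⟨hσ.contDiffAt.of_le two_le_infty, (hval y hy).trans (by linarith), ?_, by positivity,
    fun u w ↦ (d₂ u w).trans ?_⟩
  · refine ContinuousLinearMap.opNorm_le_bound _ (by positivity) fun u ↦ (d₁ u).trans ?_
    gcongr
    linarith
  · exact mul_le_mul_of_nonneg_right (mul_le_mul_of_nonneg_right (mul_le_mul_of_nonneg_right
      (by linarith) hk0.le) (norm_nonneg _)) (norm_nonneg _)

end LocalModel

/-! ### The variable step and the regularised covariant derivative. -/

noncomputable section LocalEstimates

variable {E : Type} [NormedAddCommGroup E] [NormedSpace ℝ E]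

/-- `|σ₀|² + |σ₁|²`. -/
def pairSq (σ₀ σ₁ : E → ℂ) (x : E) : ℝ := ‖σ₀ x‖ ^ 2 + ‖σ₁ x‖ ^ 2

/-- A smooth function comparable with `√w / √k` where `κ² ≤ w`, and vanishing where `w` does. -/
def stepSize (k : ℕ) (κ : ℝ) (w : E → ℝ) (x : E) : ℝ :=
  (Real.sqrt k)⁻¹ * (Real.sqrt (w x + κ ^ 2) - κ)

theorem pairSq_nonneg (σ₀ σ₁ : E → ℂ) (x : E) : 0 ≤ pairSq σ₀ σ₁ x := by
  unfold pairSq; positivity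

theorem norm_le_sqrt_pairSq (σ₀ σ₁ : E → ℂ) (x : E) :
    ‖σ₀ x‖ ≤ Real.sqrt (pairSq σ₀ σ₁ x) ∧ ‖σ₁ x‖ ≤ Real.sqrt (pairSq σ₀ σ₁ x) := by
  constructor <;> refine Real.le_sqrt_of_sq_le ?_ <;> unfold pairSq <;> nlinarith [sq_nonneg ‖σ₀ x‖, sq_nonneg ‖σ₁ x‖]

/-- For 0 ≤ s ≤ 1/k and θ x₀ = 0 the exponent iksθ(v) has value 0, first derivative at most T and
second derivative O(k), so the phase affects the jets of σ by constant factors only. -/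
theorem jetBound_transported {k : ℕ} {θ : E → E →L[ℝ] ℝ} {σ : E → ℂ} {v x₀ : E} {s A T : ℝ}
    (hk : 1 ≤ k) (hs : s ∈ Set.Icc 0 (k : ℝ)⁻¹) (hv : ‖v‖ ≤ 1) (hT : 0 ≤ T) (hA : 0 ≤ A)
    (hθ0 : θ x₀ = 0) (hθ : JetBound (fun x ↦ ((θ x v : ℝ) : ℂ)) x₀ 0 T T)
    (hσ : JetBound σ (x₀ + s • v) A (A * Real.sqrt k) (A * k)) :
    JetBound (transported k θ σ v) (x₀, s) (A * (T ^ 2 + 7 * T + 5))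
      (A * (T ^ 2 + 7 * T + 5) * Real.sqrt k) (A * (T ^ 2 + 7 * T + 5) * k) := by
  have hk0 : (0 : ℝ) < k := by exact_mod_cast hk
  have hk1 : (1 : ℝ) ≤ k := by exact_mod_cast hk
  have hl1 : 1 ≤ Real.sqrt k := Real.one_le_sqrt.2 hk1
  have hlk : Real.sqrt k ≤ k := by
    have := Real.sq_sqrt hk0.le
    nlinarith
  have hks : k * s ≤ 1 := by
    calc k * s ≤ k * (k : ℝ)⁻¹ := by gcongr; exact hs.2
      _ = 1 := mul_inv_cancel₀ hk0.ne'
  have hs1 : s ≤ 1 := hs.2.trans (inv_le_one_of_one_le₀ hk1)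
  have hs0 := hs.1
  have j₁ : JetBound (fun p : E × ℝ ↦ ((p.2 : ℝ) : ℂ)) (x₀, s) s 1 0 :=
    JetBound.clm (Complex.ofRealCLM.comp (ContinuousLinearMap.snd ℝ E ℝ))
      (by simp [abs_of_nonneg hs.1])
      (fun u ↦ by simpa using norm_snd_le u) zero_le_one
  have j₂ := ((j₁.mul (hθ.comp_fst (s := s))).const_mul (k : ℂ)).const_mul Complex.I
  have j₃ : JetBound (fun p : E × ℝ ↦ (k : ℂ) * ((p.2 : ℂ) * (θ p.1 v : ℂ)) * Complex.I) (x₀, s)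
      0 T (3 * T * k) := by
    refine (j₂.congr (Eventually.of_forall fun p ↦ mul_comm _ _)).mono ?_ ?_ ?_
    · simp
    · simp only [Complex.norm_I, Complex.norm_natCast]; nlinarith
    · simp only [Complex.norm_I, Complex.norm_natCast]; nlinarith
  have j₄ : JetBound (fun p : E × ℝ ↦
      Complex.exp ((k : ℂ) * ((p.2 : ℂ) * (θ p.1 v : ℂ)) * Complex.I)) (x₀, s) 1 T
      ((T ^ 2 + 3 * T) * k) := by
    have := (JetBound.complex_exp _).comp j₃.contDiffAt j₃.one j₃.nonneg₂ j₃.two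
    simp only [hθ0, zero_apply, Complex.ofReal_zero, mul_zero, zero_mul, Complex.exp_zero,
      norm_one] at this
    exact this.mono le_rfl (by linarith) (by nlinarith)
  refine ((hσ.comp_add_smul hv).mul j₄).mono ?_ ?_ ?_
  · nlinarith [mul_nonneg hA hT, mul_nonneg hA (sq_nonneg T)]
  · have h₁ := mul_nonneg hA hT
    have h₂ := mul_nonneg hA (sq_nonneg T)
    have h₃ : A * T ≤ A * T * Real.sqrt k := le_mul_of_one_le_right h₁ hl1
    have h₄ : 0 ≤ A * T ^ 2 * Real.sqrt k := by positivity
    have h₅ : 0 ≤ A * T * Real.sqrt k := by positivity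
    have h₆ : 0 ≤ A * Real.sqrt k := by positivity
    nlinarith
  · have h₁ := mul_nonneg hA hT
    have h₃ : A * T * Real.sqrt k ≤ A * T * k := by gcongr
    have h₆ : 0 ≤ A * k := by positivity
    nlinarith

/-- The first derivative of |σ|² is 2 Re(conj(σ) Dσ) and keeps a factor y, the norm of the pair.
This factor is what later gives the square root of |σ₀|² + |σ₁|² a bounded slope. -/
theorem jetBound_pairSq {k : ℕ} {σ₀ σ₁ : E → ℂ} {x₀ : E} {A : ℝ} (hk : 1 ≤ k) (hA : 1 ≤ A)
    (h₀ : JetBound σ₀ x₀ A (A * Real.sqrt k) (A * k))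
    (h₁ : JetBound σ₁ x₀ A (A * Real.sqrt k) (A * k))
    (hy : Real.sqrt (pairSq σ₀ σ₁ x₀) ≤ (Real.sqrt k)⁻¹) :
    JetBound (pairSq σ₀ σ₁) x₀ (2 * pairSq σ₀ σ₁ x₀)
      (4 * A * Real.sqrt (pairSq σ₀ σ₁ x₀) * Real.sqrt k) (8 * A ^ 2 * k) := by
  have hk0 : (0 : ℝ) < k := by exact_mod_cast hk
  have hk1 : (1 : ℝ) ≤ k := by exact_mod_cast hk
  have hl1 : 1 ≤ Real.sqrt k := Real.one_le_sqrt.2 hk1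
  set y := Real.sqrt (pairSq σ₀ σ₁ x₀) with hydef
  have hy0 : 0 ≤ y := Real.sqrt_nonneg _
  have hy1 : y ≤ 1 := hy.trans (inv_le_one_of_one_le₀ hl1)
  have hyy : y ^ 2 = pairSq σ₀ σ₁ x₀ := Real.sq_sqrt (pairSq_nonneg _ _ _)
  have aux {σ : E → ℂ} (h : JetBound σ x₀ A (A * Real.sqrt k) (A * k)) (hσ : ‖σ x₀‖ ≤ y) :
      JetBound (fun z ↦ ‖σ z‖ ^ 2) x₀ (y ^ 2) (2 * A * y * Real.sqrt k) (4 * A ^ 2 * k) := by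
    -- The zeroth-order bound A is sharpened to y before squaring.
    have h' : JetBound σ x₀ y (A * Real.sqrt k) (A * k) :=
      ⟨h.contDiffAt, hσ, h.one, h.nonneg₂, h.two⟩
    have := (h'.mul h'.conj).clm_comp Complex.reCLM (fun u ↦ Complex.abs_re_le_norm u)
    refine (this.congr (Eventually.of_forall fun z ↦ ?_)).mono (by nlinarith) (by nlinarith) ?_
    · simp only [Complex.reCLM_apply, Complex.mul_conj, Complex.ofReal_re, Complex.normSq_eq_norm_sq]
    · have := Real.sq_sqrt hk0.le
      have h₂ : y * (A * k) ≤ A ^ 2 * k := by nlinarith [mul_nonneg (by linarith : 0 ≤ A) hk0.le, mul_le_mul_of_nonneg_right hy1 (by positivity : 0 ≤ A * k), mul_le_mul_of_nonneg_right hA (by positivity : 0 ≤ A * k)]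
      have h₃ : A * Real.sqrt k * (A * Real.sqrt k) = A ^ 2 * k := by
        rw [show A * Real.sqrt k * (A * Real.sqrt k) = A ^ 2 * (Real.sqrt k) ^ 2 by ring, this]
      rw [h₃]
      linarith
  have hn := norm_le_sqrt_pairSq σ₀ σ₁ x₀
  refine ((aux h₀ hn.1).add (aux h₁ hn.2)).mono (by linarith) (by linarith) (by linarith)

/-- With S = √(w + κ²) and y = √w one has (S - κ)(S + κ) = y². If κ ≤ y then S ≤ 2y, so S + κ ≤ 3y,
and the step is comparable with y/√k. -/
theorem stepSize_bounds {k : ℕ} {κ : ℝ} {w : E → ℝ} {x₀ : E} (hk : 1 ≤ k) (hκ : 0 < κ)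
    (hw : 0 ≤ w x₀) :
    0 ≤ stepSize k κ w x₀ ∧ stepSize k κ w x₀ ≤ (Real.sqrt k)⁻¹ * Real.sqrt (w x₀) ∧
      (κ ≤ Real.sqrt (w x₀) → (Real.sqrt k)⁻¹ * Real.sqrt (w x₀) ≤ 3 * stepSize k κ w x₀) := by
  have hk0 : (0 : ℝ) < k := by exact_mod_cast hk
  have hl : 0 < (Real.sqrt k)⁻¹ := inv_pos.2 (Real.sqrt_pos.2 hk0)
  set y := Real.sqrt (w x₀)
  have hy0 : 0 ≤ y := Real.sqrt_nonneg _
  have hyy : w x₀ = y ^ 2 := (Real.sq_sqrt hw).symm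
  have hS := Real.sq_sqrt (by positivity : 0 ≤ w x₀ + κ ^ 2)
  set S := Real.sqrt (w x₀ + κ ^ 2)
  have hS0 : 0 ≤ S := Real.sqrt_nonneg _
  rw [hyy] at hS
  have h₁ : κ ≤ S := by nlinarith
  have h₂ : S ≤ y + κ := by nlinarith
  refine ⟨mul_nonneg hl.le (by linarith), mul_le_mul_of_nonneg_left (by linarith) hl.le, ?_⟩
  intro hyκ
  have : y ≤ 3 * (S - κ) := by
    have h₃ : S ≤ 2 * y := by nlinarith
    have h₄ : (S - κ) * (S + κ) = y ^ 2 := by nlinarith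
    have h₅ : (S - κ) * (S + κ) ≤ (S - κ) * (3 * y) :=
      mul_le_mul_of_nonneg_left (by linarith) (by linarith)
    have hypos : 0 < y := hκ.trans_le hyκ
    nlinarith
  calc _ ≤ (Real.sqrt k)⁻¹ * (3 * (S - κ)) := by gcongr
    _ = 3 * ((Real.sqrt k)⁻¹ * (S - κ)) := by ring

/-- The slope is y/S ≤ 1 times a constant, whatever κ is. The second derivative is only O(√k/S),
hence bounded by O(√k) after multiplication by y ≤ S. -/
theorem jetBound_stepSize {k : ℕ} {σ₀ σ₁ : E → ℂ} {x₀ : E} {A κ : ℝ} (hk : 1 ≤ k) (hA : 1 ≤ A)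
    (hκ : 0 < κ)
    (h₀ : JetBound σ₀ x₀ A (A * Real.sqrt k) (A * k))
    (h₁ : JetBound σ₁ x₀ A (A * Real.sqrt k) (A * k))
    (hy : Real.sqrt (pairSq σ₀ σ₁ x₀) ≤ (Real.sqrt k)⁻¹) :
    ∃ b₀ B, JetBound (stepSize k κ (pairSq σ₀ σ₁)) x₀ b₀ (4 * A) B ∧
      Real.sqrt (pairSq σ₀ σ₁ x₀) * B ≤ 24 * A ^ 2 * Real.sqrt k := by
  have hk0 : (0 : ℝ) < k := by exact_mod_cast hk
  have hl : 0 < Real.sqrt k := Real.sqrt_pos.2 hk0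
  have hll : Real.sqrt k ^ 2 = k := Real.sq_sqrt hk0.le
  have hw := jetBound_pairSq hk hA h₀ h₁ hy
  have hs := hw.sqrt_comp hκ (pairSq_nonneg σ₀ σ₁)
  set y := Real.sqrt (pairSq σ₀ σ₁ x₀) with hydef
  have hy0 : 0 ≤ y := Real.sqrt_nonneg _
  have hS : y ≤ Real.sqrt (pairSq σ₀ σ₁ x₀ + κ ^ 2) := Real.sqrt_le_sqrt (by nlinarith)
  have hS0 : 0 < Real.sqrt (pairSq σ₀ σ₁ x₀ + κ ^ 2) :=
    Real.sqrt_pos.2 (by have := pairSq_nonneg σ₀ σ₁ x₀; positivity)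
  set S := Real.sqrt (pairSq σ₀ σ₁ x₀ + κ ^ 2)
  have hi : 0 < S⁻¹ := inv_pos.2 hS0
  have hSy : S⁻¹ * y ≤ 1 := by
    rw [inv_mul_le_iff₀ hS0]; linarith
  have hSy0 : 0 ≤ S⁻¹ * y := by positivity
  set T : ℝ →L[ℝ] ℝ := (Real.sqrt k)⁻¹ • ContinuousLinearMap.id ℝ ℝ
  have hT (u : ℝ) : ‖T u‖ ≤ (Real.sqrt k)⁻¹ * ‖u‖ := by
    simp [T, abs_of_pos hl]
  have hsub := hs.sub (JetBound.const x₀ κ)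
  have hc := (JetBound.clm T (x := Real.sqrt (pairSq σ₀ σ₁ x₀ + κ ^ 2) - κ) le_rfl hT
    (by positivity)).comp (g := fun z ↦ Real.sqrt (pairSq σ₀ σ₁ z + κ ^ 2) - κ)
    hsub.contDiffAt hsub.one hsub.nonneg₂ hsub.two
  refine ⟨_, _, (hc.congr (Eventually.of_forall fun z ↦ ?_)).mono le_rfl ?_ le_rfl, ?_⟩
  · simp [T, stepSize]
  · calc (Real.sqrt k)⁻¹ * (S⁻¹ * (4 * A * y * Real.sqrt k) + 0)
        = 4 * A * (S⁻¹ * y) * ((Real.sqrt k)⁻¹ * Real.sqrt k) := by ring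
      _ ≤ 4 * A * 1 * 1 := by
        rw [inv_mul_cancel₀ hl.ne']
        gcongr
      _ = 4 * A := by ring
  · have e : (Real.sqrt k)⁻¹ * k = Real.sqrt k := by
      rw [inv_mul_eq_iff_eq_mul₀ hl.ne', ← pow_two, hll]
    calc y * (0 * _ ^ 2 + (Real.sqrt k)⁻¹ * (S⁻¹ ^ 3 * (4 * A * y * Real.sqrt k) ^ 2
          + S⁻¹ * (8 * A ^ 2 * k) + 0))
        = (16 * A ^ 2 * (S⁻¹ * y) ^ 3 * (Real.sqrt k ^ 2) + 8 * A ^ 2 * (S⁻¹ * y) * k)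
          * (Real.sqrt k)⁻¹ := by ring
      _ ≤ (16 * A ^ 2 * 1 * k + 8 * A ^ 2 * 1 * k) * (Real.sqrt k)⁻¹ := by
        rw [hll]
        have : (S⁻¹ * y) ^ 3 ≤ 1 := pow_le_one₀ hSy0 hSy
        gcongr
      _ = 24 * A ^ 2 * ((Real.sqrt k)⁻¹ * k) := by ring
      _ = _ := by rw [e]

/-- The regularised derivative is bounded with its derivatives, and close to the covariant
derivative. -/
theorem weightedBound_regDeriv [FiniteDimensional ℝ E] {k : ℕ} {θ : E → E →L[ℝ] ℝ}
    {σ σ₀ σ₁ : E → ℂ}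
    {v x₀ : E} {A B κ M : ℝ} (hk : 1 ≤ k) (hA : 1 ≤ A) (hB : 0 ≤ B) (hκ : 0 < κ)
    (hM : 0 ≤ M) (hκM : κ * M ≤ k)
    (hθ : ContDiff ℝ ∞ θ) (hσ : ContDiff ℝ ∞ σ)
    (h₀ : JetBound σ₀ x₀ A (A * Real.sqrt k) (A * k))
    (h₁ : JetBound σ₁ x₀ A (A * Real.sqrt k) (A * k))
    (hy : Real.sqrt (pairSq σ₀ σ₁ x₀) ≤ (Real.sqrt k)⁻¹)
    (hF : ∀ s ∈ Set.Icc 0 (k : ℝ)⁻¹, JetBound (transported k θ σ v) (x₀, s) B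
      (B * Real.sqrt k) (B * k))
    (hD : ∀ r ∈ Set.Icc (0 : ℝ) 1, ∀ u u', ‖fderiv ℝ (fderiv ℝ
      (hadamardQuotient (transported k θ σ v))) (x₀, r) u u'‖ ≤ M * ‖u‖ * ‖u'‖) :
    WeightedBound (regDeriv k θ σ v (stepSize k κ (pairSq σ₀ σ₁))) x₀
        (Real.sqrt (pairSq σ₀ σ₁ x₀)) (Real.sqrt k)
        (((12 * B + 1) * (1 + 4 * A) ^ 2 + 24 * A ^ 2 * B) * Real.sqrt k) ∧
      ‖regDeriv k θ σ v (stepSize k κ (pairSq σ₀ σ₁)) x₀ - covDeriv k θ σ x₀ v‖ ≤ B := by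
  have hk0 : (0 : ℝ) < k := by exact_mod_cast hk
  have hk1 : (1 : ℝ) ≤ k := by exact_mod_cast hk
  have hl1 : 1 ≤ Real.sqrt k := Real.one_le_sqrt.2 hk1
  have hl : 0 < Real.sqrt k := Real.sqrt_pos.2 hk0
  have hll : Real.sqrt k ^ 2 = k := Real.sq_sqrt hk0.le
  obtain ⟨b₀, b₂, hρ, hb₂⟩ := jetBound_stepSize hk hA hκ h₀ h₁ hy
  obtain ⟨r₀, r₁, r₂⟩ := stepSize_bounds (w := pairSq σ₀ σ₁) (x₀ := x₀) hk hκ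
    (pairSq_nonneg σ₀ σ₁ x₀)
  set ρ := stepSize k κ (pairSq σ₀ σ₁) with hρdef
  set y := Real.sqrt (pairSq σ₀ σ₁ x₀) with hydef
  have hy0 : 0 ≤ y := Real.sqrt_nonneg _
  have hρk : ρ x₀ ≤ (k : ℝ)⁻¹ := by
    refine r₁.trans ((mul_le_mul_of_nonneg_left hy (by positivity)).trans (le_of_eq ?_))
    rw [← mul_inv, ← pow_two, hll]
  have hρ1 : ρ x₀ ≤ 1 := hρk.trans (inv_le_one_of_one_le₀ hk1)
  have hFc := contDiff_transported (k := k) hθ hσ v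
  have hQ (r : ℝ) (hr : r ∈ Set.Icc 0 (ρ x₀)) :
      JetBound (hadamardQuotient (transported k θ σ v)) (x₀, r) (B * Real.sqrt k) (B * k) M :=
    jetBound_hadamardQuotient hFc hr.1 (fun s hs ↦ hF s ⟨hs.1, (hs.2.trans hr.2).trans hρk⟩) hM
      (fun _ ↦ Or.inr (hD r ⟨hr.1, hr.2.trans hρ1⟩)) (fun _ ↦ hD r ⟨hr.1, hr.2.trans hρ1⟩)
  constructor
  · obtain ⟨B₃, hQ₃, hB₃⟩ : ∃ B₃, JetBound (hadamardQuotient (transported k θ σ v)) (x₀, ρ x₀)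
        (B * Real.sqrt k) (B * k) B₃ ∧ y * B₃ ≤ (12 * B + 1) * (k * Real.sqrt k) := by
      rcases le_or_gt κ y with hyκ | hyκ
      · have hρpos : 0 < ρ x₀ := by
          have := r₂ hyκ
          have : 0 < (Real.sqrt k)⁻¹ * y := mul_pos (inv_pos.2 hl) (hκ.trans_le hyκ)
          linarith
        refine ⟨(ρ x₀)⁻¹ * (4 * (B * k)), jetBound_hadamardQuotient hFc r₀
          (fun s hs ↦ hF s ⟨hs.1, hs.2.trans hρk⟩) (by positivity) (fun _ ↦ Or.inl le_rfl)
          (fun h ↦ absurd h hρpos.ne'), ?_⟩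
        have h₃ : y ≤ 3 * Real.sqrt k * ρ x₀ := by
          have := mul_le_mul_of_nonneg_left (r₂ hyκ) hl.le
          rw [← mul_assoc, mul_inv_cancel₀ hl.ne', one_mul] at this
          linarith
        have h₄ : y * (ρ x₀)⁻¹ ≤ 3 * Real.sqrt k := by
          rw [← div_eq_mul_inv, div_le_iff₀ hρpos]; exact h₃
        calc y * ((ρ x₀)⁻¹ * (4 * (B * k))) = (y * (ρ x₀)⁻¹) * (4 * (B * k)) := by ring
          _ ≤ (3 * Real.sqrt k) * (4 * (B * k)) := by gcongr
          _ ≤ _ := by nlinarith [mul_pos hk0 hl]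
      · refine ⟨M, hQ _ ⟨r₀, le_rfl⟩, ?_⟩
        calc y * M ≤ κ * M := by gcongr
          _ ≤ k * 1 := by linarith
          _ ≤ 1 * (k * Real.sqrt k) := by rw [one_mul]; gcongr
          _ ≤ _ := by gcongr; linarith
    have key := hQ₃.comp_graph hρ
    refine ⟨_, JetBound.mono key ?_ ?_ le_rfl, ?_⟩
    · have h₅ : (1 : ℝ) ≤ (1 + 4 * A) ^ 2 := one_le_pow₀ (by linarith)
      gcongr
      nlinarith [mul_nonneg (sq_nonneg A) hB]
    · rw [mul_assoc _ (Real.sqrt k) (Real.sqrt k), ← pow_two, hll, mul_right_comm]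
      gcongr
      nlinarith [mul_nonneg (sq_nonneg A) hB]
    · have e₁ : y * B₃ * (1 + 4 * A) ^ 2 ≤ (12 * B + 1) * (k * Real.sqrt k) * (1 + 4 * A) ^ 2 := by
        gcongr
      have e₂ : (B * k) * (y * b₂) ≤ (B * k) * (24 * A ^ 2 * Real.sqrt k) := by gcongr
      rw [hll]
      nlinarith
  · rw [← hadamardQuotient_transported_zero (hσ.differentiable (by simp) x₀) hθ hσ v]
    -- Mean value inequality in the vertical direction: the quotient has derivative at most Bk and
    -- the step is at most 1/k.
    have := (convex_segment ((x₀, 0) : E × ℝ) (x₀, ρ x₀)).norm_image_sub_le_of_norm_fderiv_le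
      (𝕜 := ℝ) (f := hadamardQuotient (transported k θ σ v)) (C := B * k)
      (fun z _ ↦ (contDiff_hadamardQuotient hFc).differentiable (by simp) z)
      (fun z hz ↦ by
        obtain ⟨a, b, ha, hb, hab, rfl⟩ := hz
        have hz : (a • (x₀, 0) + b • (x₀, ρ x₀) : E × ℝ) = (x₀, b * ρ x₀) := by
          ext
          · simp [← add_smul, hab]
          · simp
        rw [hz]
        exact (hQ (b * ρ x₀) ⟨by positivity, by nlinarith⟩).one)
      (left_mem_segment ℝ _ _) (right_mem_segment ℝ _ _)
    refine this.trans ?_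
    have e : ‖((x₀, ρ x₀) : E × ℝ) - (x₀, 0)‖ = ρ x₀ := by
      simp [Prod.norm_def, abs_of_nonneg r₀, r₀]
    rw [e]
    calc B * k * ρ x₀ ≤ B * k * (k : ℝ)⁻¹ := by gcongr
      _ = B := by field_simp

end LocalEstimates

/-! ### The correction factor b and the cut-off perturbation, with their jets. -/

noncomputable section LocalPerturbation

theorem JetBound.exists_of_isCompact {V G : Type*} [NormedAddCommGroup V] [NormedSpace ℝ V]
    [NormedAddCommGroup G] [NormedSpace ℝ G] {h : V → G} (hh : ContDiff ℝ ∞ h) {K : Set V}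
    (hK : IsCompact K) : ∃ p, 0 ≤ p ∧ ∀ x ∈ K, JetBound h x p p p := by
  obtain ⟨p₀, h₀⟩ := hK.exists_bound_of_continuousOn hh.continuous.continuousOn
  obtain ⟨p₁, h₁⟩ := hK.exists_bound_of_continuousOn (hh.continuous_fderiv (by simp)).continuousOn
  obtain ⟨p₂, h₂⟩ := hK.exists_bound_of_continuousOn
    (hh.continuous_iteratedFDeriv (m := 2) two_le_infty).continuousOn
  refine ⟨max p₀ (max p₁ (max p₂ 0)), by simp, fun x hx ↦ ⟨hh.contDiffAt.of_le two_le_infty,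
    (h₀ x hx).trans (by simp), (h₁ x hx).trans (by simp), by simp, fun u v ↦ ?_⟩⟩
  have := ContinuousMultilinearMap.le_of_opNorm_le (h₂ x hx) ![u, v]
  rw [iteratedFDeriv_two_apply] at this
  simp only [Matrix.cons_val_zero, Matrix.cons_val_one, Fin.prod_univ_two] at this
  rw [mul_assoc]
  exact this.trans (by gcongr; simp)

section Pairing

variable {E : Type*} {ι : Type*} [Fintype ι]

/-- The bilinear form with coefficients `P a b`. -/
def pairing (P : ι → ι → E → ℝ) (x : E) (α β : ι → ℂ) : ℂ :=
  ∑ a, ∑ b, (P a b x : ℂ) * α a * β b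

/-- The correction factor `-P(q₀, q₁) / P(q₀, conj q₀)`. -/
def corr (P : ι → ι → E → ℝ) (q₀ q₁ : ι → E → ℂ) (x : E) : ℂ :=
  -(pairing P x (fun a ↦ q₀ a x) (fun a ↦ q₁ a x)
    * (pairing P x (fun a ↦ q₀ a x) (fun a ↦ (starRingEnd ℂ) (q₀ a x)))⁻¹)

theorem norm_pairing_sub_le {P : ι → ι → E → ℝ} {x : E} {α α' β β' : ι → ℂ} {p ε m : ℝ}
    (hP : ∀ a b, ‖(P a b x : ℂ)‖ ≤ p) (hp : 0 ≤ p) (hε : 0 ≤ ε) (hm : 0 ≤ m)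
    (hα : ∀ a, ‖α a - α' a‖ ≤ ε) (hβ : ∀ a, ‖β a - β' a‖ ≤ ε)
    (hα₀ : ∀ a, ‖α a‖ ≤ m) (hβ₀ : ∀ a, ‖β' a‖ ≤ m) :
    ‖pairing P x α β - pairing P x α' β'‖
      ≤ (Fintype.card ι : ℝ) ^ 2 * p * (2 * ε * m) := by
  simp only [pairing, ← Finset.sum_sub_distrib]
  have key (a b : ι) : ‖(P a b x : ℂ) * α a * β b - (P a b x : ℂ) * α' a * β' b‖
      ≤ p * (2 * ε * m) := by
    rw [show (P a b x : ℂ) * α a * β b - (P a b x : ℂ) * α' a * β' b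
      = (P a b x : ℂ) * (α a * (β b - β' b) + (α a - α' a) * β' b) by ring, norm_mul]
    have h₁ : ‖α a * (β b - β' b)‖ ≤ m * ε := by
      rw [norm_mul]; gcongr; exacts [hα₀ a, hβ b]
    have h₂ : ‖(α a - α' a) * β' b‖ ≤ ε * m := by
      rw [norm_mul]; gcongr; exacts [hα a, hβ₀ b]
    have h₃ := norm_add_le (α a * (β b - β' b)) ((α a - α' a) * β' b)
    gcongr
    · exact hP a b
    · linarith
  refine (norm_sum_le _ _).trans ?_
  have := Finset.sum_le_card_nsmul Finset.univ
    (fun a ↦ ‖∑ b, ((P a b x : ℂ) * α a * β b - (P a b x : ℂ) * α' a * β' b)‖)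
    (Fintype.card ι * (p * (2 * ε * m))) (fun a _ ↦ by
      refine (norm_sum_le _ _).trans ?_
      have := Finset.sum_le_card_nsmul Finset.univ _ _ (fun b _ ↦ key a b)
      simpa using this)
  refine this.trans (le_of_eq ?_)
  simp
  ring

theorem pairing_smul (P : ι → ι → E → ℝ) (x : E) (α β : ι → ℂ) (s t : ℂ) :
    pairing P x (fun a ↦ s * α a) (fun a ↦ t * β a) = s * t * pairing P x α β := by
  simp only [pairing, Finset.mul_sum]
  refine Finset.sum_congr rfl fun a _ ↦ Finset.sum_congr rfl fun b _ ↦ ?_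
  ring

end Pairing

section

variable {E : Type} [NormedAddCommGroup E] [NormedSpace ℝ E] {ι : Type*} [Fintype ι]

theorem weightedBound_pairing {P : ι → ι → E → ℝ} {q₀ q₁ : ι → E → ℂ} {x₀ : E} {y l a b p : ℝ}
    (hl : 1 ≤ l) (hy : y ≤ 1) (h₀ : ∀ i, WeightedBound (q₀ i) x₀ y l a)
    (h₁ : ∀ i, WeightedBound (q₁ i) x₀ y l b)
    (hP : ∀ i j, JetBound (fun x ↦ (P i j x : ℂ)) x₀ p p p) :
    WeightedBound (fun x ↦ pairing P x (fun i ↦ q₀ i x) (fun i ↦ q₁ i x)) x₀ y l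
      ((Fintype.card ι : ℝ) ^ 2 * (16 * (p * a * b))) := by
  have hl0 : 0 ≤ l := by linarith
  have := WeightedBound.sum Finset.univ fun i _ ↦ WeightedBound.sum Finset.univ fun j _ ↦
    ((WeightedBound.of_jetBound (hP i j) le_rfl le_rfl le_rfl hl hy).mul hl0 hy (h₀ i)).mul
      hl0 hy (h₁ j)
  refine WeightedBound.mono this (le_of_eq ?_) hl0
  simp
  ring

/-- Here c₀, c₁ stand for the true derivatives and q₀, q₁ for the regularised ones, at distance O(1)
while both have size O(l). The pairings therefore change by O(l): the numerator stays O(l), and the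
denominator keeps half of c l² once l is large. The weighted bound alone would only say that the
factor is O(1); the last estimate, O(1/l), is the gain coming from the smallness of the numerator.
-/
theorem corr_bounds {P : ι → ι → E → ℝ} {q₀ q₁ : ι → E → ℂ} {c₀ c₁ : ι → ℂ}
    {x₀ : E} {y l A B p c C R : ℝ} (hl : 1 ≤ l) (hy : y ≤ 1) (hA : 0 ≤ A) (hB : 0 ≤ B)
    (hC : 0 ≤ C) (hp : 0 ≤ p)
    (hR : R = (Fintype.card ι : ℝ) ^ 2 * p)
    (h₀ : ∀ i, WeightedBound (q₀ i) x₀ y l (A * l)) (h₁ : ∀ i, WeightedBound (q₁ i) x₀ y l (A * l))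
    (hP : ∀ i j, JetBound (fun x ↦ (P i j x : ℂ)) x₀ p p p)
    (hB₀ : ∀ i, ‖q₀ i x₀ - c₀ i‖ ≤ B) (hB₁ : ∀ i, ‖q₁ i x₀ - c₁ i‖ ≤ B)
    (hc₀ : ∀ i, ‖c₀ i‖ ≤ A * l) (hc₁ : ∀ i, ‖c₁ i‖ ≤ A * l)
    (hnum : ‖pairing P x₀ c₀ c₁‖ ≤ C * l)
    (hden : c * l ^ 2 ≤ ‖pairing P x₀ c₀ (fun i ↦ (starRingEnd ℂ) (c₀ i))‖)
    (hc : 0 < c) (hlarge : 4 * R * B * A ≤ c * l) :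
    c / 2 * l ^ 2 ≤
      ‖pairing P x₀ (fun a ↦ q₀ a x₀) (fun a ↦ (starRingEnd ℂ) (q₀ a x₀))‖ ∧
    WeightedBound (corr P q₀ q₁) x₀ y l
      (4 * (16 * R * A ^ 2 * (3 * (max 1 (16 * R * A ^ 2 / (c / 2))) ^ 2 * (c / 2)⁻¹))) ∧
    ‖corr P q₀ q₁ x₀‖ ≤ (C + 2 * R * B * A) * (c / 2)⁻¹ * l⁻¹ := by
  have hl0 : 0 < l := by linarith
  have hR0 : 0 ≤ R := by rw [hR]; positivity
  have hPn (i j : ι) : ‖(P i j x₀ : ℂ)‖ ≤ p := (hP i j).zero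
  have n₀ (i : ι) : ‖q₀ i x₀‖ ≤ A * l := by obtain ⟨_, h, -⟩ := h₀ i; exact h.zero
  have d₁ := norm_pairing_sub_le (m := A * l) hPn hp hB (by positivity) hB₀ hB₁ n₀ hc₁
  have d₂ := norm_pairing_sub_le (m := A * l) hPn hp hB (by positivity) hB₀
    (β := fun i ↦ (starRingEnd ℂ) (q₀ i x₀)) (β' := fun i ↦ (starRingEnd ℂ) (c₀ i))
    (fun i ↦ by rw [← map_sub, RCLike.norm_conj]; exact hB₀ i) n₀
    (fun i ↦ by rw [RCLike.norm_conj]; exact hc₀ i)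
  rw [← hR] at d₁ d₂
  have wn := weightedBound_pairing hl hy h₀ h₁ hP
  have wd := weightedBound_pairing hl hy h₀ (fun i ↦ (h₀ i).conj) hP
  have eR : (Fintype.card ι : ℝ) ^ 2 * (16 * (p * (A * l) * (A * l))) = 16 * R * A ^ 2 * l ^ 2 := by
    rw [hR]; ring
  rw [eR] at wn wd
  set num := fun x ↦ pairing P x (fun a ↦ q₀ a x) (fun a ↦ q₁ a x)
  set den := fun x ↦ pairing P x (fun a ↦ q₀ a x) (fun a ↦ (starRingEnd ℂ) (q₀ a x))
  have b₂ : c / 2 * l ^ 2 ≤ ‖den x₀‖ := by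
    have := norm_sub_norm_le (pairing P x₀ c₀ (fun i ↦ (starRingEnd ℂ) (c₀ i))) (den x₀)
    rw [norm_sub_rev] at this
    have e : R * (2 * B * (A * l)) ≤ c / 2 * l ^ 2 := by nlinarith
    linarith [d₂]
  have b₁ : ‖num x₀‖ ≤ (C + 2 * R * B * A) * l := by
    have := norm_sub_norm_le (num x₀) (pairing P x₀ c₀ c₁)
    have e : (C + 2 * R * B * A) * l = C * l + R * (2 * B * (A * l)) := by ring
    linarith [d₁]
  have hδ : 0 < c / 2 * l ^ 2 := by positivity
  refine ⟨b₂, ?_, ?_⟩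
  · have wi := WeightedBound.inv (β := max 1 (16 * R * A ^ 2 / (c / 2))) hl0.le hy hδ
      (le_max_left _ _) (wd.mono (by
        calc 16 * R * A ^ 2 * l ^ 2 = 16 * R * A ^ 2 / (c / 2) * (c / 2 * l ^ 2) := by
              field_simp
          _ ≤ _ := by gcongr; exact le_max_right _ _) hl0.le) b₂
    obtain ⟨B', h', hB'⟩ := wn.mul hl0.le hy wi
    have := (⟨B', h'.neg, hB'⟩ : WeightedBound (corr P q₀ q₁) x₀ y l _)
    refine WeightedBound.mono this (le_of_eq ?_) hl0.le
    rw [mul_inv]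
    field_simp
  · rw [corr, norm_neg, norm_mul, norm_inv]
    calc _ ≤ (C + 2 * R * B * A) * l * (c / 2 * l ^ 2)⁻¹ := by
          gcongr
      _ = _ := by field_simp

/-- A smooth function equal to `1` for `t ≤ 1/4` and to `0` for `t ≥ 1/2`. -/
def cutoff (t : ℝ) : ℝ := Real.smoothTransition (2 - 4 * t)

theorem contDiff_cutoff : ContDiff ℝ ∞ cutoff :=
  Real.smoothTransition.contDiff.comp (contDiff_const.sub (contDiff_const.mul contDiff_id))

theorem cutoff_eq_zero {t : ℝ} (ht : 1 / 2 ≤ t) : cutoff t = 0 :=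
  Real.smoothTransition.zero_of_nonpos (by linarith)

theorem cutoff_eventuallyEq_one : cutoff =ᶠ[𝓝 0] fun _ ↦ 1 := by
  filter_upwards [Iio_mem_nhds (show (0 : ℝ) < 1 / 4 by norm_num)] with t ht
  exact Real.smoothTransition.one_of_one_le (by linarith [Set.mem_Iio.1 ht])

/-- The local perturbation built from a correction factor `b`. -/
def cutPert (ψ : E → ℝ) (k : ℕ) (σ₀ σ₁ b : E → ℂ) (x : E) : ℂ :=
  (ψ x : ℂ) * ((cutoff (k * pairSq σ₀ σ₁ x) : ℂ) * (b x * (starRingEnd ℂ) (σ₀ x)))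

-- Order count with l = √k and y ≤ 1/l. The factor b is O(1/l) with derivative O(l), and y times its
-- second derivative is O(k), while conj(σ₀) is at most y with derivatives O(l) and O(k). In the
-- second derivative of the product, D²b meets |σ₀| ≤ y, and every term is O(k). The cutoff has
-- derivatives O(k) and O(k²), but they multiply a product of size O(1/k) and derivative O(1).
set_option maxHeartbeats 800000 in
theorem jetBound_cutPert {ψ : E → ℝ} {k : ℕ} {σ₀ σ₁ b : E → ℂ} {x₀ : E} {A p q A₅ A₇ : ℝ}
    (hk : 1 ≤ k) (hA : 1 ≤ A) (hA₇ : 0 ≤ A₇)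
    (h₀ : JetBound σ₀ x₀ A (A * Real.sqrt k) (A * k))
    (h₁ : JetBound σ₁ x₀ A (A * Real.sqrt k) (A * k))
    (hy : Real.sqrt (pairSq σ₀ σ₁ x₀) ≤ (Real.sqrt k)⁻¹)
    (hψ : JetBound ψ x₀ p p p)
    (hq : ∀ t ∈ Set.Icc (0 : ℝ) 1, JetBound cutoff t q q q)
    (hb : WeightedBound b x₀ (Real.sqrt (pairSq σ₀ σ₁ x₀)) (Real.sqrt k) A₅)
    (hb₀ : ‖b x₀‖ ≤ A₇ * (Real.sqrt k)⁻¹) :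
    JetBound (cutPert ψ k σ₀ σ₁ b) x₀ (p * q * (200 * A ^ 2 * (A₇ + A₅)) * (k : ℝ)⁻¹)
      (p * q * (200 * A ^ 2 * (A₇ + A₅))) (p * q * (200 * A ^ 2 * (A₇ + A₅)) * k) := by
  have hk0 : (0 : ℝ) < k := by exact_mod_cast hk
  have hk1 : (1 : ℝ) ≤ k := by exact_mod_cast hk
  have hl1 : 1 ≤ Real.sqrt k := Real.one_le_sqrt.2 hk1
  have hl : 0 < Real.sqrt k := Real.sqrt_pos.2 hk0
  have hll : Real.sqrt k * Real.sqrt k = k := Real.mul_self_sqrt hk0.le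
  have hki : (Real.sqrt k)⁻¹ * (Real.sqrt k)⁻¹ = (k : ℝ)⁻¹ := by rw [← mul_inv, hll]
  have hli : (Real.sqrt k)⁻¹ * Real.sqrt k = 1 := inv_mul_cancel₀ hl.ne'
  have hkk : (k : ℝ) * (k : ℝ)⁻¹ = 1 := mul_inv_cancel₀ hk0.ne'
  have hA₅ := hb.nonneg
  have hw := jetBound_pairSq hk hA h₀ h₁ hy
  have hyy : Real.sqrt (pairSq σ₀ σ₁ x₀) ^ 2 = pairSq σ₀ σ₁ x₀ := Real.sq_sqrt (pairSq_nonneg _ _ _)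
  have hσy := (norm_le_sqrt_pairSq σ₀ σ₁ x₀).1
  have hp := hψ.nonneg₀
  set y := Real.sqrt (pairSq σ₀ σ₁ x₀) with hydef
  have hy0 : 0 ≤ y := Real.sqrt_nonneg _
  set l := Real.sqrt k
  have hwk : pairSq σ₀ σ₁ x₀ ≤ (k : ℝ)⁻¹ := by
    rw [← hyy, ← hki, pow_two]; gcongr
  have hyl : y * l ≤ 1 := by rw [← hli]; gcongr
  have hsq : (k : ℝ)⁻¹ ≤ 1 := inv_le_one_of_one_le₀ hk1
  -- the cutoff
  have hkw : JetBound (fun x ↦ k * pairSq σ₀ σ₁ x) x₀ 2 (4 * A * k) (8 * A ^ 2 * k ^ 2) := by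
    have := (JetBound.clm (((k : ℝ)) • ContinuousLinearMap.id ℝ ℝ) (x := pairSq σ₀ σ₁ x₀)
      (t₁ := k) le_rfl (fun u ↦ by simp) hk0.le).comp (g := pairSq σ₀ σ₁) hw.contDiffAt hw.one
        hw.nonneg₂ hw.two
    refine (this.congr (Eventually.of_forall fun x ↦ by simp)).mono ?_ ?_ ?_
    · simp only [smul_apply, ContinuousLinearMap.coe_id', id_eq, smul_eq_mul]
      rw [Real.norm_of_nonneg (mul_nonneg hk0.le (pairSq_nonneg _ _ _))]
      nlinarith
    · have := mul_le_mul_of_nonneg_left hyl (by positivity : 0 ≤ 4 * A * k)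
      linarith
    · linarith
  have hmem : k * pairSq σ₀ σ₁ x₀ ∈ Set.Icc (0 : ℝ) 1 :=
    ⟨mul_nonneg hk0.le (pairSq_nonneg _ _ _), by
      rw [← hkk]; gcongr⟩
  have hq0 := (hq _ hmem).nonneg₀
  have hχ := ((hq _ hmem).comp (g := fun x ↦ k * pairSq σ₀ σ₁ x) hkw.contDiffAt hkw.one hkw.nonneg₂
    hkw.two).clm_comp Complex.ofRealCLM (fun u ↦ by simp)
  have hψ' := hψ.clm_comp Complex.ofRealCLM (fun u ↦ by simp)
  obtain ⟨Bb, hbj, hBb⟩ := hb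
  have hg := (⟨hbj.contDiffAt, hb₀, hbj.one, hbj.nonneg₂, hbj.two⟩ :
    JetBound b x₀ (A₇ * l⁻¹) (A₅ * l) Bb).mul
      (⟨h₀.conj.contDiffAt, by simpa using hσy, h₀.conj.one, h₀.conj.nonneg₂, h₀.conj.two⟩ :
        JetBound (fun z ↦ (starRingEnd ℂ) (σ₀ z)) x₀ y (A * l) (A * k))
  set a := A₇ + A₅ with ha
  have ha0 : 0 ≤ a := by positivity
  have hA0 : 0 ≤ A := by linarith
  have hg' : JetBound (fun z ↦ b z * (starRingEnd ℂ) (σ₀ z)) x₀ (a * (k : ℝ)⁻¹) (A * a)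
      (3 * A * a * k) := by
    refine hg.mono ?_ ?_ ?_
    · calc A₇ * l⁻¹ * y ≤ A₇ * l⁻¹ * l⁻¹ := by gcongr
        _ = A₇ * (k : ℝ)⁻¹ := by rw [mul_assoc, hki]
        _ ≤ _ := by gcongr; linarith
    · calc A₇ * l⁻¹ * (A * l) + A₅ * l * y = A₇ * A * (l⁻¹ * l) + A₅ * (y * l) := by ring
        _ ≤ A₇ * A * 1 + A₅ * 1 := by rw [hli]; gcongr
        _ ≤ _ := by rw [ha]; nlinarith
    · have e₁ : A₇ * l⁻¹ * (A * k) ≤ A₇ * A * k := by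
        have : l⁻¹ ≤ 1 := inv_le_one_of_one_le₀ hl1
        have := mul_le_mul_of_nonneg_left this (by positivity : 0 ≤ A₇ * A * k)
        nlinarith
      have e₂ : A₅ * l * (A * l) = A₅ * A * k := by rw [← hll]; ring
      have e₃ : Bb * y ≤ A₅ * k := by rw [← hll]; nlinarith
      have e₄ : A₅ * k ≤ A * A₅ * k := by
        have : 0 ≤ A₅ * k := by positivity
        nlinarith
      rw [ha]
      have : 0 ≤ A₇ * A * k := by positivity
      nlinarith
  have hki1 : (k : ℝ) ^ 2 * (k : ℝ)⁻¹ = k := by field_simp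
  have hA2 : A ≤ A ^ 2 := by nlinarith
  have s₀ : q * (a * (k : ℝ)⁻¹) ≤ q * (A ^ 2 * a) * (k : ℝ)⁻¹ := by
    have : a ≤ A ^ 2 * a := le_mul_of_one_le_left ha0 (by nlinarith)
    calc _ = q * a * (k : ℝ)⁻¹ := by ring
      _ ≤ _ := by gcongr
  have s₁ : q * (A * a) + q * (4 * A * k) * (a * (k : ℝ)⁻¹) ≤ 5 * (q * (A ^ 2 * a)) := by
    rw [show q * (4 * A * k) * (a * (k : ℝ)⁻¹) = 4 * (q * (A * a)) * (k * (k : ℝ)⁻¹) by ring, hkk]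
    have : q * (A * a) ≤ q * (A ^ 2 * a) := by gcongr
    linarith
  have s₂ : q * (3 * A * a * k) + 2 * (q * (4 * A * k) * (A * a))
      + (q * (4 * A * k) ^ 2 + q * (8 * A ^ 2 * k ^ 2)) * (a * (k : ℝ)⁻¹)
      ≤ 35 * (q * (A ^ 2 * a)) * k := by
    rw [show (q * (4 * A * k) ^ 2 + q * (8 * A ^ 2 * k ^ 2)) * (a * (k : ℝ)⁻¹)
      = 24 * (q * (A ^ 2 * a)) * (k ^ 2 * (k : ℝ)⁻¹) by ring, hki1]
    have : q * (A * a) * k ≤ q * (A ^ 2 * a) * k := by gcongr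
    linarith
  set Y := q * (A ^ 2 * a) with hY
  have hY0 : 0 ≤ Y := by positivity
  have hpY : 0 ≤ p * Y := by positivity
  have eY : p * q * (200 * A ^ 2 * a) = 200 * (p * Y) := by rw [hY]; ring
  have hχg : JetBound (fun z ↦ (cutoff (k * pairSq σ₀ σ₁ z) : ℂ) * (b z * (starRingEnd ℂ) (σ₀ z)))
      x₀ (Y * (k : ℝ)⁻¹) (5 * Y) (35 * Y * k) := (hχ.mul hg').mono s₀ s₁ s₂
  have hall := hψ'.mul hχg
  rw [eY]
  have u₀ : p * (Y * (k : ℝ)⁻¹) ≤ p * Y * 1 := by rw [← mul_assoc]; gcongr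
  have u₁ : p * Y ≤ p * Y * k := le_mul_of_one_le_right hpY hk1
  have u₂ : 0 ≤ p * Y * (k : ℝ)⁻¹ := by positivity
  refine JetBound.mono hall ?_ ?_ ?_
  · linarith
  · linarith
  · linarith

end

end LocalPerturbation

/-! ### Uniform bounds for the local perturbation at one point, in the gauge adapted to it. -/

noncomputable section LocalTheorem

variable {E : Type} [NormedAddCommGroup E] [NormedSpace ℝ E] {ι : Type*} [Fintype ι]

/-- The local perturbation. -/
def localPert (ψ : E → ℝ) (P : ι → ι → E → ℝ) (v : ι → E) (k : ℕ) (κ : ℝ) (θ : E → E →L[ℝ] ℝ)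
    (σ₀ σ₁ : E → ℂ) : E → ℂ :=
  cutPert ψ k σ₀ σ₁ (corr P (fun a ↦ regDeriv k θ σ₀ (v a) (stepSize k κ (pairSq σ₀ σ₁)))
    (fun a ↦ regDeriv k θ σ₁ (v a) (stepSize k κ (pairSq σ₀ σ₁))))

theorem regDeriv_gauge {k : ℕ} {θ : E → E →L[ℝ] ℝ} {σ : E → ℂ} (ℓ : E →L[ℝ] ℝ) (x₀ : E)
    (hθ : ContDiff ℝ ∞ θ) (hσ : ContDiff ℝ ∞ σ) (v : E) (ρ : E → ℝ) (x : E) :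
    regDeriv k (fun y ↦ θ y - ℓ) (fun y ↦ gaugePhase k ℓ x₀ y * σ y) v ρ x
      = gaugePhase k ℓ x₀ x * regDeriv k θ σ v ρ x :=
  hadamardQuotient_transported_gauge ℓ x₀ hθ hσ v x _

theorem pairSq_gauge (k : ℕ) (ℓ : E →L[ℝ] ℝ) (x₀ : E) (σ₀ σ₁ : E → ℂ) :
    pairSq (fun y ↦ gaugePhase k ℓ x₀ y * σ₀ y) (fun y ↦ gaugePhase k ℓ x₀ y * σ₁ y)
      = pairSq σ₀ σ₁ := by
  ext y; simp [pairSq, norm_gaugePhase]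

/-- Under a phase g the numerator of b scales by g², the denominator by g conj(g) = 1 and conj(σ₀)
by conj(g); the product scales by g, as a section must. -/
theorem localPert_gauge {ψ : E → ℝ} {P : ι → ι → E → ℝ} {v : ι → E} {k : ℕ} {κ : ℝ}
    {θ : E → E →L[ℝ] ℝ} {σ₀ σ₁ : E → ℂ} (ℓ : E →L[ℝ] ℝ) (x₀ : E) (hθ : ContDiff ℝ ∞ θ)
    (h₀ : ContDiff ℝ ∞ σ₀) (h₁ : ContDiff ℝ ∞ σ₁) (x : E) :
    localPert ψ P v k κ (fun y ↦ θ y - ℓ) (fun y ↦ gaugePhase k ℓ x₀ y * σ₀ y)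
        (fun y ↦ gaugePhase k ℓ x₀ y * σ₁ y) x
      = gaugePhase k ℓ x₀ x * localPert ψ P v k κ θ σ₀ σ₁ x := by
  have hg : gaugePhase k ℓ x₀ x * (starRingEnd ℂ) (gaugePhase k ℓ x₀ x) = 1 := by
    rw [Complex.mul_conj, Complex.normSq_eq_norm_sq, norm_gaugePhase]; simp
  simp only [localPert, cutPert, corr, pairSq_gauge, regDeriv_gauge ℓ x₀ hθ h₀,
    regDeriv_gauge ℓ x₀ hθ h₁, map_mul, pairing_smul]
  rw [hg, one_mul]
  linear_combination (ψ x : ℂ) * (cutoff (k * pairSq σ₀ σ₁ x) : ℂ) * (-(gaugePhase k ℓ x₀ x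
    * pairing P x (fun a ↦ regDeriv k θ σ₀ (v a) (stepSize k κ (pairSq σ₀ σ₁)) x)
        (fun a ↦ regDeriv k θ σ₁ (v a) (stepSize k κ (pairSq σ₀ σ₁)) x)
    * (pairing P x (fun a ↦ regDeriv k θ σ₀ (v a) (stepSize k κ (pairSq σ₀ σ₁)) x)
        (fun a ↦ (starRingEnd ℂ) (regDeriv k θ σ₀ (v a) (stepSize k κ (pairSq σ₀ σ₁)) x)))⁻¹)
    * (starRingEnd ℂ) (σ₀ x)) * hg

/-- The constants A' and k₀ do not depend on M or κ, which enter only through κM ≤ k. Thus M, a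
bound that involves third derivatives of the sections, may grow with k in any way. The nonvanishing
of the denominator is recorded because smoothness of the perturbation depends on it. -/
theorem exists_jetBound_localPert [FiniteDimensional ℝ E] (T C p c : ℝ) (hT : 0 ≤ T) (hC : 0 ≤ C)
    (hp : 0 ≤ p) (hc : 0 < c) :
    ∃ A' : ℝ, ∃ k₀ : ℕ, 0 ≤ A' ∧ 1 ≤ k₀ ∧ ∀ (k : ℕ) (P : ι → ι → E → ℝ) (v : ι → E) (ψ : E → ℝ)
      (θ : E → E →L[ℝ] ℝ) (σ₀ σ₁ : E → ℂ) (x₀ : E) (κ M : ℝ), k₀ ≤ k →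
      ContDiff ℝ ∞ θ → ContDiff ℝ ∞ σ₀ → ContDiff ℝ ∞ σ₁ → θ x₀ = 0 → (∀ a, ‖v a‖ ≤ 1) →
      Real.sqrt (pairSq σ₀ σ₁ x₀) ≤ (Real.sqrt k)⁻¹ →
      (∀ y ∈ Metric.closedBall x₀ (k : ℝ)⁻¹, ∀ w, ‖fderiv ℝ (fun z ↦ θ z w) y‖ ≤ T * ‖w‖) →
      (∀ a, JetBound (fun x ↦ ((θ x (v a) : ℝ) : ℂ)) x₀ 0 T T) →
      (∀ σ, σ = σ₀ ∨ σ = σ₁ → ∀ y ∈ Metric.closedBall x₀ (k : ℝ)⁻¹, (∀ u,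
        ‖covDeriv k θ σ y u‖ ≤ C * Real.sqrt k * ‖u‖) ∧ ∀ u w,
        ‖covDeriv k θ (fun z ↦ covDeriv k θ σ z w) y u‖ ≤ C * k * (‖u‖ * ‖w‖)) →
      (∀ i j, JetBound (fun x ↦ (P i j x : ℂ)) x₀ p p p) → JetBound ψ x₀ p p p →
      ‖pairing P x₀ (fun a ↦ covDeriv k θ σ₀ x₀ (v a)) (fun a ↦ covDeriv k θ σ₁ x₀ (v a))‖
        ≤ C * Real.sqrt k →
      c * k ≤ ‖pairing P x₀ (fun a ↦ covDeriv k θ σ₀ x₀ (v a))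
        (fun a ↦ (starRingEnd ℂ) (covDeriv k θ σ₀ x₀ (v a)))‖ →
      0 < κ → 0 ≤ M → κ * M ≤ k →
      (∀ σ, σ = σ₀ ∨ σ = σ₁ → ∀ a, ∀ r ∈ Set.Icc (0 : ℝ) 1, ∀ u u', ‖fderiv ℝ (fderiv ℝ
        (hadamardQuotient (transported k θ σ (v a)))) (x₀, r) u u'‖ ≤ M * ‖u‖ * ‖u'‖) →
      JetBound (localPert ψ P v k κ θ σ₀ σ₁) x₀ (A' * (k : ℝ)⁻¹) A' (A' * k) ∧
      pairing P x₀ (fun a ↦ regDeriv k θ σ₀ (v a) (stepSize k κ (pairSq σ₀ σ₁)) x₀)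
        (fun a ↦ (starRingEnd ℂ) (regDeriv k θ σ₀ (v a) (stepSize k κ (pairSq σ₀ σ₁)) x₀)) ≠ 0 := by
  obtain ⟨A, hA, hjet⟩ := exists_jetBound_of_covDeriv (E := E) T C hT hC
  obtain ⟨q, hq0, hq⟩ := JetBound.exists_of_isCompact contDiff_cutoff (isCompact_Icc (a := (0 : ℝ))
    (b := 1))
  have hA0 : 0 ≤ A := by linarith
  set B := A * (T ^ 2 + 7 * T + 5) with hB
  have hB0 : 0 ≤ B := by positivity
  set A₂ := max ((12 * B + 1) * (1 + 4 * A) ^ 2 + 24 * A ^ 2 * B) C with hA₂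
  have hA₂0 : 0 ≤ A₂ := hC.trans (le_max_right _ _)
  set R := (Fintype.card ι : ℝ) ^ 2 * p with hR
  have hR0 : 0 ≤ R := by positivity
  -- From k₁ on, √k is large enough for `hlarge` in `corr_bounds`: regularising the derivatives
  -- costs at most half of the denominator.
  obtain ⟨k₁, hk₁⟩ := exists_nat_ge ((4 * R * B * A₂ / c) ^ 2)
  refine ⟨p * q * (200 * A ^ 2 * ((C + 2 * R * B * A₂) * (c / 2)⁻¹ +
    4 * (16 * R * A₂ ^ 2 * (3 * (max 1 (16 * R * A₂ ^ 2 / (c / 2))) ^ 2 * (c / 2)⁻¹)))),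
    max k₁ 1, by positivity, le_max_right _ _, ?_⟩
  intro k P v ψ θ σ₀ σ₁ x₀ κ M hk hθ hσ₀ hσ₁ hθ0 hv hy hTb hθj hcov hP hψ hnum hden hκ hM hκM hD
  have hk1 : 1 ≤ k := (le_max_right _ _).trans hk
  have hk0 : (0 : ℝ) < k := by exact_mod_cast hk1
  have hk1' : (1 : ℝ) ≤ k := by exact_mod_cast hk1
  have hl1 : 1 ≤ Real.sqrt k := Real.one_le_sqrt.2 hk1'
  have hll : Real.sqrt k ^ 2 = k := Real.sq_sqrt hk0.le
  have hy1 : Real.sqrt (pairSq σ₀ σ₁ x₀) ≤ 1 := hy.trans (inv_le_one_of_one_le₀ hl1)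
  have hself : x₀ ∈ Metric.closedBall x₀ (k : ℝ)⁻¹ := Metric.mem_closedBall_self (by positivity)
  have hlarge : 4 * R * B * A₂ ≤ c * Real.sqrt k := by
    have : 4 * R * B * A₂ / c ≤ Real.sqrt k := Real.le_sqrt_of_sq_le (hk₁.trans (by
      exact_mod_cast (le_max_left _ _).trans hk))
    rw [div_le_iff₀ hc] at this
    linarith
  have hn := norm_le_sqrt_pairSq σ₀ σ₁ x₀
  have hsm {σ : E → ℂ} (h : σ = σ₀ ∨ σ = σ₁) : ContDiff ℝ ∞ σ := by
    rcases h with rfl | rfl <;> assumption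
  have hj {σ : E → ℂ} (h : σ = σ₀ ∨ σ = σ₁) :
      ∀ y ∈ Metric.closedBall x₀ (k : ℝ)⁻¹, JetBound σ y A (A * Real.sqrt k) (A * k) :=
    hjet k θ σ x₀ hk1 hθ (hsm h) hθ0
      (by rcases h with rfl | rfl; exacts [hn.1.trans hy1, hn.2.trans hy1]) hTb
      (fun y hy u ↦ (hcov σ h y hy).1 u) (fun y hy u w ↦ (hcov σ h y hy).2 u w)
  have hq' {σ : E → ℂ} (h : σ = σ₀ ∨ σ = σ₁) (a : ι) :=
    weightedBound_regDeriv (v := v a) hk1 hA hB0 hκ hM hκM hθ (hsm h) (hj (Or.inl rfl) x₀ hself)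
      (hj (Or.inr rfl) x₀ hself) hy
      (fun s hs ↦ jetBound_transported hk1 hs (hv a) hT hA0 hθ0 (hθj a) (hj h _ (by
        rw [Metric.mem_closedBall, dist_eq_norm, add_sub_cancel_left, norm_smul,
          Real.norm_of_nonneg hs.1]
        calc s * ‖v a‖ ≤ (k : ℝ)⁻¹ * 1 := by gcongr; exacts [hs.2, hv a]
          _ = _ := mul_one _))) (hD σ h a)
  have hcv {σ : E → ℂ} (h : σ = σ₀ ∨ σ = σ₁) (a : ι) :
      ‖covDeriv k θ σ x₀ (v a)‖ ≤ A₂ * Real.sqrt k := by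
    refine ((hcov σ h x₀ hself).1 (v a)).trans ?_
    calc C * Real.sqrt k * ‖v a‖ ≤ C * Real.sqrt k * 1 := by gcongr; exact hv a
      _ ≤ A₂ * Real.sqrt k := by rw [mul_one]; gcongr; exact le_max_right _ _
  have hW {σ : E → ℂ} (h : σ = σ₀ ∨ σ = σ₁) (a : ι) := (hq' h a).1.mono
    (mul_le_mul_of_nonneg_right (le_max_left _ C) (Real.sqrt_nonneg k)) (by positivity)
  obtain ⟨b₁, b₂, b₃⟩ := corr_bounds hl1 hy1 hA₂0 hB0 hC hp hR (hW (Or.inl rfl)) (hW (Or.inr rfl)) hP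
    (fun a ↦ (hq' (Or.inl rfl) a).2) (fun a ↦ (hq' (Or.inr rfl) a).2) (hcv (Or.inl rfl))
    (hcv (Or.inr rfl)) hnum (by rw [hll]; exact hden) hc hlarge
  refine ⟨jetBound_cutPert hk1 hA (by positivity) (hj (Or.inl rfl) x₀ hself)
    (hj (Or.inr rfl) x₀ hself) hy hψ hq b₂ b₃, norm_pos_iff.1 (lt_of_lt_of_le ?_ b₁)⟩
  rw [hll]
  positivity

theorem jetBound_gaugePhase (k : ℕ) (ℓ : E →L[ℝ] ℝ) (x₀ : E) :
    JetBound (gaugePhase k ℓ x₀) x₀ 1 (k * ‖ℓ‖) ((k * ‖ℓ‖) ^ 2) := by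
  set S : E →L[ℝ] ℂ := ((k : ℂ) * Complex.I) • Complex.ofRealCLM.comp ℓ with hS
  have hb (u : E) : ‖S u‖ ≤ k * ‖ℓ‖ * ‖u‖ := by
    have := ℓ.le_opNorm u
    simp only [hS, smul_apply, ContinuousLinearMap.comp_apply, Complex.ofRealCLM_apply, norm_smul,
      norm_mul, Complex.norm_I, mul_one, Complex.norm_natCast, Complex.norm_real]
    rw [mul_assoc]
    gcongr
  have h := (JetBound.clm S (x := x₀) le_rfl hb (by positivity)).sub (JetBound.const x₀ (S x₀))
  have := (JetBound.complex_exp _).comp (g := fun y ↦ S y - S x₀) h.contDiffAt h.one h.nonneg₂ h.two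
  simp only [sub_self, Complex.exp_zero, norm_one, add_zero, one_mul, mul_zero] at this
  refine this.congr (Eventually.of_forall fun y ↦ ?_)
  simp only [gaugePhase, hS, smul_apply, ContinuousLinearMap.comp_apply,
    Complex.ofRealCLM_apply, map_sub, smul_eq_mul, Complex.ofReal_sub]
  congr 1
  ring

/-- The gauge varies with the base point, but by covariance the gauged quotient is a phase times one
fixed smooth function, so compactness yields a single M for all base points. It depends on k without
control. -/
theorem exists_bound_hadamardQuotient_gauge [FiniteDimensional ℝ E] {k : ℕ} {θ : E → E →L[ℝ] ℝ}
    {σ : E → ℂ} (hθ : ContDiff ℝ ∞ θ) (hσ : ContDiff ℝ ∞ σ) (v : E) {K : Set E} (hK : IsCompact K) :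
    ∃ M, 0 ≤ M ∧ ∀ x₀ ∈ K, ∀ r ∈ Set.Icc (0 : ℝ) 1, ∀ u u', ‖fderiv ℝ (fderiv ℝ
      (hadamardQuotient (transported k (fun y ↦ θ y - θ x₀)
        (fun y ↦ gaugePhase k (θ x₀) x₀ y * σ y) v))) (x₀, r) u u'‖ ≤ M * ‖u‖ * ‖u'‖ := by
  obtain ⟨m, hm, hQ⟩ := JetBound.exists_of_isCompact
    (contDiff_hadamardQuotient (contDiff_transported (k := k) hθ hσ v))
    (hK.prod (isCompact_Icc (a := (0 : ℝ)) (b := 1)))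
  obtain ⟨t, ht⟩ := hK.exists_bound_of_continuousOn hθ.continuous.continuousOn
  refine ⟨max (1 * m + 2 * (k * t * m) + (k * t) ^ 2 * m) 0, le_max_right _ _,
    fun x₀ hx₀ r hr u u' ↦ ?_⟩
  have hg := (jetBound_gaugePhase k (θ x₀) x₀).mono le_rfl
    (show k * ‖θ x₀‖ ≤ k * t by gcongr; exact ht x₀ hx₀)
    (show (k * ‖θ x₀‖) ^ 2 ≤ (k * t) ^ 2 by gcongr; exact ht x₀ hx₀)
  have h := (((hg.comp_fst (s := r)).mul (hQ (x₀, r) ⟨hx₀, hr⟩)).congr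
    (Eventually.of_forall fun q ↦
      hadamardQuotient_transported_gauge (θ x₀) x₀ hθ hσ v q.1 q.2)).two u u'
  refine h.trans ?_
  gcongr
  exact le_max_left _ _

end LocalTheorem

/-! ### The perturbation over a chart: smoothness, bounds, and the equation along the zeros. -/

noncomputable section LocalConclusion

variable {E : Type} [NormedAddCommGroup E] [NormedSpace ℝ E] {ι : Type*} [Fintype ι]

/-- Where the connection form vanishes, ∇f = Df, and ∇∇f differs from D²f only by ik(Dθ)f, which is
O(1) because f = O(1/k). -/
theorem norm_covDeriv_of_jetBound {k : ℕ} {θ : E → E →L[ℝ] ℝ} {f : E → ℂ} {x₀ : E} {a T : ℝ}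
    (hk : 1 ≤ k) (hθ : ContDiff ℝ ∞ θ) (hθ0 : θ x₀ = 0)
    (hT : ∀ w, ‖fderiv ℝ (fun z ↦ θ z w) x₀‖ ≤ T * ‖w‖) (hT0 : 0 ≤ T)
    (hf : JetBound f x₀ (a * (k : ℝ)⁻¹) a (a * k)) :
    (∀ u, ‖covDeriv k θ f x₀ u‖ ≤ a * ‖u‖) ∧ ∀ u w,
      ‖covDeriv k θ (fun z ↦ covDeriv k θ f z w) x₀ u‖ ≤ (a + T * a) * k * (‖u‖ * ‖w‖) := by
  have hk0 : (0 : ℝ) < k := by exact_mod_cast hk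
  have hk1 : (1 : ℝ) ≤ k := by exact_mod_cast hk
  have ha := hf.nonneg₁
  constructor
  · intro u
    rw [covDeriv, hθ0]
    simpa using ContinuousLinearMap.le_of_opNorm_le _ hf.one u
  · intro u w
    have hθw : HasFDerivAt (fun z ↦ ((θ z w : ℝ) : ℂ))
        (Complex.ofRealCLM.comp (fderiv ℝ (fun z ↦ θ z w) x₀)) x₀ :=
      Complex.ofRealCLM.hasFDerivAt.comp x₀
        ((hθ.clm_apply contDiff_const).differentiable (by simp) x₀).hasFDerivAt
    have hdd := (JetBound.fderiv_differentiableAt hf.contDiffAt).hasFDerivAt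
    have key : HasFDerivAt (fun z ↦ covDeriv k θ f z w) _ x₀ :=
      (hdd.clm_apply (hasFDerivAt_const w x₀)).add ((hθw.const_mul ((k : ℂ) * Complex.I)).mul
        (hf.contDiffAt.differentiableAt (by norm_num)).hasFDerivAt)
    have e : covDeriv k θ (fun z ↦ covDeriv k θ f z w) x₀ u = fderiv ℝ (fderiv ℝ f) x₀ u w
        + (k : ℂ) * Complex.I * ((fderiv ℝ (fun z ↦ θ z w) x₀ u : ℝ) : ℂ) * f x₀ := by
      rw [covDeriv, key.fderiv]
      simp [hθ0]
      ring
    have n₁ : ‖(k : ℂ) * Complex.I * ((fderiv ℝ (fun z ↦ θ z w) x₀ u : ℝ) : ℂ) * f x₀‖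
        ≤ k * (T * ‖w‖ * ‖u‖) * (a * (k : ℝ)⁻¹) := by
      rw [norm_mul, norm_mul, norm_mul, Complex.norm_I, mul_one, Complex.norm_natCast,
        Complex.norm_real]
      have h₁ := ContinuousLinearMap.le_of_opNorm_le _ (hT w) u
      have h₂ := hf.zero
      gcongr
    rw [e]
    have n₂ : k * (T * ‖w‖ * ‖u‖) * (a * (k : ℝ)⁻¹) = T * a * (‖u‖ * ‖w‖) := by
      field_simp
    have n₃ : T * a * (‖u‖ * ‖w‖) ≤ T * a * (‖u‖ * ‖w‖) * k :=
      le_mul_of_one_le_right (by positivity) hk1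
    have := norm_add_le (fderiv ℝ (fderiv ℝ f) x₀ u w)
      ((k : ℂ) * Complex.I * ((fderiv ℝ (fun z ↦ θ z w) x₀ u : ℝ) : ℂ) * f x₀)
    have := hf.two u w
    linarith

theorem exists_bounds_gauge {θ : E → E →L[ℝ] ℝ} (hθ : ContDiff ℝ ∞ θ) {K : Set E}
    (hK : IsCompact K) : ∃ T : ℝ, 0 ≤ T ∧ (∀ x₀, ∀ y ∈ K, ∀ w,
      ‖fderiv ℝ (fun z ↦ (θ z - θ x₀) w) y‖ ≤ T * ‖w‖) ∧ ∀ x₀ ∈ K, ∀ w, ‖w‖ ≤ 1 →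
      JetBound (fun x ↦ (((θ x - θ x₀) w : ℝ) : ℂ)) x₀ 0 T T := by
  obtain ⟨T, hT0, hT⟩ := JetBound.exists_of_isCompact hθ hK
  refine ⟨T, hT0, fun x₀ y hy w ↦ ?_, fun x₀ hx₀ w hw ↦ ?_⟩
  · have key : HasFDerivAt (fun z ↦ (θ z - θ x₀) w) _ y :=
      (((hθ.differentiable (by simp) y).hasFDerivAt).sub_const (θ x₀)).clm_apply
        (hasFDerivAt_const w y)
    rw [key.fderiv]
    refine ContinuousLinearMap.opNorm_le_bound _ (by positivity) fun u ↦ ?_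
    simp only [ContinuousLinearMap.comp_zero, zero_add,
      ContinuousLinearMap.flip_apply]
    calc ‖fderiv ℝ θ y u w‖ ≤ ‖fderiv ℝ θ y u‖ * ‖w‖ := ContinuousLinearMap.le_opNorm _ _
      _ ≤ (T * ‖u‖) * ‖w‖ := by
        gcongr
        exact ContinuousLinearMap.le_of_opNorm_le _ (hT y hy).one u
      _ = _ := by ring
  · have h := ((hT x₀ hx₀).sub (JetBound.const x₀ (θ x₀))).clm_comp
      (Complex.ofRealCLM.comp (ContinuousLinearMap.apply ℝ ℝ w)) (fun u ↦ by
        simp only [ContinuousLinearMap.comp_apply, ContinuousLinearMap.apply_apply,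
          Complex.ofRealCLM_apply, Complex.norm_real]
        exact (u.le_opNorm w).trans (mul_le_of_le_one_right (norm_nonneg _) hw))
    refine ⟨h.contDiffAt, by simp, h.one.trans (by simp), hT0, fun u v ↦ ?_⟩
    have := h.two u v
    rwa [add_zero] at this

theorem contDiff_regDeriv [FiniteDimensional ℝ E] {k : ℕ} {θ : E → E →L[ℝ] ℝ} {σ : E → ℂ} {ρ : E → ℝ}
    (hθ : ContDiff ℝ ∞ θ) (hσ : ContDiff ℝ ∞ σ) (hρ : ContDiff ℝ ∞ ρ) (v : E) :
    ContDiff ℝ ∞ (regDeriv k θ σ v ρ) :=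
  (contDiff_hadamardQuotient (contDiff_transported hθ hσ v)).comp (contDiff_id.prodMk hρ)

theorem contDiff_pairSq {σ₀ σ₁ : E → ℂ} (h₀ : ContDiff ℝ ∞ σ₀) (h₁ : ContDiff ℝ ∞ σ₁) :
    ContDiff ℝ ∞ (pairSq σ₀ σ₁) :=
  (h₀.norm_sq ℝ).add (h₁.norm_sq ℝ)

theorem contDiff_stepSize {k : ℕ} {κ : ℝ} {w : E → ℝ} (hκ : 0 < κ) (hw : ContDiff ℝ ∞ w)
    (hw0 : ∀ x, 0 ≤ w x) : ContDiff ℝ ∞ (stepSize k κ w) :=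
  contDiff_const.mul (((hw.add contDiff_const).sqrt fun x ↦ by
    have := hw0 x; positivity).sub contDiff_const)

theorem ContDiff.pairing {P : ι → ι → E → ℝ} {q₀ q₁ : ι → E → ℂ}
    (hP : ∀ i j, ContDiff ℝ ∞ (P i j)) (h₀ : ∀ i, ContDiff ℝ ∞ (q₀ i))
    (h₁ : ∀ i, ContDiff ℝ ∞ (q₁ i)) :
    ContDiff ℝ ∞ fun x ↦ pairing P x (fun i ↦ q₀ i x) (fun i ↦ q₁ i x) :=
  ContDiff.sum fun i _ ↦ ContDiff.sum fun j _ ↦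
    ((Complex.ofRealCLM.contDiff.comp (hP i j)).mul (h₀ i)).mul (h₁ j)

theorem contDiffAt_corr {P : ι → ι → E → ℝ} {q₀ q₁ : ι → E → ℂ}
    (hP : ∀ i j, ContDiff ℝ ∞ (P i j)) (h₀ : ∀ i, ContDiff ℝ ∞ (q₀ i))
    (h₁ : ∀ i, ContDiff ℝ ∞ (q₁ i)) {x : E}
    (hx : pairing P x (fun a ↦ q₀ a x) (fun a ↦ (starRingEnd ℂ) (q₀ a x)) ≠ 0) :
    ContDiffAt ℝ ∞ (corr P q₀ q₁) x :=
  (((ContDiff.pairing hP h₀ h₁).contDiffAt).mul ((ContDiff.pairing hP h₀ fun i ↦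
    Complex.conjCLE.contDiff.comp (h₀ i)).contDiffAt.inv hx)).neg

/-- The local perturbation: an approximate solution with uniform bounds of
`P(∇σ₀, ∇(σ₁ + f)) = 0` along the common zero set. -/
theorem exists_localPerturbation [FiniteDimensional ℝ E] {θ : E → E →L[ℝ] ℝ} {P : ι → ι → E → ℝ}
    {v : ι → E} {ψ : E → ℝ} {σ₀ σ₁ : ℕ → E → ℂ} {r₀ C c : ℝ} (hθ : ContDiff ℝ ∞ θ)
    (hP : ∀ i j, ContDiff ℝ ∞ (P i j)) (hv : ∀ a, ‖v a‖ ≤ 1) (hψ : ContDiff ℝ ∞ ψ)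
    (hψc : HasCompactSupport ψ) (hσ₀ : ∀ k, ContDiff ℝ ∞ (σ₀ k)) (hσ₁ : ∀ k, ContDiff ℝ ∞ (σ₁ k))
    (hr₀ : 0 < r₀) (hC : 0 ≤ C) (hc : 0 < c)
    (hcov : ∀ k, 1 ≤ k → ∀ σ, σ = σ₀ k ∨ σ = σ₁ k → ∀ y ∈ Metric.cthickening r₀ (tsupport ψ),
      (∀ u, ‖covDeriv k θ σ y u‖ ≤ C * Real.sqrt k * ‖u‖) ∧ ∀ u w,
        ‖covDeriv k θ (fun z ↦ covDeriv k θ σ z w) y u‖ ≤ C * k * (‖u‖ * ‖w‖))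
    (hpair : ∀ᶠ k : ℕ in atTop, ∀ x ∈ tsupport ψ, pairSq (σ₀ k) (σ₁ k) x ≤ (k : ℝ)⁻¹ →
      ‖pairing P x (fun a ↦ covDeriv k θ (σ₀ k) x (v a)) (fun a ↦ covDeriv k θ (σ₁ k) x (v a))‖
        ≤ C * Real.sqrt k ∧
      c * k ≤ ‖pairing P x (fun a ↦ covDeriv k θ (σ₀ k) x (v a))
        (fun a ↦ (starRingEnd ℂ) (covDeriv k θ (σ₀ k) x (v a)))‖) :
    ∃ (f : ℕ → E → ℂ) (C' : ℝ), ∀ᶠ k : ℕ in atTop, ContDiff ℝ ∞ (f k) ∧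
      (∀ x, x ∉ tsupport ψ → f k x = 0) ∧
      (∀ x, (k : ℝ)⁻¹ ≤ pairSq (σ₀ k) (σ₁ k) x → f k x = 0) ∧ (∀ x, σ₀ k x = 0 → f k x = 0) ∧
      (∀ x, ‖f k x‖ ≤ C' * (k : ℝ)⁻¹ ∧ (∀ u, ‖covDeriv k θ (f k) x u‖ ≤ C' * ‖u‖) ∧ ∀ u w,
        ‖covDeriv k θ (fun z ↦ covDeriv k θ (f k) z w) x u‖ ≤ C' * k * (‖u‖ * ‖w‖)) ∧
      ∀ x, σ₀ k x = 0 → σ₁ k x = 0 →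
        pairing P x (fun a ↦ covDeriv k θ (σ₀ k) x (v a)) (fun a ↦ covDeriv k θ (f k) x (v a))
          = -(ψ x : ℂ) * pairing P x (fun a ↦ covDeriv k θ (σ₀ k) x (v a))
            (fun a ↦ covDeriv k θ (σ₁ k) x (v a)) := by
  set K := tsupport ψ with hKdef
  have hK : IsCompact K := hψc
  obtain ⟨T, hT0, hT, hTj⟩ := exists_bounds_gauge hθ hK.cthickening (K := Metric.cthickening r₀ K)
  obtain ⟨pψ, hpψ0, hpψ⟩ := JetBound.exists_of_isCompact hψ hK
  choose pP hpP0 hpP using fun i j ↦ JetBound.exists_of_isCompact (hP i j) hK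
  set p := pψ + ∑ i, ∑ j, pP i j with hp
  have hsum0 (i : ι) : 0 ≤ ∑ j, pP i j := Finset.sum_nonneg fun j _ ↦ hpP0 i j
  have hp0 : 0 ≤ p := add_nonneg hpψ0 (Finset.sum_nonneg fun i _ ↦ hsum0 i)
  have hpψ' : pψ ≤ p := le_add_of_nonneg_right (Finset.sum_nonneg fun i _ ↦ hsum0 i)
  have hpP' (i j : ι) : pP i j ≤ p := by
    have h₁ := Finset.single_le_sum (f := fun j ↦ pP i j) (fun j _ ↦ hpP0 i j) (Finset.mem_univ j)
    have h₂ := Finset.single_le_sum (f := fun i ↦ ∑ j, pP i j) (fun i _ ↦ hsum0 i)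
      (Finset.mem_univ i)
    exact h₁.trans (h₂.trans (le_add_of_nonneg_left hpψ0))
  choose M₀ hM₀ hD₀ using fun k a ↦
    exists_bound_hadamardQuotient_gauge (k := k) hθ (hσ₀ k) (v a) hK
  choose M₁ hM₁ hD₁ using fun k a ↦
    exists_bound_hadamardQuotient_gauge (k := k) hθ (hσ₁ k) (v a) hK
  set M : ℕ → ℝ := fun k ↦ ∑ a, (M₀ k a + M₁ k a) with hMdef
  have hMnn (k : ℕ) (a : ι) : 0 ≤ M₀ k a + M₁ k a := add_nonneg (hM₀ k a) (hM₁ k a)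
  have hM (k : ℕ) : 0 ≤ M k := Finset.sum_nonneg fun a _ ↦ hMnn k a
  have hMa (k : ℕ) (a : ι) : M₀ k a + M₁ k a ≤ M k :=
    Finset.single_le_sum (f := fun a ↦ M₀ k a + M₁ k a) (fun a _ ↦ hMnn k a) (Finset.mem_univ a)
  obtain ⟨A', k₀, hA', hk₀, hmain⟩ := exists_jetBound_localPert (E := E) (ι := ι) T C p c hT0 hC
    hp0 hc
  -- Any positive κ with κM ≤ k would do; here κM ≤ 1, and no rate in k is needed.
  set κ : ℕ → ℝ := fun k ↦ (M k + 1)⁻¹ with hκ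
  have hκ0 (k : ℕ) : 0 < κ k := inv_pos.2 (by linarith [hM k])
  refine ⟨fun k ↦ localPert ψ P v k (κ k) θ (σ₀ k) (σ₁ k), A' + T * A', ?_⟩
  obtain ⟨k₁, hk₁⟩ := exists_nat_ge r₀⁻¹
  filter_upwards [hpair, eventually_ge_atTop k₀, eventually_ge_atTop k₁] with k hpair hkk₀ hkk₁
  have hk1 : 1 ≤ k := hk₀.trans hkk₀
  have hk0 : (0 : ℝ) < k := by exact_mod_cast hk1
  have hk1' : (1 : ℝ) ≤ k := by exact_mod_cast hk1
  have hkr : (k : ℝ)⁻¹ ≤ r₀ := by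
    rw [inv_le_comm₀ hk0 hr₀]
    exact hk₁.trans (by exact_mod_cast hkk₁)
  set f := localPert ψ P v k (κ k) θ (σ₀ k) (σ₁ k) with hf
  set w := pairSq (σ₀ k) (σ₁ k) with hw
  have hwc : ContDiff ℝ ∞ w := contDiff_pairSq (hσ₀ k) (hσ₁ k)
  have hρ : ContDiff ℝ ∞ (stepSize k (κ k) w) :=
    contDiff_stepSize (hκ0 k) hwc (pairSq_nonneg _ _)
  have hq₀ (a : ι) : ContDiff ℝ ∞ (regDeriv k θ (σ₀ k) (v a) (stepSize k (κ k) w)) :=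
    contDiff_regDeriv hθ (hσ₀ k) hρ (v a)
  have hq₁ (a : ι) : ContDiff ℝ ∞ (regDeriv k θ (σ₁ k) (v a) (stepSize k (κ k) w)) :=
    contDiff_regDeriv hθ (hσ₁ k) hρ (v a)
  have hfz (x : E) (hx : ψ x = 0 ∨ (k : ℝ)⁻¹ / 2 ≤ w x) : f x = 0 := by
    rcases hx with hx | hx
    · simp [hf, localPert, cutPert, hx]
    · have : cutoff (k * w x) = 0 := cutoff_eq_zero (by
        calc (1 : ℝ) / 2 = k * ((k : ℝ)⁻¹ / 2) := by field_simp
          _ ≤ _ := by gcongr)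
      simp [hf, localPert, cutPert, ← hw, this]
  -- The cutoff vanishes from 1/(2k) on, while the estimates are available up to 1/k. Because of
  -- this gap f vanishes on a neighbourhood of every other point, and the junk value of the quotient
  -- where its denominator may vanish is never met.
  have hfe (x : E) (hx : ¬(x ∈ K ∧ w x ≤ (k : ℝ)⁻¹)) : f =ᶠ[𝓝 x] fun _ ↦ 0 := by
    by_cases hxK : x ∈ K
    · have hx' : (k : ℝ)⁻¹ / 2 < w x := by
        have : 0 < (k : ℝ)⁻¹ := by positivity
        have : (k : ℝ)⁻¹ < w x := not_le.1 fun h ↦ hx ⟨hxK, h⟩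
        linarith
      filter_upwards [hwc.continuous.continuousAt.eventually (lt_mem_nhds hx')] with y hy using
        hfz y (Or.inr hy.le)
    · filter_upwards [(isClosed_tsupport ψ).isOpen_compl.mem_nhds hxK] with y hy using
        hfz y (Or.inl (image_eq_zero_of_notMem_tsupport hy))
  -- the estimates where `f` may be nonzero
  have hgood (x : E) (hxK : x ∈ K) (hx : w x ≤ (k : ℝ)⁻¹) :
      JetBound (fun y ↦ gaugePhase k (θ x) x y * f y) x (A' * (k : ℝ)⁻¹) A' (A' * k) ∧
      pairing P x (fun a ↦ regDeriv k θ (σ₀ k) (v a) (stepSize k (κ k) w) x)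
        (fun a ↦ (starRingEnd ℂ) (regDeriv k θ (σ₀ k) (v a) (stepSize k (κ k) w) x)) ≠ 0 := by
    have hball {y : E} (hy : y ∈ Metric.closedBall x (k : ℝ)⁻¹) : y ∈ Metric.cthickening r₀ K :=
      Metric.closedBall_subset_cthickening hxK r₀ (Metric.closedBall_subset_closedBall hkr hy)
    have hxc : x ∈ Metric.cthickening r₀ K :=
      hball (Metric.mem_closedBall_self (by positivity))
    have hg {σ : E → ℂ} (hσ : σ = σ₀ k ∨ σ = σ₁ k) : ContDiff ℝ ∞ σ := by
      rcases hσ with rfl | rfl; exacts [hσ₀ k, hσ₁ k]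
    have hcg {σ : E → ℂ} (hσ : σ = σ₀ k ∨ σ = σ₁ k) (y u : E) :
        covDeriv k (fun y ↦ θ y - θ x) (fun y ↦ gaugePhase k (θ x) x y * σ y) y u
          = gaugePhase k (θ x) x y * covDeriv k θ σ y u :=
      covDeriv_gauge k θ (θ x) x ((hg hσ).differentiable (by simp) y) u
    obtain ⟨hp₁, hp₂⟩ := hpair x hxK hx
    obtain ⟨hJ, hne⟩ := hmain k P v ψ (fun y ↦ θ y - θ x) (fun y ↦ gaugePhase k (θ x) x y * σ₀ k y)
      (fun y ↦ gaugePhase k (θ x) x y * σ₁ k y) x (κ k) (M k) hkk₀ (hθ.sub contDiff_const)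
      ((contDiff_gaugePhase k (θ x) x).mul (hσ₀ k)) ((contDiff_gaugePhase k (θ x) x).mul (hσ₁ k))
      (sub_self _) hv (by
        rw [pairSq_gauge, ← Real.sqrt_inv]
        exact Real.sqrt_le_sqrt hx)
      (fun y hy w ↦ hT x y (hball hy) w) (fun a ↦ hTj x hxc (v a) (hv a))
      (by
        have (σ : E → ℂ) (hσ : σ = σ₀ k ∨ σ = σ₁ k) (y : E)
            (hy : y ∈ Metric.closedBall x (k : ℝ)⁻¹) :
            (∀ u, ‖covDeriv k (fun y ↦ θ y - θ x) (fun y ↦ gaugePhase k (θ x) x y * σ y) y u‖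
              ≤ C * Real.sqrt k * ‖u‖) ∧ ∀ u w, ‖covDeriv k (fun y ↦ θ y - θ x)
              (fun z ↦ covDeriv k (fun y ↦ θ y - θ x) (fun y ↦ gaugePhase k (θ x) x y * σ y) z w)
              y u‖ ≤ C * k * (‖u‖ * ‖w‖) := by
          refine ⟨fun u ↦ ?_, fun u w ↦ ?_⟩
          · rw [hcg hσ, norm_mul, norm_gaugePhase, one_mul]
            exact (hcov k hk1 σ hσ y (hball hy)).1 u
          · rw [covDeriv_covDeriv_gauge (θ x) x hθ (hg hσ), norm_mul, norm_gaugePhase, one_mul]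
            exact (hcov k hk1 σ hσ y (hball hy)).2 u w
        rintro σ (rfl | rfl) y hy
        exacts [this _ (Or.inl rfl) y hy, this _ (Or.inr rfl) y hy])
      (fun i j ↦ ((hpP i j x hxK).mono (hpP' i j) (hpP' i j) (hpP' i j)).clm_comp Complex.ofRealCLM
        fun u ↦ by simp) ((hpψ x hxK).mono hpψ' hpψ' hpψ')
      (by simpa only [hcg (Or.inl rfl), hcg (Or.inr rfl), gaugePhase_self, one_mul] using hp₁)
      (by simpa only [hcg (Or.inl rfl), gaugePhase_self, one_mul] using hp₂) (hκ0 k) (hM k)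
      (by
        rw [hκ, inv_mul_le_iff₀ (by linarith [hM k])]
        nlinarith [hM k])
      (by
        rintro σ (rfl | rfl) a r hr u u'
        · refine (hD₀ k a x hxK r hr u u').trans ?_
          gcongr
          linarith [hMa k a, hM₁ k a]
        · refine (hD₁ k a x hxK r hr u u').trans ?_
          gcongr
          linarith [hMa k a, hM₀ k a])
    refine ⟨hJ.congr (Eventually.of_forall fun y ↦
      (localPert_gauge (θ x) x hθ (hσ₀ k) (hσ₁ k) y).symm), ?_⟩
    simpa only [pairSq_gauge, regDeriv_gauge (θ x) x hθ (hσ₀ k), gaugePhase_self, one_mul] using hne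
  have hcs (x : E) (hxK : x ∈ K) (hx : w x ≤ (k : ℝ)⁻¹) : ContDiffAt ℝ ∞ (fun y ↦ (ψ y : ℂ) *
      ((cutoff (k * w y) : ℂ) * corr P (fun a ↦ regDeriv k θ (σ₀ k) (v a) (stepSize k (κ k) w))
        (fun a ↦ regDeriv k θ (σ₁ k) (v a) (stepSize k (κ k) w)) y)) x :=
    (Complex.ofRealCLM.contDiff.comp hψ).contDiffAt.mul
      ((Complex.ofRealCLM.contDiff.comp (contDiff_cutoff.comp
        (contDiff_const.mul hwc))).contDiffAt.mul (contDiffAt_corr hP hq₀ hq₁ (hgood x hxK hx).2))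
  have hfeq : f = fun y ↦ ((ψ y : ℂ) *
      ((cutoff (k * w y) : ℂ) * corr P (fun a ↦ regDeriv k θ (σ₀ k) (v a) (stepSize k (κ k) w))
        (fun a ↦ regDeriv k θ (σ₁ k) (v a) (stepSize k (κ k) w)) y)) *
        (starRingEnd ℂ) (σ₀ k y) := by
    ext y
    simp only [hf, localPert, cutPert, hw]
    ring
  have hfc : ContDiff ℝ ∞ f := by
    rw [contDiff_iff_contDiffAt]
    intro x
    by_cases hx : x ∈ K ∧ w x ≤ (k : ℝ)⁻¹
    · rw [hfeq]
      exact (hcs x hx.1 hx.2).mul (Complex.conjCLE.contDiff.comp (hσ₀ k)).contDiffAt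
    · exact contDiffAt_const.congr_of_eventuallyEq (hfe x hx)
  have hcov0 (x : E) (hx : ¬(x ∈ K ∧ w x ≤ (k : ℝ)⁻¹)) (u : E) : covDeriv k θ f x u = 0 := by
    rw [covDeriv, (hfe x hx).fderiv_eq (𝕜 := ℝ), (hfe x hx).eq_of_nhds]
    simp
  refine ⟨hfc, fun x hx ↦ (hfe x fun h ↦ hx h.1).eq_of_nhds, fun x hx ↦ hfz x (Or.inr ?_),
    fun x hx ↦ by rw [hfeq]; simp [hx], fun x ↦ ?_, fun x h₀ h₁ ↦ ?_⟩
  · have : 0 < (k : ℝ)⁻¹ := by positivity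
    linarith
  · by_cases hx : x ∈ K ∧ w x ≤ (k : ℝ)⁻¹
    · obtain ⟨hJ, -⟩ := hgood x hx.1 hx.2
      have hxc : x ∈ Metric.cthickening r₀ K := Metric.self_subset_cthickening K hx.1
      obtain ⟨b₁, b₂⟩ := norm_covDeriv_of_jetBound hk1 (hθ.sub contDiff_const) (sub_self (θ x))
        (hT x x hxc) hT0 hJ
      have hTA : 0 ≤ T * A' := by positivity
      refine ⟨?_, fun u ↦ ?_, fun u w ↦ ?_⟩
      · have := hJ.zero
        rw [norm_mul, norm_gaugePhase, one_mul] at this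
        refine this.trans ?_
        gcongr
        linarith
      · have := b₁ u
        rw [covDeriv_gauge k θ (θ x) x (hfc.differentiable (by simp) x), norm_mul, norm_gaugePhase,
          one_mul] at this
        refine this.trans ?_
        gcongr
        linarith
      · have := b₂ u w
        rwa [covDeriv_covDeriv_gauge (θ x) x hθ hfc, norm_mul, norm_gaugePhase,
          one_mul] at this
    · have hev : ∀ w', (fun z ↦ covDeriv k θ f z w') =ᶠ[𝓝 x] fun _ ↦ 0 := fun w' ↦ by
        filter_upwards [(hfe x hx).eventuallyEq_nhds] with y hy
        rw [covDeriv, hy.fderiv_eq (𝕜 := ℝ), hy.eq_of_nhds]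
        simp
      have hA'' : 0 ≤ A' + T * A' := by positivity
      refine ⟨?_, fun u ↦ ?_, fun u w' ↦ ?_⟩
      · rw [(hfe x hx).eq_of_nhds, norm_zero]; positivity
      · rw [hcov0 x hx, norm_zero]; positivity
      · rw [covDeriv, (hev w').fderiv_eq (𝕜 := ℝ), (hev w').eq_of_nhds]
        simp only [fderiv_fun_const, Pi.zero_apply, zero_apply, mul_zero, add_zero, norm_zero]
        positivity
  · by_cases hxK : x ∈ K
    · have hw0 : w x = 0 := by simp [hw, pairSq, h₀, h₁]
      have hwk : w x ≤ (k : ℝ)⁻¹ := by rw [hw0]; positivity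
      -- At a common zero the step is zero, so the regularised derivatives are the covariant
      -- derivatives.
      have hstep : stepSize k (κ k) w x = 0 := by
        simp [stepSize, hw0, Real.sqrt_sq (hκ0 k).le]
      have hreg {σ : E → ℂ} (hσ : ContDiff ℝ ∞ σ) (a : ι) :
          regDeriv k θ σ (v a) (stepSize k (κ k) w) x = covDeriv k θ σ x (v a) := by
        rw [regDeriv, hstep]
        exact hadamardQuotient_transported_zero (hσ.differentiable (by simp) x) hθ hσ (v a)
      have hne := (hgood x hxK hwk).2
      simp only [hreg (hσ₀ k)] at hne
      have hh := ((hcs x hxK hwk).differentiableAt (by simp)).hasFDerivAt.mul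
        (((Complex.conjCLE : ℂ ≃L[ℝ] ℂ) : ℂ →L[ℝ] ℂ).hasFDerivAt.comp x
          ((hσ₀ k).differentiable (by simp) x).hasFDerivAt)
      have hfd := hh.congr_of_eventuallyEq (Eventually.of_forall fun y ↦ congrFun hfeq y)
      -- At a zero of σ₀ only the derivative falling on conj(σ₀) survives, and the cutoff equals 1
      -- there: ∇f = ψ b conj(∇σ₀).
      have hcv (u : E) : covDeriv k θ f x u = (ψ x : ℂ) *
          corr P (fun a ↦ regDeriv k θ (σ₀ k) (v a) (stepSize k (κ k) w))
            (fun a ↦ regDeriv k θ (σ₁ k) (v a) (stepSize k (κ k) w)) x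
          * (starRingEnd ℂ) (covDeriv k θ (σ₀ k) x u) := by
        have hfx : f x = 0 := by rw [hfeq]; simp [h₀]
        rw [covDeriv, hfx, hfd.fderiv, covDeriv, h₀]
        simp [h₀, hw0, cutoff_eventuallyEq_one.eq_of_nhds]
      simp only [hcv, corr, hreg (hσ₀ k), hreg (hσ₁ k)]
      have := pairing_smul P x (fun a ↦ covDeriv k θ (σ₀ k) x (v a))
        (fun a ↦ (starRingEnd ℂ) (covDeriv k θ (σ₀ k) x (v a))) 1
      simp only [one_mul] at this
      rw [this]
      field_simp
    · have : ¬(x ∈ K ∧ w x ≤ (k : ℝ)⁻¹) := fun h ↦ hxK h.1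
      simp only [hcov0 x this, image_eq_zero_of_notMem_tsupport hxK]
      simp [pairing]

end LocalConclusion

/-! ### Linear algebra of the Poisson pairing and of the symplectic normal space. -/

noncomputable section SymplecticLinearAlgebra

variable {V : Type*} [AddCommGroup V] [Module ℝ V]

/-- A symplectic form and a compatible complex structure on a real vector space. -/
structure CompatiblePair (Φ : V →ₗ[ℝ] V →ₗ[ℝ] ℝ) (J : V →ₗ[ℝ] V) : Prop where
  alt (u : V) : Φ u u = 0
  sq (u : V) : J (J u) = -u
  symm (u v : V) : Φ u (J v) = Φ v (J u)
  pos (u : V) : u ≠ 0 → 0 < Φ u (J u)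

/-- The norm of the metric `Φ(·, J·)`. -/
def compatNorm (Φ : V →ₗ[ℝ] V →ₗ[ℝ] ℝ) (J : V →ₗ[ℝ] V) (u : V) : ℝ := Real.sqrt (Φ u (J u))

/-- The complex bilinear Poisson pairing of complex-valued real-linear forms; `H` sends a form to
its Hamiltonian vector. -/
def poisson (H : (V →ₗ[ℝ] ℝ) →ₗ[ℝ] V) (α β : V →ₗ[ℝ] ℂ) : ℂ :=
  α (H (Complex.reLm ∘ₗ β)) + Complex.I * α (H (Complex.imLm ∘ₗ β))

theorem compatNorm_nonneg (Φ : V →ₗ[ℝ] V →ₗ[ℝ] ℝ) (J : V →ₗ[ℝ] V) (u : V) :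
    0 ≤ compatNorm Φ J u := Real.sqrt_nonneg _

theorem poisson_add_left (H : (V →ₗ[ℝ] ℝ) →ₗ[ℝ] V) (α α' β : V →ₗ[ℝ] ℂ) :
    poisson H (α + α') β = poisson H α β + poisson H α' β := by
  simp only [poisson, LinearMap.add_apply]; ring

theorem poisson_add_right (H : (V →ₗ[ℝ] ℝ) →ₗ[ℝ] V) (α β β' : V →ₗ[ℝ] ℂ) :
    poisson H α (β + β') = poisson H α β + poisson H α β' := by
  simp only [poisson, LinearMap.comp_add, map_add]; ring

theorem poisson_smul_left (H : (V →ₗ[ℝ] ℝ) →ₗ[ℝ] V) (z : ℂ) (α β : V →ₗ[ℝ] ℂ) :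
    poisson H (z • α) β = z * poisson H α β := by
  simp only [poisson, LinearMap.smul_apply, smul_eq_mul]; ring

theorem poisson_smul_right (H : (V →ₗ[ℝ] ℝ) →ₗ[ℝ] V) (z : ℂ) (α β : V →ₗ[ℝ] ℂ) :
    poisson H α (z • β) = z * poisson H α β := by
  have h₁ : Complex.reLm ∘ₗ (z • β) = z.re • (Complex.reLm ∘ₗ β) - z.im • (Complex.imLm ∘ₗ β) := by
    ext u; simp
  have h₂ : Complex.imLm ∘ₗ (z • β) = z.re • (Complex.imLm ∘ₗ β) + z.im • (Complex.reLm ∘ₗ β) := by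
    ext u; simp
  simp only [poisson, h₁, h₂, map_sub, map_add, map_smul, Complex.real_smul]
  conv_rhs => rw [← Complex.re_add_im z]
  linear_combination (-(z.im : ℂ) * α (H (Complex.imLm ∘ₗ β))) * Complex.I_mul_I

/-- The Poisson pairing in a basis. -/
theorem poisson_eq_sum {ι : Type*} [Fintype ι] (H : (V →ₗ[ℝ] ℝ) →ₗ[ℝ] V) (b : Module.Basis ι ℝ V)
    (α β : V →ₗ[ℝ] ℂ) :
    poisson H α β = ∑ i, ∑ j, ((b.coord i (H (b.coord j)) : ℝ) : ℂ) * α (b i) * β (b j) := by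
  have hγ (γ : V →ₗ[ℝ] ℝ) : α (H γ)
      = ∑ i, ∑ j, ((b.coord i (H (b.coord j)) : ℝ) : ℂ) * α (b i) * (γ (b j) : ℂ) := by
    have e : γ = ∑ j, γ (b j) • b.coord j := by
      refine b.ext fun i ↦ ?_
      simp
    have hv (v : V) : α v = ∑ i, (b.coord i v : ℂ) * α (b i) := by
      conv_lhs => rw [← b.sum_repr v]
      simp only [map_sum, map_smul, Complex.real_smul, Module.Basis.coord_apply]
    conv_lhs => rw [e]
    simp only [map_sum, map_smul]
    rw [Finset.sum_comm]
    refine Finset.sum_congr rfl fun j _ ↦ ?_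
    rw [hv (H (b.coord j)), Finset.smul_sum]
    refine Finset.sum_congr rfl fun i _ ↦ ?_
    rw [Complex.real_smul]
    ring
  rw [poisson, hγ, hγ, Finset.mul_sum, ← Finset.sum_add_distrib]
  refine Finset.sum_congr rfl fun i _ ↦ ?_
  rw [Finset.mul_sum, ← Finset.sum_add_distrib]
  refine Finset.sum_congr rfl fun j _ ↦ ?_
  conv_rhs => rw [← Complex.re_add_im (β (b j))]
  simp only [LinearMap.comp_apply, Complex.reLm_coe, Complex.imLm_coe]
  ring

/-- Every nondegenerate form on a finite-dimensional space has Hamiltonian vectors. -/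
theorem exists_hamiltonian [FiniteDimensional ℝ V] {Φ : V →ₗ[ℝ] V →ₗ[ℝ] ℝ}
    (hΦ : ∀ u, (∀ v, Φ u v = 0) → u = 0) :
    ∃ H : (V →ₗ[ℝ] ℝ) →ₗ[ℝ] V, ∀ γ v, Φ (H γ) v = γ v := by
  have hinj : Function.Injective Φ := by
    rw [injective_iff_map_eq_zero]
    intro u hu
    exact hΦ u fun v ↦ by rw [hu]; rfl
  have e := LinearMap.linearEquivOfInjective_apply (f := Φ) (hf := hinj)
    (hdim := (Subspace.dual_finrank_eq (K := ℝ) (V := V)).symm)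
  refine ⟨(Φ.linearEquivOfInjective hinj
    (Subspace.dual_finrank_eq (K := ℝ) (V := V)).symm).symm.toLinearMap, fun γ v ↦ ?_⟩
  rw [← e, LinearEquiv.coe_coe, LinearEquiv.apply_symm_apply]

namespace CompatiblePair

variable {Φ : V →ₗ[ℝ] V →ₗ[ℝ] ℝ} {J : V →ₗ[ℝ] V} {H : (V →ₗ[ℝ] ℝ) →ₗ[ℝ] V}

theorem antisymm (h : CompatiblePair Φ J) (u v : V) : Φ u v = -Φ v u := by
  have := h.alt (u + v)
  simp only [map_add, LinearMap.add_apply, h.alt, zero_add, add_zero] at this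
  linarith

theorem nonneg (h : CompatiblePair Φ J) (u : V) : 0 ≤ Φ u (J u) := by
  rcases eq_or_ne u 0 with rfl | hu
  · simp
  · exact (h.pos u hu).le

theorem norm_sq (h : CompatiblePair Φ J) (u : V) : compatNorm Φ J u ^ 2 = Φ u (J u) :=
  Real.sq_sqrt (h.nonneg u)

theorem norm_J (h : CompatiblePair Φ J) (u : V) : compatNorm Φ J (J u) = compatNorm Φ J u := by
  rw [compatNorm, compatNorm, h.sq, map_neg, h.antisymm, neg_neg]

theorem norm_pos (h : CompatiblePair Φ J) {u : V} (hu : u ≠ 0) : 0 < compatNorm Φ J u :=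
  Real.sqrt_pos.2 (h.pos u hu)

theorem abs_metric_le (h : CompatiblePair Φ J) (u v : V) :
    |Φ u (J v)| ≤ compatNorm Φ J u * compatNorm Φ J v := by
  have := LinearMap.BilinForm.apply_mul_apply_le_of_forall_zero_le
    (Φ.compl₁₂ LinearMap.id J) h.nonneg u v
  refine abs_le_of_sq_le_sq ?_ (mul_nonneg (Real.sqrt_nonneg _) (Real.sqrt_nonneg _))
  rw [mul_pow, h.norm_sq, h.norm_sq, pow_two]
  nth_rw 2 [h.symm]
  simpa using this

theorem abs_le (h : CompatiblePair Φ J) (u v : V) :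
    |Φ u v| ≤ compatNorm Φ J u * compatNorm Φ J v := by
  have := h.abs_metric_le u (J v)
  rwa [h.sq, map_neg, abs_neg, h.norm_J] at this

/-- For u = Hγ, |u|² = Φ(u, Ju) = γ(Ju) ≤ a|u|, because J is an isometry. -/
theorem norm_ham_le (h : CompatiblePair Φ J) (hH : ∀ γ v, Φ (H γ) v = γ v) {γ : V →ₗ[ℝ] ℝ} {a : ℝ}
    (ha : 0 ≤ a) (hγ : ∀ v, |γ v| ≤ a * compatNorm Φ J v) : compatNorm Φ J (H γ) ≤ a := by
  by_cases h0 : H γ = 0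
  · simpa [h0, compatNorm] using ha
  · have h₁ := h.norm_sq (H γ)
    rw [hH] at h₁
    have h₂ := (le_abs_self _).trans (hγ (J (H γ)))
    rw [h.norm_J] at h₂
    nlinarith [h.norm_pos h0]

/-- J is skew for Φ, by the symmetry of Φ(·, J·), and nondegeneracy identifies the two vectors. -/
theorem ham_comp_J (h : CompatiblePair Φ J) (hH : ∀ γ v, Φ (H γ) v = γ v)
    (hnd : ∀ u, (∀ v, Φ u v = 0) → u = 0) (γ : V →ₗ[ℝ] ℝ) : H (γ ∘ₗ J) = -J (H γ) := by
  rw [← sub_eq_zero]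
  refine hnd _ fun v ↦ ?_
  rw [map_sub, LinearMap.sub_apply, hH, map_neg, LinearMap.neg_apply, LinearMap.comp_apply,
    ← hH γ, h.symm, h.antisymm v]
  ring

theorem norm_poisson_le (h : CompatiblePair Φ J) (hH : ∀ γ v, Φ (H γ) v = γ v)
    {α β : V →ₗ[ℝ] ℂ} {A B : ℝ} (hA : 0 ≤ A) (hB : 0 ≤ B)
    (hα : ∀ v, ‖α v‖ ≤ A * compatNorm Φ J v) (hβ : ∀ v, ‖β v‖ ≤ B * compatNorm Φ J v) :
    ‖poisson H α β‖ ≤ 2 * (A * B) := by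
  have h₁ : ‖α (H (Complex.reLm ∘ₗ β))‖ ≤ A * B := (hα _).trans (by
    gcongr
    exact h.norm_ham_le hH hB fun v ↦ (Complex.abs_re_le_norm _).trans (hβ v))
  have h₂ : ‖α (H (Complex.imLm ∘ₗ β))‖ ≤ A * B := (hα _).trans (by
    gcongr
    exact h.norm_ham_le hH hB fun v ↦ (Complex.abs_im_le_norm _).trans (hβ v))
  refine (_root_.norm_add_le _ _).trans ?_
  rw [norm_mul, Complex.norm_I, one_mul]
  linarith

/-- The Poisson pairing of two almost complex linear forms is small. -/
theorem norm_poisson_le_of_almost_complex (h : CompatiblePair Φ J)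
    (hH : ∀ γ v, Φ (H γ) v = γ v) (hnd : ∀ u, (∀ v, Φ u v = 0) → u = 0)
    {α β : V →ₗ[ℝ] ℂ} {A B A' B' : ℝ} (hA : 0 ≤ A) (hB : 0 ≤ B) (hA' : 0 ≤ A') (hB' : 0 ≤ B')
    (hα : ∀ v, ‖α v‖ ≤ A * compatNorm Φ J v) (hβ : ∀ v, ‖β v‖ ≤ A' * compatNorm Φ J v)
    (hαJ : ∀ v, ‖α (J v) - Complex.I * α v‖ ≤ B * compatNorm Φ J v)
    (hβJ : ∀ v, ‖β (J v) - Complex.I * β v‖ ≤ B' * compatNorm Φ J v) :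
    ‖poisson H α β‖ ≤ A * B' + B * A' + B * B' := by
  set ρ := α ∘ₗ J - Complex.I • α with hρ
  set ρ' := β ∘ₗ J - Complex.I • β with hρ'
  have e₁ : α ∘ₗ J = Complex.I • α + ρ := by rw [hρ]; abel
  have e₂ : β ∘ₗ J = Complex.I • β + ρ' := by rw [hρ']; abel
  -- J is symplectic, hence preserves the pairing. On complex linear forms J acts as i on both
  -- arguments, so the pairing equals its own opposite; what remains of twice the pairing is made of
  -- the error forms ρ, ρ'.
  have e₃ : poisson H (α ∘ₗ J) (β ∘ₗ J) = poisson H α β := by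
    simp only [poisson, ← LinearMap.comp_assoc, h.ham_comp_J hH hnd]
    simp only [LinearMap.comp_apply, map_neg, h.sq, neg_neg]
  rw [e₁, e₂] at e₃
  simp only [poisson_add_left, poisson_add_right, poisson_smul_left, poisson_smul_right] at e₃
  have e₄ : 2 * poisson H α β = Complex.I * poisson H α ρ' + Complex.I * poisson H ρ β
      + poisson H ρ ρ' := by
    linear_combination -e₃ + poisson H α β * Complex.I_mul_I
  have n₁ := h.norm_poisson_le hH hA hB' hα (β := ρ') (by simpa [hρ'] using hβJ)
  have n₂ := h.norm_poisson_le hH hB hA' (α := ρ) (by simpa [hρ] using hαJ) hβ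
  have n₃ := h.norm_poisson_le hH hB hB' (α := ρ) (by simpa [hρ] using hαJ) (β := ρ')
    (by simpa [hρ'] using hβJ)
  have n₄ : ‖(2 : ℂ) * poisson H α β‖ ≤ 2 * (A * B') + 2 * (B * A') + 2 * (B * B') := by
    rw [e₄]
    refine (_root_.norm_add_le _ _).trans (add_le_add ((_root_.norm_add_le _ _).trans
      (add_le_add ?_ ?_)) n₃)
    · rwa [norm_mul, Complex.norm_I, one_mul]
    · rwa [norm_mul, Complex.norm_I, one_mul]
  rw [norm_mul, Complex.norm_ofNat] at n₄
  linarith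

/-- The Poisson pairing of an almost complex linear form with its conjugate is large. -/
theorem le_norm_poisson_conj (h : CompatiblePair Φ J)
    (hH : ∀ γ v, Φ (H γ) v = γ v) (hnd : ∀ u, (∀ v, Φ u v = 0) → u = 0)
    {α : V →ₗ[ℝ] ℂ} {A B r : ℝ} (hA : 0 ≤ A) (hB : 0 ≤ B) (hr : 0 < r)
    (hα : ∀ v, ‖α v‖ ≤ A * compatNorm Φ J v)
    (hαJ : ∀ v, ‖α (J v) - Complex.I * α v‖ ≤ B * compatNorm Φ J v)
    {v : V} (hv : α v = 1) (hvr : compatNorm Φ J v ≤ r) :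
    2 * (r⁻¹ ^ 2 - A * B) ≤ ‖poisson H α (Complex.conjAe.toLinearMap ∘ₗ α)‖ := by
  set a := Complex.reLm ∘ₗ α with ha
  set b := Complex.imLm ∘ₗ α with hb
  set ρ := α ∘ₗ J - Complex.I • α with hρ
  have e₁ : Complex.reLm ∘ₗ Complex.conjAe.toLinearMap ∘ₗ α = a := by ext u; simp [ha]
  have e₂ : Complex.imLm ∘ₗ Complex.conjAe.toLinearMap ∘ₗ α = -b := by ext u; simp [hb]
  have hαab (u : V) : α u = (a u : ℂ) + Complex.I * (b u : ℂ) := by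
    conv_lhs => rw [← Complex.re_add_im (α u)]
    simp [ha, hb, mul_comm]
  -- With α = a + ib the pairing reduces to a(Hb). Almost complex linearity says b ≈ -a ∘ J, so that
  -- a(Hb) ≈ |Ha|², which is positive.
  have e₃ : poisson H α (Complex.conjAe.toLinearMap ∘ₗ α) = -2 * Complex.I * (a (H b) : ℂ) := by
    have h₁ : a (H a) = 0 := by rw [← hH, h.alt]
    have h₂ : b (H b) = 0 := by rw [← hH, h.alt]
    have h₃ : b (H a) = -a (H b) := by rw [← hH b, ← hH a, h.antisymm]
    rw [poisson, e₁, e₂, map_neg, map_neg, hαab, hαab, h₁, h₂, h₃]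
    push_cast
    ring
  have e₄ : b = Complex.reLm ∘ₗ ρ - a ∘ₗ J := by
    ext u; simp [ha, hb, hρ]
  have e₅ : a (H b) = a (H (Complex.reLm ∘ₗ ρ)) + compatNorm Φ J (H a) ^ 2 := by
    rw [e₄, map_sub, h.ham_comp_J hH hnd, sub_neg_eq_add, map_add, h.norm_sq, hH]
  have n₁ : |a (H (Complex.reLm ∘ₗ ρ))| ≤ A * B := by
    refine (Complex.abs_re_le_norm _).trans ((hα _).trans ?_)
    gcongr
    exact h.norm_ham_le hH hB fun v ↦ (Complex.abs_re_le_norm _).trans (by simpa [hρ] using hαJ v)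
  -- The vector v with α v = 1 tests Ha: 1 = Φ(Ha, v) ≤ |Ha| r.
  have n₂ : r⁻¹ ≤ compatNorm Φ J (H a) := by
    have h₁ : Φ (H a) v = 1 := by rw [hH]; simp [ha, hv]
    have h₂ := (le_abs_self _).trans (h.abs_le (H a) v)
    rw [h₁] at h₂
    rw [inv_le_iff_one_le_mul₀ hr]
    exact h₂.trans (mul_le_mul_of_nonneg_left hvr (compatNorm_nonneg _ _ _))
  have n₃ : r⁻¹ ^ 2 ≤ compatNorm Φ J (H a) ^ 2 := by gcongr
  rw [e₃]
  have : ‖-2 * Complex.I * (a (H b) : ℂ)‖ = 2 * |a (H b)| := by simp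
  rw [this, e₅]
  have := le_abs_self (a (H (Complex.reLm ∘ₗ ρ)) + compatNorm Φ J (H a) ^ 2)
  have := (_root_.abs_le.1 n₁).1
  linarith

section Normal

variable {Y : Type*} [AddCommGroup Y] [Module ℝ Y] [Module ℂ Y]
  {D : V →ₗ[ℝ] Y} {R : Y →ₗ[ℝ] V} {S : Submodule ℝ V} {N : Y → ℝ} {r B : ℝ}

/-- Put ρ = D(Ju) - iDu. The vector u' - Ju + Rρ lies in ker D, hence is Φ-orthogonal to u, so Φ(u,
u') = |u|² - Φ(u, Rρ) and the last term is at most rB|u|². Taking u' = 0 gives injectivity of D on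
the normal space; taking u' = ju gives positivity. -/
theorem sq_le_of_mem_orthogonal (h : CompatiblePair Φ J) (hDR : ∀ w, D (R w) = w)
    (hR : ∀ w, compatNorm Φ J (R w) ≤ r * N w) (hr : 0 ≤ r)
    (hB : ∀ v, N (D (J v) - Complex.I • D v) ≤ B * compatNorm Φ J v)
    {u : V} (hu : ∀ v, D v = 0 → Φ u v = 0) {u' : V} (hu' : D u' = Complex.I • D u) :
    (1 - r * B) * compatNorm Φ J u ^ 2 ≤ Φ u u' := by
  set ρ := D (J u) - Complex.I • D u with hρ
  have h₁ := hu (u' - J u + R ρ) (by rw [map_add, hDR, map_sub, hu', hρ]; abel)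
  rw [map_add, map_sub, ← h.norm_sq] at h₁
  have h₂ : Φ u (R ρ) ≤ compatNorm Φ J u * (r * (B * compatNorm Φ J u)) := by
    refine (le_abs_self _).trans ((h.abs_le u (R ρ)).trans ?_)
    refine mul_le_mul_of_nonneg_left ((hR ρ).trans ?_) (compatNorm_nonneg _ _ _)
    exact mul_le_mul_of_nonneg_left (hB u) hr
  nlinarith

theorem injOn_orthogonal (h : CompatiblePair Φ J) (hDR : ∀ w, D (R w) = w)
    (hR : ∀ w, compatNorm Φ J (R w) ≤ r * N w) (hr : 0 ≤ r)
    (hB : ∀ v, N (D (J v) - Complex.I • D v) ≤ B * compatNorm Φ J v) (hrB : r * B < 1)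
    {u : V} (hu : ∀ v, D v = 0 → Φ u v = 0) (hDu : D u = 0) : u = 0 := by
  by_contra h0
  have h₁ := h.sq_le_of_mem_orthogonal hDR hR hr hB hu (u' := 0) (by simp [hDu])
  rw [map_zero] at h₁
  nlinarith [pow_pos (h.norm_pos h0) 2]

/-- The Hamiltonian vectors X(l) of the forms l ∘ D, with l a real functional on Y, parametrise the
normal space. The hypothesis `hiso` says precisely that jX(l) = -X(l ∘ i); evaluating Φ(jX(l), jv)
by the defining property of X then gives back l(Dv) = Φ(X(l), v). -/
theorem normal_positive [IsScalarTower ℝ ℂ Y] [FiniteDimensional ℝ V] [FiniteDimensional ℝ Y] (h : CompatiblePair Φ J)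
    (hH : ∀ γ v, Φ (H γ) v = γ v) (hDR : ∀ w, D (R w) = w)
    (hR : ∀ w, compatNorm Φ J (R w) ≤ r * N w) (hr : 0 ≤ r)
    (hB : ∀ v, N (D (J v) - Complex.I • D v) ≤ B * compatNorm Φ J v) (hrB : r * B < 1)
    (hiso : ∀ l : Y →ₗ[ℝ] ℝ, D (H (l ∘ₗ D))
      = Complex.I • D (H (l ∘ₗ (LinearMap.lsmul ℂ Y Complex.I).restrictScalars ℝ ∘ₗ D)))
    (hS : ∀ u, u ∈ S ↔ ∀ v, D v = 0 → Φ u v = 0) :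
    Function.Bijective (D.domRestrict S) ∧ ∃ j : S →ₗ[ℝ] S,
      (∀ u : S, D (j u) = Complex.I • D u) ∧ (∀ u v : S, Φ (j u) (j v) = Φ u v) ∧
      (∀ u : S, u ≠ 0 → 0 < Φ u (j u)) := by
  have hinj : Function.Injective (D.domRestrict S) := by
    rw [injective_iff_map_eq_zero]
    rintro ⟨u, hu⟩ hDu
    exact Subtype.ext (h.injOn_orthogonal hDR hR hr hB hrB ((hS u).1 hu) hDu)
  have hX (l : Y →ₗ[ℝ] ℝ) : H (l ∘ₗ D) ∈ S := (hS _).2 fun v hv ↦ by simp [hH, hv]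
  let X : (Y →ₗ[ℝ] ℝ) →ₗ[ℝ] S :=
    { toFun := fun l ↦ ⟨H (l ∘ₗ D), hX l⟩
      map_add' := fun l l' ↦ Subtype.ext (by simp [LinearMap.add_comp])
      map_smul' := fun t l ↦ Subtype.ext (by simp [LinearMap.smul_comp]) }
  have hXinj : Function.Injective X := by
    rw [injective_iff_map_eq_zero]
    intro l hl
    ext w
    have h₁ : H (l ∘ₗ D) = 0 := congrArg Subtype.val hl
    have h₂ := hH (l ∘ₗ D) (R w)
    rw [h₁] at h₂
    simpa [hDR] using h₂.symm
  -- Both X and D restricted to S are injective, and Y and its dual have the same dimension; this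
  -- yields at once surjectivity of D on S and the fact that every vector of S is some X(l).
  have hsurj' : Function.Surjective (D.domRestrict S ∘ₗ X) :=
    (LinearMap.injective_iff_surjective_of_finrank_eq_finrank
      (Subspace.dual_finrank_eq (K := ℝ) (V := Y))).1 (hinj.comp hXinj)
  have hsurj : Function.Surjective (D.domRestrict S) := fun w ↦ by
    obtain ⟨l, hl⟩ := hsurj' w
    exact ⟨X l, hl⟩
  have hXsurj (u : S) : ∃ l, X l = u := by
    obtain ⟨l, hl⟩ := hsurj' (D u)
    exact ⟨l, hinj hl⟩
  set e := LinearEquiv.ofBijective (D.domRestrict S) ⟨hinj, hsurj⟩ with he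
  set j : S →ₗ[ℝ] S := e.symm.toLinearMap ∘ₗ (LinearMap.lsmul ℂ Y Complex.I).restrictScalars ℝ
    ∘ₗ e.toLinearMap with hj
  have hDj (u : S) : D (j u) = Complex.I • D u := by
    have : e (j u) = Complex.I • e u := by simp [hj]
    exact this
  have hjX (l : Y →ₗ[ℝ] ℝ) :
      j (X l) = -X (l ∘ₗ (LinearMap.lsmul ℂ Y Complex.I).restrictScalars ℝ) := by
    apply hinj
    change D (j (X l)) = D.domRestrict S (-X _)
    rw [hDj, map_neg]
    change Complex.I • D (H (l ∘ₗ D)) = -D (H _)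
    rw [hiso, smul_smul, Complex.I_mul_I, neg_one_smul]
    rfl
  refine ⟨⟨hinj, hsurj⟩, j, hDj, fun u v ↦ ?_, fun u hu ↦ ?_⟩
  · obtain ⟨l, rfl⟩ := hXsurj u
    have h₁ : Φ (X l) v = l (D v) := hH _ _
    have h₂ : Φ (X (l ∘ₗ (LinearMap.lsmul ℂ Y Complex.I).restrictScalars ℝ)) (j v)
      = l (Complex.I • D (j v)) := hH _ _
    rw [hjX, Submodule.coe_neg, map_neg, LinearMap.neg_apply, h₁, h₂, hDj, smul_smul,
      Complex.I_mul_I, neg_one_smul, map_neg, neg_neg]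
  · have := h.sq_le_of_mem_orthogonal hDR hR hr hB ((hS u).1 u.2) (hDj u)
    have h₁ := h.norm_pos (u := (u : V)) (fun h0 ↦ hu (Subtype.ext h0))
    have : 0 < (1 - r * B) * compatNorm Φ J u ^ 2 := mul_pos (by linarith) (pow_pos h₁ 2)
    linarith

end Normal

end CompatiblePair

/-- Right inverses persist under small perturbations. -/
theorem exists_rightInverse_of_perturbation {Y : Type*} [AddCommGroup Y] [Module ℝ Y]
    [FiniteDimensional ℝ Y] {D D' : V →ₗ[ℝ] Y} {R : Y →ₗ[ℝ] V} {N : Y → ℝ} {G : V → ℝ} {r C : ℝ}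
    (hDR : ∀ w, D (R w) = w) (hR : ∀ w, G (R w) ≤ r * N w)
    (hN : ∀ w w', N (w + w') ≤ N w + N w') (hN0 : ∀ w, N w ≤ 0 → w = 0) (hNz : N 0 = 0)
    (hr : 0 ≤ r) (hC : 0 ≤ C)
    (hD : ∀ u, N (D u - D' u) ≤ C * G u) (hCr : C * r ≤ 1 / 2) :
    ∃ R' : Y →ₗ[ℝ] V, (∀ w, D' (R' w) = w) ∧ ∀ w, G (R' w) ≤ 2 * r * N w := by
  -- Neumann argument: D'R differs from the identity by at most half, so it loses at most half of N
  -- w. Nonnegativity of N is not assumed and is deduced from `hN0` and `hNz`.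
  have key (w : Y) : N w ≤ 2 * N (D' (R w)) := by
    have h₁ := hN (D' (R w)) (D (R w) - D' (R w))
    rw [add_sub_cancel, hDR] at h₁
    have h₂ : N (w - D' (R w)) ≤ C * (r * N w) := by
      have := hD (R w)
      rw [hDR] at this
      exact this.trans (mul_le_mul_of_nonneg_left (hR w) hC)
    have h₃ : 0 ≤ N w := by
      by_contra hneg
      have := hN0 w (not_le.1 hneg).le
      rw [this, hNz] at hneg
      exact hneg le_rfl
    nlinarith
  have hinj : Function.Injective (D' ∘ₗ R) := by
    rw [injective_iff_map_eq_zero]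
    intro w hw
    refine hN0 w ?_
    have := key w
    rw [LinearMap.comp_apply] at hw
    rw [hw, hNz] at this
    linarith
  set e := LinearEquiv.ofInjectiveEndo (D' ∘ₗ R) hinj
  have he (w : Y) : D' (R (e.symm w)) = w := by
    have := e.apply_symm_apply w
    exact this
  refine ⟨R ∘ₗ e.symm.toLinearMap, he, fun w ↦ ?_⟩
  have h₁ := key (e.symm w)
  rw [he] at h₁
  have h₂ := hR (e.symm w)
  simp only [LinearMap.comp_apply, LinearEquiv.coe_coe]
  nlinarith

end SymplecticLinearAlgebra

/-! ### The lines L^k in unit vectors, and the real structure on sections. -/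

noncomputable section TensorPowers

variable {X : Type*} [TopologicalSpace X]
  {L : X → Type*} [TopologicalSpace (TotalSpace ℂ L)]
  [∀ x, NormedAddCommGroup (L x)] [∀ x, InnerProductSpace ℂ (L x)]
  [FiberBundle ℂ L]

/-- The coordinate on `L^k_y` in the frame `v^{⊗k}`, for a unit vector `v` of `L_y`. -/
def coordIn (k : ℕ) {y : X} (v : L y) : LPow L k y →ₗ[ℂ] ℂ :=
  PiTensorProduct.lift ((MultilinearMap.mkPiAlgebra ℂ (Fin k) ℂ).compLinearMap
    (fun _ ↦ (innerSL ℂ v).toLinearMap))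

theorem coordIn_tprod (k : ℕ) {y : X} (v : L y) (w : Fin k → L y) :
    coordIn k v (PiTensorProduct.tprod ℂ w) = ∏ i, inner ℂ v (w i) := by
  simp [coordIn]

theorem coordIn_self (k : ℕ) {y : X} {v : L y} (hv : ‖v‖ = 1) :
    coordIn k v (PiTensorProduct.tprod ℂ fun _ ↦ v) = 1 := by
  simp [coordIn_tprod, inner_self_eq_norm_sq_to_K, hv]

variable [VectorBundle ℂ ℂ L]

theorem linearMapAt_self_ne_zero {x₀ y : X} (hy : y ∈ (trivializationAt ℂ L x₀).baseSet) {v : L y}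
    (hv : v ≠ 0) : (trivializationAt ℂ L x₀).linearMapAt ℂ y v ≠ 0 := by
  intro h
  apply hv
  have := (trivializationAt ℂ L x₀).symmₗ_linearMapAt (R := ℂ) hy v
  rwa [h, map_zero, eq_comm] at this

/-- The trivialization identifies the fibre with ℂ, so any two vectors are proportional, and pairing
with v reads off the factor. -/
theorem line_eq {y : X} {v : L y} (hv : ‖v‖ = 1) (w : L y) : w = (inner ℂ v w : ℂ) • v := by
  have hy := FiberBundle.mem_baseSet_trivializationAt ℂ L y
  have hv0 : v ≠ 0 := by
    rintro rfl
    simp at hv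
  have hne := linearMapAt_self_ne_zero hy hv0
  set e := (trivializationAt ℂ L y).linearMapAt ℂ y with he
  have hinj (a b : L y) (h : e a = e b) : a = b := by
    rw [← (trivializationAt ℂ L y).symmₗ_linearMapAt (R := ℂ) hy a, ← he, h, he,
      (trivializationAt ℂ L y).symmₗ_linearMapAt (R := ℂ) hy b]
  have hw : w = (e w / e v) • v := hinj _ _ (by rw [map_smul, smul_eq_mul, div_mul_cancel₀ _ hne])
  have hi : (inner ℂ v w : ℂ) = e w / e v := by
    conv_lhs => rw [hw]
    rw [inner_smul_right, inner_self_eq_norm_sq_to_K, hv]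
    simp
  rw [hi]
  exact hw

theorem eq_coordIn_smul (k : ℕ) {y : X} {v : L y} (hv : ‖v‖ = 1) (t : LPow L k y) :
    t = coordIn k v t • PiTensorProduct.tprod ℂ fun _ ↦ v := by
  induction t using PiTensorProduct.induction_on with
  | smul_tprod r w =>
    rw [map_smul, coordIn_tprod, smul_eq_mul, mul_smul]
    congr 1
    conv_lhs => rw [show w = fun i ↦ (inner ℂ v (w i) : ℂ) • v from funext fun i ↦ line_eq hv (w i)]
    rw [MultilinearMap.map_smul_univ]
  | add a b ha hb => rw [map_add, add_smul, ← ha, ← hb]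

theorem powCoord_tprod (k : ℕ) (x₀ y : X) (w : Fin k → L y) :
    powCoord k x₀ y (PiTensorProduct.tprod ℂ w)
      = ∏ i, (trivializationAt ℂ L x₀).linearMapAt ℂ y (w i) := by
  simp [powCoord]

theorem powCoord_eq (k : ℕ) (x₀ : X) {y : X} {v : L y} (hv : ‖v‖ = 1) (t : LPow L k y) :
    powCoord k x₀ y t = coordIn k v t * (trivializationAt ℂ L x₀).linearMapAt ℂ y v ^ k := by
  conv_lhs => rw [eq_coordIn_smul k hv t]
  rw [map_smul, powCoord_tprod]
  simp

theorem lFrame_self_coord (x : X) :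
    (trivializationAt ℂ L x).linearMapAt ℂ x (lFrame L x x) = 1 := by
  have hy := FiberBundle.mem_baseSet_trivializationAt ℂ L x
  have := (trivializationAt ℂ L x).linearMapAt_symmₗ (R := ℂ) hy 1
  rwa [(trivializationAt ℂ L x).symmₗ_apply (R := ℂ) hy] at this

theorem lFrame_self_ne_zero (x : X) : lFrame L x x ≠ 0 := by
  intro h
  have := lFrame_self_coord (L := L) x
  rw [h, map_zero] at this
  exact zero_ne_one this

/-- A unit vector is a multiple of the frame, with inverse norm. -/
theorem eq_smul_lFrame {x : X} (v : L x) :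
    v = ((trivializationAt ℂ L x).linearMapAt ℂ x v) • lFrame L x x := by
  have hy := FiberBundle.mem_baseSet_trivializationAt ℂ L x
  have h := (trivializationAt ℂ L x).symmₗ_linearMapAt (R := ℂ) hy
  rw [← h (((trivializationAt ℂ L x).linearMapAt ℂ x v) • lFrame L x x), map_smul,
    lFrame_self_coord, smul_eq_mul, mul_one, h]

/-- The coordinate of a unit vector in the trivialization has modulus inverse to the norm of the
frame vector, so the k-th powers cancel. Norms can thus be computed in any unit vector. -/
theorem powNorm_eq (k : ℕ) {x : X} {v : L x} (hv : ‖v‖ = 1) (t : LPow L k x) :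
    powNorm k x t = ‖coordIn k v t‖ := by
  have h : ‖(trivializationAt ℂ L x).linearMapAt ℂ x v‖ * ‖lFrame L x x‖ = 1 := by
    rw [← norm_smul, ← eq_smul_lFrame, hv]
  rw [powNorm, powCoord_eq k x hv, norm_mul, norm_pow, mul_assoc, ← mul_pow, h, one_pow, mul_one]

theorem exists_unit (x : X) : ∃ v : L x, ‖v‖ = 1 := by
  have h : ‖lFrame L x x‖ ≠ 0 := norm_ne_zero_iff.2 (lFrame_self_ne_zero x)
  refine ⟨((‖lFrame L x x‖⁻¹ : ℝ) : ℂ) • lFrame L x x, ?_⟩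
  rw [norm_smul]
  simp [h]

theorem coordIn_injective (k : ℕ) {y : X} {v : L y} (hv : ‖v‖ = 1) :
    Function.Injective (coordIn k v) := fun a b h ↦ by
  rw [eq_coordIn_smul k hv a, eq_coordIn_smul k hv b, h]

/-- The coordinate in a unit frame as a linear equivalence. -/
def coordEquiv (k : ℕ) {y : X} {v : L y} (hv : ‖v‖ = 1) : LPow L k y ≃ₗ[ℂ] ℂ :=
  LinearEquiv.ofBijective (coordIn k v) ⟨coordIn_injective k hv, fun z ↦
    ⟨z • PiTensorProduct.tprod ℂ fun _ ↦ v, by rw [map_smul, coordIn_self k hv]; simp⟩⟩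

section Real

variable {c : X → X} {chat : ∀ x, L x →ₛₗ[starRingEnd ℂ] L (c x)}

theorem chatPow_eq (k : ℕ) {x : X} {v : L x} (hv : ‖v‖ = 1) (t : LPow L k x) :
    chatPow chat k x t
      = (starRingEnd ℂ) (coordIn k v t) • PiTensorProduct.tprod ℂ fun _ ↦ chat x v := by
  have h : chat x v = (starRingEnd ℂ) ((trivializationAt ℂ L x).linearMapAt ℂ x v)
      • chat x (lFrame L x x) := by
    conv_lhs => rw [eq_smul_lFrame v]
    rw [map_smulₛₗ]
  rw [chatPow, powCoord_eq k x hv, show (fun _ : Fin k ↦ chat x v) = fun _ ↦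
    (starRingEnd ℂ) ((trivializationAt ℂ L x).linearMapAt ℂ x v) • chat x (lFrame L x x)
    from funext fun _ ↦ h, MultilinearMap.map_smul_univ, smul_smul]
  simp

theorem coordIn_chatPow (hiso : ∀ (x : X) (v : L x), ‖chat x v‖ = ‖v‖) (k : ℕ) {x : X} {v : L x}
    (hv : ‖v‖ = 1) (t : LPow L k x) :
    coordIn k (chat x v) (chatPow chat k x t) = (starRingEnd ℂ) (coordIn k v t) := by
  rw [chatPow_eq k hv, map_smul, coordIn_self k (by rw [hiso, hv]), smul_eq_mul, mul_one]

theorem chatPow_injective (hiso : ∀ (x : X) (v : L x), ‖chat x v‖ = ‖v‖) (k : ℕ) (x : X) :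
    Function.Injective (chatPow chat k x) := fun a b h ↦ by
  obtain ⟨v, hv⟩ := exists_unit (L := L) x
  have h₁ := coordIn_chatPow hiso k hv a
  rw [h, coordIn_chatPow hiso k hv b] at h₁
  exact coordIn_injective k hv (star_injective h₁).symm

theorem powNorm_chatPow (hiso : ∀ (x : X) (v : L x), ‖chat x v‖ = ‖v‖) (k : ℕ) {x : X}
    (t : LPow L k x) : powNorm k (c x) (chatPow chat k x t) = powNorm k x t := by
  obtain ⟨v, hv⟩ := exists_unit (L := L) x
  rw [powNorm_eq k hv, powNorm_eq k (show ‖chat x v‖ = 1 by rw [hiso, hv]),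
    coordIn_chatPow hiso k hv, RCLike.norm_conj]

theorem chatPow_add (k : ℕ) {x : X} (t t' : LPow L k x) :
    chatPow chat k x (t + t') = chatPow chat k x t + chatPow chat k x t' := by
  simp only [chatPow, map_add, add_smul]

theorem chatPow_smul (k : ℕ) {x : X} (z : ℂ) (t : LPow L k x) :
    chatPow chat k x (z • t) = (starRingEnd ℂ) z • chatPow chat k x t := by
  simp only [chatPow, map_smul, smul_eq_mul, map_mul, mul_smul]

/-- The action of the real structure on sections of `L^k`. -/
def conjSection (chat : ∀ x, L x →ₛₗ[starRingEnd ℂ] L (c x)) (k : ℕ) (f : ∀ x, LPow L k x) (x : X) :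
    LPow L k x :=
  (starRingEnd ℂ) (coordIn k (chat x (exists_unit (L := L) x).choose) (f (c x)))
    • PiTensorProduct.tprod ℂ fun _ ↦ (exists_unit (L := L) x).choose

/-- This characterises the conjugate section and shows that the unit vector chosen in its definition
is irrelevant. -/
theorem chatPow_conjSection (hiso : ∀ (x : X) (v : L x), ‖chat x v‖ = ‖v‖) (k : ℕ)
    (f : ∀ x, LPow L k x) (x : X) : chatPow chat k x (conjSection chat k f x) = f (c x) := by
  set v := (exists_unit (L := L) x).choose with hvdef
  have hv : ‖v‖ = 1 := (exists_unit (L := L) x).choose_spec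
  have hv' : ‖chat x v‖ = 1 := by rw [hiso, hv]
  rw [chatPow_eq k hv, conjSection, ← hvdef, map_smul, coordIn_self k hv, smul_eq_mul, mul_one,
    Complex.conj_conj, ← eq_coordIn_smul k hv']

theorem coordIn_conjSection (hiso : ∀ (x : X) (v : L x), ‖chat x v‖ = ‖v‖) (k : ℕ)
    (f : ∀ x, LPow L k x) {x : X} {v : L x} (hv : ‖v‖ = 1) :
    coordIn k v (conjSection chat k f x) = (starRingEnd ℂ) (coordIn k (chat x v) (f (c x))) := by
  rw [← chatPow_conjSection hiso k f x, coordIn_chatPow hiso k hv, Complex.conj_conj]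

/-- The fibre over c (c x) is only propositionally the fibre over x, so involutivity is used in the
total space and the equality of points is eliminated by cases. -/
theorem chatPow_chatPow
    (hinv : ∀ (x : X) (v : L x), (⟨c (c x), chat (c x) (chat x v)⟩ : TotalSpace ℂ L) = ⟨x, v⟩)
    (hiso : ∀ (x : X) (v : L x), ‖chat x v‖ = ‖v‖) (k : ℕ)
    (f : ∀ x, LPow L k x) (x : X) :
    chatPow chat k (c x) (chatPow chat k x (f x)) = f (c (c x)) := by
  obtain ⟨v, hv⟩ := exists_unit (L := L) x
  have hv' : ‖chat x v‖ = 1 := by rw [hiso, hv]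
  rw [chatPow_eq k hv', coordIn_chatPow hiso k hv, Complex.conj_conj]
  have key (y : X) (w : L y) (h : (⟨y, w⟩ : TotalSpace ℂ L) = ⟨x, v⟩) :
      coordIn k v (f x) • PiTensorProduct.tprod ℂ (fun _ : Fin k ↦ w) = f y := by
    cases h
    exact (eq_coordIn_smul k hv _).symm
  exact key _ _ (hinv x v)

theorem conjSection_apply_conj
    (hinv : ∀ (x : X) (v : L x), (⟨c (c x), chat (c x) (chat x v)⟩ : TotalSpace ℂ L) = ⟨x, v⟩)
    (hiso : ∀ (x : X) (v : L x), ‖chat x v‖ = ‖v‖) (k : ℕ)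
    (f : ∀ x, LPow L k x) (x : X) :
    conjSection chat k f (c x) = chatPow chat k x (f x) := by
  apply chatPow_injective hiso k (c x)
  rw [chatPow_conjSection hiso, chatPow_chatPow hinv hiso]

/-- The quotient of two coordinates does not depend on the frame, and in the frames v and chat v the
real structure conjugates coordinates. -/
theorem isSymmetricPencil_of_symmetric (hiso : ∀ (x : X) (v : L x), ‖chat x v‖ = ‖v‖) {k : ℕ}
    {s₀ s₁ : ∀ x, LPow L k x} (h₀ : IsSymmetricSection chat k s₀)
    (h₁ : IsSymmetricSection chat k s₁) : IsSymmetricPencil c k s₀ s₁ := by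
  intro x hx
  have hz (s : ∀ x, LPow L k x) (h : IsSymmetricSection chat k s) : s (c x) = 0 ↔ s x = 0 := by
    rw [h x]
    constructor
    · intro h0
      apply chatPow_injective hiso k x
      rw [h0]; simp [chatPow]
    · intro h0; rw [h0]; simp [chatPow]
  refine ⟨by rwa [hz s₀ h₀, hz s₁ h₁], ?_⟩
  rw [pencil, pencil]
  by_cases h0 : s₀ x = 0
  · rw [if_pos h0, if_pos ((hz s₀ h₀).2 h0)]
    rfl
  · rw [if_neg h0, if_neg (fun h ↦ h0 ((hz s₀ h₀).1 h))]
    obtain ⟨v, hv⟩ := exists_unit (L := L) x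
    have hv' : ‖chat x v‖ = 1 := by rw [hiso, hv]
    have hn (y : X) (w : L y) (hw : ‖w‖ = 1) (a b : LPow L k y) :
        powCoord k y y a / powCoord k y y b = coordIn k w a / coordIn k w b := by
      rw [powCoord_eq k y hw, powCoord_eq k y hw, mul_div_mul_right]
      refine pow_ne_zero _ (linearMapAt_self_ne_zero
        (FiberBundle.mem_baseSet_trivializationAt ℂ L y) ?_)
      rintro rfl
      simp at hw
    rw [hn _ _ hv', hn _ _ hv, h₀ x, h₁ x, coordIn_chatPow hiso k hv, coordIn_chatPow hiso k hv,
      ← map_div₀]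
    rfl

end Real

end TensorPowers

/-! ### Global smooth sections that are unit frames near a point. -/

noncomputable section SmoothFrames

variable {n : ℕ} {X : Type*} [TopologicalSpace X] [ChartedSpace (RModel n) X]

theorem ContMDiffAt.mvfderiv_apply_section [IsManifold (𝓡 (2 * n)) ∞ X] {G : Type*}
    [NormedAddCommGroup G] [NormedSpace ℝ G] {φ : X → G} {x : X}
    {V : ∀ x : X, TangentSpace (𝓡 (2 * n)) x}
    (hφ : ContMDiffAt (𝓡 (2 * n)) 𝓘(ℝ, G) ∞ φ x)
    (hV : ContMDiffAt (𝓡 (2 * n)) (𝓡 (2 * n)).tangent ∞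
      (fun y ↦ (⟨y, V y⟩ : TangentBundle (𝓡 (2 * n)) X)) x) :
    ContMDiffAt (𝓡 (2 * n)) 𝓘(ℝ, G) ∞ (fun y ↦ mvfderiv (𝓡 (2 * n)) φ y (V y)) x := by
  have : IsManifold (𝓡 (2 * n)) (∞ + 1) X := by simpa using ‹IsManifold (𝓡 (2 * n)) ∞ X›
  have : IsManifold (𝓡 (2 * n)) 1 X := .of_le (n := ∞) (by exact_mod_cast le_top)
  have h := hφ.mfderiv_const (m := ∞) (by simp)
  have h2 := ContMDiffAt.clm_apply_of_inCoordinates (IM := 𝓡 (2 * n)) (IB₁ := 𝓡 (2 * n))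
    (b₁ := fun y : X ↦ y) (b₂ := φ)
    (E₁ := (TangentSpace (𝓡 (2 * n)) : X → Type _)) (E₂ := (TangentSpace 𝓘(ℝ, G) : G → Type _))
    (ϕ := fun y ↦ mfderiv (𝓡 (2 * n)) 𝓘(ℝ, G) φ y) (v := V) h hV hφ
  exact (contMDiff_snd_tangentBundle_modelSpace G 𝓘(ℝ, G)).contMDiffAt.comp x h2

theorem ContMDiffAt.mul_complex {f g : X → ℂ} {x : X}
    (hf : ContMDiffAt (𝓡 (2 * n)) 𝓘(ℝ, ℂ) ∞ f x) (hg : ContMDiffAt (𝓡 (2 * n)) 𝓘(ℝ, ℂ) ∞ g x) :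
    ContMDiffAt (𝓡 (2 * n)) 𝓘(ℝ, ℂ) ∞ (fun y ↦ f y * g y) x :=
  (contDiff_fst.mul contDiff_snd : ContDiff ℝ ∞ fun p : ℂ × ℂ ↦ p.1 * p.2).contMDiff.contMDiffAt.comp
    x (hf.prodMk_space hg)

/-- Multiplication by a bump function. Local frames are extended to global sections because the
invariance of the connection under `chat` is available only for those. -/
theorem exists_contMDiff_extension [T2Space X] [IsManifold (𝓡 (2 * n)) ∞ X]
    {F : Type*} [NormedAddCommGroup F] [NormedSpace ℝ F]
    {V : X → Type*} [TopologicalSpace (TotalSpace F V)] [∀ x, AddCommGroup (V x)]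
    [∀ x, Module ℝ (V x)] [∀ x, TopologicalSpace (V x)] [FiberBundle F V] [VectorBundle ℝ F V]
    [ContMDiffVectorBundle ∞ F V (𝓡 (2 * n))] {U : Set X} (hU : IsOpen U) {p : X} (hp : p ∈ U)
    {σ : ∀ x, V x}
    (hσ : ContMDiffOn (𝓡 (2 * n)) ((𝓡 (2 * n)).prod 𝓘(ℝ, F)) ∞
      (fun x ↦ TotalSpace.mk' F x (σ x)) U) :
    ∃ τ : ∀ x, V x, ContMDiff (𝓡 (2 * n)) ((𝓡 (2 * n)).prod 𝓘(ℝ, F)) ∞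
      (fun x ↦ TotalSpace.mk' F x (τ x)) ∧ ∀ᶠ x in 𝓝 p, τ x = σ x := by
  obtain ⟨f, -, hf⟩ := (SmoothBumpFunction.nhds_basis_tsupport (I := 𝓡 (2 * n)) p).mem_iff.1
    (hU.mem_nhds hp)
  refine ⟨(f : X → ℝ) • σ, ContMDiffOn.smul_section_of_tsupport f.contMDiff.contMDiffOn hU hf hσ, ?_⟩
  filter_upwards [f.eventuallyEq_one] with x hx
  simp [hx]

variable {L : X → Type*} [TopologicalSpace (TotalSpace ℂ L)]
  [∀ x, NormedAddCommGroup (L x)] [∀ x, InnerProductSpace ℂ (L x)]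
  [FiberBundle ℂ L] [VectorBundle ℂ ℂ L]

theorem eventually_mem_baseSet (x₀ : X) : ∀ᶠ y in 𝓝 x₀, y ∈ (trivializationAt ℂ L x₀).baseSet :=
  (trivializationAt ℂ L x₀).open_baseSet.mem_nhds (FiberBundle.mem_baseSet_trivializationAt ℂ L x₀)

theorem eq_smul_lFrame_of_mem {x₀ y : X} (hy : y ∈ (trivializationAt ℂ L x₀).baseSet) (v : L y) :
    v = ((trivializationAt ℂ L x₀).linearMapAt ℂ y v) • lFrame L x₀ y := by
  have h := (trivializationAt ℂ L x₀).symmₗ_linearMapAt (R := ℂ) hy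
  have h1 : (trivializationAt ℂ L x₀).linearMapAt ℂ y (lFrame L x₀ y) = 1 := by
    have := (trivializationAt ℂ L x₀).linearMapAt_symmₗ (R := ℂ) hy 1
    rwa [(trivializationAt ℂ L x₀).symmₗ_apply (R := ℂ) hy] at this
  rw [← h (((trivializationAt ℂ L x₀).linearMapAt ℂ y v) • lFrame L x₀ y), map_smul,
    h1, smul_eq_mul, mul_one, h]

section

variable [VectorBundle ℝ ℂ L] 

theorem contMDiffAt_linearMapAt {x₀ : X} {e : ∀ x, L x} 
    (he : ContMDiffAt (𝓡 (2 * n)) ((𝓡 (2 * n)).prod 𝓘(ℝ, ℂ)) ∞ (fun x ↦ TotalSpace.mk' ℂ x (e x)) x₀) :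
    ContMDiffAt (𝓡 (2 * n)) 𝓘(ℝ, ℂ) ∞
      (fun y ↦ (trivializationAt ℂ L x₀).linearMapAt ℂ y (e y)) x₀ := by
  rw [Bundle.contMDiffAt_section] at he
  refine he.congr_of_eventuallyEq ?_
  filter_upwards [eventually_mem_baseSet (L := L) x₀] with y hy
  rw [(trivializationAt ℂ L x₀).coe_linearMapAt_of_mem hy]

theorem contMDiffAt_lFrame [IsManifold (𝓡 (2 * n)) ∞ X] (x₀ : X) : ContMDiffAt (𝓡 (2 * n))
    ((𝓡 (2 * n)).prod 𝓘(ℝ, ℂ)) ∞ (fun x ↦ TotalSpace.mk' ℂ x (lFrame L x₀ x)) x₀ := by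
  rw [Bundle.contMDiffAt_section]
  refine (contMDiffAt_const (c := (1 : ℂ))).congr_of_eventuallyEq ?_
  filter_upwards [eventually_mem_baseSet (L := L) x₀] with y hy
  rw [lFrame, (trivializationAt ℂ L x₀).apply_mk_symm hy]

theorem contMDiffAt_inner (hL : IsSmoothHermitian L n) {x₀ : X} {e f : ∀ x, L x}
    (he : ContMDiffAt (𝓡 (2 * n)) ((𝓡 (2 * n)).prod 𝓘(ℝ, ℂ)) ∞ (fun x ↦ TotalSpace.mk' ℂ x (e x)) x₀)
    (hf : ContMDiffAt (𝓡 (2 * n)) ((𝓡 (2 * n)).prod 𝓘(ℝ, ℂ)) ∞ (fun x ↦ TotalSpace.mk' ℂ x (f x)) x₀) :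
    ContMDiffAt (𝓡 (2 * n)) 𝓘(ℝ, ℂ) ∞ (fun y ↦ (inner ℂ (e y) (f y) : ℂ)) x₀ := by
  have h1 := (Complex.conjCLE : ℂ ≃L[ℝ] ℂ).contDiff.contMDiff.contMDiffAt.comp x₀
    (contMDiffAt_linearMapAt he)
  have h2 := contMDiffAt_linearMapAt hf
  have h3 := Complex.ofRealCLM.contDiff.contMDiff.contMDiffAt.comp x₀ (hL x₀)
  refine ((h1.mul_complex h2).mul_complex h3).congr_of_eventuallyEq ?_
  filter_upwards [eventually_mem_baseSet (L := L) x₀] with y hy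
  conv_lhs => rw [eq_smul_lFrame_of_mem hy (e y), eq_smul_lFrame_of_mem hy (f y)]
  rw [inner_smul_left, inner_smul_right, inner_self_eq_norm_sq_to_K]
  simp [mul_assoc]

end

variable (n) in
/-- A smooth section of `L` that is a unit frame over the open set `U`. -/
structure IsUnitFrame (e : ∀ x, L x) (U : Set X) : Prop where
  smooth : ContMDiff (𝓡 (2 * n)) ((𝓡 (2 * n)).prod 𝓘(ℝ, ℂ)) ∞ (fun x ↦ TotalSpace.mk' ℂ x (e x))
  isOpen : IsOpen U
  unit : ∀ x ∈ U, ‖e x‖ = 1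

theorem IsUnitFrame.mono {e : ∀ x, L x} {U U' : Set X} (he : IsUnitFrame n e U) (hU : IsOpen U')
    (h : U' ⊆ U) : IsUnitFrame n e U' := ⟨he.smooth, hU, fun x hx ↦ he.unit x (h hx)⟩

theorem exists_isUnitFrame [VectorBundle ℝ ℂ L] [T2Space X] [IsManifold (𝓡 (2 * n)) ∞ X]
    [ContMDiffVectorBundle ∞ ℂ L (𝓡 (2 * n))]
    (hL : IsSmoothHermitian L n) (p : X) : ∃ (e : ∀ x, L x) (U : Set X), p ∈ U ∧ IsUnitFrame n e U := by
  obtain ⟨W, hW, hWs⟩ := FiberBundle.exists_contMDiffOn_extend (k := ∞) (𝓡 (2 * n)) ℂ (lFrame L p p)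
  obtain ⟨e₀, he₀, heq⟩ := exists_contMDiff_extension isOpen_interior
    (mem_interior_iff_mem_nhds.2 hW) (hWs.mono interior_subset)
  have h0 : e₀ p ≠ 0 := by
    rw [heq.self_of_nhds, FiberBundle.extend_apply_self]
    exact lFrame_self_ne_zero p
  set a := ‖e₀ p‖ ^ 2 with ha
  have ha0 : 0 < a := by positivity
  have hN : ContMDiff (𝓡 (2 * n)) 𝓘(ℝ, ℝ) ∞ (fun y ↦ ‖e₀ y‖ ^ 2) := fun x ↦ by
    have := Complex.reCLM.contDiff.contMDiff.contMDiffAt.comp x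
      (contMDiffAt_inner hL he₀.contMDiffAt he₀.contMDiffAt)
    refine this.congr_of_eventuallyEq (Eventually.of_forall fun y ↦ ?_)
    simp [inner_self_eq_norm_sq_to_K, ← Complex.ofReal_pow]
  -- A smooth function of t = |e₀|² that equals 1/√t for t ≥ a/2 and vanishes for t ≤ a/4: it
  -- normalises e₀ near p and remains smooth at the zeros of e₀.
  have hh : ContDiff ℝ ∞ (fun t : ℝ ↦ Real.smoothTransition (4 / a * t - 1) * (√t)⁻¹) := by
    rw [contDiff_iff_contDiffAt]
    intro t
    rcases lt_or_ge 0 t with ht | ht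
    · refine ContDiffAt.mul ?_ ?_
      · exact (Real.smoothTransition.contDiff.comp (by fun_prop)).contDiffAt
      · exact (Real.contDiffAt_sqrt ht.ne').inv (Real.sqrt_pos.2 ht).ne'
    · refine (contDiffAt_const (c := (0 : ℝ))).congr_of_eventuallyEq ?_
      filter_upwards [eventually_lt_nhds (show t < a / 4 by linarith)] with s hs
      have : 4 / a * s - 1 ≤ 0 := by
        rw [div_mul_eq_mul_div, sub_nonpos, div_le_one ha0]; linarith
      rw [Real.smoothTransition.zero_of_nonpos this, zero_mul]
  refine ⟨(fun y ↦ Real.smoothTransition (4 / a * ‖e₀ y‖ ^ 2 - 1) * (√(‖e₀ y‖ ^ 2))⁻¹) • e₀,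
    {y | a / 2 < ‖e₀ y‖ ^ 2}, ?_, ?_, ?_, ?_⟩
  · change a / 2 < a
    linarith
  · exact ContMDiff.smul_section (hh.contMDiff.comp hN) he₀
  · exact isOpen_lt continuous_const hN.continuous
  · intro x (hx : a / 2 < ‖e₀ x‖ ^ 2)
    have h1 : 1 ≤ 4 / a * ‖e₀ x‖ ^ 2 - 1 := by
      rw [div_mul_eq_mul_div, le_sub_iff_add_le, le_div_iff₀ ha0]; linarith
    have h2 : ‖e₀ x‖ ≠ 0 := fun h ↦ by rw [h] at hx; norm_num at hx; linarith
    simp only [Pi.smul_apply']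
    rw [Real.smoothTransition.one_of_one_le h1, one_mul, Real.sqrt_sq (norm_nonneg _), norm_smul,
      norm_inv, norm_norm, inv_mul_cancel₀ h2]

end SmoothFrames

/-! ### The covariant derivative of L^k in a unit frame. -/

noncomputable section NablaFrames

variable {n : ℕ} {X : Type*} [TopologicalSpace X] [ChartedSpace (RModel n) X]
  {L : X → Type*} [TopologicalSpace (TotalSpace ℂ L)]
  [∀ x, NormedAddCommGroup (L x)] [∀ x, InnerProductSpace ℂ (L x)]
  [FiberBundle ℂ L]

/-- The real connection form of a unitary connection in a unit frame: `∇e = iθ ⊗ e`. -/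
def frameForm (cov : CovariantDerivative (𝓡 (2 * n)) ℂ L) (e : ∀ x, L x) (x : X)
    (u : TangentSpace (𝓡 (2 * n)) x) : ℝ :=
  (inner ℂ (e x) (cov e x u)).im

variable [VectorBundle ℂ ℂ L] [VectorBundle ℝ ℂ L]

theorem linearMapAt_unit_ne_zero {x₀ y : X} (hy : y ∈ (trivializationAt ℂ L x₀).baseSet) {v : L y}
    (hv : ‖v‖ = 1) : (trivializationAt ℂ L x₀).linearMapAt ℂ y v ≠ 0 :=
  linearMapAt_self_ne_zero hy (by rintro rfl; simp at hv)

variable {e : ∀ x, L x} {U : Set X}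

theorem IsUnitFrame.eventually_unit (he : IsUnitFrame n e U) {x : X} (hx : x ∈ U) :
    ∀ᶠ y in 𝓝 x, y ∈ (trivializationAt ℂ L x).baseSet ∧ y ∈ U ∧ ‖e y‖ = 1 := by
  filter_upwards [eventually_mem_baseSet (L := L) x, he.isOpen.mem_nhds hx] with y hy hy'
  exact ⟨hy, hy', he.unit y hy'⟩

theorem contMDiffAt_coordIn (he : IsUnitFrame n e U) {k : ℕ} {s : ∀ x, LPow L k x} {x : X}
    (hs : ContMDiffAt (𝓡 (2 * n)) 𝓘(ℝ, ℂ) ∞ (fun y ↦ powCoord k x y (s y)) x) (hx : x ∈ U) :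
    ContMDiffAt (𝓡 (2 * n)) 𝓘(ℝ, ℂ) ∞ (fun y ↦ coordIn k (e y) (s y)) x := by
  have h0 := linearMapAt_unit_ne_zero (FiberBundle.mem_baseSet_trivializationAt ℂ L x) (he.unit x hx)
  have h1 : ContDiffAt ℝ ∞ (fun z : ℂ ↦ (z ^ k)⁻¹)
      ((trivializationAt ℂ L x).linearMapAt ℂ x (e x)) :=
    (contDiffAt_id.pow k).inv (pow_ne_zero k h0)
  have h2 := h1.contMDiffAt.comp x (contMDiffAt_linearMapAt (he.smooth.contMDiffAt (x := x)))
  refine (hs.mul_complex h2).congr_of_eventuallyEq ?_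
  filter_upwards [he.eventually_unit hx] with y hy
  have h3 := linearMapAt_unit_ne_zero hy.1 hy.2.2
  simp only [Function.comp_apply]
  rw [powCoord_eq k x hy.2.2, mul_inv_cancel_right₀ (pow_ne_zero k h3)]

theorem contMDiffAt_powCoord (he : IsUnitFrame n e U) {k : ℕ} {s : ∀ x, LPow L k x} {x : X}
    (hs : ContMDiffAt (𝓡 (2 * n)) 𝓘(ℝ, ℂ) ∞ (fun y ↦ coordIn k (e y) (s y)) x) (hx : x ∈ U) :
    ContMDiffAt (𝓡 (2 * n)) 𝓘(ℝ, ℂ) ∞ (fun y ↦ powCoord k x y (s y)) x := by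
  have h1 : ContDiff ℝ ∞ (fun z : ℂ ↦ z ^ k) := contDiff_id.pow k
  have h2 := h1.contMDiff.contMDiffAt.comp x (contMDiffAt_linearMapAt (he.smooth.contMDiffAt (x := x)))
  refine (hs.mul_complex h2).congr_of_eventuallyEq ?_
  filter_upwards [he.eventually_unit hx] with y hy
  simp only [Function.comp_apply]
  rw [powCoord_eq k x hy.2.2]

theorem IsSmoothSection.coordIn (he : IsUnitFrame n e U) {k : ℕ} {s : ∀ x, LPow L k x}
    (hs : IsSmoothSection n k s) {x : X} (hx : x ∈ U) :
    ContMDiffAt (𝓡 (2 * n)) 𝓘(ℝ, ℂ) ∞ (fun y ↦ coordIn k (e y) (s y)) x :=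
  contMDiffAt_coordIn he (hs x) hx

/-- A compactly supported coordinate function in a unit frame gives a smooth section. -/
theorem isSmoothSection_smul_tprod {k : ℕ} {F : X → ℂ} (hF : ContMDiff (𝓡 (2 * n)) 𝓘(ℝ, ℂ) ∞ F)
    (he : ContMDiff (𝓡 (2 * n)) ((𝓡 (2 * n)).prod 𝓘(ℝ, ℂ)) ∞ (fun x ↦ TotalSpace.mk' ℂ x (e x))) :
    IsSmoothSection (L := L) n k (fun y ↦ F y • PiTensorProduct.tprod ℂ fun _ ↦ e y) := by
  intro x
  have h1 : ContDiff ℝ ∞ (fun z : ℂ ↦ z ^ k) := contDiff_id.pow k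
  have h2 := h1.contMDiff.contMDiffAt.comp x (contMDiffAt_linearMapAt (he.contMDiffAt (x := x)))
  refine (hF.contMDiffAt.mul_complex h2).congr_of_eventuallyEq (Eventually.of_forall fun y ↦ ?_)
  simp [powCoord_tprod]

section Connection

variable [IsManifold (𝓡 (2 * n)) ∞ X]
  {Ω : ∀ x : X, TangentSpace (𝓡 (2 * n)) x →L[ℝ] TangentSpace (𝓡 (2 * n)) x →L[ℝ] ℝ}
  {cov : CovariantDerivative (𝓡 (2 * n)) ℂ L}

theorem IsUnitFrame.mdifferentiableAt (he : IsUnitFrame n e U) (x : X) :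
    MDifferentiableAt (𝓡 (2 * n)) ((𝓡 (2 * n)).prod 𝓘(ℝ, ℂ)) (fun y ↦ TotalSpace.mk' ℂ y (e y)) x :=
  he.smooth.contMDiffAt.mdifferentiableAt (by simp)

theorem mvfderiv_congr {G : Type*} [NormedAddCommGroup G] [NormedSpace ℝ G] {f g : X → G} {x : X}
    (h : f =ᶠ[𝓝 x] g) : mvfderiv (𝓡 (2 * n)) f x = mvfderiv (𝓡 (2 * n)) g x := by
  ext u
  have := h.mfderiv_eq (I := 𝓡 (2 * n)) (I' := 𝓘(ℝ, G))
  exact DFunLike.congr_fun this u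

theorem mvfderiv_comp_fderiv {G G' : Type*} [NormedAddCommGroup G] [NormedSpace ℝ G]
    [NormedAddCommGroup G'] [NormedSpace ℝ G'] {f : X → G} {Φ : G → G'} {x : X}
    (hΦ : DifferentiableAt ℝ Φ (f x)) (hf : MDifferentiableAt (𝓡 (2 * n)) 𝓘(ℝ, G) f x)
    (u : TangentSpace (𝓡 (2 * n)) x) :
    mvfderiv (𝓡 (2 * n)) (fun y ↦ Φ (f y)) x u
      = fderiv ℝ Φ (f x) (mvfderiv (𝓡 (2 * n)) f x u) := by
  have h : HasMFDerivAt (𝓡 (2 * n)) 𝓘(ℝ, G') (fun y ↦ Φ (f y)) x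
      ((fderiv ℝ Φ (f x)).comp (mfderiv (𝓡 (2 * n)) 𝓘(ℝ, G) f x)) :=
    (hΦ.hasFDerivAt.hasMFDerivAt).comp x hf.hasMFDerivAt
  have h2 := h.mfderiv
  exact DFunLike.congr_fun h2 u

theorem mvfderiv_prodMk {G G' : Type*} [NormedAddCommGroup G] [NormedSpace ℝ G]
    [NormedAddCommGroup G'] [NormedSpace ℝ G'] {f : X → G} {g : X → G'} {x : X}
    (hf : MDifferentiableAt (𝓡 (2 * n)) 𝓘(ℝ, G) f x)
    (hg : MDifferentiableAt (𝓡 (2 * n)) 𝓘(ℝ, G') g x) (u : TangentSpace (𝓡 (2 * n)) x) :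
    mvfderiv (𝓡 (2 * n)) (fun y ↦ (f y, g y)) x u
      = (mvfderiv (𝓡 (2 * n)) f x u, mvfderiv (𝓡 (2 * n)) g x u) := by
  have h := hf.prodMk_space hg
  have h1 := mvfderiv_comp_fderiv (Φ := fun p : G × G' ↦ p.1) differentiableAt_fst h u
  have h2 := mvfderiv_comp_fderiv (Φ := fun p : G × G' ↦ p.2) differentiableAt_snd h u
  rw [fderiv_fst] at h1
  rw [fderiv_snd] at h2
  exact Prod.ext h1.symm h2.symm

theorem mvfderiv_mul_complex {f g : X → ℂ} {x : X}
    (hf : MDifferentiableAt (𝓡 (2 * n)) 𝓘(ℝ, ℂ) f x)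
    (hg : MDifferentiableAt (𝓡 (2 * n)) 𝓘(ℝ, ℂ) g x) (u : TangentSpace (𝓡 (2 * n)) x) :
    mvfderiv (𝓡 (2 * n)) (fun y ↦ f y * g y) x u
      = f x * mvfderiv (𝓡 (2 * n)) g x u + mvfderiv (𝓡 (2 * n)) f x u * g x := by
  have h : HasFDerivAt (fun p : ℂ × ℂ ↦ p.1 * p.2) _ (f x, g x) :=
    (hasFDerivAt_fst (𝕜 := ℝ)).mul hasFDerivAt_snd
  rw [mvfderiv_comp_fderiv (f := fun y ↦ (f y, g y)) (Φ := fun p : ℂ × ℂ ↦ p.1 * p.2)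
    h.differentiableAt (hf.prodMk_space hg), h.fderiv, mvfderiv_prodMk hf hg]
  simp [mul_comm]

theorem mvfderiv_pow_complex (k : ℕ) {g : X → ℂ} {x : X}
    (hg : MDifferentiableAt (𝓡 (2 * n)) 𝓘(ℝ, ℂ) g x) (u : TangentSpace (𝓡 (2 * n)) x) :
    mvfderiv (𝓡 (2 * n)) (fun y ↦ g y ^ k) x u
      = (k : ℂ) * g x ^ (k - 1) * mvfderiv (𝓡 (2 * n)) g x u := by
  have h : HasFDerivAt (fun z : ℂ ↦ z ^ k) _ (g x) :=
    ((hasDerivAt_pow k (g x)).hasFDerivAt).restrictScalars ℝ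
  rw [mvfderiv_comp_fderiv (Φ := fun z : ℂ ↦ z ^ k) h.differentiableAt hg, h.fderiv]
  simp [mul_comm]

/-- Differentiating ⟨e, e⟩ = 1 makes ⟨e, ∇e⟩ purely imaginary, so the connection form is i times a
real form. -/
theorem cov_unitFrame (hcov : IsPrequantumConnection Ω cov) (he : IsUnitFrame n e U) {x : X}
    (hx : x ∈ U) (u : TangentSpace (𝓡 (2 * n)) x) :
    cov e x u = (Complex.I * (frameForm cov e x u : ℂ)) • e x := by
  have h1 := hcov.unitary e e x (he.mdifferentiableAt x) (he.mdifferentiableAt x) u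
  have h2 : mvfderiv (𝓡 (2 * n)) (fun y ↦ (inner ℂ (e y) (e y) : ℂ)) x = 0 := by
    rw [mvfderiv_congr (g := fun _ ↦ (1 : ℂ)), mvfderiv_const]
    filter_upwards [he.isOpen.mem_nhds hx] with y hy
    rw [inner_self_eq_norm_sq_to_K, he.unit y hy]
    simp
  rw [h2] at h1
  have h3 : (inner ℂ (e x) (cov e x u) : ℂ) = Complex.I * (frameForm cov e x u : ℂ) := by
    rw [← inner_conj_symm (cov e x u)] at h1
    have h4 : (0 : ℝ) = (inner ℂ (e x) (cov e x u)).re + (inner ℂ (e x) (cov e x u)).re :=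
      congrArg Complex.re h1
    apply Complex.ext
    · simp; linarith
    · simp [frameForm]
  rw [← h3]
  exact line_eq (he.unit x hx) _

/-- The Leibniz rule of a covariant derivative concerns real functions. A complex factor is split
into real and imaginary parts, and complex linearity of the connection treats the section i f. -/
theorem cov_smul_complex (hcov : IsPrequantumConnection Ω cov) {x : X} {f : ∀ x, L x} {g : X → ℂ}
    (hf : MDifferentiableAt (𝓡 (2 * n)) ((𝓡 (2 * n)).prod 𝓘(ℝ, ℂ))
      (fun y ↦ TotalSpace.mk' ℂ y (f y)) x)
    (hg : MDifferentiableAt (𝓡 (2 * n)) 𝓘(ℝ, ℂ) g x) (u : TangentSpace (𝓡 (2 * n)) x) :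
    MDifferentiableAt (𝓡 (2 * n)) ((𝓡 (2 * n)).prod 𝓘(ℝ, ℂ))
      (fun y ↦ TotalSpace.mk' ℂ y (g y • f y)) x ∧
    cov (fun y ↦ g y • f y) x u
      = g x • cov f x u + mvfderiv (𝓡 (2 * n)) g x u • f x := by
  have hI : MDifferentiableAt (𝓡 (2 * n)) ((𝓡 (2 * n)).prod 𝓘(ℝ, ℂ))
      (fun y ↦ TotalSpace.mk' ℂ y (Complex.I • f y)) x := by
    rw [mdifferentiableAt_section] at hf ⊢
    have h1 : MDifferentiableAt 𝓘(ℝ, ℂ) 𝓘(ℝ, ℂ) (fun z : ℂ ↦ Complex.I * z)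
        (trivializationAt ℂ L x ⟨x, f x⟩).2 :=
      (by fun_prop : DifferentiableAt ℝ (fun z : ℂ ↦ Complex.I * z) _).mdifferentiableAt
    refine (MDifferentiableAt.comp x h1 hf).congr_of_eventuallyEq ?_
    filter_upwards [eventually_mem_baseSet (L := L) x] with y hy
    simp only [Function.comp_apply]
    have h2 (v : L y) := congrFun ((trivializationAt ℂ L x).coe_linearMapAt_of_mem (R := ℂ) hy) v
    rw [← h2, ← h2, map_smul, smul_eq_mul]
  have hre : MDifferentiableAt (𝓡 (2 * n)) 𝓘(ℝ, ℝ) (fun y ↦ (g y).re) x :=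
    MDifferentiableAt.comp x (Complex.reCLM.differentiableAt.mdifferentiableAt) hg
  have him : MDifferentiableAt (𝓡 (2 * n)) 𝓘(ℝ, ℝ) (fun y ↦ (g y).im) x :=
    MDifferentiableAt.comp x (Complex.imCLM.differentiableAt.mdifferentiableAt) hg
  have hsplit : (fun y ↦ g y • f y)
      = (fun y ↦ (g y).re) • f + (fun y ↦ (g y).im) • (fun y ↦ Complex.I • f y) := by
    funext y
    simp only [Pi.add_apply, Pi.smul_apply']
    conv_lhs => rw [← Complex.re_add_im (g y), add_smul, mul_smul]
    rfl
  have h1 := hre.smul_section hf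
  have h2 := him.smul_section hI
  have hd : mvfderiv (𝓡 (2 * n)) g x u = ((mvfderiv (𝓡 (2 * n)) (fun y ↦ (g y).re) x u : ℝ) : ℂ)
      + ((mvfderiv (𝓡 (2 * n)) (fun y ↦ (g y).im) x u : ℝ) : ℂ) * Complex.I := by
    have e1 := mvfderiv_comp_fderiv Complex.reCLM.differentiableAt hg u
    have e2 := mvfderiv_comp_fderiv Complex.imCLM.differentiableAt hg u
    simp only [ContinuousLinearMap.fderiv, Complex.reCLM_apply, Complex.imCLM_apply] at e1 e2
    rw [e1, e2, Complex.re_add_im]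
  refine ⟨?_, ?_⟩
  · have := mdifferentiableAt_add_section h1 h2
    simp only [congrFun hsplit]
    exact this
  · rw [hsplit, cov.isCovariantDerivativeOnUniv.add h1 h2,
      cov.isCovariantDerivativeOnUniv.leibniz hf hre,
      cov.isCovariantDerivativeOnUniv.leibniz hI him, hd]
    simp only [_root_.add_apply, _root_.smul_apply, ContinuousLinearMap.smulRight_apply]
    have h3 := hcov.complex_linear f x hf u
    rw [show cov.toFun (fun y ↦ Complex.I • f y) x u = Complex.I • cov f x u from h3]
    conv_rhs => rw [← Complex.re_add_im (g x)]
    simp only [add_smul, mul_smul, Complex.coe_smul]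
    rw [add_add_add_comm]

/-- The derivative on L^k is defined in the frame of the trivialization. If e = g · `lFrame`,
coordinates change by g^k, and comparing the two expressions of ∇e determines dg; what remains is
the connection form kiθ of the unit frame. -/
theorem coordIn_nabla (hcov : IsPrequantumConnection Ω cov) (he : IsUnitFrame n e U) {k : ℕ}
    {s : ∀ x, LPow L k x} {x : X} (hx : x ∈ U)
    (hs : MDifferentiableAt (𝓡 (2 * n)) 𝓘(ℝ, ℂ) (fun y ↦ coordIn k (e y) (s y)) x)
    (u : TangentSpace (𝓡 (2 * n)) x) :
    coordIn k (e x) (nabla cov k s x u) = mvfderiv (𝓡 (2 * n)) (fun y ↦ coordIn k (e y) (s y)) x u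
      + k * Complex.I * (frameForm cov e x u : ℂ) * coordIn k (e x) (s x) := by
  set g : X → ℂ := fun y ↦ (trivializationAt ℂ L x).linearMapAt ℂ y (e y) with hg
  have hgd : MDifferentiableAt (𝓡 (2 * n)) 𝓘(ℝ, ℂ) g x :=
    (contMDiffAt_linearMapAt he.smooth.contMDiffAt).mdifferentiableAt (by simp)
  have hpow : MDifferentiableAt (𝓡 (2 * n)) 𝓘(ℝ, ℂ) (fun y ↦ g y ^ k) x :=
    MDifferentiableAt.comp x (g := fun z : ℂ ↦ z ^ k)
      ((by fun_prop : DifferentiableAt ℝ (fun z : ℂ ↦ z ^ k) _).mdifferentiableAt) hgd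
  have hbase := FiberBundle.mem_baseSet_trivializationAt ℂ L x
  have h0 : g x ≠ 0 := linearMapAt_unit_ne_zero hbase (he.unit x hx)
  have h1 : mvfderiv (𝓡 (2 * n)) (fun y ↦ powCoord k x y (s y)) x
      = mvfderiv (𝓡 (2 * n)) (fun y ↦ coordIn k (e y) (s y) * g y ^ k) x := by
    refine mvfderiv_congr ?_
    filter_upwards [he.eventually_unit hx] with y hy
    rw [powCoord_eq k x hy.2.2]
  have hfr : MDifferentiableAt (𝓡 (2 * n)) ((𝓡 (2 * n)).prod 𝓘(ℝ, ℂ))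
      (fun y ↦ TotalSpace.mk' ℂ y (lFrame L x y)) x :=
    (contMDiffAt_lFrame x).mdifferentiableAt (by simp)
  obtain ⟨h2, h3⟩ := cov_smul_complex hcov hfr hgd u
  have h4 : cov e x u = g x • cov (lFrame L x) x u
      + mvfderiv (𝓡 (2 * n)) g x u • lFrame L x x := by
    rw [← h3]
    refine DFunLike.congr_fun (cov.isCovariantDerivativeOnUniv.congr_of_eventuallyEq
      (he.mdifferentiableAt x) h2 univ_mem ?_) u
    filter_upwards [eventually_mem_baseSet (L := L) x] with y hy
    exact eq_smul_lFrame_of_mem hy (e y)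
  have h5 : connForm cov x u
      = (trivializationAt ℂ L x).linearMapAt ℂ x (cov (lFrame L x) x u) := rfl
  have h6 : Complex.I * (frameForm cov e x u : ℂ) * g x
      = g x * connForm cov x u + mvfderiv (𝓡 (2 * n)) g x u := by
    have := congrArg ((trivializationAt ℂ L x).linearMapAt ℂ x) h4
    rw [cov_unitFrame hcov he hx, map_smul, map_add, map_smul, map_smul, lFrame_self_coord, ← h5]
      at this
    simpa using this
  have h7 : coordIn k (e x) (powFrame k x) = (g x ^ k)⁻¹ := by
    have h8 : powCoord k x x (powFrame k x : LPow L k x) = 1 := by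
      rw [powFrame, powCoord_tprod]
      simp [lFrame_self_coord]
    rw [powCoord_eq k x (he.unit x hx)] at h8
    exact eq_inv_of_mul_eq_one_left h8
  -- The case k = 0, where the exponent k - 1 truncates, is saved by the factor k.
  have h9 : (k : ℂ) * g x ^ (k - 1) * g x = k * g x ^ k := by
    rcases k with _ | k
    · simp
    · rw [Nat.add_sub_cancel, pow_succ]; ring
  have h10 : nabla cov k s x u = (mvfderiv (𝓡 (2 * n)) (fun y ↦ powCoord k x y (s y)) x u
      + (k : ℂ) * powCoord k x x (s x) * connForm cov x u) • powFrame k x := by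
    simp [nabla]
  rw [h10, map_smul, h7, h1, mvfderiv_mul_complex hs hpow, mvfderiv_pow_complex k hgd,
    powCoord_eq k x (he.unit x hx), smul_eq_mul]
  have h11 : mvfderiv (𝓡 (2 * n)) g x u
      = Complex.I * (frameForm cov e x u : ℂ) * g x - g x * connForm cov x u := by rw [h6]; ring
  rw [h11, ← div_eq_mul_inv, div_eq_iff (pow_ne_zero k h0)]
  linear_combination (coordIn k (e x) (s x) * (Complex.I * (frameForm cov e x u : ℂ)
    - connForm cov x u)) * h9

theorem contMDiffAt_frameForm (hL : IsSmoothHermitian L n) (hcov : IsPrequantumConnection Ω cov)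
    [ContMDiffVectorBundle ∞ ℂ L (𝓡 (2 * n))]
    (he : ContMDiff (𝓡 (2 * n)) ((𝓡 (2 * n)).prod 𝓘(ℝ, ℂ)) ∞ (fun x ↦ TotalSpace.mk' ℂ x (e x)))
    {V : ∀ x : X, TangentSpace (𝓡 (2 * n)) x} {x : X}
    (hV : ContMDiffAt (𝓡 (2 * n)) (𝓡 (2 * n)).tangent ∞
      (fun y ↦ (⟨y, V y⟩ : TangentBundle (𝓡 (2 * n)) X)) x) :
    ContMDiffAt (𝓡 (2 * n)) 𝓘(ℝ, ℝ) ∞ (fun y ↦ frameForm cov e y (V y)) x := by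
  have h1 := hcov.smooth.contMDiff.contMDiff (σ := e) (by simpa using he.contMDiffOn)
  have h2 : ContMDiffAt (𝓡 (2 * n)) ((𝓡 (2 * n)).prod 𝓘(ℝ, ℂ)) ∞
      (fun y ↦ TotalSpace.mk' ℂ y (cov e y (V y))) x :=
    ContMDiffAt.clm_bundle_apply (h1.contMDiffAt univ_mem) hV
  exact Complex.imCLM.contDiff.contMDiff.contMDiffAt.comp x
    (contMDiffAt_inner hL he.contMDiffAt h2)

theorem contMDiffAt_coordIn_nabla (hL : IsSmoothHermitian L n) (hcov : IsPrequantumConnection Ω cov)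
    [ContMDiffVectorBundle ∞ ℂ L (𝓡 (2 * n))] (he : IsUnitFrame n e U) {k : ℕ}
    {s : ∀ x, LPow L k x} (hs : IsSmoothSection n k s)
    {V : ∀ x : X, TangentSpace (𝓡 (2 * n)) x} {x : X} (hx : x ∈ U)
    (hV : ContMDiffAt (𝓡 (2 * n)) (𝓡 (2 * n)).tangent ∞
      (fun y ↦ (⟨y, V y⟩ : TangentBundle (𝓡 (2 * n)) X)) x) :
    ContMDiffAt (𝓡 (2 * n)) 𝓘(ℝ, ℂ) ∞ (fun y ↦ coordIn k (e y) (nabla cov k s y (V y))) x := by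
  have h1 := (hs.coordIn he hx).mvfderiv_apply_section hV
  have h2 := Complex.ofRealCLM.contDiff.contMDiff.contMDiffAt.comp x
    (contMDiffAt_frameForm hL hcov he.smooth hV)
  have h3 := ((contMDiffAt_const (c := (k : ℂ) * Complex.I)).mul_complex h2).mul_complex
    (hs.coordIn he hx)
  refine (h1.add h3).congr_of_eventuallyEq ?_
  filter_upwards [he.isOpen.mem_nhds hx] with y hy
  rw [coordIn_nabla hcov he hy ((hs.coordIn he hy).mdifferentiableAt (by simp))]
  rfl

theorem IsSmoothSection.nabla_apply [T2Space X] [ContMDiffVectorBundle ∞ ℂ L (𝓡 (2 * n))]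
    (hL : IsSmoothHermitian L n) (hcov : IsPrequantumConnection Ω cov) {k : ℕ}
    {s : ∀ x, LPow L k x} (hs : IsSmoothSection n k s) {V : ∀ x : X, TangentSpace (𝓡 (2 * n)) x}
    (hV : ContMDiff (𝓡 (2 * n)) (𝓡 (2 * n)).tangent ∞
      (fun y ↦ (⟨y, V y⟩ : TangentBundle (𝓡 (2 * n)) X))) :
    IsSmoothSection n k (fun y ↦ nabla cov k s y (V y)) := by
  intro x
  obtain ⟨e, U, hx, he⟩ := exists_isUnitFrame hL x
  exact contMDiffAt_powCoord he (contMDiffAt_coordIn_nabla hL hcov he hs hx hV.contMDiffAt) hx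

end Connection

end NablaFrames

/-! ### Conjugation by the real structure commutes with the connection. -/

noncomputable section ConjugateSections

variable {n : ℕ} {X : Type*} [TopologicalSpace X] [ChartedSpace (RModel n) X]
  {L : X → Type*} [TopologicalSpace (TotalSpace ℂ L)]
  [∀ x, NormedAddCommGroup (L x)] [∀ x, InnerProductSpace ℂ (L x)]
  [FiberBundle ℂ L] [VectorBundle ℂ ℂ L] [VectorBundle ℝ ℂ L] [IsManifold (𝓡 (2 * n)) ∞ X]
  {Ω : ∀ x : X, TangentSpace (𝓡 (2 * n)) x →L[ℝ] TangentSpace (𝓡 (2 * n)) x →L[ℝ] ℝ}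
  {J : ∀ x : X, TangentSpace (𝓡 (2 * n)) x →L[ℝ] TangentSpace (𝓡 (2 * n)) x}
  {cov : CovariantDerivative (𝓡 (2 * n)) ℂ L}
  {c : X → X} {chat : ∀ x, L x →ₛₗ[starRingEnd ℂ] L (c x)}
  {e : ∀ x, L x} {U : Set X}

/-- Vectors obtained by applying the lift twice live over c (c x); this moves them to the fibre over
x without casts. -/
theorem exists_transport {x y : X} (h : y = x) (w : L y) :
    ∃ v : L x, (⟨x, v⟩ : TotalSpace ℂ L) = ⟨y, w⟩ := by
  subst h
  exact ⟨w, rfl⟩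

/-- The conjugate of a unit frame is a unit frame. -/
theorem exists_conj_frame (hc : IsRealStructure Ω J c) (hchat : IsRealLineStructure cov c chat)
    (he : IsUnitFrame n e U) : ∃ e' : ∀ x, L x, IsUnitFrame n e' (c ⁻¹' U) ∧
      ∀ x, e' (c x) = chat x (e x) := by
  choose e' he' using fun x : X ↦ exists_transport (L := L) (hc.involutive x) (chat (c x) (e (c x)))
  have hval (x : X) : e' (c x) = chat x (e x) := by
    have h1 := he' (c x)
    have h2 : (⟨c (c x), e (c (c x))⟩ : TotalSpace ℂ L) = ⟨x, e x⟩ := by rw [hc.involutive x]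
    have h3 := congrArg (fun p : TotalSpace ℂ L ↦ (⟨c p.1, chat p.1 p.2⟩ : TotalSpace ℂ L)) h2
    simp only at h3
    rw [h3] at h1
    simpa using h1
  refine ⟨e', ⟨?_, he.isOpen.preimage hc.smooth.continuous, fun x hx ↦ ?_⟩, hval⟩
  · have h := hchat.smooth.comp (he.smooth.comp hc.smooth)
    exact h.congr he'
  · have hx' : c x ∈ U := hx
    have := hval (c x)
    have key (y : X) (h : c (c x) = y) : ‖e' y‖ = ‖e' (c (c x))‖ := by subst h; rfl
    rw [key x (hc.involutive x), this, hchat.isometric, he.unit _ hx']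

/-- The lift is antilinear, so it turns iθ into -iθ. -/
theorem frameForm_conj (hcov : IsPrequantumConnection Ω cov) (hc : IsRealStructure Ω J c)
    (hchat : IsRealLineStructure cov c chat) (he : IsUnitFrame n e U) {e' : ∀ x, L x}
    (he' : IsUnitFrame n e' (c ⁻¹' U)) (hee' : ∀ x, e' (c x) = chat x (e x)) {x : X} (hx : x ∈ U)
    (u : TangentSpace (𝓡 (2 * n)) x) :
    frameForm cov e' (c x) (mfderiv (𝓡 (2 * n)) (𝓡 (2 * n)) c x u) = -frameForm cov e x u := by
  have hx' : c x ∈ c ⁻¹' U := by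
    change c (c x) ∈ U
    rwa [hc.involutive x]
  have h := hchat.invariant e e' he.smooth he'.smooth hee' x u
  rw [frameForm, h, cov_unitFrame hcov he hx, map_smulₛₗ, ← hee' x, inner_smul_right,
    inner_self_eq_norm_sq_to_K, he'.unit _ hx']
  simp

variable (c) in
/-- The vector field whose image under `c` is `V`. -/
def conjField (V : ∀ x : X, TangentSpace (𝓡 (2 * n)) x) (x : X) : TangentSpace (𝓡 (2 * n)) x :=
  (mfderiv (𝓡 (2 * n)) (𝓡 (2 * n)) c (c x) (V (c x)) : RModel n)

theorem coordIn_conjSection_frame (hchat : IsRealLineStructure cov c chat) (he : IsUnitFrame n e U) {e' : ∀ x, L x}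
    (hee' : ∀ x, e' (c x) = chat x (e x)) {k : ℕ} (f : ∀ x, LPow L k x) {x : X} (hx : x ∈ U) :
    coordIn k (e x) (conjSection chat k f x)
      = (starRingEnd ℂ) (coordIn k (e' (c x)) (f (c x))) := by
  rw [coordIn_conjSection hchat.isometric k f (he.unit x hx), hee']

theorem contMDiffAt_conj {φ : X → ℂ} {x : X} (h : ContMDiffAt (𝓡 (2 * n)) 𝓘(ℝ, ℂ) ∞ φ x) :
    ContMDiffAt (𝓡 (2 * n)) 𝓘(ℝ, ℂ) ∞ (fun y ↦ (starRingEnd ℂ) (φ y)) x :=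
  (Complex.conjCLE : ℂ ≃L[ℝ] ℂ).contDiff.contMDiff.contMDiffAt.comp x h

theorem mvfderiv_comp_map {G : Type*} [NormedAddCommGroup G] [NormedSpace ℝ G] {φ : X → G} {x : X}
    (hφ : MDifferentiableAt (𝓡 (2 * n)) 𝓘(ℝ, G) φ (c x))
    (hc : MDifferentiableAt (𝓡 (2 * n)) (𝓡 (2 * n)) c x) (u : TangentSpace (𝓡 (2 * n)) x) :
    mvfderiv (𝓡 (2 * n)) (φ ∘ c) x u
      = mvfderiv (𝓡 (2 * n)) φ (c x) (mfderiv (𝓡 (2 * n)) (𝓡 (2 * n)) c x u) :=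
  DFunLike.congr_fun (mfderiv_comp x hφ hc) u

theorem IsSmoothSection.conjSection [T2Space X] [ContMDiffVectorBundle ∞ ℂ L (𝓡 (2 * n))]
    (hL : IsSmoothHermitian L n) (hc : IsRealStructure Ω J c)
    (hchat : IsRealLineStructure cov c chat) {k : ℕ} {f : ∀ x, LPow L k x}
    (hf : IsSmoothSection n k f) : IsSmoothSection n k (conjSection chat k f) := by
  intro x
  obtain ⟨e, U, hx, he⟩ := exists_isUnitFrame hL x
  obtain ⟨e', he', hee'⟩ := exists_conj_frame hc hchat he
  have hx' : c x ∈ c ⁻¹' U := by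
    change c (c x) ∈ U
    rwa [hc.involutive x]
  refine contMDiffAt_powCoord he ?_ hx
  refine (contMDiffAt_conj ((hf.coordIn he' hx').comp x hc.smooth.contMDiffAt)).congr_of_eventuallyEq
    ?_
  filter_upwards [he.isOpen.mem_nhds hx] with y hy
  rw [coordIn_conjSection_frame hchat he hee' f hy]
  rfl

/-- In conjugate unit frames the coordinate of the conjugate section is the conjugate of the
coordinate composed with c, and conjugating ikθ compensates the sign change of the connection form.
-/
theorem chatPow_nabla_conjSection [T2Space X] [ContMDiffVectorBundle ∞ ℂ L (𝓡 (2 * n))]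
    (hL : IsSmoothHermitian L n) (hcov : IsPrequantumConnection Ω cov)
    (hc : IsRealStructure Ω J c) (hchat : IsRealLineStructure cov c chat) {k : ℕ}
    {f : ∀ x, LPow L k x} (hf : IsSmoothSection n k f) (x : X) (u : TangentSpace (𝓡 (2 * n)) x) :
    chatPow chat k x (nabla cov k (_root_.conjSection chat k f) x u)
      = nabla cov k f (c x) (mfderiv (𝓡 (2 * n)) (𝓡 (2 * n)) c x u) := by
  obtain ⟨e, U, hx, he⟩ := exists_isUnitFrame hL x
  obtain ⟨e', he', hee'⟩ := exists_conj_frame hc hchat he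
  have hx' : c x ∈ c ⁻¹' U := by
    change c (c x) ∈ U
    rwa [hc.involutive x]
  have hd := (hf.coordIn he' hx').mdifferentiableAt (by simp)
  apply coordIn_injective k (he'.unit _ hx')
  rw [hee', coordIn_chatPow hchat.isometric k (he.unit x hx), ← hee',
    coordIn_nabla hcov he hx (((hf.conjSection hL hc hchat).coordIn he hx).mdifferentiableAt
      (by simp)), coordIn_nabla hcov he' hx' hd, frameForm_conj hcov hc hchat he he' hee' hx,
    coordIn_conjSection_frame hchat he hee' f hx]
  have h1 : mvfderiv (𝓡 (2 * n)) (fun y ↦ coordIn k (e y) (_root_.conjSection chat k f y)) x u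
      = (starRingEnd ℂ) (mvfderiv (𝓡 (2 * n)) (fun y ↦ coordIn k (e' y) (f y)) (c x)
        (mfderiv (𝓡 (2 * n)) (𝓡 (2 * n)) c x u)) := by
    have hcd : MDifferentiableAt (𝓡 (2 * n)) (𝓡 (2 * n)) c x :=
      hc.smooth.contMDiffAt.mdifferentiableAt (by simp)
    rw [mvfderiv_congr (g := fun y ↦ (Complex.conjCLE : ℂ ≃L[ℝ] ℂ) (((fun y ↦ coordIn k (e' y) (f y)) ∘ c) y)),
      mvfderiv_comp_fderiv (Complex.conjCLE : ℂ ≃L[ℝ] ℂ).differentiableAt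
        (MDifferentiableAt.comp x hd hcd), mvfderiv_comp_map hd hcd,
      ContinuousLinearEquiv.fderiv]
    · rfl
    · filter_upwards [he.isOpen.mem_nhds hx] with y hy
      rw [coordIn_conjSection_frame hchat he hee' f hy]
      rfl
  rw [h1]
  simp

theorem powNorm_nabla_conjSection [T2Space X] [ContMDiffVectorBundle ∞ ℂ L (𝓡 (2 * n))]
    (hL : IsSmoothHermitian L n) (hcov : IsPrequantumConnection Ω cov)
    (hc : IsRealStructure Ω J c) (hchat : IsRealLineStructure cov c chat) {k : ℕ}
    {f : ∀ x, LPow L k x} (hf : IsSmoothSection n k f) (x : X) (u : TangentSpace (𝓡 (2 * n)) x) :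
    powNorm k x (nabla cov k (conjSection chat k f) x u)
      = powNorm k (c x) (nabla cov k f (c x) (mfderiv (𝓡 (2 * n)) (𝓡 (2 * n)) c x u)) := by
  rw [← chatPow_nabla_conjSection hL hcov hc hchat hf, powNorm_chatPow hchat.isometric]

/-- The map c reverses both Ω and J, and the two signs cancel in Ω(·, J·). -/
theorem gNorm_mfderiv (hc : IsRealStructure Ω J c) (x : X)
    (u : TangentSpace (𝓡 (2 * n)) x) :
    gNorm Ω J (c x) (mfderiv (𝓡 (2 * n)) (𝓡 (2 * n)) c x u) = gNorm Ω J x u := by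
  have h := hc.antisymplectic x u (J x u)
  rw [hc.antiholomorphic, map_neg, neg_inj] at h
  rw [gNorm, gNorm, h]

theorem mfderiv_mfderiv (hc : IsRealStructure Ω J c) (x : X) (u : TangentSpace (𝓡 (2 * n)) x) :
    (mfderiv (𝓡 (2 * n)) (𝓡 (2 * n)) c (c x) (mfderiv (𝓡 (2 * n)) (𝓡 (2 * n)) c x u) : RModel n)
      = u := by
  have hd (y : X) : MDifferentiableAt (𝓡 (2 * n)) (𝓡 (2 * n)) c y :=
    hc.smooth.contMDiffAt.mdifferentiableAt (by simp)
  have h := mfderiv_comp x (hd (c x)) (hd x)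
  have h2 : c ∘ c = id := funext hc.involutive
  rw [h2, mfderiv_id] at h
  exact (DFunLike.congr_fun h u).symm

theorem contMDiff_conjField (hc : IsRealStructure Ω J c) {V : ∀ x : X, TangentSpace (𝓡 (2 * n)) x}
    (hV : ContMDiff (𝓡 (2 * n)) (𝓡 (2 * n)).tangent ∞
      (fun y ↦ (⟨y, V y⟩ : TangentBundle (𝓡 (2 * n)) X))) :
    ContMDiff (𝓡 (2 * n)) (𝓡 (2 * n)).tangent ∞
      (fun y ↦ (⟨y, conjField c V y⟩ : TangentBundle (𝓡 (2 * n)) X)) := by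
  have h := (hc.smooth.contMDiff_tangentMap (m := ∞) (by simp)).comp (hV.comp hc.smooth)
  refine h.congr fun x ↦ ?_
  simp only [Function.comp_apply, tangentMap]
  rw [conjField]
  have key (y : X) (h : y = x) (w : RModel n) :
      (⟨x, w⟩ : TangentBundle (𝓡 (2 * n)) X) = ⟨y, w⟩ := by subst h; rfl
  exact key _ (hc.involutive x) _

theorem mfderiv_conjField (hc : IsRealStructure Ω J c) (V : ∀ x : X, TangentSpace (𝓡 (2 * n)) x)
    (x : X) : mfderiv (𝓡 (2 * n)) (𝓡 (2 * n)) c x (conjField c V x) = V (c x) := by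
  have key (y : X) (h : y = c x) (w : RModel n) :
      (mfderiv (𝓡 (2 * n)) (𝓡 (2 * n)) c x (mfderiv (𝓡 (2 * n)) (𝓡 (2 * n)) c (c x) w) : RModel n)
        = w := by
    have hd (y : X) : MDifferentiableAt (𝓡 (2 * n)) (𝓡 (2 * n)) c y :=
      hc.smooth.contMDiffAt.mdifferentiableAt (by simp)
    have h1 := mfderiv_mfderiv hc (c x) w
    rw [hc.involutive x] at h1
    exact h1
  exact key _ rfl _

/-- Second derivatives of a conjugate section. -/
theorem powNorm_nabla_nabla_conjSection [T2Space X] [ContMDiffVectorBundle ∞ ℂ L (𝓡 (2 * n))]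
    (hL : IsSmoothHermitian L n) (hcov : IsPrequantumConnection Ω cov)
    (hc : IsRealStructure Ω J c) (hchat : IsRealLineStructure cov c chat) {k : ℕ}
    {f : ∀ x, LPow L k x} (hf : IsSmoothSection n k f) {V : ∀ x : X, TangentSpace (𝓡 (2 * n)) x}
    (hV : ContMDiff (𝓡 (2 * n)) (𝓡 (2 * n)).tangent ∞
      (fun y ↦ (⟨y, V y⟩ : TangentBundle (𝓡 (2 * n)) X)))
    (x : X) (u : TangentSpace (𝓡 (2 * n)) x) :
    powNorm k x (nabla cov k (fun y ↦ nabla cov k (conjSection chat k f) y (V y)) x u)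
      = powNorm k (c x) (nabla cov k (fun y ↦ nabla cov k f y (conjField c V y)) (c x)
        (mfderiv (𝓡 (2 * n)) (𝓡 (2 * n)) c x u)) := by
  have hW := contMDiff_conjField hc hV
  rw [← powNorm_nabla_conjSection hL hcov hc hchat (hf.nabla_apply hL hcov hW)]
  congr 3
  funext y
  apply chatPow_injective hchat.isometric k y
  rw [chatPow_nabla_conjSection hL hcov hc hchat hf, chatPow_conjSection hchat.isometric]
  congr 1
  rw [conjField]
  have key (z : X) (h : z = y) : mfderiv (𝓡 (2 * n)) (𝓡 (2 * n)) c y (V y)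
      = (mfderiv (𝓡 (2 * n)) (𝓡 (2 * n)) c z (V z) : RModel n) := by subst h; rfl
  exact key _ (hc.involutive y)

end ConjugateSections

/-! ### Coordinate fields of a chart, and comparison of the metric with the Euclidean one. -/

noncomputable section ChartFrames

/-- Compactness: monotonicity in the constant lets finitely many local constants be merged by taking
maxima. -/
theorem exists_forall_of_eventually {X : Type*} [TopologicalSpace X] [CompactSpace X]
    {P : X → ℝ → Prop} (hmono : ∀ x C C', C ≤ C' → P x C → P x C')
    (h : ∀ p, ∃ C, ∀ᶠ x in 𝓝 p, P x C) : ∃ C, ∀ x, P x C := by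
  have := isCompact_univ.induction_on (p := fun s : Set X ↦ ∃ C, ∀ x ∈ s, P x C)
    ⟨0, by simp⟩ (fun _ _ hst ⟨C, hC⟩ ↦ ⟨C, fun x hx ↦ hC x (hst hx)⟩)
    (fun _ _ ⟨C, hC⟩ ⟨C', hC'⟩ ↦ ⟨max C C', fun x hx ↦ hx.elim
      (fun hx ↦ hmono x _ _ (le_max_left _ _) (hC x hx))
      (fun hx ↦ hmono x _ _ (le_max_right _ _) (hC' x hx))⟩)
    (fun p _ ↦ by
      obtain ⟨C, hC⟩ := h p
      exact ⟨_, mem_nhdsWithin_of_mem_nhds hC, C, fun x hx ↦ hx⟩)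
  obtain ⟨C, hC⟩ := this
  exact ⟨C, fun x ↦ hC x (Set.mem_univ x)⟩

variable {n : ℕ} {X : Type*} [TopologicalSpace X] [ChartedSpace (RModel n) X]
  [IsManifold (𝓡 (2 * n)) ∞ X]
  {Ω : ∀ x : X, TangentSpace (𝓡 (2 * n)) x →L[ℝ] TangentSpace (𝓡 (2 * n)) x →L[ℝ] ℝ}
  {J : ∀ x : X, TangentSpace (𝓡 (2 * n)) x →L[ℝ] TangentSpace (𝓡 (2 * n)) x}

/-- Smoothness of a vector field. -/
abbrev IsSmoothField (V : ∀ x : X, TangentSpace (𝓡 (2 * n)) x) : Prop :=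
  ContMDiff (𝓡 (2 * n)) (𝓡 (2 * n)).tangent ∞ (fun y ↦ (⟨y, V y⟩ : TangentBundle (𝓡 (2 * n)) X))

theorem IsSymplecticForm.contMDiff_apply (hΩ : IsSymplecticForm Ω)
    {V W : ∀ x : X, TangentSpace (𝓡 (2 * n)) x} (hV : IsSmoothField V) (hW : IsSmoothField W) :
    ContMDiff (𝓡 (2 * n)) 𝓘(ℝ, ℝ) ∞ (fun x ↦ Ω x (V x) (W x)) := by
  intro x
  have h : ContMDiffAt (𝓡 (2 * n)) ((𝓡 (2 * n)).prod 𝓘(ℝ, ℝ)) ∞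
      (fun m ↦ TotalSpace.mk' ℝ (E := Bundle.Trivial X ℝ) m (Ω m (V m) (W m))) x := by
    apply ContMDiffAt.clm_bundle_apply₂ (F₁ := RModel n) (F₂ := RModel n)
    · exact hΩ.smooth.contMDiffAt
    · exact hV.contMDiffAt
    · exact hW.contMDiffAt
  simp only [contMDiffAt_totalSpace] at h
  exact h.2

theorem IsCompatibleComplexStructure.isSmoothField_apply (hJ : IsCompatibleComplexStructure Ω J)
    {V : ∀ x : X, TangentSpace (𝓡 (2 * n)) x} (hV : IsSmoothField V) :
    IsSmoothField fun x ↦ J x (V x) := fun _ ↦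
  ContMDiffAt.clm_bundle_apply (F₁ := RModel n) (F₂ := RModel n) hJ.smooth.contMDiffAt
    hV.contMDiffAt

/-- The bilinear form `Ω` at `x`. -/
def formAt (Ω : ∀ x : X, TangentSpace (𝓡 (2 * n)) x →L[ℝ] TangentSpace (𝓡 (2 * n)) x →L[ℝ] ℝ)
    (x : X) : TangentSpace (𝓡 (2 * n)) x →ₗ[ℝ] TangentSpace (𝓡 (2 * n)) x →ₗ[ℝ] ℝ :=
  ContinuousLinearMap.coeLM ℝ ∘ₗ (Ω x).toLinearMap

theorem compatiblePair (hΩ : IsSymplecticForm Ω) (hJ : IsCompatibleComplexStructure Ω J) (x : X) :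
    CompatiblePair (formAt Ω x) (J x).toLinearMap :=
  ⟨hΩ.alternating x, hJ.sq x, hJ.symm x, hJ.pos x⟩

theorem gNorm_eq (x : X) (u : TangentSpace (𝓡 (2 * n)) x) :
    gNorm Ω J x u = compatNorm (formAt Ω x) (J x).toLinearMap u := rfl

theorem gNorm_nonneg {x : X} (u : TangentSpace (𝓡 (2 * n)) x) : 0 ≤ gNorm Ω J x u :=
  Real.sqrt_nonneg _

/-- A local frame of `TX` made of global smooth fields which are the coordinate fields of the
chart at `p` over the open set `U`. -/
structure IsChartFrame (p : X) (W : Fin (2 * n) → ∀ x : X, TangentSpace (𝓡 (2 * n)) x)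
    (U : Set X) : Prop where
  smooth : ∀ a, IsSmoothField (W a)
  isOpen : IsOpen U
  subset : U ⊆ (chartAt (RModel n) p).source
  expand : ∀ y ∈ U, ∀ u : TangentSpace (𝓡 (2 * n)) y,
    u = ∑ a, (mvfderiv (𝓡 (2 * n)) (extChartAt (𝓡 (2 * n)) p) y u : RModel n) a • W a y
  deriv_field : ∀ y ∈ U, ∀ a, mvfderiv (𝓡 (2 * n)) (extChartAt (𝓡 (2 * n)) p) y (W a y)
    = EuclideanSpace.single a 1

theorem IsChartFrame.mono {p : X} {W : Fin (2 * n) → ∀ x : X, TangentSpace (𝓡 (2 * n)) x}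
    {U U' : Set X} (h : IsChartFrame p W U) (hU : IsOpen U') (hs : U' ⊆ U) : IsChartFrame p W U' :=
  ⟨h.smooth, hU, hs.trans h.subset, fun y hy ↦ h.expand y (hs hy), fun y hy ↦
    h.deriv_field y (hs hy)⟩

/-- The trivialization of the tangent bundle at p is the derivative of the chart, so its local frame
consists of the coordinate fields; they are made global by bump functions. -/
theorem exists_isChartFrame [T2Space X] (p : X) :
    ∃ (W : Fin (2 * n) → ∀ x : X, TangentSpace (𝓡 (2 * n)) x) (U : Set X),
      p ∈ U ∧ IsChartFrame p W U := by
  have : IsManifold (𝓡 (2 * n)) 1 X := .of_le (n := ∞) (by exact_mod_cast le_top)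
  have : IsManifold (𝓡 (2 * n)) (∞ + 1) X := by simpa using ‹IsManifold (𝓡 (2 * n)) ∞ X›
  set t := trivializationAt (RModel n) (TangentSpace (𝓡 (2 * n)) : X → Type _) p with ht
  let b := (EuclideanSpace.basisFun (Fin (2 * n)) ℝ).toBasis
  have hp : p ∈ t.baseSet := FiberBundle.mem_baseSet_trivializationAt' p
  choose W hW hWeq using fun a ↦ exists_contMDiff_extension t.open_baseSet hp
    (t.contMDiffOn_localFrame_baseSet (I := 𝓡 (2 * n)) ∞ b a)
  have hev : ∀ᶠ y in 𝓝 p, y ∈ t.baseSet ∧ ∀ a, W a y = t.localFrame b a y :=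
    Filter.Eventually.and (t.open_baseSet.mem_nhds hp) (eventually_all.2 hWeq)
  obtain ⟨U, hU, hUo, hpU⟩ := eventually_nhds_iff.1 hev
  have hA (y : X) (hy : y ∈ U) (u : TangentSpace (𝓡 (2 * n)) y) :
      mvfderiv (𝓡 (2 * n)) (extChartAt (𝓡 (2 * n)) p) y u = t.continuousLinearMapAt ℝ y u := by
    have := TangentBundle.continuousLinearMapAt_trivializationAt (I := 𝓡 (2 * n)) (x₀ := p) (hU y hy).1
    exact (DFunLike.congr_fun this u).symm
  have hsymm (y : X) (hy : y ∈ U) (a : Fin (2 * n)) :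
      W a y = t.symmL ℝ y (EuclideanSpace.single a 1) := by
    rw [(hU y hy).2 a, t.localFrame_apply_of_mem_baseSet b (hU y hy).1]
    simp [b, Trivialization.basisAt, Trivialization.symmL]
    exact (t.symmₗ_apply (R := ℝ) (hU y hy).1 _).symm
  refine ⟨W, U, hpU, hW, hUo, fun y hy ↦ (hU y hy).1, fun y hy u ↦ ?_, fun y hy a ↦ ?_⟩
  · have key (w : RModel n) : t.symmL ℝ y w
        = ∑ a, w a • t.symmL ℝ y (EuclideanSpace.single a 1) := by
      simp_rw [← map_smul, ← map_sum]
      congr 1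
      ext i
      simp [Pi.single_apply]
    rw [hA y hy]
    simp_rw [hsymm y hy]
    rw [← key]
    exact (t.symmL_continuousLinearMapAt (R := ℝ) (hU y hy).1 u).symm
  · rw [hA y hy, hsymm y hy]
    exact t.continuousLinearMapAt_symmL (R := ℝ) (hU y hy).1 _

/-- The metric `Ω(·, J·)` in a chart frame. -/
theorem metric_sum_smul {W : Fin (2 * n) → ∀ x : X, TangentSpace (𝓡 (2 * n)) x}
    (y : X) (ξ : Fin (2 * n) → ℝ) :
    Ω y (∑ a, ξ a • W a y) (J y (∑ a, ξ a • W a y))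
      = ∑ a, ∑ b, ξ a * ξ b * Ω y (W a y) (J y (W b y)) := by
  simp only [map_sum, map_smul, _root_.sum_apply, _root_.smul_apply, smul_eq_mul,
    Finset.mul_sum]
  rw [Finset.sum_comm]
  refine Finset.sum_congr rfl fun a _ ↦ Finset.sum_congr rfl fun b _ ↦ ?_
  ring

/-- In the frame the metric is a continuous function of the point and of the coordinates, positive
on a compact neighbourhood times the unit sphere; homogeneity extends the bounds to all vectors. -/
theorem IsChartFrame.exists_gNorm_bounds [T2Space X] [CompactSpace X] (hΩ : IsSymplecticForm Ω)
    (hJ : IsCompatibleComplexStructure Ω J) {p : X}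
    {W : Fin (2 * n) → ∀ x : X, TangentSpace (𝓡 (2 * n)) x} {U : Set X} (h : IsChartFrame p W U)
    (hp : p ∈ U) : ∃ C, 0 < C ∧ ∀ᶠ y in 𝓝 p, y ∈ U ∧ ∀ u : TangentSpace (𝓡 (2 * n)) y,
      ‖mvfderiv (𝓡 (2 * n)) (extChartAt (𝓡 (2 * n)) p) y u‖ ≤ C * gNorm Ω J y u ∧
      gNorm Ω J y u ≤ C * ‖mvfderiv (𝓡 (2 * n)) (extChartAt (𝓡 (2 * n)) p) y u‖ := by
  obtain ⟨K, hK, hKU, hKc⟩ := local_compact_nhds (h.isOpen.mem_nhds hp)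
  set f : X × RModel n → ℝ := fun q ↦ ∑ a, ∑ b, q.2 a * q.2 b * Ω q.1 (W a q.1) (J q.1 (W b q.1))
    with hf
  have hfc : Continuous f := by
    refine continuous_finsetSum _ fun a _ ↦ continuous_finsetSum _ fun b _ ↦ ?_
    have := (hΩ.contMDiff_apply (h.smooth a) (hJ.isSmoothField_apply (h.smooth b))).continuous
    have h2 := this.comp (continuous_fst (X := X) (Y := RModel n))
    have h3 (i : Fin (2 * n)) : Continuous fun q : X × RModel n ↦ q.2 i := by fun_prop
    exact ((h3 a).mul (h3 b)).mul h2
  have hfeq (y : X) (hy : y ∈ U) (u : TangentSpace (𝓡 (2 * n)) y) :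
      Ω y u (J y u) = f (y, mvfderiv (𝓡 (2 * n)) (extChartAt (𝓡 (2 * n)) p) y u) := by
    conv_lhs => rw [h.expand y hy u]
    exact metric_sum_smul y _
  have hhom (y : X) (t : ℝ) (ξ : RModel n) : f (y, t • ξ) = t ^ 2 * f (y, ξ) := by
    simp only [hf, Finset.mul_sum, PiLp.smul_apply, smul_eq_mul]
    refine Finset.sum_congr rfl fun a _ ↦ Finset.sum_congr rfl fun b _ ↦ ?_
    ring
  have hKS := hKc.prod (isCompact_sphere (0 : RModel n) 1)
  obtain ⟨m, hm, hmf⟩ := hKS.exists_forall_le' hfc.continuousOn (a := 0) (by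
    rintro ⟨y, ξ⟩ ⟨hy, hξ⟩
    set u : TangentSpace (𝓡 (2 * n)) y := ∑ a, ξ a • W a y with hu
    have h1 : mvfderiv (𝓡 (2 * n)) (extChartAt (𝓡 (2 * n)) p) y u = ξ := by
      simp only [hu, map_sum, map_smul, h.deriv_field y (hKU hy)]
      ext i
      simp [Pi.single_apply]
    have h2 := hfeq y (hKU hy) u
    rw [h1] at h2
    rw [← h2]
    refine hJ.pos y u fun h0 ↦ ?_
    rw [h0, map_zero] at h1
    rw [← h1] at hξ
    simp at hξ)
  obtain ⟨M, hM⟩ := hKS.exists_bound_of_continuousOn hfc.continuousOn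
  refine ⟨max (√m)⁻¹ (√(max M 0)), lt_of_lt_of_le (by positivity) (le_max_left _ _), ?_⟩
  filter_upwards [hK] with y hy
  refine ⟨hKU hy, fun u ↦ ?_⟩
  set ξ := mvfderiv (𝓡 (2 * n)) (extChartAt (𝓡 (2 * n)) p) y u with hξ
  have hsq : m * ‖ξ‖ ^ 2 ≤ f (y, ξ) ∧ f (y, ξ) ≤ max M 0 * ‖ξ‖ ^ 2 := by
    rcases eq_or_ne ξ 0 with h0 | h0
    · rw [h0]; simp [hf]
    · have hn : ‖ξ‖ ≠ 0 := norm_ne_zero_iff.2 h0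
      have h1 : f (y, ξ) = ‖ξ‖ ^ 2 * f (y, ‖ξ‖⁻¹ • ξ) := by
        rw [hhom, ← mul_assoc, ← mul_pow, mul_inv_cancel₀ hn, one_pow, one_mul]
      have h2 : ((y, ‖ξ‖⁻¹ • ξ) : X × RModel n) ∈ K ×ˢ Metric.sphere (0 : RModel n) 1 :=
        ⟨hy, by simp [norm_smul, hn]⟩
      have h3 := hmf _ h2
      have h4 := (le_abs_self _).trans (hM _ h2)
      rw [h1]
      constructor
      · nlinarith [sq_nonneg ‖ξ‖]
      · nlinarith [sq_nonneg ‖ξ‖, le_max_left M 0]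
  have hg : gNorm Ω J y u = √(f (y, ξ)) := by rw [gNorm, hfeq y (hKU hy) u]
  rw [hg]
  constructor
  · refine le_trans ?_ (mul_le_mul_of_nonneg_right (le_max_left _ _) (Real.sqrt_nonneg _))
    rw [← div_eq_inv_mul, le_div_iff₀ (Real.sqrt_pos.2 hm)]
    refine Real.le_sqrt_of_sq_le ?_
    rw [mul_pow, Real.sq_sqrt hm.le, mul_comm]
    exact hsq.1
  · refine le_trans ?_ (mul_le_mul_of_nonneg_right (le_max_right _ _) (norm_nonneg _))
    rw [Real.sqrt_le_left (by positivity), mul_pow, Real.sq_sqrt (le_max_right _ _)]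
    exact hsq.2

end ChartFrames

/-! ### Boundedness of the Levi-Civita connection. -/

noncomputable section SecondDerivatives

variable {n : ℕ} {X : Type*} [TopologicalSpace X] [ChartedSpace (RModel n) X]
  [IsManifold (𝓡 (2 * n)) ∞ X]
  {Ω : ∀ x : X, TangentSpace (𝓡 (2 * n)) x →L[ℝ] TangentSpace (𝓡 (2 * n)) x →L[ℝ] ℝ}
  {J : ∀ x : X, TangentSpace (𝓡 (2 * n)) x →L[ℝ] TangentSpace (𝓡 (2 * n)) x}
  {D : CovariantDerivative (𝓡 (2 * n)) (RModel n) (TangentSpace (𝓡 (2 * n)) : X → Type _)}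

section Koszul

variable {U V W : ∀ x : X, TangentSpace (𝓡 (2 * n)) x}

theorem IsSmoothField.mdifferentiableAt (hV : IsSmoothField V) (x : X) :
    MDifferentiableAt (𝓡 (2 * n)) (𝓡 (2 * n)).tangent
      (fun y ↦ (⟨y, V y⟩ : TangentBundle (𝓡 (2 * n)) X)) x :=
  hV.contMDiffAt.mdifferentiableAt (by simp)

theorem IsSmoothField.mlieBracket (hU : IsSmoothField U) (hV : IsSmoothField V) :
    IsSmoothField (VectorField.mlieBracket (𝓡 (2 * n)) U V) := fun x ↦ by
  have : IsManifold (𝓡 (2 * n)) 1 X := .of_le (n := ∞) (by exact_mod_cast le_top)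
  have h2 : IsManifold (𝓡 (2 * n)) 2 X :=
    .of_le (n := ∞) two_le_infty
  have : IsManifold (𝓡 (2 * n)) (minSmoothness ℝ 2) X := by
    rwa [minSmoothness_of_isRCLikeNormedField]
  have : IsManifold (𝓡 (2 * n)) ((⊤ : ℕ∞) + 1) X := by simpa using ‹IsManifold (𝓡 (2 * n)) ∞ X›
  exact ContMDiffAt.mlieBracket_vectorField (m := ⊤) (n := ⊤) hU.contMDiffAt hV.contMDiffAt (by simp)

/-- No continuity of `D` is assumed, only that it is torsion free and metric. Koszul's formula
expresses it through smooth data, and this is where all bounds on it come from. -/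
theorem koszul (hJ : IsCompatibleComplexStructure Ω J) (hD : IsLeviCivita Ω J D)
    (hU : IsSmoothField U) (hV : IsSmoothField V) (hW : IsSmoothField W) (x : X) :
    2 * Ω x (D V x (U x)) (J x (W x))
      = mvfderiv (𝓡 (2 * n)) (fun y ↦ Ω y (V y) (J y (W y))) x (U x)
        + mvfderiv (𝓡 (2 * n)) (fun y ↦ Ω y (U y) (J y (W y))) x (V x)
        - mvfderiv (𝓡 (2 * n)) (fun y ↦ Ω y (U y) (J y (V y))) x (W x)
        + Ω x (VectorField.mlieBracket (𝓡 (2 * n)) U V x) (J x (W x))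
        - Ω x (VectorField.mlieBracket (𝓡 (2 * n)) U W x) (J x (V x))
        - Ω x (VectorField.mlieBracket (𝓡 (2 * n)) V W x) (J x (U x)) := by
  have h {A B : ∀ x : X, TangentSpace (𝓡 (2 * n)) x} (hA : MDifferentiableAt (𝓡 (2 * n))
      (𝓡 (2 * n)).tangent (fun y ↦ (⟨y, A y⟩ : TangentBundle (𝓡 (2 * n)) X)) x)
      (hB : MDifferentiableAt (𝓡 (2 * n)) (𝓡 (2 * n)).tangent
        (fun y ↦ (⟨y, B y⟩ : TangentBundle (𝓡 (2 * n)) X)) x) :=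
    D.torsion_eq_zero_iff.1 hD.torsion_free hA hB
  have hU' := hU.mdifferentiableAt x
  have hV' := hV.mdifferentiableAt x
  have hW' := hW.mdifferentiableAt x
  rw [hD.metric V W x hV' hW', hD.metric U W x hU' hW', hD.metric U V x hU' hV', ← h hU' hV',
    ← h hU' hW', ← h hV' hW']
  simp only [map_sub, _root_.sub_apply]
  have s := hJ.symm x
  rw [s (V x) (D W x (U x)), s (U x) (D W x (V x)), s (U x) (D V x (W x))]
  ring

theorem exists_bound_metric_deriv [CompactSpace X] (hΩ : IsSymplecticForm Ω)
    (hJ : IsCompatibleComplexStructure Ω J) (hD : IsLeviCivita Ω J D)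
    (hU : IsSmoothField U) (hV : IsSmoothField V) (hW : IsSmoothField W) :
    ∃ C, ∀ x, |Ω x (D V x (U x)) (J x (W x))| ≤ C := by
  have hc {A B Y : ∀ x : X, TangentSpace (𝓡 (2 * n)) x} (hA : IsSmoothField A)
      (hB : IsSmoothField B) (hY : IsSmoothField Y) :
      Continuous fun x ↦ mvfderiv (𝓡 (2 * n)) (fun y ↦ Ω y (A y) (J y (B y))) x (Y x) :=
    continuous_iff_continuousAt.2 fun x ↦
      ((hΩ.contMDiff_apply hA (hJ.isSmoothField_apply hB)).contMDiffAt.mvfderiv_apply_section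
        hY.contMDiffAt).continuousAt
  have hb {A B Y : ∀ x : X, TangentSpace (𝓡 (2 * n)) x} (hA : IsSmoothField A)
      (hB : IsSmoothField B) (hY : IsSmoothField Y) :
      Continuous fun x ↦ Ω x (VectorField.mlieBracket (𝓡 (2 * n)) A B x) (J x (Y x)) :=
    (hΩ.contMDiff_apply (hA.mlieBracket hB) (hJ.isSmoothField_apply hY)).continuous
  have hcont : Continuous fun x ↦ 2 * Ω x (D V x (U x)) (J x (W x)) := by
    simp_rw [koszul hJ hD hU hV hW]
    exact (((((hc hV hW hU).add (hc hU hW hV)).sub (hc hU hV hW)).add (hb hU hV hW)).sub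
      (hb hU hW hV)).sub (hb hV hW hU)
  obtain ⟨C, hC⟩ := isCompact_univ.exists_bound_of_continuousOn hcont.continuousOn
  refine ⟨C, fun x ↦ ?_⟩
  have := hC x (Set.mem_univ x)
  rw [Real.norm_eq_abs, abs_mul, abs_two] at this
  linarith [abs_nonneg (Ω x (D V x (U x)) (J x (W x)))]

theorem exists_bound_gNorm [CompactSpace X] (hΩ : IsSymplecticForm Ω)
    (hJ : IsCompatibleComplexStructure Ω J) (hV : IsSmoothField V) :
    ∃ C, 0 ≤ C ∧ ∀ x, gNorm Ω J x (V x) ≤ C := by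
  have hcont := (hΩ.contMDiff_apply hV (hJ.isSmoothField_apply hV)).continuous
  obtain ⟨C, hC⟩ := isCompact_univ.exists_bound_of_continuousOn hcont.continuousOn
  exact ⟨√C, Real.sqrt_nonneg _, fun x ↦ Real.sqrt_le_sqrt ((le_abs_self _).trans
    (hC x (Set.mem_univ x)))⟩

theorem abs_coord_le (ξ : RModel n) (a : Fin (2 * n)) : |ξ a| ≤ ‖ξ‖ := PiLp.norm_apply_le ξ a

/-- For w = D_uV, expand |w|² = g(D_uV, w) in a chart frame with respect to u and the last w. The
coefficients g(D_{W_a}V, W_b) are bounded by Koszul's formula, so |w|² ≤ C|u||w|, and one factor |w|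
is divided out. -/
theorem exists_bound_leviCivita [T2Space X] [CompactSpace X] (hΩ : IsSymplecticForm Ω)
    (hJ : IsCompatibleComplexStructure Ω J) (hD : IsLeviCivita Ω J D) (hV : IsSmoothField V) :
    ∃ C, 0 ≤ C ∧ ∀ x u, gNorm Ω J x (D V x u) ≤ C * gNorm Ω J x u := by
  suffices h : ∃ C, ∀ x, ∀ u, gNorm Ω J x (D V x u) ≤ C * gNorm Ω J x u by
    obtain ⟨C, hC⟩ := h
    exact ⟨max C 0, le_max_right _ _, fun x u ↦ (hC x u).trans
      (mul_le_mul_of_nonneg_right (le_max_left _ _) (gNorm_nonneg _))⟩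
  refine exists_forall_of_eventually (fun x C C' h hC u ↦ (hC u).trans
    (mul_le_mul_of_nonneg_right h (gNorm_nonneg _))) fun p ↦ ?_
  obtain ⟨W, S, hp, hW⟩ := exists_isChartFrame (n := n) p
  obtain ⟨C₀, hC₀, hb⟩ := hW.exists_gNorm_bounds hΩ hJ hp
  choose M hM using fun ab : Fin (2 * n) × Fin (2 * n) ↦
    exists_bound_metric_deriv hΩ hJ hD (hW.smooth ab.1) hV (hW.smooth ab.2)
  obtain ⟨M', hM'⟩ := Finite.exists_le M
  have hM0 (a b : Fin (2 * n)) : 0 ≤ M' := (abs_nonneg _).trans ((hM (a, b) p).trans (hM' _))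
  refine ⟨∑ _a : Fin (2 * n), ∑ _b : Fin (2 * n), C₀ * C₀ * M', ?_⟩
  filter_upwards [hb] with y hy u
  set w := D V y u with hw
  have h1 : gNorm Ω J y w ^ 2 ≤ (∑ _a : Fin (2 * n), ∑ _b : Fin (2 * n), C₀ * C₀ * M')
      * gNorm Ω J y u * gNorm Ω J y w := by
    rw [gNorm_eq (J := J) y w, (compatiblePair hΩ hJ y).norm_sq, ← gNorm_eq]
    have e1 : formAt Ω y w ((J y).toLinearMap w) = ∑ a, ∑ b,
        (mvfderiv (𝓡 (2 * n)) (extChartAt (𝓡 (2 * n)) p) y u : RModel n) a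
          * (mvfderiv (𝓡 (2 * n)) (extChartAt (𝓡 (2 * n)) p) y w : RModel n) b
          * Ω y (D V y (W a y)) (J y (W b y)) := by
      change Ω y w (J y w) = _
      conv_lhs => rw [hW.expand y hy.1 w]
      have e2 : w = ∑ a, (mvfderiv (𝓡 (2 * n)) (extChartAt (𝓡 (2 * n)) p) y u : RModel n) a
          • D V y (W a y) := by
        rw [hw]
        conv_lhs => rw [hW.expand y hy.1 u]
        simp only [map_sum, map_smul]
      rw [← hW.expand y hy.1 w]
      conv_lhs =>
        enter [2]
        rw [hW.expand y hy.1 w]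
      conv_lhs =>
        enter [1, 2]
        rw [e2]
      simp only [map_sum, map_smul, _root_.sum_apply, _root_.smul_apply, smul_eq_mul,
        Finset.mul_sum]
      rw [Finset.sum_comm]
      refine Finset.sum_congr rfl fun a _ ↦ Finset.sum_congr rfl fun b _ ↦ ?_
      ring
    rw [e1, Finset.sum_mul, Finset.sum_mul]
    refine Finset.sum_le_sum fun a _ ↦ ?_
    rw [Finset.sum_mul, Finset.sum_mul]
    refine Finset.sum_le_sum fun b _ ↦ ?_
    have hu := (abs_coord_le _ a).trans (hy.2 u).1
    have hw' := (abs_coord_le _ b).trans (hy.2 w).1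
    have hg := (hM (a, b) y).trans (hM' _)
    refine (le_abs_self _).trans ?_
    rw [abs_mul, abs_mul]
    calc _ ≤ C₀ * gNorm Ω J y u * (C₀ * gNorm Ω J y w) * M' := by
          refine mul_le_mul (mul_le_mul hu hw' (abs_nonneg _) ?_) hg (abs_nonneg _) ?_
          · exact mul_nonneg hC₀.le (gNorm_nonneg _)
          · exact mul_nonneg (mul_nonneg hC₀.le (gNorm_nonneg _))
              (mul_nonneg hC₀.le (gNorm_nonneg _))
      _ = _ := by ring
  rcases (gNorm_nonneg (Ω := Ω) (J := J) w).eq_or_lt with h0 | h0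
  · rw [← h0]
    refine mul_nonneg (Finset.sum_nonneg fun a _ ↦ Finset.sum_nonneg fun b _ ↦ ?_) (gNorm_nonneg _)
    exact mul_nonneg (mul_self_nonneg _) (hM0 a b)
  · rw [sq] at h1
    exact le_of_mul_le_mul_right h1 h0

end Koszul

end SecondDerivatives

/-! ### Norms on L^k, tensoriality of ∇∇, and second-order bounds expressed with smooth fields. -/

noncomputable section AsymptoticBounds

variable {n : ℕ} {X : Type*} [TopologicalSpace X] [ChartedSpace (RModel n) X]
  [IsManifold (𝓡 (2 * n)) ∞ X]
  {L : X → Type*} [TopologicalSpace (TotalSpace ℂ L)]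
  [∀ x, NormedAddCommGroup (L x)] [∀ x, InnerProductSpace ℂ (L x)]
  [FiberBundle ℂ L] [VectorBundle ℂ ℂ L] [VectorBundle ℝ ℂ L]
  {Ω : ∀ x : X, TangentSpace (𝓡 (2 * n)) x →L[ℝ] TangentSpace (𝓡 (2 * n)) x →L[ℝ] ℝ}
  {J : ∀ x : X, TangentSpace (𝓡 (2 * n)) x →L[ℝ] TangentSpace (𝓡 (2 * n)) x}
  {D : CovariantDerivative (𝓡 (2 * n)) (RModel n) (TangentSpace (𝓡 (2 * n)) : X → Type _)}
  {cov : CovariantDerivative (𝓡 (2 * n)) ℂ L}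

section Norm

theorem powNorm_nonneg (k : ℕ) {x : X} (t : LPow L k x) : 0 ≤ powNorm k x t :=
  mul_nonneg (norm_nonneg _) (pow_nonneg (norm_nonneg _) _)

theorem powNorm_add_le (k : ℕ) {x : X} (t t' : LPow L k x) :
    powNorm k x (t + t') ≤ powNorm k x t + powNorm k x t' := by
  obtain ⟨v, hv⟩ := exists_unit (L := L) x
  simp only [powNorm_eq k hv, map_add]
  exact norm_add_le _ _

theorem powNorm_smul (k : ℕ) {x : X} (z : ℂ) (t : LPow L k x) :
    powNorm k x (z • t) = ‖z‖ * powNorm k x t := by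
  obtain ⟨v, hv⟩ := exists_unit (L := L) x
  simp only [powNorm_eq k hv, map_smul, norm_smul]

theorem powNorm_eq_zero (k : ℕ) {x : X} {t : LPow L k x} : powNorm k x t = 0 ↔ t = 0 := by
  obtain ⟨v, hv⟩ := exists_unit (L := L) x
  rw [powNorm_eq k hv, norm_eq_zero]
  exact ⟨fun h ↦ coordIn_injective k hv (by rw [h, map_zero]), fun h ↦ by rw [h, map_zero]⟩

end Norm

section Tensorial

variable {e : ∀ x, L x} {U : Set X}

/-- `TensorialAt` tests on fields that are merely differentiable at the point, so versions for
smooth fields do not suffice. -/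
theorem mdifferentiableAt_mvfderiv_apply {φ : X → ℂ} {x : X}
    {V : ∀ x : X, TangentSpace (𝓡 (2 * n)) x} (hφ : ContMDiffAt (𝓡 (2 * n)) 𝓘(ℝ, ℂ) ∞ φ x)
    (hV : MDifferentiableAt (𝓡 (2 * n)) (𝓡 (2 * n)).tangent
      (fun y ↦ (⟨y, V y⟩ : TangentBundle (𝓡 (2 * n)) X)) x) :
    MDifferentiableAt (𝓡 (2 * n)) 𝓘(ℝ, ℂ) (fun y ↦ mvfderiv (𝓡 (2 * n)) φ y (V y)) x := by
  have : IsManifold (𝓡 (2 * n)) (∞ + 1) X := by simpa using ‹IsManifold (𝓡 (2 * n)) ∞ X›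
  have : IsManifold (𝓡 (2 * n)) 1 X := .of_le (n := ∞) (by exact_mod_cast le_top)
  have h := (hφ.mfderiv_const (m := ∞) (by simp)).mdifferentiableAt (by simp)
  have h2 := MDifferentiableAt.clm_apply_of_inCoordinates (IM := 𝓡 (2 * n)) (IB₁ := 𝓡 (2 * n))
    (b₁ := fun y : X ↦ y) (b₂ := φ)
    (E₁ := (TangentSpace (𝓡 (2 * n)) : X → Type _)) (E₂ := (TangentSpace 𝓘(ℝ, ℂ) : ℂ → Type _))
    (ϕ := fun y ↦ mfderiv (𝓡 (2 * n)) 𝓘(ℝ, ℂ) φ y) (v := V) h hV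
    (hφ.mdifferentiableAt (by simp))
  have h3 := (contMDiff_snd_tangentBundle_modelSpace (n := 1) ℂ 𝓘(ℝ, ℂ)).contMDiffAt
    (x := ⟨φ x, mfderiv (𝓡 (2 * n)) 𝓘(ℝ, ℂ) φ x (V x)⟩)
  exact (h3.mdifferentiableAt (by simp)).comp x h2

theorem MDifferentiableAt.mul_complex {f g : X → ℂ} {x : X}
    (hf : MDifferentiableAt (𝓡 (2 * n)) 𝓘(ℝ, ℂ) f x)
    (hg : MDifferentiableAt (𝓡 (2 * n)) 𝓘(ℝ, ℂ) g x) :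
    MDifferentiableAt (𝓡 (2 * n)) 𝓘(ℝ, ℂ) (fun y ↦ f y * g y) x :=
  MDifferentiableAt.comp x (g := fun p : ℂ × ℂ ↦ p.1 * p.2)
    ((by fun_prop : DifferentiableAt ℝ (fun p : ℂ × ℂ ↦ p.1 * p.2) _).mdifferentiableAt)
    (hf.prodMk_space hg)

theorem mdifferentiableAt_frameForm
    (hcov : IsPrequantumConnection Ω cov) [ContMDiffVectorBundle ∞ ℂ L (𝓡 (2 * n))]
    (he : IsUnitFrame n e U) {V : ∀ x : X, TangentSpace (𝓡 (2 * n)) x} {x : X} (hx : x ∈ U)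
    (hV : MDifferentiableAt (𝓡 (2 * n)) (𝓡 (2 * n)).tangent
      (fun y ↦ (⟨y, V y⟩ : TangentBundle (𝓡 (2 * n)) X)) x) :
    MDifferentiableAt (𝓡 (2 * n)) 𝓘(ℝ, ℂ) (fun y ↦ (frameForm cov e y (V y) : ℂ)) x := by
  have h1 := hcov.smooth.contMDiff.contMDiff (σ := e) (by simpa using he.smooth.contMDiffOn)
  have h2 : MDifferentiableAt (𝓡 (2 * n)) ((𝓡 (2 * n)).prod 𝓘(ℝ, ℂ))
      (fun y ↦ TotalSpace.mk' ℂ y (cov e y (V y))) x :=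
    MDifferentiableAt.clm_bundle_apply ((h1.contMDiffAt univ_mem).mdifferentiableAt (by simp)) hV
  rw [mdifferentiableAt_section] at h2
  have h0 := linearMapAt_unit_ne_zero (FiberBundle.mem_baseSet_trivializationAt ℂ L x) (he.unit x hx)
  have h3 : ContDiffAt ℝ ∞ (fun z : ℂ ↦ z⁻¹) ((trivializationAt ℂ L x).linearMapAt ℂ x (e x)) :=
    contDiffAt_id.inv h0
  have h4 := h3.contMDiffAt.comp x (contMDiffAt_linearMapAt (he.smooth.contMDiffAt (x := x)))
  refine ((mdifferentiableAt_const (c := -Complex.I)).mul_complex (MDifferentiableAt.mul_complex h2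
    (h4.mdifferentiableAt (by simp)))).congr_of_eventuallyEq ?_
  filter_upwards [he.eventually_unit hx] with y hy
  have h5 := linearMapAt_unit_ne_zero hy.1 hy.2.2
  have h6 := congrFun ((trivializationAt ℂ L x).coe_linearMapAt_of_mem (R := ℂ) hy.1)
    (cov e y (V y))
  simp only [Function.comp_apply]
  rw [← h6, cov_unitFrame hcov he hy.2.1, map_smul, smul_eq_mul, mul_inv_cancel_right₀ h5,
    ← mul_assoc, neg_mul, Complex.I_mul_I, neg_neg, one_mul]

theorem mdifferentiableAt_coordIn_nabla
    (hcov : IsPrequantumConnection Ω cov)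
    [ContMDiffVectorBundle ∞ ℂ L (𝓡 (2 * n))] (he : IsUnitFrame n e U) {k : ℕ}
    {s : ∀ x, LPow L k x} (hs : IsSmoothSection n k s)
    {V : ∀ x : X, TangentSpace (𝓡 (2 * n)) x} {x : X} (hx : x ∈ U)
    (hV : MDifferentiableAt (𝓡 (2 * n)) (𝓡 (2 * n)).tangent
      (fun y ↦ (⟨y, V y⟩ : TangentBundle (𝓡 (2 * n)) X)) x) :
    MDifferentiableAt (𝓡 (2 * n)) 𝓘(ℝ, ℂ) (fun y ↦ coordIn k (e y) (nabla cov k s y (V y))) x := by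
  have h1 := mdifferentiableAt_mvfderiv_apply (hs.coordIn he hx) hV
  have h2 := mdifferentiableAt_frameForm hcov he hx hV
  have h3 := ((mdifferentiableAt_const (c := (k : ℂ) * Complex.I)).mul_complex h2).mul_complex
    ((hs.coordIn he hx).mdifferentiableAt (by simp))
  refine (h1.add h3).congr_of_eventuallyEq ?_
  filter_upwards [he.isOpen.mem_nhds hx] with y hy
  rw [coordIn_nabla hcov he hy ((hs.coordIn he hy).mdifferentiableAt (by simp))]
  rfl

/-- The second covariant derivative is tensorial. -/
theorem tensorialAt_nabla_nabla
    (hcov : IsPrequantumConnection Ω cov)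
    [ContMDiffVectorBundle ∞ ℂ L (𝓡 (2 * n))] (he : IsUnitFrame n e U) {k : ℕ}
    {s : ∀ x, LPow L k x} (hs : IsSmoothSection n k s) {x : X} (hx : x ∈ U)
    (u : TangentSpace (𝓡 (2 * n)) x) :
    TensorialAt (𝓡 (2 * n)) (RModel n)
      (fun V : ∀ x : X, TangentSpace (𝓡 (2 * n)) x ↦ coordIn k (e x)
        (nabla cov k (fun y ↦ nabla cov k s y (V y)) x u - nabla cov k s x (D V x u))) x where
  smul {f V} hf hV := by
    have hd := mdifferentiableAt_coordIn_nabla hcov he hs hx hV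
    have hfc : MDifferentiableAt (𝓡 (2 * n)) 𝓘(ℝ, ℂ) (fun y ↦ (f y : ℂ)) x :=
      MDifferentiableAt.comp x (Complex.ofRealCLM.differentiableAt.mdifferentiableAt) hf
    have heq : (fun y ↦ coordIn k (e y) (nabla cov k s y ((f • V) y)))
        = fun y ↦ (f y : ℂ) * coordIn k (e y) (nabla cov k s y (V y)) := by
      funext y
      simp [map_smul]
    have hfd : mvfderiv (𝓡 (2 * n)) (fun y ↦ (f y : ℂ)) x u
        = (mvfderiv (𝓡 (2 * n)) f x u : ℂ) := by
      have := mvfderiv_comp_fderiv Complex.ofRealCLM.differentiableAt hf u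
      simpa using this
    simp only [map_sub]
    rw [coordIn_nabla hcov he hx (by rw [heq]; exact hfc.mul_complex hd),
      coordIn_nabla hcov he hx hd, heq, mvfderiv_mul_complex hfc hd, hfd,
      D.isCovariantDerivativeOnUniv.leibniz hV hf]
    simp
    ring
  add {V W} hV hW := by
    have hd := mdifferentiableAt_coordIn_nabla hcov he hs hx hV
    have hd' := mdifferentiableAt_coordIn_nabla hcov he hs hx hW
    have heq : (fun y ↦ coordIn k (e y) (nabla cov k s y ((V + W) y)))
        = (fun y ↦ coordIn k (e y) (nabla cov k s y (V y)))
          + fun y ↦ coordIn k (e y) (nabla cov k s y (W y)) := by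
      funext y
      simp
    simp only [map_sub]
    rw [coordIn_nabla hcov he hx (by rw [heq]; exact hd.add hd'),
      coordIn_nabla hcov he hx hd, coordIn_nabla hcov he hx hd', heq, mvfderiv_add hd hd',
      D.isCovariantDerivativeOnUniv.add hV hW]
    simp
    ring

/-- The extension of v used in `nablaTwo` is the one built into `TensorialAt.mkHom`, so the identity
is definitional; it brings linearity in v and the freedom to use any other extension. -/
theorem coordIn_nablaTwo
    (hcov : IsPrequantumConnection Ω cov)
    [ContMDiffVectorBundle ∞ ℂ L (𝓡 (2 * n))] (he : IsUnitFrame n e U) {k : ℕ}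
    {s : ∀ x, LPow L k x} (hs : IsSmoothSection n k s) {x : X} (hx : x ∈ U)
    (u v : TangentSpace (𝓡 (2 * n)) x) :
    have : IsManifold (𝓡 (2 * n)) 1 X := .of_le (n := ∞) (by exact_mod_cast le_top)
    coordIn k (e x) (nablaTwo D cov k s x u v)
      = TensorialAt.mkHom _ x (tensorialAt_nabla_nabla (D := D) hcov he hs hx u) v := rfl

theorem coordIn_nablaTwo_field
    (hcov : IsPrequantumConnection Ω cov)
    [ContMDiffVectorBundle ∞ ℂ L (𝓡 (2 * n))] (he : IsUnitFrame n e U) {k : ℕ}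
    {s : ∀ x, LPow L k x} (hs : IsSmoothSection n k s) {x : X} (hx : x ∈ U)
    (u : TangentSpace (𝓡 (2 * n)) x) {V : ∀ x : X, TangentSpace (𝓡 (2 * n)) x}
    (hV : IsSmoothField V) :
    coordIn k (e x) (nablaTwo D cov k s x u (V x)) = coordIn k (e x)
        (nabla cov k (fun y ↦ nabla cov k s y (V y)) x u - nabla cov k s x (D V x u)) := by
  have : IsManifold (𝓡 (2 * n)) 1 X := .of_le (n := ∞) (by exact_mod_cast le_top)
  rw [coordIn_nablaTwo hcov he hs hx]
  exact TensorialAt.mkHom_apply _ (hV.mdifferentiableAt x)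

end Tensorial

/-- First derivatives of order `√k`. -/
def HasFirstBound (Ω : ∀ x : X, TangentSpace (𝓡 (2 * n)) x →L[ℝ] TangentSpace (𝓡 (2 * n)) x →L[ℝ] ℝ)
    (J : ∀ x : X, TangentSpace (𝓡 (2 * n)) x →L[ℝ] TangentSpace (𝓡 (2 * n)) x)
    (cov : CovariantDerivative (𝓡 (2 * n)) ℂ L) (s : ∀ (k : ℕ) (x : X), LPow L k x) : Prop :=
  ∃ C, 0 ≤ C ∧ ∀ k : ℕ, 1 ≤ k → ∀ x u,
    powNorm k x (nabla cov k (s k) x u) ≤ C * √k * gNorm Ω J x u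

/-- Second derivatives of order `k`, formed with smooth fields. -/
def HasSecondBound (Ω : ∀ x : X, TangentSpace (𝓡 (2 * n)) x →L[ℝ] TangentSpace (𝓡 (2 * n)) x →L[ℝ] ℝ)
    (J : ∀ x : X, TangentSpace (𝓡 (2 * n)) x →L[ℝ] TangentSpace (𝓡 (2 * n)) x)
    (cov : CovariantDerivative (𝓡 (2 * n)) ℂ L) (s : ∀ (k : ℕ) (x : X), LPow L k x) : Prop :=
  ∀ V : ∀ x : X, TangentSpace (𝓡 (2 * n)) x, IsSmoothField V → ∃ C, 0 ≤ C ∧ ∀ k : ℕ, 1 ≤ k →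
    ∀ x u, powNorm k x (nabla cov k (fun y ↦ nabla cov k (s k) y (V y)) x u)
      ≤ C * k * gNorm Ω J x u

theorem sqrt_natCast_le {k : ℕ} (hk : 1 ≤ k) : √(k : ℝ) ≤ k := by
  have : (1 : ℝ) ≤ k := by exact_mod_cast hk
  rw [Real.sqrt_le_left (by linarith)]
  nlinarith

theorem IsAH.hasFirstBound {s : ∀ (k : ℕ) (x : X), LPow L k x} (h : IsAH Ω J D cov s) :
    HasFirstBound Ω J cov s := by
  obtain ⟨C, hC⟩ := h
  refine ⟨max C 0, le_max_right _ _, fun k hk x u ↦ ((hC k hk x).2.1 u).trans ?_⟩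
  gcongr
  · exact gNorm_nonneg _
  · exact le_max_left _ _

variable [T2Space X] [CompactSpace X] [ContMDiffVectorBundle ∞ ℂ L (𝓡 (2 * n))]

/-- ∇_u(∇_V s) = (∇∇s)(u, V) + ∇_{D_uV}s, and the last term is O(√k). The resulting condition no
longer mentions `D`, so it passes to conjugate sections without proving that c preserves the
Levi-Civita connection. -/
theorem hasSecondBound_of_nablaTwo (hL : IsSmoothHermitian L n) (hΩ : IsSymplecticForm Ω)
    (hJ : IsCompatibleComplexStructure Ω J) (hD : IsLeviCivita Ω J D)
    (hcov : IsPrequantumConnection Ω cov) {s : ∀ (k : ℕ) (x : X), LPow L k x}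
    (hs : ∀ k, IsSmoothSection n k (s k)) (h₁ : HasFirstBound Ω J cov s) {C : ℝ}
    (hC : ∀ k : ℕ, 1 ≤ k → ∀ x u v, powNorm k x (nablaTwo D cov k (s k) x u v)
      ≤ C * k * (gNorm Ω J x u * gNorm Ω J x v)) : HasSecondBound Ω J cov s := by
  intro V hV
  obtain ⟨C₁, hC₁, h₁⟩ := h₁
  obtain ⟨A, hA, hVA⟩ := exists_bound_gNorm hΩ hJ hV
  obtain ⟨B, hB, hVB⟩ := exists_bound_leviCivita hΩ hJ hD hV
  refine ⟨max C 0 * A + C₁ * B, by positivity, fun k hk x u ↦ ?_⟩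
  obtain ⟨e, U, hx, he⟩ := exists_isUnitFrame hL x
  have h2 := coordIn_nablaTwo_field (D := D) hcov he (hs k) hx u hV
  have h3 := coordIn_injective k (he.unit x hx) h2
  have h4 : nabla cov k (fun y ↦ nabla cov k (s k) y (V y)) x u
      = nablaTwo D cov k (s k) x u (V x) + nabla cov k (s k) x (D V x u) := by
    rw [h3, sub_add_cancel]
  have hg := gNorm_nonneg (Ω := Ω) (J := J) u
  have hk0 : (0 : ℝ) ≤ k := Nat.cast_nonneg k
  rw [h4]
  calc _ ≤ _ := powNorm_add_le k _ _
    _ ≤ C * k * (gNorm Ω J x u * gNorm Ω J x (V x)) + C₁ * √k * gNorm Ω J x (D V x u) :=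
        add_le_add (hC k hk x u (V x)) (h₁ k hk x _)
    _ ≤ max C 0 * k * (gNorm Ω J x u * A) + C₁ * k * (B * gNorm Ω J x u) := by
        have := sqrt_natCast_le hk
        have i1 := hVA x
        have i2 := hVB x u
        have i3 := le_max_left C 0
        have i4 := gNorm_nonneg (Ω := Ω) (J := J) (V x)
        have i5 := gNorm_nonneg (Ω := Ω) (J := J) (D V x u)
        refine add_le_add ?_ ?_ <;> gcongr
    _ = _ := by ring

theorem IsAH.hasSecondBound (hL : IsSmoothHermitian L n) (hΩ : IsSymplecticForm Ω)
    (hJ : IsCompatibleComplexStructure Ω J) (hD : IsLeviCivita Ω J D)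
    (hcov : IsPrequantumConnection Ω cov) {s : ∀ (k : ℕ) (x : X), LPow L k x}
    (hs : ∀ k, IsSmoothSection n k (s k)) (h : IsAH Ω J D cov s) : HasSecondBound Ω J cov s := by
  obtain ⟨C, hC⟩ := id h
  exact hasSecondBound_of_nablaTwo hL hΩ hJ hD hcov hs h.hasFirstBound
    fun k hk x ↦ (hC k hk x).2.2

/-- First and second order bounds give the bound on `∇∇s`. -/
theorem exists_bound_nablaTwo (hL : IsSmoothHermitian L n) (hΩ : IsSymplecticForm Ω)
    (hJ : IsCompatibleComplexStructure Ω J) (hD : IsLeviCivita Ω J D)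
    (hcov : IsPrequantumConnection Ω cov) {s : ∀ (k : ℕ) (x : X), LPow L k x}
    (hs : ∀ k, IsSmoothSection n k (s k)) (h₁ : HasFirstBound Ω J cov s)
    (h₂ : HasSecondBound Ω J cov s) : ∃ C, ∀ x : X, ∀ k : ℕ, 1 ≤ k → ∀ u v,
      powNorm k x (nablaTwo D cov k (s k) x u v) ≤ C * k * (gNorm Ω J x u * gNorm Ω J x v) := by
  have : IsManifold (𝓡 (2 * n)) 1 X := .of_le (n := ∞) (by exact_mod_cast le_top)
  obtain ⟨C₁, hC₁, h₁⟩ := h₁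
  refine exists_forall_of_eventually (fun x C C' h hC k hk u v ↦ (hC k hk u v).trans ?_) fun p ↦ ?_
  · have h1 := gNorm_nonneg (Ω := Ω) (J := J) u
    have h2 := gNorm_nonneg (Ω := Ω) (J := J) v
    gcongr
  obtain ⟨W, S, hp, hW⟩ := exists_isChartFrame (n := n) p
  obtain ⟨e, U, hpU, he⟩ := exists_isUnitFrame hL p
  obtain ⟨C₀, hC₀, hb⟩ := hW.exists_gNorm_bounds hΩ hJ hp
  choose A hA hA2 using fun a ↦ h₂ (W a) (hW.smooth a)
  choose B hB hB2 using fun a ↦ exists_bound_leviCivita hΩ hJ hD (hW.smooth a)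
  refine ⟨∑ a, C₀ * (A a + C₁ * B a), ?_⟩
  filter_upwards [hb, he.isOpen.mem_nhds hpU] with y hy hyU k hk u v
  have hg := gNorm_nonneg (Ω := Ω) (J := J) u
  have hgv := gNorm_nonneg (Ω := Ω) (J := J) v
  have hterm (a : Fin (2 * n)) : ‖coordIn k (e y) (nablaTwo D cov k (s k) y u (W a y))‖
      ≤ (A a + C₁ * B a) * k * gNorm Ω J y u := by
    rw [coordIn_nablaTwo_field (D := D) hcov he (hs k) hyU u (hW.smooth a), map_sub]
    refine (norm_sub_le _ _).trans ?_
    rw [← powNorm_eq k (he.unit y hyU), ← powNorm_eq k (he.unit y hyU)]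
    calc _ ≤ A a * k * gNorm Ω J y u + C₁ * √k * gNorm Ω J y (D (W a) y u) :=
          add_le_add (hA2 a k hk y u) (h₁ k hk y _)
      _ ≤ A a * k * gNorm Ω J y u + C₁ * k * (B a * gNorm Ω J y u) := by
          have := sqrt_natCast_le hk
          have i2 := hB2 a y u
          have i5 := gNorm_nonneg (Ω := Ω) (J := J) (D (W a) y u)
          have := hB a
          gcongr
      _ = _ := by ring
  have hexp : coordIn k (e y) (nablaTwo D cov k (s k) y u v)
      = ∑ a, ((mvfderiv (𝓡 (2 * n)) (extChartAt (𝓡 (2 * n)) p) y v : RModel n) a : ℂ)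
        * coordIn k (e y) (nablaTwo D cov k (s k) y u (W a y)) := by
    conv_lhs => rw [hW.expand y hy.1 v]
    simp only [coordIn_nablaTwo (D := D) hcov he (hs k) hyU, map_sum, map_smul,
      Complex.real_smul]
  rw [powNorm_eq k (he.unit y hyU), hexp]
  refine (norm_sum_le _ _).trans ?_
  rw [Finset.sum_mul, Finset.sum_mul]
  refine Finset.sum_le_sum fun a _ ↦ ?_
  rw [norm_mul, Complex.norm_real, Real.norm_eq_abs]
  have := hA a
  have := hB a
  calc _ ≤ C₀ * gNorm Ω J y v * ((A a + C₁ * B a) * k * gNorm Ω J y u) :=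
        mul_le_mul ((abs_coord_le _ a).trans (hy.2 v).1) (hterm a) (norm_nonneg _)
          (by positivity)
    _ = _ := by ring

end AsymptoticBounds

/-! ### Dictionary between sections of L^k and functions in a chart. -/

noncomputable section ChartExpressions

variable {n : ℕ} {X : Type*} [TopologicalSpace X] [ChartedSpace (RModel n) X]
  [IsManifold (𝓡 (2 * n)) ∞ X]
  {L : X → Type*} [TopologicalSpace (TotalSpace ℂ L)]
  [∀ x, NormedAddCommGroup (L x)] [∀ x, InnerProductSpace ℂ (L x)]
  [FiberBundle ℂ L] [VectorBundle ℂ ℂ L] [VectorBundle ℝ ℂ L]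
  {Ω : ∀ x : X, TangentSpace (𝓡 (2 * n)) x →L[ℝ] TangentSpace (𝓡 (2 * n)) x →L[ℝ] ℝ}
  {cov : CovariantDerivative (𝓡 (2 * n)) ℂ L}

theorem nabla_eq_zero {k : ℕ} {s : ∀ x, LPow L k x} {x : X} (h : ∀ᶠ y in 𝓝 x, s y = 0) :
    nabla cov k s x = 0 := by
  have h1 : (fun y ↦ powCoord k x y (s y)) =ᶠ[𝓝 x] fun _ ↦ (0 : ℂ) := by
    filter_upwards [h] with y hy
    rw [hy, map_zero]
  ext u
  have h2 := mvfderiv_congr (n := n) h1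
  rw [mvfderiv_const] at h2
  simp [nabla, h2, h.self_of_nhds]

theorem nablaTwo_eq_zero {D : CovariantDerivative (𝓡 (2 * n)) (RModel n)
    (TangentSpace (𝓡 (2 * n)) : X → Type _)} {k : ℕ} {s : ∀ x, LPow L k x} {x : X}
    (h : ∀ᶠ y in 𝓝 x, s y = 0) (u v : TangentSpace (𝓡 (2 * n)) x) :
    nablaTwo D cov k s x u v = 0 := by
  rw [nablaTwo, nabla_eq_zero h, nabla_eq_zero]
  · simp
  · filter_upwards [eventually_eventually_nhds.2 h] with y hy
    rw [nabla_eq_zero hy]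
    rfl

/-- The covariant derivative of `s` at `x`, read in the unit vector `v`. -/
def covForm (cov : CovariantDerivative (𝓡 (2 * n)) ℂ L) (k : ℕ) {x : X} (v : L x)
    (s : ∀ x, LPow L k x) : TangentSpace (𝓡 (2 * n)) x →ₗ[ℝ] ℂ :=
  (coordIn k v).restrictScalars ℝ ∘ₗ nabla cov k s x

theorem covForm_apply {k : ℕ} {x : X} (v : L x) (s : ∀ x, LPow L k x)
    (u : TangentSpace (𝓡 (2 * n)) x) : covForm cov k v s u = coordIn k v (nabla cov k s x u) := rfl

theorem covForm_eq_smul {k : ℕ} {x : X} (v : L x) {w : L x} (hw : ‖w‖ = 1) (s : ∀ x, LPow L k x) :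
    covForm cov k v s = (coordIn k v (PiTensorProduct.tprod ℂ fun _ ↦ w)) • covForm cov k w s := by
  ext u
  rw [LinearMap.smul_apply, covForm_apply, covForm_apply, smul_eq_mul]
  conv_lhs => rw [eq_coordIn_smul k hw (nabla cov k s x u)]
  rw [map_smul, smul_eq_mul, mul_comm]

section Linear

variable [T2Space X] [ContMDiffVectorBundle ∞ ℂ L (𝓡 (2 * n))]

theorem IsSmoothSection.add {k : ℕ} {s t : ∀ x, LPow L k x} (hs : IsSmoothSection n k s)
    (ht : IsSmoothSection n k t) : IsSmoothSection n k fun x ↦ s x + t x := fun x ↦ by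
  simp only [map_add]
  exact (hs x).add (ht x)

theorem IsSmoothSection.const_smul {k : ℕ} {s : ∀ x, LPow L k x} (hs : IsSmoothSection n k s)
    (z : ℂ) : IsSmoothSection n k fun x ↦ z • s x := fun x ↦ by
  simp only [map_smul, smul_eq_mul]
  exact contMDiffAt_const.mul_complex (hs x)

theorem nabla_add {k : ℕ} {s t : ∀ x, LPow L k x} {x : X}
    (hs : MDifferentiableAt (𝓡 (2 * n)) 𝓘(ℝ, ℂ) (fun y ↦ powCoord k x y (s y)) x)
    (ht : MDifferentiableAt (𝓡 (2 * n)) 𝓘(ℝ, ℂ) (fun y ↦ powCoord k x y (t y)) x) :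
    nabla cov k (fun y ↦ s y + t y) x = nabla cov k s x + nabla cov k t x := by
  ext u
  have h : mvfderiv (𝓡 (2 * n)) (fun y ↦ powCoord k x y (s y) + powCoord k x y (t y)) x
      = mvfderiv (𝓡 (2 * n)) (fun y ↦ powCoord k x y (s y)) x
        + mvfderiv (𝓡 (2 * n)) (fun y ↦ powCoord k x y (t y)) x := mvfderiv_add hs ht
  simp only [nabla, map_add, h, LinearMap.smulRight_apply, LinearMap.add_apply, LinearMap.smul_apply,
    ContinuousLinearMap.coe_coe, _root_.add_apply, smul_eq_mul, ← add_smul]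
  congr 1
  ring

theorem nabla_const_smul {k : ℕ} {s : ∀ x, LPow L k x} {x : X}
    (hs : MDifferentiableAt (𝓡 (2 * n)) 𝓘(ℝ, ℂ) (fun y ↦ powCoord k x y (s y)) x) (z : ℂ) :
    nabla cov k (fun y ↦ z • s y) x = z • nabla cov k s x := by
  ext u
  have h := mvfderiv_mul_complex (mdifferentiableAt_const (c := z)) hs u
  simp [nabla, h, mvfderiv_const, smul_smul, mul_add, mul_assoc, mul_left_comm]

theorem IsSmoothSection.mdifferentiableAt {k : ℕ} {s : ∀ x, LPow L k x}
    (hs : IsSmoothSection n k s) (x : X) :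
    MDifferentiableAt (𝓡 (2 * n)) 𝓘(ℝ, ℂ) (fun y ↦ powCoord k x y (s y)) x :=
  (hs x).mdifferentiableAt (by simp)

end Linear

section Chart

variable {p : X} {W : Fin (2 * n) → ∀ x : X, TangentSpace (𝓡 (2 * n)) x} {U : Set X}
  {e : ∀ x, L x} {θ : RModel n → RModel n →L[ℝ] ℝ}

theorem IsChartFrame.mdifferentiableAt (hW : IsChartFrame p W U) {y : X} (hy : y ∈ U) :
    MDifferentiableAt (𝓡 (2 * n)) 𝓘(ℝ, RModel n) (extChartAt (𝓡 (2 * n)) p) y :=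
  ((contMDiffAt_extChartAt' (n := ∞) (hW.subset hy))).mdifferentiableAt (by simp)

theorem IsChartFrame.frameForm_eq (hW : IsChartFrame p W U)
    (hθ : ∀ y ∈ U, ∀ a, θ (extChartAt (𝓡 (2 * n)) p y) (EuclideanSpace.single a 1)
      = frameForm cov e y (W a y)) {y : X} (hy : y ∈ U) (u : TangentSpace (𝓡 (2 * n)) y) :
    frameForm cov e y u = θ (extChartAt (𝓡 (2 * n)) p y)
      (mvfderiv (𝓡 (2 * n)) (extChartAt (𝓡 (2 * n)) p) y u) := by
  set ξ := mvfderiv (𝓡 (2 * n)) (extChartAt (𝓡 (2 * n)) p) y u with hξ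
  have h1 : ξ = ∑ a, ξ a • (EuclideanSpace.single a 1 : RModel n) := by
    ext i
    simp [Pi.single_apply]
  have h2 := hW.expand y hy u
  rw [← hξ] at h2
  rw [h2]
  conv_rhs => rw [h1]
  simp only [map_sum, map_smul, hθ y hy, frameForm, smul_eq_mul, inner_sum]
  simp [Complex.im_sum, inner_smul_right_eq_smul]

theorem coordIn_nabla_of_chart (hcov : IsPrequantumConnection Ω cov) (hW : IsChartFrame p W U)
    (he : IsUnitFrame n e U)
    (hθ : ∀ y ∈ U, ∀ a, θ (extChartAt (𝓡 (2 * n)) p y) (EuclideanSpace.single a 1)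
      = frameForm cov e y (W a y)) {k : ℕ} {s : ∀ x, LPow L k x} {σ : RModel n → ℂ} {y : X}
    (hy : y ∈ U) (hs : ∀ᶠ z in 𝓝 y, coordIn k (e z) (s z) = σ (extChartAt (𝓡 (2 * n)) p z))
    (hσ : DifferentiableAt ℝ σ (extChartAt (𝓡 (2 * n)) p y)) (u : TangentSpace (𝓡 (2 * n)) y) :
    coordIn k (e y) (nabla cov k s y u) = covDeriv k θ σ (extChartAt (𝓡 (2 * n)) p y)
      (mvfderiv (𝓡 (2 * n)) (extChartAt (𝓡 (2 * n)) p) y u) := by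
  have hd : MDifferentiableAt (𝓡 (2 * n)) 𝓘(ℝ, ℂ) (fun z ↦ σ (extChartAt (𝓡 (2 * n)) p z)) y :=
    hσ.mdifferentiableAt.comp y (hW.mdifferentiableAt hy)
  have hs' : (fun z ↦ coordIn k (e z) (s z)) =ᶠ[𝓝 y] fun z ↦ σ (extChartAt (𝓡 (2 * n)) p z) := hs
  rw [coordIn_nabla hcov he hy (hd.congr_of_eventuallyEq hs') u, mvfderiv_congr hs',
    mvfderiv_comp_fderiv hσ (hW.mdifferentiableAt hy), hs.self_of_nhds, covDeriv,
    hW.frameForm_eq hθ hy]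

/-- Near y the field W a is a coordinate field, so ∇_{W a} s is represented in the chart by a
covariant derivative in a constant direction, and the first-order formula applies to it once more.
-/
theorem coordIn_nabla_nabla_of_chart (hcov : IsPrequantumConnection Ω cov)
    (hW : IsChartFrame p W U) (he : IsUnitFrame n e U) (hθs : ContDiff ℝ ∞ θ)
    (hθ : ∀ y ∈ U, ∀ a, θ (extChartAt (𝓡 (2 * n)) p y) (EuclideanSpace.single a 1)
      = frameForm cov e y (W a y)) {k : ℕ} {s : ∀ x, LPow L k x} {σ : RModel n → ℂ}
    (hσ : ContDiff ℝ ∞ σ) {y : X} (hy : y ∈ U)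
    (hs : ∀ᶠ z in 𝓝 y, coordIn k (e z) (s z) = σ (extChartAt (𝓡 (2 * n)) p z))
    (a : Fin (2 * n)) (u : TangentSpace (𝓡 (2 * n)) y) :
    coordIn k (e y) (nabla cov k (fun z ↦ nabla cov k s z (W a z)) y u)
      = covDeriv k θ (fun z ↦ covDeriv k θ σ z (EuclideanSpace.single a 1))
        (extChartAt (𝓡 (2 * n)) p y) (mvfderiv (𝓡 (2 * n)) (extChartAt (𝓡 (2 * n)) p) y u) := by
  refine coordIn_nabla_of_chart hcov hW he hθ hy ?_
    ((contDiff_covDeriv hθs hσ _).differentiable (by simp) _) u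
  filter_upwards [eventually_eventually_nhds.2 hs, hW.isOpen.mem_nhds hy] with z hz hzU
  rw [coordIn_nabla_of_chart hcov hW he hθ hzU hz (hσ.differentiable (by simp) _),
    hW.deriv_field z hzU]

theorem coordIn_nablaTwo_of_chart [T2Space X] [ContMDiffVectorBundle ∞ ℂ L (𝓡 (2 * n))]
    {D : CovariantDerivative (𝓡 (2 * n)) (RModel n)
    (TangentSpace (𝓡 (2 * n)) : X → Type _)} (hcov : IsPrequantumConnection Ω cov)
    (hW : IsChartFrame p W U) (he : IsUnitFrame n e U) {k : ℕ} {s : ∀ x, LPow L k x}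
    (hs : IsSmoothSection n k s) {y : X} (hy : y ∈ U) (u v : TangentSpace (𝓡 (2 * n)) y) :
    coordIn k (e y) (nablaTwo D cov k s y u v)
      = ∑ a, ((mvfderiv (𝓡 (2 * n)) (extChartAt (𝓡 (2 * n)) p) y v : RModel n) a : ℂ)
        * (coordIn k (e y) (nabla cov k (fun z ↦ nabla cov k s z (W a z)) y u)
          - coordIn k (e y) (nabla cov k s y (D (W a) y u))) := by
  have : IsManifold (𝓡 (2 * n)) 1 X := .of_le (n := ∞) (by exact_mod_cast le_top)
  conv_lhs => rw [hW.expand y hy v]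
  simp only [coordIn_nablaTwo (D := D) hcov he hs hy, map_sum, map_smul, Complex.real_smul]
  refine Finset.sum_congr rfl fun a _ ↦ ?_
  rw [← coordIn_nablaTwo (D := D) hcov he hs hy,
    coordIn_nablaTwo_field (D := D) hcov he hs hy u (hW.smooth a), map_sub]

theorem IsChartFrame.exists_preimage (hW : IsChartFrame p W U) {y : X} (hy : y ∈ U) (ξ : RModel n) :
    ∃ u : TangentSpace (𝓡 (2 * n)) y, mvfderiv (𝓡 (2 * n)) (extChartAt (𝓡 (2 * n)) p) y u = ξ := by
  refine ⟨∑ a, ξ a • W a y, ?_⟩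
  simp only [map_sum, map_smul, hW.deriv_field y hy]
  ext i
  simp [Pi.single_apply]

end Chart

end ChartExpressions

/-! ### Extending local data to the model space and back; the Poisson tensor in coordinates. -/

noncomputable section ChartExtension

/-- Cramer's rule: the adjugate and the determinant are polynomial in the entries. -/
theorem contDiffAt_matrix_inv_apply {m : Type*} [Fintype m] [DecidableEq m] {A : m → m → ℝ}
    (hA : (Matrix.of A).det ≠ 0) (i j : m) :
    ContDiffAt ℝ ∞ (fun B : m → m → ℝ ↦ (Matrix.of B)⁻¹ i j) A := by
  have hdet : ContDiff ℝ ∞ fun B : m → m → ℝ ↦ (Matrix.of B).det := by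
    simp only [Matrix.det_apply]
    refine ContDiff.sum fun τ _ ↦ ContDiff.const_smul _ (contDiff_prod fun l _ ↦ ?_)
    simp only [Matrix.of_apply]
    fun_prop
  have hadj : ContDiff ℝ ∞ fun B : m → m → ℝ ↦ (Matrix.of B).adjugate i j := by
    simp only [Matrix.adjugate_apply, Matrix.det_apply]
    refine ContDiff.sum fun τ _ ↦ ContDiff.const_smul _ (contDiff_prod fun l _ ↦ ?_)
    by_cases h : τ l = j
    · simp only [h, Matrix.updateRow_self]
      fun_prop
    · simp only [Matrix.updateRow_ne h, Matrix.of_apply]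
      fun_prop
  have := (hdet.contDiffAt.inv hA).mul (hadj.contDiffAt (x := A))
  refine this.congr_of_eventuallyEq (Eventually.of_forall fun B ↦ ?_)
  simp [Matrix.inv_def, Ring.inverse_eq_inv']

variable {n : ℕ} {X : Type*} [TopologicalSpace X] [ChartedSpace (RModel n) X]
  [IsManifold (𝓡 (2 * n)) ∞ X]

/-- The factor 4 leaves room for nested balls: supports in radius r, their r-thickening in 2r,
agreement with the original data up to 3r, and cutting off before 4r. -/
theorem exists_chart_ball {p : X} {U : Set X} (hU : IsOpen U) (hp : p ∈ U) : ∃ r, 0 < r ∧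
      Metric.closedBall (extChartAt (𝓡 (2 * n)) p p) (4 * r) ⊆ (extChartAt (𝓡 (2 * n)) p).target ∧
      ∀ z ∈ Metric.closedBall (extChartAt (𝓡 (2 * n)) p p) (4 * r),
        (extChartAt (𝓡 (2 * n)) p).symm z ∈ U := by
  have h1 : (extChartAt (𝓡 (2 * n)) p).target ∈ 𝓝 (extChartAt (𝓡 (2 * n)) p p) :=
    extChartAt_target_mem_nhds p
  have h2 : ∀ᶠ z in 𝓝 (extChartAt (𝓡 (2 * n)) p p), (extChartAt (𝓡 (2 * n)) p).symm z ∈ U := by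
    have := (continuousAt_extChartAt_symm (I := 𝓡 (2 * n)) p).tendsto
    rw [extChartAt_to_inv] at this
    exact this (hU.mem_nhds hp)
  obtain ⟨ε, hε, h⟩ := Metric.nhds_basis_closedBall.mem_iff.1 (inter_mem h1 h2)
  refine ⟨ε / 4, by positivity, ?_, ?_⟩
  · rw [mul_div_cancel₀ _ (by norm_num)]
    exact h.trans Set.inter_subset_left
  · rw [mul_div_cancel₀ _ (by norm_num)]
    exact fun z hz ↦ (h hz).2

/-- A smooth function near `p`, read in the chart and cut off. -/
theorem exists_contDiff_chart {G : Type*} [NormedAddCommGroup G] [NormedSpace ℝ G] {p : X}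
    {U : Set X} {r : ℝ} (hr : 0 < r)
    (hr₁ : Metric.closedBall (extChartAt (𝓡 (2 * n)) p p) (4 * r)
      ⊆ (extChartAt (𝓡 (2 * n)) p).target)
    (hr₂ : ∀ z ∈ Metric.closedBall (extChartAt (𝓡 (2 * n)) p p) (4 * r),
      (extChartAt (𝓡 (2 * n)) p).symm z ∈ U) {g : X → G}
    (hg : ∀ y ∈ U, ContMDiffAt (𝓡 (2 * n)) 𝓘(ℝ, G) ∞ g y) : ∃ F : RModel n → G,
      ContDiff ℝ ∞ F ∧
      (∀ z ∈ Metric.closedBall (extChartAt (𝓡 (2 * n)) p p) (3 * r),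
        F z = g ((extChartAt (𝓡 (2 * n)) p).symm z)) ∧
      ∀ z, F z ≠ 0 → z ∈ Metric.closedBall (extChartAt (𝓡 (2 * n)) p p) (4 * r) ∧
        g ((extChartAt (𝓡 (2 * n)) p).symm z) ≠ 0 := by
  set q := extChartAt (𝓡 (2 * n)) p p with hq
  let β : ContDiffBump q := ⟨3 * r, 4 * r, by positivity, by linarith⟩
  refine ⟨fun z ↦ β z • g ((extChartAt (𝓡 (2 * n)) p).symm z), ?_, fun z hz ↦ ?_, fun z hz ↦ ?_⟩
  · rw [contDiff_iff_contDiffAt]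
    intro z
    by_cases hz : z ∈ Metric.closedBall q (4 * r)
    · have h1 : ContMDiffAt 𝓘(ℝ, RModel n) (𝓡 (2 * n)) ∞ (extChartAt (𝓡 (2 * n)) p).symm z :=
        (contMDiffOn_extChartAt_symm p).contMDiffAt
          ((isOpen_extChartAt_target p).mem_nhds (hr₁ hz))
      have h2 := (hg _ (hr₂ z hz)).comp z h1
      exact β.contDiffAt.smul h2.contDiffAt
    · refine (contDiffAt_const (c := (0 : G))).congr_of_eventuallyEq ?_
      filter_upwards [Metric.isClosed_closedBall.isOpen_compl.mem_nhds hz] with w hw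
      have : β w = 0 := β.zero_of_le_dist (by
        simp only [Set.mem_compl_iff, Metric.mem_closedBall, not_le] at hw
        exact hw.le)
      rw [this, zero_smul]
  · simp only
    rw [β.one_of_mem_closedBall hz, one_smul]
  · have h1 := left_ne_zero_of_smul hz
    refine ⟨?_, right_ne_zero_of_smul hz⟩
    by_contra h
    refine h1 (β.zero_of_le_dist ?_)
    simp only [Metric.mem_closedBall, not_le] at h
    exact h.le

/-- A function of the chart at `p` with support in a compact subset of the target, as a function
on the manifold. -/
theorem exists_contMDiff_of_chart [T2Space X] {G : Type*} [NormedAddCommGroup G] [NormedSpace ℝ G]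
    {p : X} {K : Set (RModel n)} (hK : IsCompact K) (hKt : K ⊆ (extChartAt (𝓡 (2 * n)) p).target)
    {F : RModel n → G} (hF : ContDiff ℝ ∞ F) (h0 : ∀ z, z ∉ K → F z = 0) :
    ∃ f : X → G, ContMDiff (𝓡 (2 * n)) 𝓘(ℝ, G) ∞ f ∧
      (∀ y ∈ (extChartAt (𝓡 (2 * n)) p).source, f y = F (extChartAt (𝓡 (2 * n)) p y)) ∧
      ∀ y, y ∉ (extChartAt (𝓡 (2 * n)) p).symm '' K → f y = 0 := by
  classical
  have hcl : IsClosed ((extChartAt (𝓡 (2 * n)) p).symm '' K) :=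
    (hK.image_of_continuousOn ((continuousOn_extChartAt_symm p).mono hKt)).isClosed
  set f : X → G := fun y ↦ if y ∈ (extChartAt (𝓡 (2 * n)) p).source then
    F (extChartAt (𝓡 (2 * n)) p y) else 0 with hf
  have hz (y : X) (hy : y ∉ (extChartAt (𝓡 (2 * n)) p).symm '' K) : f y = 0 := by
    simp only [hf]
    split_ifs with h
    · refine h0 _ fun hk ↦ hy ⟨_, hk, (extChartAt (𝓡 (2 * n)) p).left_inv h⟩
    · rfl
  refine ⟨f, fun y ↦ ?_, fun y hy ↦ if_pos hy, hz⟩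
  by_cases hy : y ∈ (extChartAt (𝓡 (2 * n)) p).symm '' K
  · have hs : y ∈ (extChartAt (𝓡 (2 * n)) p).source := by
      obtain ⟨z, hz, rfl⟩ := hy
      exact (extChartAt (𝓡 (2 * n)) p).map_target (hKt hz)
    have hs' : y ∈ (chartAt (RModel n) p).source := by rwa [extChartAt_source] at hs
    refine (hF.contMDiff.contMDiffAt.comp y (contMDiffAt_extChartAt' hs')).congr_of_eventuallyEq ?_
    filter_upwards [(isOpen_extChartAt_source p).mem_nhds hs] with w hw
    exact if_pos hw
  · refine contMDiffAt_const (c := (0 : G)) |>.congr_of_eventuallyEq ?_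
    filter_upwards [hcl.isOpen_compl.mem_nhds hy] with w hw
    exact hz w hw

variable {Ω : ∀ x : X, TangentSpace (𝓡 (2 * n)) x →L[ℝ] TangentSpace (𝓡 (2 * n)) x →L[ℝ] ℝ}
  {p : X} {W : Fin (2 * n) → ∀ x : X, TangentSpace (𝓡 (2 * n)) x} {U : Set X}

/-- The basis of a tangent space given by a chart frame. -/
theorem IsChartFrame.exists_basis (hW : IsChartFrame p W U) {y : X} (hy : y ∈ U) :
    ∃ b : Module.Basis (Fin (2 * n)) ℝ (TangentSpace (𝓡 (2 * n)) y), ∀ a, b a = W a y := by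
  have hsp : ⊤ ≤ Submodule.span ℝ (Set.range fun a ↦ W a y) := fun u _ ↦ by
    rw [hW.expand y hy u]
    exact Submodule.sum_mem _ fun a _ ↦ Submodule.smul_mem _ _ (Submodule.subset_span ⟨a, rfl⟩)
  have hli : LinearIndependent ℝ fun a ↦ W a y := by
    rw [Fintype.linearIndependent_iff]
    intro ξ hξ a
    have h1 := congrArg (mvfderiv (𝓡 (2 * n)) (extChartAt (𝓡 (2 * n)) p) y) hξ
    simp only [map_sum, map_smul, hW.deriv_field y hy, map_zero] at h1
    have h2 := congrArg (fun v : RModel n ↦ v a) h1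
    simpa [Pi.single_apply] using h2
  exact ⟨Module.Basis.mk hli hsp, fun a ↦ by rw [Module.Basis.mk_apply]⟩

/-- The Gram matrix of `Ω` in the frame `W`. -/
def gram (Ω : ∀ x : X, TangentSpace (𝓡 (2 * n)) x →L[ℝ] TangentSpace (𝓡 (2 * n)) x →L[ℝ] ℝ)
    (W : Fin (2 * n) → ∀ x : X, TangentSpace (𝓡 (2 * n)) x) (y : X) (a b : Fin (2 * n)) : ℝ :=
  Ω y (W a y) (W b y)

/-- Evaluating Ω on the Hamiltonian vector of a dual basis form and a basis vector gives the
Kronecker delta. Thus the Poisson tensor is the inverse of the Gram matrix, up to transposition, and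
is smooth. -/
theorem IsChartFrame.gram_mul {H : ∀ x : X, (TangentSpace (𝓡 (2 * n)) x →ₗ[ℝ] ℝ) →ₗ[ℝ]
    TangentSpace (𝓡 (2 * n)) x} (hH : ∀ x γ v, Ω x (H x γ) v = γ v) {y : X}
    (b : Module.Basis (Fin (2 * n)) ℝ (TangentSpace (𝓡 (2 * n)) y)) (hb : ∀ a, b a = W a y) :
    Matrix.of (fun j i ↦ b.coord i (H y (b.coord j))) * Matrix.of (gram Ω W y) = 1 := by
  ext j l
  rw [Matrix.mul_apply]
  have h1 := hH y (b.coord j) (W l y)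
  rw [← b.sum_repr (H y (b.coord j))] at h1
  simp only [map_sum, map_smul, _root_.sum_apply, _root_.smul_apply, smul_eq_mul, hb] at h1
  simp only [Matrix.of_apply, gram, Module.Basis.coord_apply]
  rw [h1, ← hb l, Module.Basis.coord_apply, Module.Basis.repr_self, Matrix.one_apply,
    Finsupp.single_apply]
  simp only [eq_comm]

theorem IsChartFrame.gram_spec (hW : IsChartFrame p W U)
    {H : ∀ x : X, (TangentSpace (𝓡 (2 * n)) x →ₗ[ℝ] ℝ) →ₗ[ℝ]
    TangentSpace (𝓡 (2 * n)) x} (hH : ∀ x γ v, Ω x (H x γ) v = γ v) {y : X} (hy : y ∈ U) :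
    (Matrix.of (gram Ω W y)).det ≠ 0 ∧ ∀ α β : TangentSpace (𝓡 (2 * n)) y →ₗ[ℝ] ℂ,
      poisson (H y) α β = ∑ i, ∑ j, (((Matrix.of (gram Ω W y))⁻¹ j i : ℝ) : ℂ) * α (W i y) * β (W j y) := by
  obtain ⟨b, hb⟩ := hW.exists_basis hy
  have h := IsChartFrame.gram_mul hH b hb
  refine ⟨fun h0 ↦ ?_, fun α β ↦ ?_⟩
  · have := congrArg Matrix.det h
    rw [Matrix.det_mul, h0, mul_zero, Matrix.det_one] at this
    exact zero_ne_one this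
  · rw [poisson_eq_sum (H y) b, Matrix.inv_eq_left_inv h]
    simp [hb]

theorem IsChartFrame.contMDiffAt_gram_inv (hΩ : IsSymplecticForm Ω) (hW : IsChartFrame p W U)
    {H : ∀ x : X, (TangentSpace (𝓡 (2 * n)) x →ₗ[ℝ] ℝ) →ₗ[ℝ]
    TangentSpace (𝓡 (2 * n)) x} (hH : ∀ x γ v, Ω x (H x γ) v = γ v) {y : X} (hy : y ∈ U)
    (i j : Fin (2 * n)) :
    ContMDiffAt (𝓡 (2 * n)) 𝓘(ℝ, ℝ) ∞ (fun z ↦ (Matrix.of (gram Ω W z))⁻¹ j i) y := by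
  have h1 : ContMDiffAt (𝓡 (2 * n)) 𝓘(ℝ, Fin (2 * n) → Fin (2 * n) → ℝ) ∞ (gram Ω W) y := by
    rw [contMDiffAt_pi_space]
    intro a
    rw [contMDiffAt_pi_space]
    intro b
    exact (hΩ.contMDiff_apply (hW.smooth a) (hW.smooth b)).contMDiffAt
  exact (contDiffAt_matrix_inv_apply (hW.gram_spec hH hy).1 j i).contMDiffAt.comp y h1

end ChartExtension

/-! ### Transfer of first and second order bounds between the manifold and a chart. -/

noncomputable section BoundTransfer

theorem covDeriv_direction_sum {ι E : Type} [NormedAddCommGroup E] [NormedSpace ℝ E]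
    {k : ℕ} {θ : E → E →L[ℝ] ℝ}
    {σ : E → ℂ} (hθ : ContDiff ℝ ∞ θ) (hσ : ContDiff ℝ ∞ σ) (S : Finset ι) (ξ : ι → ℝ)
    (b : ι → E) (x u : E) :
    covDeriv k θ (fun z ↦ covDeriv k θ σ z (∑ a ∈ S, ξ a • b a)) x u
      = ∑ a ∈ S, (ξ a : ℂ) * covDeriv k θ (fun z ↦ covDeriv k θ σ z (b a)) x u := by
  have h1 : (fun z ↦ covDeriv k θ σ z (∑ a ∈ S, ξ a • b a))
      = fun z ↦ ∑ a ∈ S, ξ a • covDeriv k θ σ z (b a) := by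
    funext z
    simp only [covDeriv, map_sum, map_smul, Complex.ofReal_sum, Finset.mul_sum, Finset.sum_mul,
      smul_add, Finset.sum_add_distrib, smul_eq_mul, Complex.real_smul, Complex.ofReal_mul]
    congr 1
    refine Finset.sum_congr rfl fun a _ ↦ ?_
    ring
  have hd (a : ι) : DifferentiableAt ℝ (fun z ↦ ξ a • covDeriv k θ σ z (b a)) x :=
    ((contDiff_covDeriv hθ hσ (b a)).differentiable (by simp) x).const_smul (ξ a)
  have hd' (a : ι) : DifferentiableAt ℝ (fun z ↦ covDeriv k θ σ z (b a)) x :=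
    (contDiff_covDeriv hθ hσ (b a)).differentiable (by simp) x
  have h2 : fderiv ℝ (fun z ↦ ∑ a ∈ S, ξ a • covDeriv k θ σ z (b a)) x u
      = ∑ a ∈ S, ξ a • fderiv ℝ (fun z ↦ covDeriv k θ σ z (b a)) x u := by
    rw [fderiv_fun_sum fun a _ ↦ hd a, _root_.sum_apply]
    refine Finset.sum_congr rfl fun a _ ↦ ?_
    rw [fderiv_fun_const_smul (hd' a), _root_.smul_apply]
  rw [h1, covDeriv, h2, Finset.mul_sum, ← Finset.sum_add_distrib]
  refine Finset.sum_congr rfl fun a _ ↦ ?_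
  simp only [covDeriv, Complex.real_smul]
  ring

theorem sum_apply_smul_single {m : ℕ} (ξ : EuclideanSpace ℝ (Fin m)) :
    ξ = ∑ a, ξ a • (EuclideanSpace.single a 1 : EuclideanSpace ℝ (Fin m)) := by
  ext i
  simp [Pi.single_apply]

variable {n : ℕ} {X : Type*} [TopologicalSpace X] [ChartedSpace (RModel n) X]
  [IsManifold (𝓡 (2 * n)) ∞ X]
  {L : X → Type*} [TopologicalSpace (TotalSpace ℂ L)]
  [∀ x, NormedAddCommGroup (L x)] [∀ x, InnerProductSpace ℂ (L x)]
  [FiberBundle ℂ L] [VectorBundle ℂ ℂ L] [VectorBundle ℝ ℂ L]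
  {Ω : ∀ x : X, TangentSpace (𝓡 (2 * n)) x →L[ℝ] TangentSpace (𝓡 (2 * n)) x →L[ℝ] ℝ}
  {J : ∀ x : X, TangentSpace (𝓡 (2 * n)) x →L[ℝ] TangentSpace (𝓡 (2 * n)) x}
  {D : CovariantDerivative (𝓡 (2 * n)) (RModel n) (TangentSpace (𝓡 (2 * n)) : X → Type _)}
  {cov : CovariantDerivative (𝓡 (2 * n)) ℂ L}
  {p : X} {W : Fin (2 * n) → ∀ x : X, TangentSpace (𝓡 (2 * n)) x} {U : Set X}
  {e : ∀ x, L x} {θ : RModel n → RModel n →L[ℝ] ℝ} {C₀ : ℝ}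

/-- Bounds on a sequence of sections give bounds on its expressions in a chart. -/
theorem exists_bound_covDeriv_of_chart (hcov : IsPrequantumConnection Ω cov)
    (hW : IsChartFrame p W U) (he : IsUnitFrame n e U) (hθs : ContDiff ℝ ∞ θ)
    (hθ : ∀ y ∈ U, ∀ a, θ (extChartAt (𝓡 (2 * n)) p y) (EuclideanSpace.single a 1)
      = frameForm cov e y (W a y)) (hC₀ : 0 ≤ C₀)
    (hU : ∀ y ∈ U, ∀ u : TangentSpace (𝓡 (2 * n)) y,
      gNorm Ω J y u ≤ C₀ * ‖mvfderiv (𝓡 (2 * n)) (extChartAt (𝓡 (2 * n)) p) y u‖)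
    {s : ∀ (k : ℕ) (x : X), LPow L k x} {σ : ℕ → RModel n → ℂ} (hσ : ∀ k, ContDiff ℝ ∞ (σ k))
    (hs : ∀ k, ∀ y ∈ U, coordIn k (e y) (s k y) = σ k (extChartAt (𝓡 (2 * n)) p y))
    (h₁ : HasFirstBound Ω J cov s) (h₂ : HasSecondBound Ω J cov s) :
    ∃ C, 0 ≤ C ∧ ∀ k, 1 ≤ k → ∀ y ∈ U,
      (∀ u, ‖covDeriv k θ (σ k) (extChartAt (𝓡 (2 * n)) p y) u‖ ≤ C * √k * ‖u‖) ∧ ∀ u w,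
        ‖covDeriv k θ (fun z ↦ covDeriv k θ (σ k) z w) (extChartAt (𝓡 (2 * n)) p y) u‖
          ≤ C * k * (‖u‖ * ‖w‖) := by
  obtain ⟨C₁, hC₁, h₁⟩ := h₁
  choose A hA hA2 using fun a ↦ h₂ (W a) (hW.smooth a)
  have hAs : 0 ≤ ∑ a, A a := Finset.sum_nonneg fun a _ ↦ hA a
  refine ⟨(C₁ + ∑ a, A a) * C₀, by positivity, fun k hk y hy ↦ ?_⟩
  have hsy : ∀ᶠ z in 𝓝 y, coordIn k (e z) (s k z) = σ k (extChartAt (𝓡 (2 * n)) p z) := by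
    filter_upwards [hW.isOpen.mem_nhds hy] with z hz using hs k z hz
  constructor
  · intro u
    obtain ⟨w, rfl⟩ := hW.exists_preimage hy u
    rw [← coordIn_nabla_of_chart hcov hW he hθ hy hsy ((hσ k).differentiable (by simp) _),
      ← powNorm_eq k (he.unit y hy)]
    calc _ ≤ C₁ * √k * gNorm Ω J y w := h₁ k hk y w
      _ ≤ (C₁ + ∑ a, A a) * √k
          * (C₀ * ‖mvfderiv (𝓡 (2 * n)) (extChartAt (𝓡 (2 * n)) p) y w‖) := by
          have := hU y hy w
          have := gNorm_nonneg (Ω := Ω) (J := J) w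
          gcongr
          linarith
      _ = _ := by ring
  · intro u w
    obtain ⟨u, rfl⟩ := hW.exists_preimage hy u
    have hw : (fun z ↦ covDeriv k θ (σ k) z w)
        = fun z ↦ covDeriv k θ (σ k) z (∑ a, w a • (EuclideanSpace.single a 1 : RModel n)) := by
      rw [← sum_apply_smul_single]
    rw [hw, covDeriv_direction_sum hθs (hσ k)]
    refine (norm_sum_le _ _).trans ?_
    have hterm (a : Fin (2 * n)) : ‖(w a : ℂ) * covDeriv k θ (fun z ↦ covDeriv k θ (σ k) z
        (EuclideanSpace.single a 1)) (extChartAt (𝓡 (2 * n)) p y)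
        (mvfderiv (𝓡 (2 * n)) (extChartAt (𝓡 (2 * n)) p) y u)‖ ≤ A a * (C₀ * k *
        (‖mvfderiv (𝓡 (2 * n)) (extChartAt (𝓡 (2 * n)) p) y u‖ * ‖w‖)) := by
      rw [← coordIn_nabla_nabla_of_chart hcov hW he hθs hθ (hσ k) hy hsy, norm_mul,
        ← powNorm_eq k (he.unit y hy), Complex.norm_real, Real.norm_eq_abs]
      calc _ ≤ ‖w‖ * (A a * k * gNorm Ω J y u) :=
            mul_le_mul (abs_coord_le w a) (hA2 a k hk y u) (powNorm_nonneg _ _) (norm_nonneg _)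
        _ ≤ ‖w‖ * (A a * k * (C₀ * ‖mvfderiv (𝓡 (2 * n)) (extChartAt (𝓡 (2 * n)) p) y u‖)) := by
            have := hU y hy u
            have := hA a
            gcongr
        _ = _ := by ring
    refine (Finset.sum_le_sum fun a _ ↦ hterm a).trans ?_
    rw [← Finset.sum_mul]
    calc _ ≤ (C₁ + ∑ a, A a) * (C₀ * k *
          (‖mvfderiv (𝓡 (2 * n)) (extChartAt (𝓡 (2 * n)) p) y u‖ * ‖w‖)) := by
          gcongr
          linarith
      _ = _ := by ring

variable [T2Space X] [CompactSpace X] [ContMDiffVectorBundle ∞ ℂ L (𝓡 (2 * n))]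

/-- Bounds on expressions in a chart give bounds on a sequence of sections. -/
theorem exists_bound_of_chart (hΩ : IsSymplecticForm Ω)
    (hJ : IsCompatibleComplexStructure Ω J) (hD : IsLeviCivita Ω J D)
    (hcov : IsPrequantumConnection Ω cov)
    (hW : IsChartFrame p W U) (he : IsUnitFrame n e U) (hθs : ContDiff ℝ ∞ θ)
    (hθ : ∀ y ∈ U, ∀ a, θ (extChartAt (𝓡 (2 * n)) p y) (EuclideanSpace.single a 1)
      = frameForm cov e y (W a y)) (hC₀ : 0 ≤ C₀)
    (hU : ∀ y ∈ U, ∀ u : TangentSpace (𝓡 (2 * n)) y,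
      ‖mvfderiv (𝓡 (2 * n)) (extChartAt (𝓡 (2 * n)) p) y u‖ ≤ C₀ * gNorm Ω J y u)
    {f : ∀ (k : ℕ) (x : X), LPow L k x} {φ : ℕ → RModel n → ℂ} (hφ : ∀ k, ContDiff ℝ ∞ (φ k))
    (hf : ∀ k, IsSmoothSection n k (f k))
    (hfφ : ∀ k, ∀ y ∈ U, coordIn k (e y) (f k y) = φ k (extChartAt (𝓡 (2 * n)) p y)) {C : ℝ}
    (hC : 0 ≤ C) (h : ∀ k, 1 ≤ k → ∀ x, ‖φ k x‖ ≤ C * (k : ℝ)⁻¹ ∧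
      (∀ u, ‖covDeriv k θ (φ k) x u‖ ≤ C * ‖u‖) ∧ ∀ u w,
        ‖covDeriv k θ (fun z ↦ covDeriv k θ (φ k) z w) x u‖ ≤ C * k * (‖u‖ * ‖w‖)) :
    ∃ C', 0 ≤ C' ∧ ∀ k : ℕ, 1 ≤ k → ∀ y ∈ U, powNorm k y (f k y) ≤ C' * (k : ℝ)⁻¹ ∧
      (∀ u, powNorm k y (nabla cov k (f k) y u) ≤ C' * gNorm Ω J y u) ∧
      ∀ u v, powNorm k y (nablaTwo D cov k (f k) y u v)
        ≤ C' * k * (gNorm Ω J y u * gNorm Ω J y v) := by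
  choose B hB hB2 using fun a ↦ exists_bound_leviCivita hΩ hJ hD (hW.smooth a)
  have hBs : 0 ≤ ∑ a, (C₀ * (C * C₀ + C * C₀ * B a)) :=
    Finset.sum_nonneg fun a _ ↦ by have := hB a; positivity
  refine ⟨C + C * C₀ + ∑ a, (C₀ * (C * C₀ + C * C₀ * B a)), by positivity, fun k hk y hy ↦ ?_⟩
  have hsy : ∀ᶠ z in 𝓝 y, coordIn k (e z) (f k z) = φ k (extChartAt (𝓡 (2 * n)) p z) := by
    filter_upwards [hW.isOpen.mem_nhds hy] with z hz using hfφ k z hz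
  obtain ⟨h0, h1, h2⟩ := h k hk (extChartAt (𝓡 (2 * n)) p y)
  have hk1 : (1 : ℝ) ≤ k := by exact_mod_cast hk
  have hfirst (u) : ‖coordIn k (e y) (nabla cov k (f k) y u)‖ ≤ C * C₀ * gNorm Ω J y u := by
    rw [coordIn_nabla_of_chart hcov hW he hθ hy hsy ((hφ k).differentiable (by simp) _)]
    calc _ ≤ _ := h1 _
      _ ≤ C * (C₀ * gNorm Ω J y u) := by gcongr; exact hU y hy u
      _ = _ := by ring
  refine ⟨?_, fun u ↦ ?_, fun u v ↦ ?_⟩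
  · rw [powNorm_eq k (he.unit y hy), hfφ k y hy]
    refine h0.trans ?_
    gcongr
    nlinarith [mul_nonneg hC hC₀]
  · rw [powNorm_eq k (he.unit y hy)]
    refine (hfirst u).trans ?_
    have := gNorm_nonneg (Ω := Ω) (J := J) u
    gcongr
    linarith
  · have hgu := gNorm_nonneg (Ω := Ω) (J := J) u
    have hgv := gNorm_nonneg (Ω := Ω) (J := J) v
    rw [powNorm_eq k (he.unit y hy), coordIn_nablaTwo_of_chart hcov hW he (hf k) hy]
    refine (norm_sum_le _ _).trans ?_
    have hterm (a : Fin (2 * n)) :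
        ‖((mvfderiv (𝓡 (2 * n)) (extChartAt (𝓡 (2 * n)) p) y v : RModel n) a : ℂ)
        * (coordIn k (e y) (nabla cov k (fun z ↦ nabla cov k (f k) z (W a z)) y u)
          - coordIn k (e y) (nabla cov k (f k) y (D (W a) y u)))‖
        ≤ C₀ * (C * C₀ + C * C₀ * B a) * (k * (gNorm Ω J y u * gNorm Ω J y v)) := by
      have i1 : ‖coordIn k (e y) (nabla cov k (fun z ↦ nabla cov k (f k) z (W a z)) y u)‖
          ≤ C * k * (C₀ * gNorm Ω J y u) := by
        rw [coordIn_nabla_nabla_of_chart hcov hW he hθs hθ (hφ k) hy hsy]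
        refine (h2 _ _).trans ?_
        rw [PiLp.norm_single, norm_one, mul_one]
        gcongr
        exact hU y hy u
      have i2 : ‖coordIn k (e y) (nabla cov k (f k) y (D (W a) y u))‖
          ≤ C * C₀ * (B a * gNorm Ω J y u) * k := by
        refine (hfirst _).trans ?_
        refine le_trans ?_ (le_mul_of_one_le_right (by have := hB a; positivity) hk1)
        gcongr
        exact hB2 a y u
      rw [norm_mul, Complex.norm_real, Real.norm_eq_abs]
      calc _ ≤ C₀ * gNorm Ω J y v
            * (C * k * (C₀ * gNorm Ω J y u) + C * C₀ * (B a * gNorm Ω J y u) * k) :=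
            mul_le_mul ((abs_coord_le _ a).trans (hU y hy v))
              ((norm_sub_le _ _).trans (add_le_add i1 i2)) (norm_nonneg _) (by positivity)
        _ = _ := by ring
    refine (Finset.sum_le_sum fun a _ ↦ hterm a).trans ?_
    rw [← Finset.sum_mul, mul_assoc]
    gcongr
    nlinarith [mul_nonneg hC hC₀]

end BoundTransfer

/-! ### The notion of correction, and its linearity in the weight function. -/

noncomputable section Corrections

variable {n : ℕ} {X : Type*} [TopologicalSpace X] [ChartedSpace (RModel n) X]
  [IsManifold (𝓡 (2 * n)) ∞ X]
  {L : X → Type*} [TopologicalSpace (TotalSpace ℂ L)]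
  [∀ x, NormedAddCommGroup (L x)] [∀ x, InnerProductSpace ℂ (L x)]
  [FiberBundle ℂ L] [VectorBundle ℂ ℂ L] [VectorBundle ℝ ℂ L]
  {Ω : ∀ x : X, TangentSpace (𝓡 (2 * n)) x →L[ℝ] TangentSpace (𝓡 (2 * n)) x →L[ℝ] ℝ}
  {J : ∀ x : X, TangentSpace (𝓡 (2 * n)) x →L[ℝ] TangentSpace (𝓡 (2 * n)) x}
  {D : CovariantDerivative (𝓡 (2 * n)) (RModel n) (TangentSpace (𝓡 (2 * n)) : X → Type _)}
  {cov : CovariantDerivative (𝓡 (2 * n)) ℂ L}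
  {H : ∀ x : X, (TangentSpace (𝓡 (2 * n)) x →ₗ[ℝ] ℝ) →ₗ[ℝ] TangentSpace (𝓡 (2 * n)) x}
  {s₀ s₁ : ∀ (k : ℕ) (x : X), LPow L k x}

/-- Near their common zeros the pairing `Π(∇s₀, ∇s₁)` is of order `√k` while `Π(∇s₀, conj ∇s₀)` is
of order `k`. -/
def HasPairingBounds (cov : CovariantDerivative (𝓡 (2 * n)) ℂ L)
    (H : ∀ x : X, (TangentSpace (𝓡 (2 * n)) x →ₗ[ℝ] ℝ) →ₗ[ℝ] TangentSpace (𝓡 (2 * n)) x)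
    (s₀ s₁ : ∀ (k : ℕ) (x : X), LPow L k x) : Prop :=
  ∃ C c : ℝ, 0 ≤ C ∧ 0 < c ∧ ∀ᶠ k : ℕ in atTop, ∀ x : X,
    powNorm k x (s₀ k x) ^ 2 + powNorm k x (s₁ k x) ^ 2 ≤ (k : ℝ)⁻¹ → ∀ v : L x, ‖v‖ = 1 →
      ‖poisson (H x) (covForm cov k v (s₀ k)) (covForm cov k v (s₁ k))‖ ≤ C * √k ∧
      c * k ≤ ‖poisson (H x) (covForm cov k v (s₀ k))
        (Complex.conjAe.toLinearMap ∘ₗ covForm cov k v (s₀ k))‖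

/-- A sequence `f` of small sections, supported near the common zeros of `s₀` and `s₁`, such that
`Π(∇s₀, ∇f) = -ρ Π(∇s₀, ∇s₁)` there. -/
structure IsCorrection
    (Ω : ∀ x : X, TangentSpace (𝓡 (2 * n)) x →L[ℝ] TangentSpace (𝓡 (2 * n)) x →L[ℝ] ℝ)
    (J : ∀ x : X, TangentSpace (𝓡 (2 * n)) x →L[ℝ] TangentSpace (𝓡 (2 * n)) x)
    (cov : CovariantDerivative (𝓡 (2 * n)) ℂ L)
    (H : ∀ x : X, (TangentSpace (𝓡 (2 * n)) x →ₗ[ℝ] ℝ) →ₗ[ℝ] TangentSpace (𝓡 (2 * n)) x)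
    (s₀ s₁ : ∀ (k : ℕ) (x : X), LPow L k x) (ρ : X → ℝ) (f : ∀ (k : ℕ) (x : X), LPow L k x) :
    Prop where
  smooth : ∀ k, IsSmoothSection n k (f k)
  eq_zero : ∀ (k : ℕ) (x : X), (k : ℝ)⁻¹ ≤ powNorm k x (s₀ k x) ^ 2 + powNorm k x (s₁ k x) ^ 2 → f k x = 0
  eq_zero_of_left : ∀ (k : ℕ) (x : X), s₀ k x = 0 → f k x = 0
  bound : ∃ C, 0 ≤ C ∧ ∀ k : ℕ, 1 ≤ k → ∀ x, powNorm k x (f k x) ≤ C * (k : ℝ)⁻¹ ∧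
    ∀ u, powNorm k x (nabla cov k (f k) x u) ≤ C * gNorm Ω J x u
  second : HasSecondBound Ω J cov f
  pairing : ∀ᶠ k : ℕ in atTop, ∀ x, s₀ k x = 0 → s₁ k x = 0 → ∀ v : L x, ‖v‖ = 1 →
    poisson (H x) (covForm cov k v (s₀ k)) (covForm cov k v (f k))
      = -(ρ x : ℂ) * poisson (H x) (covForm cov k v (s₀ k)) (covForm cov k v (s₁ k))

section Algebra

variable [T2Space X] [ContMDiffVectorBundle ∞ ℂ L (𝓡 (2 * n))]

theorem covForm_add {k : ℕ} {s t : ∀ x, LPow L k x} (hs : IsSmoothSection n k s)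
    (ht : IsSmoothSection n k t) {x : X} (v : L x) :
    covForm cov k v (fun x ↦ s x + t x) = covForm cov k v s + covForm cov k v t := by
  rw [covForm, nabla_add (hs.mdifferentiableAt x) (ht.mdifferentiableAt x), LinearMap.comp_add]
  rfl

theorem HasSecondBound.add (hL : IsSmoothHermitian L n) (hcov : IsPrequantumConnection Ω cov)
    {s t : ∀ (k : ℕ) (x : X), LPow L k x} (hs : ∀ k, IsSmoothSection n k (s k))
    (ht : ∀ k, IsSmoothSection n k (t k)) (h : HasSecondBound Ω J cov s)
    (h' : HasSecondBound Ω J cov t) : HasSecondBound Ω J cov fun k x ↦ s k x + t k x := by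
  intro V hV
  obtain ⟨C, hC, h⟩ := h V hV
  obtain ⟨C', hC', h'⟩ := h' V hV
  refine ⟨C + C', by positivity, fun k hk x u ↦ ?_⟩
  have h1 : (fun y ↦ nabla cov k (fun x ↦ s k x + t k x) y (V y))
      = fun y ↦ nabla cov k (s k) y (V y) + nabla cov k (t k) y (V y) := by
    funext y
    rw [nabla_add ((hs k).mdifferentiableAt y) ((ht k).mdifferentiableAt y)]
    rfl
  rw [h1, nabla_add (((hs k).nabla_apply hL hcov hV).mdifferentiableAt x)
    (((ht k).nabla_apply hL hcov hV).mdifferentiableAt x), LinearMap.add_apply]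
  calc _ ≤ _ := powNorm_add_le k _ _
    _ ≤ _ := add_le_add (h k hk x u) (h' k hk x u)
    _ = _ := by ring

theorem HasSecondBound.const_smul (hL : IsSmoothHermitian L n) (hcov : IsPrequantumConnection Ω cov)
    {s : ∀ (k : ℕ) (x : X), LPow L k x} (hs : ∀ k, IsSmoothSection n k (s k))
    (h : HasSecondBound Ω J cov s) (z : ℂ) : HasSecondBound Ω J cov fun k x ↦ z • s k x := by
  intro V hV
  obtain ⟨C, hC, h⟩ := h V hV
  refine ⟨‖z‖ * C, by positivity, fun k hk x u ↦ ?_⟩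
  have h1 : (fun y ↦ nabla cov k (fun x ↦ z • s k x) y (V y))
      = fun y ↦ z • nabla cov k (s k) y (V y) := by
    funext y
    rw [nabla_const_smul ((hs k).mdifferentiableAt y)]
    rfl
  rw [h1, nabla_const_smul (((hs k).nabla_apply hL hcov hV).mdifferentiableAt x),
    LinearMap.smul_apply, powNorm_smul]
  calc _ ≤ _ := mul_le_mul_of_nonneg_left (h k hk x u) (norm_nonneg _)
    _ = _ := by ring

/-- The equation along the common zeros is linear in the pair formed by the weight and the
correction; this is what allows gluing by a partition of unity. -/
theorem IsCorrection.add (hL : IsSmoothHermitian L n) (hcov : IsPrequantumConnection Ω cov)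
    {ρ ρ' : X → ℝ} {f f' : ∀ (k : ℕ) (x : X), LPow L k x}
    (h : IsCorrection Ω J cov H s₀ s₁ ρ f) (h' : IsCorrection Ω J cov H s₀ s₁ ρ' f') :
    IsCorrection Ω J cov H s₀ s₁ (fun x ↦ ρ x + ρ' x) (fun k x ↦ f k x + f' k x) where
  smooth k := (h.smooth k).add (h'.smooth k)
  eq_zero k x hx := by rw [h.eq_zero k x hx, h'.eq_zero k x hx, add_zero]
  eq_zero_of_left k x hx := by
    rw [h.eq_zero_of_left k x hx, h'.eq_zero_of_left k x hx, add_zero]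
  bound := by
    obtain ⟨C, hC, hb⟩ := h.bound
    obtain ⟨C', hC', hb'⟩ := h'.bound
    refine ⟨C + C', by positivity, fun k hk x ↦ ⟨?_, fun u ↦ ?_⟩⟩
    · rw [add_mul]
      exact (powNorm_add_le k _ _).trans (add_le_add (hb k hk x).1 (hb' k hk x).1)
    · rw [nabla_add ((h.smooth k).mdifferentiableAt x) ((h'.smooth k).mdifferentiableAt x), add_mul]
      exact (powNorm_add_le k _ _).trans (add_le_add ((hb k hk x).2 u) ((hb' k hk x).2 u))
  second := h.second.add hL hcov h.smooth h'.smooth h'.second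
  pairing := by
    filter_upwards [h.pairing, h'.pairing] with k hk hk' x hx₀ hx₁ v hv
    rw [covForm_add (h.smooth k) (h'.smooth k), poisson_add_right, hk x hx₀ hx₁ v hv,
      hk' x hx₀ hx₁ v hv]
    push_cast
    ring

theorem isCorrection_zero : IsCorrection Ω J cov H s₀ s₁ (fun _ ↦ 0) fun _ _ ↦ 0 := by
  have h0 (k : ℕ) (x : X) : nabla cov k (fun _ ↦ (0 : LPow L k _)) x = 0 :=
    nabla_eq_zero (Eventually.of_forall fun _ ↦ rfl)
  have hp (k : ℕ) (x : X) : powNorm k x (0 : LPow L k x) = 0 := (powNorm_eq_zero k).2 rfl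
  refine ⟨fun k x ↦ ?_, fun _ _ _ ↦ rfl, fun _ _ _ ↦ rfl, ⟨0, le_rfl, fun k _ x ↦ ⟨?_, fun u ↦ ?_⟩⟩,
    fun V _ ↦ ⟨0, le_rfl, fun k _ x u ↦ ?_⟩, Eventually.of_forall fun k x _ _ v _ ↦ ?_⟩
  · simp only [map_zero]
    exact contMDiffAt_const
  · rw [hp, zero_mul]
  · rw [h0, LinearMap.zero_apply, hp, zero_mul]
  · simp only [h0, LinearMap.zero_apply, hp, zero_mul, le_refl]
  · simp [covForm, h0, poisson]

theorem IsCorrection.exists_sum (hL : IsSmoothHermitian L n) (hcov : IsPrequantumConnection Ω cov)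
    {ι : Type*} (S : Finset ι) {ρ : ι → X → ℝ}
    (h : ∀ i ∈ S, ∃ f, IsCorrection Ω J cov H s₀ s₁ (ρ i) f) :
    ∃ f, IsCorrection Ω J cov H s₀ s₁ (fun x ↦ ∑ i ∈ S, ρ i x) f := by
  classical
  induction S using Finset.induction_on with
  | empty => exact ⟨_, by simpa using isCorrection_zero⟩
  | insert i S hi ih =>
    obtain ⟨f, hf⟩ := h i (Finset.mem_insert_self i S)
    obtain ⟨g, hg⟩ := ih fun j hj ↦ h j (Finset.mem_insert_of_mem hj)
    refine ⟨fun k x ↦ f k x + g k x, ?_⟩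
    simp only [Finset.sum_insert hi]
    exact hf.add hL hcov hg

end Algebra

section Local

variable {p : X} {W : Fin (2 * n) → ∀ x : X, TangentSpace (𝓡 (2 * n)) x} {U : Set X}
  {e : ∀ x, L x} {θ : RModel n → RModel n →L[ℝ] ℝ}

/-- The Poisson pairing of covariant derivatives, in a chart. -/
theorem poisson_covForm_of_chart (hcov : IsPrequantumConnection Ω cov) (hW : IsChartFrame p W U)
    (he : IsUnitFrame n e U)
    (hθ : ∀ y ∈ U, ∀ a, θ (extChartAt (𝓡 (2 * n)) p y) (EuclideanSpace.single a 1)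
      = frameForm cov e y (W a y)) (hH : ∀ x γ v, Ω x (H x γ) v = γ v)
    {P : Fin (2 * n) → Fin (2 * n) → RModel n → ℝ}
    (hP : ∀ y ∈ U, ∀ i j, P i j (extChartAt (𝓡 (2 * n)) p y) = (Matrix.of (gram Ω W y))⁻¹ j i)
    {k : ℕ} {s t : ∀ x, LPow L k x} {σ τ : RModel n → ℂ} (hσ : ContDiff ℝ ∞ σ)
    (hτ : ContDiff ℝ ∞ τ) (hs : ∀ y ∈ U, coordIn k (e y) (s y) = σ (extChartAt (𝓡 (2 * n)) p y))
    (ht : ∀ y ∈ U, coordIn k (e y) (t y) = τ (extChartAt (𝓡 (2 * n)) p y)) {y : X} (hy : y ∈ U) :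
    poisson (H y) (covForm cov k (e y) s) (covForm cov k (e y) t)
      = pairing P (extChartAt (𝓡 (2 * n)) p y)
        (fun a ↦ covDeriv k θ σ (extChartAt (𝓡 (2 * n)) p y) (EuclideanSpace.single a 1))
        (fun a ↦ covDeriv k θ τ (extChartAt (𝓡 (2 * n)) p y) (EuclideanSpace.single a 1)) ∧
    poisson (H y) (covForm cov k (e y) s) (Complex.conjAe.toLinearMap ∘ₗ covForm cov k (e y) t)
      = pairing P (extChartAt (𝓡 (2 * n)) p y)
        (fun a ↦ covDeriv k θ σ (extChartAt (𝓡 (2 * n)) p y) (EuclideanSpace.single a 1))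
        (fun a ↦ (starRingEnd ℂ)
          (covDeriv k θ τ (extChartAt (𝓡 (2 * n)) p y) (EuclideanSpace.single a 1))) := by
  have key {s : ∀ x, LPow L k x} {σ : RModel n → ℂ} (hσ : ContDiff ℝ ∞ σ)
      (hs : ∀ y ∈ U, coordIn k (e y) (s y) = σ (extChartAt (𝓡 (2 * n)) p y)) (a : Fin (2 * n)) :
      covForm cov k (e y) s (W a y) = covDeriv k θ σ (extChartAt (𝓡 (2 * n)) p y)
        (EuclideanSpace.single a 1) := by
    rw [covForm_apply, coordIn_nabla_of_chart hcov hW he hθ hy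
      (Filter.eventually_of_mem (hW.isOpen.mem_nhds hy) hs) (hσ.differentiable (by simp) _),
      hW.deriv_field y hy]
  constructor
  · rw [(hW.gram_spec hH hy).2]
    simp only [key hσ hs, key hτ ht, pairing, hP y hy]
  · rw [(hW.gram_spec hH hy).2]
    simp only [LinearMap.comp_apply, AlgEquiv.toLinearMap_apply, Complex.conjAe_coe, key hσ hs,
      key hτ ht, pairing, hP y hy]

end Local

end Corrections

/-! ### Existence of corrections with small support. -/

noncomputable section LocalCorrection

variable {n : ℕ} {X : Type*} [TopologicalSpace X] [ChartedSpace (RModel n) X]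
  [IsManifold (𝓡 (2 * n)) ∞ X] [T2Space X] [CompactSpace X]
  {L : X → Type*} [TopologicalSpace (TotalSpace ℂ L)]
  [∀ x, NormedAddCommGroup (L x)] [∀ x, InnerProductSpace ℂ (L x)]
  [FiberBundle ℂ L] [VectorBundle ℂ ℂ L] [VectorBundle ℝ ℂ L]
  [ContMDiffVectorBundle ∞ ℂ L (𝓡 (2 * n))]
  {Ω : ∀ x : X, TangentSpace (𝓡 (2 * n)) x →L[ℝ] TangentSpace (𝓡 (2 * n)) x →L[ℝ] ℝ}
  {J : ∀ x : X, TangentSpace (𝓡 (2 * n)) x →L[ℝ] TangentSpace (𝓡 (2 * n)) x}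
  {D : CovariantDerivative (𝓡 (2 * n)) (RModel n) (TangentSpace (𝓡 (2 * n)) : X → Type _)}
  {cov : CovariantDerivative (𝓡 (2 * n)) ℂ L}
  {H : ∀ x : X, (TangentSpace (𝓡 (2 * n)) x →ₗ[ℝ] ℝ) →ₗ[ℝ] TangentSpace (𝓡 (2 * n)) x}
  {s₀ s₁ : ∀ (k : ℕ) (x : X), LPow L k x}

/-- The solution of the model problem in a chart, for all `k`. -/
theorem exists_localPerturbation_all {E ι : Type} [NormedAddCommGroup E] [NormedSpace ℝ E]
    [FiniteDimensional ℝ E] [Fintype ι] {θ : E → E →L[ℝ] ℝ} {P : ι → ι → E → ℝ}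
    {v : ι → E} {ψ : E → ℝ} {σ₀ σ₁ : ℕ → E → ℂ} {r₀ C c : ℝ} (hθ : ContDiff ℝ ∞ θ)
    (hP : ∀ i j, ContDiff ℝ ∞ (P i j)) (hv : ∀ a, ‖v a‖ ≤ 1) (hψ : ContDiff ℝ ∞ ψ)
    (hψc : HasCompactSupport ψ) (hσ₀ : ∀ k, ContDiff ℝ ∞ (σ₀ k)) (hσ₁ : ∀ k, ContDiff ℝ ∞ (σ₁ k))
    (hr₀ : 0 < r₀) (hC : 0 ≤ C) (hc : 0 < c)
    (hcov : ∀ k, 1 ≤ k → ∀ σ, σ = σ₀ k ∨ σ = σ₁ k → ∀ y ∈ Metric.cthickening r₀ (tsupport ψ),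
      (∀ u, ‖covDeriv k θ σ y u‖ ≤ C * Real.sqrt k * ‖u‖) ∧ ∀ u w,
        ‖covDeriv k θ (fun z ↦ covDeriv k θ σ z w) y u‖ ≤ C * k * (‖u‖ * ‖w‖))
    (hpair : ∀ᶠ k : ℕ in atTop, ∀ x ∈ tsupport ψ, pairSq (σ₀ k) (σ₁ k) x ≤ (k : ℝ)⁻¹ →
      ‖pairing P x (fun a ↦ covDeriv k θ (σ₀ k) x (v a)) (fun a ↦ covDeriv k θ (σ₁ k) x (v a))‖
        ≤ C * Real.sqrt k ∧
      c * k ≤ ‖pairing P x (fun a ↦ covDeriv k θ (σ₀ k) x (v a))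
        (fun a ↦ (starRingEnd ℂ) (covDeriv k θ (σ₀ k) x (v a)))‖) :
    ∃ (f : ℕ → E → ℂ) (C' : ℝ), 0 ≤ C' ∧ (∀ k, ContDiff ℝ ∞ (f k) ∧
      (∀ x, x ∉ tsupport ψ → f k x = 0) ∧
      (∀ x, (k : ℝ)⁻¹ ≤ pairSq (σ₀ k) (σ₁ k) x → f k x = 0) ∧ (∀ x, σ₀ k x = 0 → f k x = 0) ∧
      (∀ x, ‖f k x‖ ≤ C' * (k : ℝ)⁻¹ ∧ (∀ u, ‖covDeriv k θ (f k) x u‖ ≤ C' * ‖u‖) ∧ ∀ u w,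
        ‖covDeriv k θ (fun z ↦ covDeriv k θ (f k) z w) x u‖ ≤ C' * k * (‖u‖ * ‖w‖))) ∧
      ∀ᶠ k : ℕ in atTop, ∀ x, σ₀ k x = 0 → σ₁ k x = 0 →
        pairing P x (fun a ↦ covDeriv k θ (σ₀ k) x (v a)) (fun a ↦ covDeriv k θ (f k) x (v a))
          = -(ψ x : ℂ) * pairing P x (fun a ↦ covDeriv k θ (σ₀ k) x (v a))
            (fun a ↦ covDeriv k θ (σ₁ k) x (v a)) := by
  obtain ⟨f, C', hf⟩ := exists_localPerturbation hθ hP hv hψ hψc hσ₀ hσ₁ hr₀ hC hc hcov hpair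
  obtain ⟨k₀, hk₀⟩ := eventually_atTop.1 hf
  have hcz (k : ℕ) (x u : E) : covDeriv k θ (fun _ ↦ 0) x u = 0 := by
    simp [covDeriv]
  -- For the finitely many small k nothing is known about the construction, so it is replaced by
  -- zero: the bounds of a correction are required for every k ≥ 1, the equation only for large k.
  refine ⟨fun k ↦ if k₀ ≤ k then f k else fun _ ↦ 0, max C' 0, le_max_right _ _, fun k ↦ ?_, ?_⟩
  · beta_reduce
    split_ifs with h
    · obtain ⟨h1, h2, h3, h4, h5, -⟩ := hk₀ k h
      refine ⟨h1, h2, h3, h4, fun x ↦ ⟨(h5 x).1.trans ?_, fun u ↦ ((h5 x).2.1 u).trans ?_,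
        fun u w ↦ ((h5 x).2.2 u w).trans ?_⟩⟩ <;> gcongr <;> exact le_max_left _ _
    · refine ⟨contDiff_const, fun _ _ ↦ rfl, fun _ _ ↦ rfl, fun _ _ ↦ rfl, fun x ↦ ⟨?_, fun u ↦ ?_,
        fun u w ↦ ?_⟩⟩
      · rw [norm_zero]
        positivity
      · rw [hcz, norm_zero]
        positivity
      · simp only [hcz, norm_zero]
        positivity
  · filter_upwards [eventually_ge_atTop k₀] with k hk
    simp only [if_pos hk]
    exact (hk₀ k hk).2.2.2.2.2

/-- Every point has a neighbourhood in which corrections can be constructed. -/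
theorem exists_local_isCorrection (hL : IsSmoothHermitian L n) (hΩ : IsSymplecticForm Ω)
    (hJ : IsCompatibleComplexStructure Ω J) (hD : IsLeviCivita Ω J D)
    (hcov : IsPrequantumConnection Ω cov) (hH : ∀ x γ v, Ω x (H x γ) v = γ v)
    (hs₀ : ∀ k, IsSmoothSection n k (s₀ k)) (hs₁ : ∀ k, IsSmoothSection n k (s₁ k))
    (hF₀ : HasFirstBound Ω J cov s₀) (hF₁ : HasFirstBound Ω J cov s₁)
    (hS₀ : HasSecondBound Ω J cov s₀) (hS₁ : HasSecondBound Ω J cov s₁)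
    (hpair : HasPairingBounds cov H s₀ s₁) (p : X) :
    ∃ V : Set X, IsOpen V ∧ p ∈ V ∧ ∀ ρ : X → ℝ, ContMDiff (𝓡 (2 * n)) 𝓘(ℝ, ℝ) ∞ ρ →
      tsupport ρ ⊆ V → ∃ f, IsCorrection Ω J cov H s₀ s₁ ρ f := by
  obtain ⟨W, U₁, hp₁, hW⟩ := exists_isChartFrame (n := n) p
  obtain ⟨e, U₂, hp₂, he⟩ := exists_isUnitFrame hL p
  obtain ⟨C₀, hC₀, hgb⟩ := hW.exists_gNorm_bounds hΩ hJ hp₁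
  obtain ⟨U₃, hU₃, hU₃o, hp₃⟩ := eventually_nhds_iff.1 (hgb.and (he.isOpen.mem_nhds hp₂))
  have hW₃ := hW.mono hU₃o fun y hy ↦ (hU₃ y hy).1.1
  have he₃ := he.mono hU₃o fun y hy ↦ (hU₃ y hy).2
  set φ := extChartAt (𝓡 (2 * n)) p with hφ
  obtain ⟨r, hr, hr₁, hr₂⟩ := exists_chart_ball (n := n) hU₃o hp₃
  set q := φ p with hq
  -- the neighbourhoods on which the cut-off expressions agree with the given ones
  have hball (t : ℝ) : IsOpen (φ.source ∩ φ ⁻¹' Metric.ball q t) :=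
    (continuousOn_extChartAt p).isOpen_inter_preimage (isOpen_extChartAt_source p) Metric.isOpen_ball
  set U := U₃ ∩ (φ.source ∩ φ ⁻¹' Metric.ball q (3 * r)) with hU
  have hUo : IsOpen U := hU₃o.inter (hball _)
  have hWU := hW₃.mono hUo Set.inter_subset_left
  have heU := he₃.mono hUo Set.inter_subset_left
  have hback (z : RModel n) (hz : z ∈ Metric.ball q (3 * r)) : φ.symm z ∈ U ∧ φ (φ.symm z) = z := by
    have h4 : z ∈ Metric.closedBall q (4 * r) :=
      Metric.closedBall_subset_closedBall (by linarith) (Metric.ball_subset_closedBall hz)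
    have h5 := φ.right_inv (hr₁ h4)
    exact ⟨⟨hr₂ z h4, φ.map_target (hr₁ h4), by simpa only [Set.mem_preimage, h5] using hz⟩, h5⟩
  have hval (y : X) (hy : y ∈ U) : φ y ∈ Metric.closedBall q (3 * r) ∧ φ.symm (φ y) = y :=
    ⟨Metric.ball_subset_closedBall hy.2.2, φ.left_inv hy.2.1⟩
  refine ⟨U₃ ∩ (φ.source ∩ φ ⁻¹' Metric.ball q r), hU₃o.inter (hball _),
    ⟨hp₃, mem_extChartAt_source p, Metric.mem_ball_self hr⟩, fun ρ hρ hρV ↦ ?_⟩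
  -- expressions in the chart
  choose θc hθc hθv _ using fun a ↦ exists_contDiff_chart (p := p) hr hr₁ hr₂
    (g := fun y ↦ frameForm cov e y (W a y))
    fun y hy ↦ contMDiffAt_frameForm hL hcov he.smooth (hW.smooth a).contMDiffAt
  choose P hP hPv _ using fun i j ↦ exists_contDiff_chart (p := p) hr hr₁ hr₂
    (g := fun y ↦ (Matrix.of (gram Ω W y))⁻¹ j i)
    fun y hy ↦ hW₃.contMDiffAt_gram_inv hΩ hH hy i j
  choose σ₀ hσ₀ hσ₀v _ using fun k ↦ exists_contDiff_chart (p := p) hr hr₁ hr₂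
    (g := fun y ↦ coordIn k (e y) (s₀ k y)) fun y hy ↦ (hs₀ k).coordIn he₃ hy
  choose σ₁ hσ₁ hσ₁v _ using fun k ↦ exists_contDiff_chart (p := p) hr hr₁ hr₂
    (g := fun y ↦ coordIn k (e y) (s₁ k y)) fun y hy ↦ (hs₁ k).coordIn he₃ hy
  obtain ⟨ψ, hψ, hψv, hψs⟩ := exists_contDiff_chart (p := p) hr hr₁ hr₂ (g := ρ)
    fun y _ ↦ hρ.contMDiffAt
  -- The 1-form whose components are the cut-off connection coefficients; it is globally smooth and
  -- agrees with the connection form over U.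
  set θ : RModel n → RModel n →L[ℝ] ℝ := fun z ↦ ∑ a, θc a z • EuclideanSpace.proj a with hθdef
  have hθs : ContDiff ℝ ∞ θ := ContDiff.sum fun a _ ↦ (hθc a).smul contDiff_const
  have hθ (y : X) (hy : y ∈ U) (a : Fin (2 * n)) :
      θ (φ y) (EuclideanSpace.single a 1) = frameForm cov e y (W a y) := by
    have h1 := (hθv a (φ y) (hval y hy).1).trans
      (congrArg (fun y ↦ frameForm cov e y (W a y)) (hval y hy).2)
    rw [← h1]
    simp [hθdef, _root_.sum_apply]
  have hPU (y : X) (hy : y ∈ U) (i j : Fin (2 * n)) :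
      P i j (φ y) = (Matrix.of (gram Ω W y))⁻¹ j i := by
    have h1 := hPv i j (φ y) (hval y hy).1
    simpa only [← hφ, (hval y hy).2] using h1
  have hσ₀U (k : ℕ) (y : X) (hy : y ∈ U) : coordIn k (e y) (s₀ k y) = σ₀ k (φ y) := by
    exact ((hσ₀v k (φ y) (hval y hy).1).trans
      (congrArg (fun y ↦ coordIn k (e y) (s₀ k y)) (hval y hy).2)).symm
  have hσ₁U (k : ℕ) (y : X) (hy : y ∈ U) : coordIn k (e y) (s₁ k y) = σ₁ k (φ y) := by
    exact ((hσ₁v k (φ y) (hval y hy).1).trans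
      (congrArg (fun y ↦ coordIn k (e y) (s₁ k y)) (hval y hy).2)).symm
  have hψU (y : X) (hy : y ∈ U) : ψ (φ y) = ρ y := by
    have h1 := hψv (φ y) (hval y hy).1
    simpa only [← hφ, (hval y hy).2] using h1
  have hψK : tsupport ψ ⊆ Metric.closedBall q r := by
    refine closure_minimal (fun z hz ↦ ?_) Metric.isClosed_closedBall
    obtain ⟨h1, h2⟩ := hψs z hz
    have h3 := hρV (subset_tsupport ρ h2)
    have h4 := h3.2.2
    rw [Set.mem_preimage, φ.right_inv (hr₁ h1)] at h4
    exact Metric.ball_subset_closedBall h4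
  have hψc : HasCompactSupport ψ :=
    (isCompact_closedBall q r).of_isClosed_subset (isClosed_tsupport ψ) hψK
  have hsub : Metric.closedBall q r ⊆ Metric.ball q (3 * r) :=
    Metric.closedBall_subset_ball (by linarith)
  -- bounds
  have hup (y : X) (hy : y ∈ U) (u : TangentSpace (𝓡 (2 * n)) y) := ((hU₃ y hy.1).1.2 u).1
  have hlow (y : X) (hy : y ∈ U) (u : TangentSpace (𝓡 (2 * n)) y) := ((hU₃ y hy.1).1.2 u).2
  obtain ⟨A₀, hA₀, hb₀⟩ := exists_bound_covDeriv_of_chart hcov hWU heU hθs hθ hC₀.le hlow hσ₀ hσ₀U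
    hF₀ hS₀
  obtain ⟨A₁, hA₁, hb₁⟩ := exists_bound_covDeriv_of_chart hcov hWU heU hθs hθ hC₀.le hlow hσ₁ hσ₁U
    hF₁ hS₁
  obtain ⟨A₂, c, hA₂, hc, hpair⟩ := hpair
  obtain ⟨f, C', hC', hf, hfp⟩ := exists_localPerturbation_all (P := P)
    (v := fun a : Fin (2 * n) ↦ (EuclideanSpace.single a 1 : RModel n)) (ψ := ψ) (σ₀ := σ₀)
    (σ₁ := σ₁) (r₀ := r) (C := A₀ + A₁ + A₂) (c := c) hθs hP (fun a ↦ by simp) hψ hψc hσ₀ hσ₁ hr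
    (by positivity) hc (by
      intro k hk σ hσ z hz
      -- The support of ψ lies in the closed ball of radius r, so its r-thickening lies in the
      -- closed ball of radius 2r, where the chart expressions are the true ones.
      have hz' : z ∈ Metric.ball q (3 * r) := by
        have h1 := Metric.cthickening_mono (le_refl r) _ |>.trans
          (Metric.cthickening_subset_of_subset r hψK) hz
        rw [cthickening_closedBall hr.le hr.le] at h1
        exact Metric.closedBall_subset_ball (by linarith) h1
      obtain ⟨h1, h2⟩ := hback z hz'
      have hc₀ := hb₀ k hk _ h1
      have hc₁ := hb₁ k hk _ h1
      rw [← hφ, h2] at hc₀ hc₁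
      rcases hσ with rfl | rfl
      · refine ⟨fun u ↦ (hc₀.1 u).trans ?_, fun u w ↦ (hc₀.2 u w).trans ?_⟩ <;> gcongr <;> linarith
      · refine ⟨fun u ↦ (hc₁.1 u).trans ?_, fun u w ↦ (hc₁.2 u w).trans ?_⟩ <;> gcongr <;> linarith) (by
      filter_upwards [hpair] with k hk z hz hzp
      obtain ⟨h1, h2⟩ := hback z (hsub (hψK hz))
      have hu := heU.unit _ h1
      have h3 := hk (φ.symm z) (by
        rw [powNorm_eq k hu, powNorm_eq k hu, hσ₀U k _ h1, hσ₁U k _ h1, h2]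
        exact hzp) _ hu
      rw [(poisson_covForm_of_chart hcov hWU heU hθ hH hPU (hσ₀ k) (hσ₁ k) (hσ₀U k) (hσ₁U k) h1).1,
        (poisson_covForm_of_chart hcov hWU heU hθ hH hPU (hσ₀ k) (hσ₀ k) (hσ₀U k) (hσ₀U k) h1).2,
        ← hφ, h2] at h3
      refine ⟨h3.1.trans ?_, h3.2⟩
      gcongr
      linarith)
  -- back to the manifold
  have hKt : Metric.closedBall q r ⊆ φ.target :=
    (Metric.closedBall_subset_closedBall (by linarith)).trans hr₁
  choose F hF hFs hF0 using fun k ↦ exists_contMDiff_of_chart (p := p) (isCompact_closedBall q r) hKt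
    (hf k).1 fun z hz ↦ (hf k).2.1 z fun h ↦ hz (hψK h)
  have hKcl : IsClosed (φ.symm '' Metric.closedBall q r) :=
    ((isCompact_closedBall q r).image_of_continuousOn
      ((continuousOn_extChartAt_symm p).mono hKt)).isClosed
  have hKU (x : X) (hx : x ∈ φ.symm '' Metric.closedBall q r) : x ∈ U := by
    obtain ⟨z, hz, rfl⟩ := hx
    exact (hback z (hsub hz)).1
  set g : ∀ (k : ℕ) (x : X), LPow L k x := fun k y ↦ F k y • PiTensorProduct.tprod ℂ fun _ ↦ e y
    with hg
  have hgs (k : ℕ) : IsSmoothSection n k (g k) := isSmoothSection_smul_tprod (hF k) he.smooth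
  have hg0 (k : ℕ) (x : X) (hx : x ∉ φ.symm '' Metric.closedBall q r) : g k x = 0 := by
    simp only [hg]
    rw [hF0 k x hx, zero_smul]
  have hg0' (k : ℕ) (x : X) (hx : x ∉ φ.symm '' Metric.closedBall q r) :
      ∀ᶠ y in 𝓝 x, g k y = 0 := by
    filter_upwards [hKcl.isOpen_compl.mem_nhds hx] with y hy using hg0 k y hy
  have hgU (k : ℕ) (y : X) (hy : y ∈ U) : coordIn k (e y) (g k y) = f k (φ y) := by
    simp only [hg]
    rw [map_smul, coordIn_self k (heU.unit y hy), hFs k y hy.2.1, smul_eq_mul, mul_one]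
  have hgz (k : ℕ) (x : X) (h : x ∈ U → f k (φ x) = 0) : g k x = 0 := by
    by_cases hx : x ∈ U
    · exact coordIn_injective k (heU.unit x hx) (by rw [hgU k x hx, h hx, map_zero])
    · exact hg0 k x fun h' ↦ hx (hKU x h')
  obtain ⟨C, hC, hbd⟩ := exists_bound_of_chart hΩ hJ hD hcov hWU heU hθs hθ hC₀.le hup
    (fun k ↦ (hf k).1) hgs hgU hC' fun k _ x ↦ (hf k).2.2.2.2 x
  have hp0 (k : ℕ) (x : X) : powNorm k x (0 : LPow L k x) = 0 := (powNorm_eq_zero k).2 rfl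
  have hbd' (k : ℕ) (hk : 1 ≤ k) (x : X) : powNorm k x (g k x) ≤ C * (k : ℝ)⁻¹ ∧
      (∀ u, powNorm k x (nabla cov k (g k) x u) ≤ C * gNorm Ω J x u) ∧
      ∀ u v, powNorm k x (nablaTwo D cov k (g k) x u v)
        ≤ C * k * (gNorm Ω J x u * gNorm Ω J x v) := by
    by_cases hx : x ∈ U
    · exact hbd k hk x hx
    · have hx' : x ∉ φ.symm '' Metric.closedBall q r := fun h' ↦ hx (hKU x h')
      refine ⟨?_, fun u ↦ ?_, fun u v ↦ ?_⟩
      · rw [hg0 k x hx', hp0]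
        positivity
      · rw [nabla_eq_zero (hg0' k x hx'), LinearMap.zero_apply, hp0]
        exact mul_nonneg hC (gNorm_nonneg _)
      · rw [nablaTwo_eq_zero (hg0' k x hx'), hp0]
        have := gNorm_nonneg (Ω := Ω) (J := J) u
        have := gNorm_nonneg (Ω := Ω) (J := J) v
        positivity
  refine ⟨g, hgs, fun k x hx ↦ hgz k x fun hxU ↦ ?_, fun k x hx ↦ hgz k x fun hxU ↦ ?_,
    ⟨C, hC, fun k hk x ↦ ⟨(hbd' k hk x).1, (hbd' k hk x).2.1⟩⟩,
    hasSecondBound_of_nablaTwo hL hΩ hJ hD hcov hgs ⟨C, hC, fun k hk x u ↦ ?_⟩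
      fun k hk x ↦ (hbd' k hk x).2.2, ?_⟩
  · have hu := heU.unit _ hxU
    rw [powNorm_eq k hu, powNorm_eq k hu, hσ₀U k _ hxU, hσ₁U k _ hxU] at hx
    exact (hf k).2.2.1 _ hx
  · refine (hf k).2.2.2.1 _ ?_
    rw [← hσ₀U k _ hxU, hx, map_zero]
  · refine ((hbd' k hk x).2.1 u).trans ?_
    have hk1 : (1 : ℝ) ≤ √k := by
      rw [Real.one_le_sqrt]
      exact_mod_cast hk
    have := gNorm_nonneg (Ω := Ω) (J := J) u
    gcongr
    exact le_mul_of_one_le_right hC hk1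
  · filter_upwards [hfp] with k hk x hx₀ hx₁ v hv
    by_cases hx : x ∈ U
    · have hu := heU.unit x hx
      have h1 := hk (φ x) (by rw [← hσ₀U k x hx, hx₀, map_zero])
        (by rw [← hσ₁U k x hx, hx₁, map_zero])
      rw [← (poisson_covForm_of_chart hcov hWU heU hθ hH hPU (hσ₀ k) (hσ₁ k) (hσ₀U k) (hσ₁U k) hx).1,
        ← (poisson_covForm_of_chart hcov hWU heU hθ hH hPU (hσ₀ k) (hf k).1 (hσ₀U k) (hgU k) hx).1,
        hψU x hx] at h1
      -- Passing to another unit vector multiplies the three forms by the same complex number, so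
      -- both sides of the equation scale alike.
      rw [covForm_eq_smul v hu (s₀ k), covForm_eq_smul v hu (s₁ k), covForm_eq_smul v hu (g k)]
      simp only [poisson_smul_left, poisson_smul_right, h1]
      ring
    · have hx' : x ∉ φ.symm '' Metric.closedBall q r := fun h' ↦ hx (hKU x h')
      have h1 : covForm cov k v (g k) = 0 := by
        rw [covForm, nabla_eq_zero (hg0' k x hx'), LinearMap.comp_zero]
      have h2 : ρ x = 0 := by
        by_contra h
        have h3 := hρV (subset_tsupport ρ h)
        exact hx ⟨h3.1, h3.2.1, Metric.ball_subset_ball (by linarith) h3.2.2⟩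
      rw [h1, h2]
      simp [poisson]

end LocalCorrection

/-! ### Gluing the corrections and making them symmetric. -/

noncomputable section GlobalCorrection

section LinearAlgebra

variable {V : Type*} [AddCommGroup V] [Module ℝ V] {Φ : V →ₗ[ℝ] V →ₗ[ℝ] ℝ} {J : V →ₗ[ℝ] V}
  {H : (V →ₗ[ℝ] ℝ) →ₗ[ℝ] V}

theorem CompatiblePair.poisson_antisymm (h : CompatiblePair Φ J) (hH : ∀ γ v, Φ (H γ) v = γ v)
    (α β : V →ₗ[ℝ] ℂ) : poisson H α β = -poisson H β α := by
  have key (γ γ' : V →ₗ[ℝ] ℝ) : γ (H γ') = -γ' (H γ) := by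
    rw [← hH γ', ← hH γ, h.antisymm]
  have hab (α : V →ₗ[ℝ] ℂ) (u : V) : α u
      = ((Complex.reLm ∘ₗ α) u : ℂ) + Complex.I * ((Complex.imLm ∘ₗ α) u : ℂ) := by
    conv_lhs => rw [← Complex.re_add_im (α u)]
    simp [mul_comm]
  rw [poisson, poisson, hab α, hab α, hab β, hab β, key (Complex.reLm ∘ₗ α) (Complex.reLm ∘ₗ β),
    key (Complex.imLm ∘ₗ α) (Complex.reLm ∘ₗ β), key (Complex.reLm ∘ₗ α) (Complex.imLm ∘ₗ β),
    key (Complex.imLm ∘ₗ α) (Complex.imLm ∘ₗ β)]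
  push_cast
  ring

theorem CompatiblePair.poisson_self (h : CompatiblePair Φ J) (hH : ∀ γ v, Φ (H γ) v = γ v)
    (α : V →ₗ[ℝ] ℂ) : poisson H α α = 0 := by
  have := h.poisson_antisymm hH α α
  exact self_eq_neg.1 this

/-- Poisson pairings under an antisymplectic map. -/
theorem poisson_antisymplectic {V' : Type*} [AddCommGroup V'] [Module ℝ V']
    {Φ' : V' →ₗ[ℝ] V' →ₗ[ℝ] ℝ} {H' : (V' →ₗ[ℝ] ℝ) →ₗ[ℝ] V'} (hH : ∀ γ v, Φ (H γ) v = γ v)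
    (hH' : ∀ γ v, Φ' (H' γ) v = γ v) (hnd : ∀ u, (∀ v, Φ' u v = 0) → u = 0) {T : V →ₗ[ℝ] V'}
    (hT : Function.Surjective T) (hTΦ : ∀ u v, Φ' (T u) (T v) = -Φ u v) (α β : V' →ₗ[ℝ] ℂ) :
    poisson H (Complex.conjAe.toLinearMap ∘ₗ α ∘ₗ T) (Complex.conjAe.toLinearMap ∘ₗ β ∘ₗ T)
      = -(starRingEnd ℂ) (poisson H' α β) := by
  -- An antisymplectic map carries Hamiltonian vectors to Hamiltonian vectors with the opposite
  -- sign.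
  have key (γ : V' →ₗ[ℝ] ℝ) : T (H (γ ∘ₗ T)) = -H' γ := by
    rw [eq_neg_iff_add_eq_zero]
    refine hnd _ fun v ↦ ?_
    obtain ⟨v, rfl⟩ := hT v
    rw [map_add, LinearMap.add_apply, hTΦ, hH, hH', LinearMap.comp_apply, neg_add_cancel]
  have e₁ : Complex.reLm ∘ₗ Complex.conjAe.toLinearMap ∘ₗ β ∘ₗ T = (Complex.reLm ∘ₗ β) ∘ₗ T := by
    ext u; simp
  have e₂ : Complex.imLm ∘ₗ Complex.conjAe.toLinearMap ∘ₗ β ∘ₗ T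
      = -((Complex.imLm ∘ₗ β) ∘ₗ T) := by
    ext u; simp
  have e₃ (u : V) : (Complex.conjAe.toLinearMap ∘ₗ α ∘ₗ T) u = (starRingEnd ℂ) (α (T u)) := by
    simp
  rw [poisson, e₁, e₂, map_neg, e₃, e₃, map_neg, key, key, poisson]
  simp only [map_neg, neg_neg, map_add, map_mul, Complex.conj_I]
  ring

end LinearAlgebra

variable {n : ℕ} {X : Type*} [TopologicalSpace X] [ChartedSpace (RModel n) X]
  [IsManifold (𝓡 (2 * n)) ∞ X] [T2Space X] [CompactSpace X]
  {L : X → Type*} [TopologicalSpace (TotalSpace ℂ L)]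
  [∀ x, NormedAddCommGroup (L x)] [∀ x, InnerProductSpace ℂ (L x)]
  [FiberBundle ℂ L] [VectorBundle ℂ ℂ L] [VectorBundle ℝ ℂ L]
  [ContMDiffVectorBundle ∞ ℂ L (𝓡 (2 * n))]
  {Ω : ∀ x : X, TangentSpace (𝓡 (2 * n)) x →L[ℝ] TangentSpace (𝓡 (2 * n)) x →L[ℝ] ℝ}
  {J : ∀ x : X, TangentSpace (𝓡 (2 * n)) x →L[ℝ] TangentSpace (𝓡 (2 * n)) x}
  {D : CovariantDerivative (𝓡 (2 * n)) (RModel n) (TangentSpace (𝓡 (2 * n)) : X → Type _)}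
  {cov : CovariantDerivative (𝓡 (2 * n)) ℂ L}
  {H : ∀ x : X, (TangentSpace (𝓡 (2 * n)) x →ₗ[ℝ] ℝ) →ₗ[ℝ] TangentSpace (𝓡 (2 * n)) x}
  {s₀ s₁ : ∀ (k : ℕ) (x : X), LPow L k x}

/-- Partition of unity subordinate to finitely many of the neighbourhoods where corrections exist;
the weights add up to 1. -/
theorem exists_isCorrection (hL : IsSmoothHermitian L n) (hΩ : IsSymplecticForm Ω)
    (hJ : IsCompatibleComplexStructure Ω J) (hD : IsLeviCivita Ω J D)
    (hcov : IsPrequantumConnection Ω cov) (hH : ∀ x γ v, Ω x (H x γ) v = γ v)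
    (hs₀ : ∀ k, IsSmoothSection n k (s₀ k)) (hs₁ : ∀ k, IsSmoothSection n k (s₁ k))
    (hF₀ : HasFirstBound Ω J cov s₀) (hF₁ : HasFirstBound Ω J cov s₁)
    (hS₀ : HasSecondBound Ω J cov s₀) (hS₁ : HasSecondBound Ω J cov s₁)
    (hpair : HasPairingBounds cov H s₀ s₁) :
    ∃ f, IsCorrection Ω J cov H s₀ s₁ (fun _ ↦ 1) f := by
  choose V hV hpV hVf using
    exists_local_isCorrection hL hΩ hJ hD hcov hH hs₀ hs₁ hF₀ hF₁ hS₀ hS₁ hpair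
  obtain ⟨S, hS⟩ := isCompact_univ.elim_finite_subcover V hV fun p _ ↦
    Set.mem_iUnion.2 ⟨p, hpV p⟩
  obtain ⟨ρ, hρ⟩ := SmoothPartitionOfUnity.exists_isSubordinate (𝓡 (2 * n)) isClosed_univ
    (fun i : S ↦ V i) (fun i ↦ hV i) (by
      intro x hx
      obtain ⟨i, hi, hxi⟩ := Set.mem_iUnion₂.1 (hS hx)
      exact Set.mem_iUnion.2 ⟨⟨i, hi⟩, hxi⟩)
  obtain ⟨f, hf⟩ := IsCorrection.exists_sum (J := J) (H := H) (s₀ := s₀) (s₁ := s₁) hL hcov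
    Finset.univ (ρ := fun i : S ↦ ρ i)
    fun i _ ↦ hVf i (ρ i) (ρ i).contMDiff (hρ i)
  refine ⟨f, ?_⟩
  have h1 : (fun x ↦ ∑ i : S, ρ i x) = fun _ ↦ (1 : ℝ) := by
    funext x
    rw [← finsum_eq_sum_of_fintype]
    exact ρ.sum_eq_one (Set.mem_univ x)
  rwa [h1] at hf

theorem covForm_const_smul {k : ℕ} {s : ∀ x, LPow L k x} (hs : IsSmoothSection n k s) (z : ℂ)
    {x : X} (v : L x) : covForm cov k v (fun x ↦ z • s x) = z • covForm cov k v s := by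
  rw [covForm, nabla_const_smul (hs.mdifferentiableAt x)]
  ext u
  simp [covForm]

theorem IsCorrection.const_smul (hL : IsSmoothHermitian L n) (hcov : IsPrequantumConnection Ω cov)
    {ρ : X → ℝ} {f : ∀ (k : ℕ) (x : X), LPow L k x}
    (h : IsCorrection Ω J cov H s₀ s₁ ρ f) (a : ℝ) :
    IsCorrection Ω J cov H s₀ s₁ (fun x ↦ a * ρ x) (fun k x ↦ (a : ℂ) • f k x) where
  smooth k := (h.smooth k).const_smul _
  eq_zero k x hx := by rw [h.eq_zero k x hx, smul_zero]
  eq_zero_of_left k x hx := by rw [h.eq_zero_of_left k x hx, smul_zero]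
  bound := by
    obtain ⟨C, hC, hb⟩ := h.bound
    refine ⟨‖(a : ℂ)‖ * C, by positivity, fun k hk x ↦ ⟨?_, fun u ↦ ?_⟩⟩
    · rw [powNorm_smul, mul_assoc]
      exact mul_le_mul_of_nonneg_left (hb k hk x).1 (norm_nonneg _)
    · rw [nabla_const_smul ((h.smooth k).mdifferentiableAt x), LinearMap.smul_apply, powNorm_smul,
        mul_assoc]
      exact mul_le_mul_of_nonneg_left ((hb k hk x).2 u) (norm_nonneg _)
  second := h.second.const_smul hL hcov h.smooth _
  pairing := by
    filter_upwards [h.pairing] with k hk x hx₀ hx₁ v hv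
    rw [covForm_const_smul (h.smooth k), poisson_smul_right, hk x hx₀ hx₁ v hv]
    push_cast
    ring

section Real

variable {c : X → X} {chat : ∀ x, L x →ₛₗ[starRingEnd ℂ] L (c x)}

theorem IsSymmetricSection.conjSection_eq (hchat : IsRealLineStructure cov c chat) {k : ℕ}
    {s : ∀ x, LPow L k x} (hs : IsSymmetricSection chat k s) : conjSection chat k s = s := by
  funext x
  apply chatPow_injective hchat.isometric k x
  rw [chatPow_conjSection hchat.isometric, hs]

theorem covForm_conjSection (hL : IsSmoothHermitian L n) (hcov : IsPrequantumConnection Ω cov)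
    (hc : IsRealStructure Ω J c) (hchat : IsRealLineStructure cov c chat) {k : ℕ}
    {f : ∀ x, LPow L k x} (hf : IsSmoothSection n k f) {x : X} {v : L x} (hv : ‖v‖ = 1) :
    covForm cov k v (conjSection chat k f) = Complex.conjAe.toLinearMap ∘ₗ
      covForm cov k (chat x v) f ∘ₗ (mfderiv (𝓡 (2 * n)) (𝓡 (2 * n)) c x).toLinearMap := by
  ext u
  have h := coordIn_chatPow hchat.isometric k hv (nabla cov k (conjSection chat k f) x u)
  rw [chatPow_nabla_conjSection hL hcov hc hchat hf] at h
  simp only [LinearMap.comp_apply, covForm_apply, ContinuousLinearMap.coe_coe,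
    AlgEquiv.toLinearMap_apply, Complex.conjAe_coe]
  rw [h, Complex.conj_conj]

theorem poisson_conjSection (hL : IsSmoothHermitian L n) (hΩ : IsSymplecticForm Ω)
    (hcov : IsPrequantumConnection Ω cov) (hH : ∀ x γ v, Ω x (H x γ) v = γ v)
    (hc : IsRealStructure Ω J c) (hchat : IsRealLineStructure cov c chat) {k : ℕ}
    {s t : ∀ x, LPow L k x} (hs : IsSmoothSection n k s) (ht : IsSmoothSection n k t) {x : X}
    {v : L x} (hv : ‖v‖ = 1) :
    poisson (H x) (covForm cov k v (conjSection chat k s)) (covForm cov k v (conjSection chat k t))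
      = -(starRingEnd ℂ)
        (poisson (H (c x)) (covForm cov k (chat x v) s) (covForm cov k (chat x v) t)) := by
  rw [covForm_conjSection hL hcov hc hchat hs hv, covForm_conjSection hL hcov hc hchat ht hv]
  refine poisson_antisymplectic (Φ := formAt Ω x) (Φ' := formAt Ω (c x)) (hH x) (hH (c x))
    (hΩ.nondegenerate (c x)) (fun w ↦ ?_) (hc.antisymplectic x) _ _
  have h1 := mfderiv_conjField hc (fun _ ↦ (w : RModel n)) x
  exact ⟨_, h1⟩

theorem powNorm_conj_symmetric (hchat : IsRealLineStructure cov c chat) {k : ℕ}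
    {s : ∀ x, LPow L k x} (hs : IsSymmetricSection chat k s) (x : X) :
    powNorm k (c x) (s (c x)) = powNorm k x (s x) := by
  rw [hs x, powNorm_chatPow hchat.isometric]

theorem conjSection_eq_zero (hchat : IsRealLineStructure cov c chat) {k : ℕ}
    {f : ∀ x, LPow L k x} {x : X} (h : f (c x) = 0) : conjSection chat k f x = 0 := by
  apply chatPow_injective hchat.isometric k x
  rw [chatPow_conjSection hchat.isometric, h]
  simp [chatPow]

/-- Both pairings at x are minus the conjugates of those at c x, since s₀ and s₁ are their own
conjugates. The equation is therefore preserved because the weight 1 is real and invariant under c,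
and the support conditions because |s₀| and |s₁| are invariant. -/
theorem IsCorrection.conjSection (hL : IsSmoothHermitian L n) (hΩ : IsSymplecticForm Ω)
    (hcov : IsPrequantumConnection Ω cov) (hH : ∀ x γ v, Ω x (H x γ) v = γ v)
    (hc : IsRealStructure Ω J c) (hchat : IsRealLineStructure cov c chat)
    (hs₀ : ∀ k, IsSmoothSection n k (s₀ k)) (hs₁ : ∀ k, IsSmoothSection n k (s₁ k))
    (hsymm₀ : ∀ k, IsSymmetricSection chat k (s₀ k))
    (hsymm₁ : ∀ k, IsSymmetricSection chat k (s₁ k)) {f : ∀ (k : ℕ) (x : X), LPow L k x}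
    (h : IsCorrection Ω J cov H s₀ s₁ (fun _ ↦ 1) f) :
    IsCorrection Ω J cov H s₀ s₁ (fun _ ↦ 1) (fun k ↦ _root_.conjSection chat k (f k)) where
  smooth k := (h.smooth k).conjSection hL hc hchat
  eq_zero k x hx := conjSection_eq_zero hchat (h.eq_zero k (c x) (by
    rwa [powNorm_conj_symmetric hchat (hsymm₀ k), powNorm_conj_symmetric hchat (hsymm₁ k)]))
  eq_zero_of_left k x hx := conjSection_eq_zero hchat (h.eq_zero_of_left k (c x) (by
    rw [hsymm₀ k x, hx]
    simp [chatPow]))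
  bound := by
    obtain ⟨C, hC, hb⟩ := h.bound
    refine ⟨C, hC, fun k hk x ↦ ⟨?_, fun u ↦ ?_⟩⟩
    · rw [← powNorm_chatPow hchat.isometric, chatPow_conjSection hchat.isometric]
      exact (hb k hk (c x)).1
    · rw [powNorm_nabla_conjSection hL hcov hc hchat (h.smooth k), ← gNorm_mfderiv hc]
      exact (hb k hk (c x)).2 _
  second := fun V hV ↦ by
    obtain ⟨C, hC, hb⟩ := h.second _ (contMDiff_conjField hc hV)
    refine ⟨C, hC, fun k hk x u ↦ ?_⟩
    rw [powNorm_nabla_nabla_conjSection hL hcov hc hchat (h.smooth k) hV, ← gNorm_mfderiv hc]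
    exact hb k hk (c x) _
  pairing := by
    filter_upwards [h.pairing] with k hk x hx₀ hx₁ v hv
    have e₀ := (hsymm₀ k).conjSection_eq hchat
    have e₁ := (hsymm₁ k).conjSection_eq hchat
    have h0 := poisson_conjSection hL hΩ hcov hH hc hchat (hs₀ k) (h.smooth k) hv
    have h1 := poisson_conjSection hL hΩ hcov hH hc hchat (hs₀ k) (hs₁ k) hv
    rw [e₀] at h0
    rw [e₀, e₁] at h1
    rw [h0, h1, hk (c x) (by rw [hsymm₀ k x, hx₀]; simp [chatPow])
      (by rw [hsymm₁ k x, hx₁]; simp [chatPow]) _ (by rw [hchat.isometric, hv])]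
    simp

/-- A symmetric correction. -/
theorem exists_symmetric_isCorrection (hL : IsSmoothHermitian L n) (hΩ : IsSymplecticForm Ω)
    (hJ : IsCompatibleComplexStructure Ω J) (hD : IsLeviCivita Ω J D)
    (hcov : IsPrequantumConnection Ω cov) (hH : ∀ x γ v, Ω x (H x γ) v = γ v)
    (hc : IsRealStructure Ω J c) (hchat : IsRealLineStructure cov c chat)
    (hs₀ : ∀ k, IsSmoothSection n k (s₀ k)) (hs₁ : ∀ k, IsSmoothSection n k (s₁ k))
    (hsymm₀ : ∀ k, IsSymmetricSection chat k (s₀ k))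
    (hsymm₁ : ∀ k, IsSymmetricSection chat k (s₁ k))
    (hF₀ : HasFirstBound Ω J cov s₀) (hF₁ : HasFirstBound Ω J cov s₁)
    (hS₀ : HasSecondBound Ω J cov s₀) (hS₁ : HasSecondBound Ω J cov s₁)
    (hpair : HasPairingBounds cov H s₀ s₁) :
    ∃ f, IsCorrection Ω J cov H s₀ s₁ (fun _ ↦ 1) f ∧ ∀ k, IsSymmetricSection chat k (f k) := by
  obtain ⟨f, hf⟩ := exists_isCorrection hL hΩ hJ hD hcov hH hs₀ hs₁ hF₀ hF₁ hS₀ hS₁ hpair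
  -- Average of f and its conjugate; the weights combine to (1 + 1)/2 = 1.
  have h := (hf.add hL hcov (hf.conjSection hL hΩ hcov hH hc hchat hs₀ hs₁ hsymm₀
    hsymm₁)).const_smul hL hcov 2⁻¹
  rw [show (fun _ : X ↦ (2⁻¹ : ℝ) * (1 + 1)) = fun _ ↦ 1 by norm_num] at h
  refine ⟨_, h, fun k x ↦ ?_⟩
  rw [chatPow_smul, chatPow_add, chatPow_conjSection hchat.isometric,
    conjSection_apply_conj hchat.involutive hchat.isometric, Complex.conj_ofReal, add_comm]

end Real

end GlobalCorrection

/-! ### From asymptotic holomorphicity and transversality to pairing bounds and normal positivity.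
-/

noncomputable section Transversality

variable {n : ℕ} {X : Type*} [TopologicalSpace X] [ChartedSpace (RModel n) X]
  [IsManifold (𝓡 (2 * n)) ∞ X]
  {L : X → Type*} [TopologicalSpace (TotalSpace ℂ L)]
  [∀ x, NormedAddCommGroup (L x)] [∀ x, InnerProductSpace ℂ (L x)]
  [FiberBundle ℂ L] [VectorBundle ℂ ℂ L] [VectorBundle ℝ ℂ L]
  {Ω : ∀ x : X, TangentSpace (𝓡 (2 * n)) x →L[ℝ] TangentSpace (𝓡 (2 * n)) x →L[ℝ] ℝ}
  {J : ∀ x : X, TangentSpace (𝓡 (2 * n)) x →L[ℝ] TangentSpace (𝓡 (2 * n)) x}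
  {D : CovariantDerivative (𝓡 (2 * n)) (RModel n) (TangentSpace (𝓡 (2 * n)) : X → Type _)}
  {cov : CovariantDerivative (𝓡 (2 * n)) ℂ L}
  {H : ∀ x : X, (TangentSpace (𝓡 (2 * n)) x →ₗ[ℝ] ℝ) →ₗ[ℝ] TangentSpace (𝓡 (2 * n)) x}
  {s₀ s₁ : ∀ (k : ℕ) (x : X), LPow L k x}

/-- The failure of complex linearity ∇s ∘ J - i∇s is -2i times the (0,1) part. -/
theorem powNorm_nabla_J_sub (k : ℕ) (s : ∀ x, LPow L k x) (x : X)
    (u : TangentSpace (𝓡 (2 * n)) x) :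
    powNorm k x (nabla cov k s x (J x u) - Complex.I • nabla cov k s x u)
      = 2 * powNorm k x (dbar J cov k s x u) := by
  have h : nabla cov k s x (J x u) - Complex.I • nabla cov k s x u
      = (-(2 * Complex.I)) • dbar J cov k s x u := by
    rw [dbar, smul_smul, smul_add, smul_smul]
    have e1 : -(2 * Complex.I) * 2⁻¹ = -Complex.I := by ring
    have e2 : -Complex.I * Complex.I = 1 := by rw [neg_mul, Complex.I_mul_I, neg_neg]
    rw [e1, e2, one_smul, neg_smul]
    abel
  rw [h, powNorm_smul]
  simp

/-- The bounds on the first derivatives of an AH sequence, read in a unit vector. -/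
theorem IsAH.exists_covForm_bounds {s : ∀ (k : ℕ) (x : X), LPow L k x} (h : IsAH Ω J D cov s) :
    ∃ C, 0 ≤ C ∧ ∀ k : ℕ, 1 ≤ k → ∀ x u,
      powNorm k x (nabla cov k (s k) x u) ≤ C * √k * gNorm Ω J x u ∧
      powNorm k x (nabla cov k (s k) x (J x u) - Complex.I • nabla cov k (s k) x u)
        ≤ 2 * C * gNorm Ω J x u := by
  obtain ⟨C, hC⟩ := h
  refine ⟨max C 0, le_max_right _ _, fun k hk x u ↦ ⟨((hC k hk x).2.1 u).trans ?_, ?_⟩⟩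
  · have := gNorm_nonneg (Ω := Ω) (J := J) u
    gcongr
    exact le_max_left _ _
  · rw [powNorm_nabla_J_sub, mul_assoc]
    have := gNorm_nonneg (Ω := Ω) (J := J) u
    refine mul_le_mul_of_nonneg_left (((hC k hk x).1 u).trans ?_) zero_le_two
    gcongr
    exact le_max_left _ _

theorem norm_covForm_J_sub (k : ℕ) (s : ∀ x, LPow L k x) {x : X} {v : L x} (hv : ‖v‖ = 1)
    (u : TangentSpace (𝓡 (2 * n)) x) :
    ‖covForm cov k v s (J x u) - Complex.I * covForm cov k v s u‖
      = powNorm k x (nabla cov k s x (J x u) - Complex.I • nabla cov k s x u) := by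
  rw [powNorm_eq k hv, map_sub, map_smul, smul_eq_mul]
  rfl

theorem pairNorm_le_of_sq_le (k : ℕ) (x : X) (w : LPow L k x × LPow L k x) {a : ℝ} (ha : 0 ≤ a)
    (h : powNorm k x w.1 ^ 2 + powNorm k x w.2 ^ 2 ≤ a ^ 2) : pairNorm k x w ≤ a :=
  Real.sqrt_le_iff.2 ⟨ha, h⟩

theorem pairNorm_zero_right (k : ℕ) (x : X) (t : LPow L k x) :
    pairNorm k x (t, 0) = powNorm k x t := by
  have h0 : powNorm k x (0 : LPow L k x) = 0 := (powNorm_eq_zero k).2 rfl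
  simp only [pairNorm, h0]
  rw [zero_pow two_ne_zero, add_zero, Real.sqrt_sq (powNorm_nonneg k t)]

theorem pairNorm_zero_left (k : ℕ) (x : X) (t : LPow L k x) :
    pairNorm k x (0, t) = powNorm k x t := by
  have h0 : powNorm k x (0 : LPow L k x) = 0 := (powNorm_eq_zero k).2 rfl
  simp only [pairNorm, h0]
  rw [zero_pow two_ne_zero, zero_add, Real.sqrt_sq (powNorm_nonneg k t)]

theorem tendsto_sqrt_natCast : Tendsto (fun k : ℕ ↦ √(k : ℝ)) atTop atTop :=
  Real.tendsto_sqrt_atTop.comp tendsto_natCast_atTop_atTop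

/-- For AH sections ∇s₀ and ∇s₁ are of order √k and complex linear up to O(1), so in their mutual
pairing the leading order k disappears. Transversality provides a vector of length O(k^{-1/2}) on
which ∇s₀ equals 1, which forces the pairing with the conjugate to be of order k. -/
theorem hasPairingBounds (hΩ : IsSymplecticForm Ω) (hJ : IsCompatibleComplexStructure Ω J)
    (hH : ∀ x γ v, Ω x (H x γ) v = γ v) (h₀ : IsAH Ω J D cov s₀) (h₁ : IsAH Ω J D cov s₁)
    (htrans : ∃ η : ℝ, 0 < η ∧ ∀ᶠ k : ℕ in atTop, IsPairTransverse Ω J cov η k (s₀ k) (s₁ k)) :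
    HasPairingBounds cov H s₀ s₁ := by
  obtain ⟨C₀, hC₀, h₀⟩ := h₀.exists_covForm_bounds
  obtain ⟨C₁, hC₁, h₁⟩ := h₁.exists_covForm_bounds
  obtain ⟨η, hη, htrans⟩ := htrans
  refine ⟨8 * (C₀ * C₁), η ^ 2, by positivity, by positivity, ?_⟩
  -- √k ≥ 1/η brings the region |s|² ≤ 1/k inside |s| ≤ η, where transversality applies; √k ≥
  -- 4C₀²/η² keeps the error 2C₀²√k below half of η²k.
  filter_upwards [htrans, eventually_ge_atTop 1, tendsto_sqrt_natCast.eventually_ge_atTop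
    (4 * C₀ ^ 2 / η ^ 2), tendsto_sqrt_natCast.eventually_ge_atTop η⁻¹] with k ht hk hk1 hk2 x hx v hv
  have hk0 : (1 : ℝ) ≤ √k := by
    rw [Real.one_le_sqrt]
    exact_mod_cast hk
  have hkk : √(k : ℝ) * √k = k := Real.mul_self_sqrt (Nat.cast_nonneg k)
  have hcp := compatiblePair hΩ hJ x
  have hα (u) : ‖covForm cov k v (s₀ k) u‖ ≤ C₀ * √k * compatNorm (formAt Ω x) (J x).toLinearMap u := by
    rw [covForm_apply, ← powNorm_eq k hv]
    exact (h₀ k hk x u).1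
  have hβ (u) : ‖covForm cov k v (s₁ k) u‖ ≤ C₁ * √k * compatNorm (formAt Ω x) (J x).toLinearMap u := by
    rw [covForm_apply, ← powNorm_eq k hv]
    exact (h₁ k hk x u).1
  have hαJ (u) := (norm_covForm_J_sub (J := J) (cov := cov) k (s₀ k) hv u).trans_le (h₀ k hk x u).2
  have hβJ (u) := (norm_covForm_J_sub (J := J) (cov := cov) k (s₁ k) hv u).trans_le (h₁ k hk x u).2
  constructor
  · refine (hcp.norm_poisson_le_of_almost_complex (hH x) (hΩ.nondegenerate x) (by positivity)
      (by positivity) (by positivity) (by positivity) hα hβ hαJ hβJ).trans ?_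
    have : 0 ≤ C₀ * C₁ := by positivity
    nlinarith
  · obtain ⟨R, hR, hRn⟩ := ht x (pairNorm_le_of_sq_le k x _ hη.le (hx.trans (by
      rw [← hkk, mul_inv, ← pow_two]
      exact pow_le_pow_left₀ (by positivity) (inv_le_of_inv_le₀ hη hk2) 2)))
    obtain ⟨t, ht⟩ : ∃ t : LPow L k x, coordIn k v t = 1 :=
      ⟨_, coordIn_self k hv⟩
    have hRt := hRn (t, 0)
    rw [pairNorm_zero_right, powNorm_eq k hv, ht, norm_one, mul_one] at hRt
    have hone : covForm cov k v (s₀ k) (R (t, 0)) = 1 := by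
      have h2 := congrArg Prod.fst (hR (t, 0))
      rw [covForm_apply, ← ht]
      exact congrArg _ h2
    have h3 := hcp.le_norm_poisson_conj (hH x) (hΩ.nondegenerate x) (A := C₀ * √k) (B := 2 * C₀)
      (r := (η * √k)⁻¹) (by positivity) (by positivity) (by positivity) hα hαJ hone hRt
    refine le_trans ?_ h3
    rw [inv_inv, mul_pow, Real.sq_sqrt (Nat.cast_nonneg k)]
    rw [div_le_iff₀ (by positivity)] at hk1
    have : 4 * C₀ ^ 2 * √k ≤ √k * η ^ 2 * √k := by gcongr
    nlinarith

section Normal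

theorem exists_complex_functional (l : ℂ × ℂ →ₗ[ℝ] ℝ) :
    ∃ a b : ℂ, ∀ z w : ℂ, l (z, w) = (a * z + b * w).re := by
  refine ⟨⟨l (1, 0), -l (Complex.I, 0)⟩, ⟨l (0, 1), -l (0, Complex.I)⟩, fun z w ↦ ?_⟩
  have h : ((z, w) : ℂ × ℂ) = z.re • (1, 0) + z.im • (Complex.I, 0) + w.re • (0, 1)
      + w.im • (0, Complex.I) := by
    ext <;> simp
  rw [h]
  simp only [map_add, map_smul]
  simp
  ring

/-- If the Poisson pairing of the two derivatives vanishes, then `ω` is of type `(1,1)` and positive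
on the symplectic normal space. -/
theorem isNormalPositive_of_poisson (hΩ : IsSymplecticForm Ω)
    (hJ : IsCompatibleComplexStructure Ω J) (hH : ∀ x γ v, Ω x (H x γ) v = γ v) {k : ℕ}
    {t₀ t₁ : ∀ x, LPow L k x} {x : X} {v : L x} (hv : ‖v‖ = 1)
    (h : poisson (H x) (covForm cov k v t₀) (covForm cov k v t₁) = 0)
    {R : LPow L k x × LPow L k x →ₗ[ℝ] TangentSpace (𝓡 (2 * n)) x} {r B : ℝ}
    (hR : ∀ w, pairNabla cov k t₀ t₁ x (R w) = w)
    (hRn : ∀ w, gNorm Ω J x (R w) ≤ r * pairNorm k x w) (hr : 0 ≤ r)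
    (hB : ∀ u, pairNorm k x (pairNabla cov k t₀ t₁ x (J x u)
      - Complex.I • pairNabla cov k t₀ t₁ x u) ≤ B * gNorm Ω J x u) (hrB : r * B < 1) :
    IsNormalPositive Ω cov k t₀ t₁ x := by
  have hcp := compatiblePair hΩ hJ x
  have : FiniteDimensional ℝ (LPow L k x) :=
    ((coordEquiv k hv).restrictScalars ℝ).symm.finiteDimensional
  have : FiniteDimensional ℝ (TangentSpace (𝓡 (2 * n)) x) :=
    inferInstanceAs (FiniteDimensional ℝ (RModel n))
  set α := covForm cov k v t₀ with hα
  set β := covForm cov k v t₁ with hβ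
  -- By antisymmetry the single equation Π(α, β) = 0 makes Π vanish on the whole complex span of α
  -- and β.
  have hpair : ∀ a b : ℂ, poisson (H x) α (a • α + b • β) = 0
      ∧ poisson (H x) β (a • α + b • β) = 0 := fun a b ↦ by
    rw [poisson_add_right, poisson_add_right]
    simp only [poisson_smul_right, hcp.poisson_self (hH x), h, hcp.poisson_antisymm (hH x) β α]
    simp
  refine hcp.normal_positive (D := pairNabla cov k t₀ t₁ x) (hH x) hR hRn hr hB hrB (fun l ↦ ?_)
    fun u ↦ Iff.rfl
  set E : (LPow L k x × LPow L k x) ≃ₗ[ℝ] ℂ × ℂ :=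
    ((coordEquiv k hv).restrictScalars ℝ).prodCongr ((coordEquiv k hv).restrictScalars ℝ) with hE
  obtain ⟨a, b, hab⟩ := exists_complex_functional (l ∘ₗ E.symm.toLinearMap)
  have hl (w : LPow L k x × LPow L k x) : l w = (a * coordIn k v w.1 + b * coordIn k v w.2).re := by
    rw [← hab]
    simp only [LinearMap.comp_apply]
    congr 1
    exact (E.symm_apply_apply w).symm
  -- A real functional is the real part of a complex one, so l ∘ D is the real part of γ = aα + bβ
  -- and l ∘ i ∘ D is minus its imaginary part. The required identity becomes D(H(Re γ)) + i D(H(Im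
  -- γ)) = 0, whose two components are Π(α, γ) and Π(β, γ).
  have e₁ : l ∘ₗ pairNabla cov k t₀ t₁ x = Complex.reLm ∘ₗ (a • α + b • β) := by
    ext u
    simp only [LinearMap.comp_apply, hl]
    rfl
  have e₂ : l ∘ₗ (LinearMap.lsmul ℂ (LPow L k x × LPow L k x) Complex.I).restrictScalars ℝ
      ∘ₗ pairNabla cov k t₀ t₁ x = -(Complex.imLm ∘ₗ (a • α + b • β)) := by
    ext u
    have h1 : l (Complex.I • pairNabla cov k t₀ t₁ x u)
        = (a * (Complex.I * α u) + b * (Complex.I * β u)).re := by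
      rw [hl, Prod.smul_fst, Prod.smul_snd, map_smul, map_smul]
      rfl
    refine h1.trans ?_
    simp
    ring
  rw [e₁, e₂, map_neg, map_neg, smul_neg, eq_neg_iff_add_eq_zero]
  have key (γ : TangentSpace (𝓡 (2 * n)) x →ₗ[ℝ] ℂ) (t : ∀ x, LPow L k x)
      (ht : γ = covForm cov k v t) (h0 : poisson (H x) γ (a • α + b • β) = 0) :
      nabla cov k t x (H x (Complex.reLm ∘ₗ (a • α + b • β)))
        + Complex.I • nabla cov k t x (H x (Complex.imLm ∘ₗ (a • α + b • β))) = 0 := by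
    apply coordIn_injective k hv
    rw [map_add, map_smul, map_zero, smul_eq_mul, ← h0, ht]
    rfl
  exact Prod.ext (key α t₀ rfl (hpair a b).1) (key β t₁ rfl (hpair a b).2)

end Normal

end Transversality

/-! ### Stability of transversality and of asymptotic holomorphicity under corrections. -/

noncomputable section Perturbation

variable {n : ℕ} {X : Type*} [TopologicalSpace X] [ChartedSpace (RModel n) X]
  [IsManifold (𝓡 (2 * n)) ∞ X] [T2Space X] [CompactSpace X]
  {L : X → Type*} [TopologicalSpace (TotalSpace ℂ L)]
  [∀ x, NormedAddCommGroup (L x)] [∀ x, InnerProductSpace ℂ (L x)]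
  [FiberBundle ℂ L] [VectorBundle ℂ ℂ L] [VectorBundle ℝ ℂ L]
  [ContMDiffVectorBundle ∞ ℂ L (𝓡 (2 * n))]
  {Ω : ∀ x : X, TangentSpace (𝓡 (2 * n)) x →L[ℝ] TangentSpace (𝓡 (2 * n)) x →L[ℝ] ℝ}
  {J : ∀ x : X, TangentSpace (𝓡 (2 * n)) x →L[ℝ] TangentSpace (𝓡 (2 * n)) x}
  {D : CovariantDerivative (𝓡 (2 * n)) (RModel n) (TangentSpace (𝓡 (2 * n)) : X → Type _)}
  {cov : CovariantDerivative (𝓡 (2 * n)) ℂ L}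
  {H : ∀ x : X, (TangentSpace (𝓡 (2 * n)) x →ₗ[ℝ] ℝ) →ₗ[ℝ] TangentSpace (𝓡 (2 * n)) x}
  {s₀ s₁ f : ∀ (k : ℕ) (x : X), LPow L k x}

theorem pairNorm_eq (k : ℕ) {x : X} {v : L x} (hv : ‖v‖ = 1) (w : LPow L k x × LPow L k x) :
    pairNorm k x w = ‖WithLp.toLp 2 (coordIn k v w.1, coordIn k v w.2)‖ := by
  rw [WithLp.prod_norm_eq_of_L2, pairNorm, powNorm_eq k hv, powNorm_eq k hv]
  rfl

theorem pairNorm_add_le (k : ℕ) {x : X} (w w' : LPow L k x × LPow L k x) :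
    pairNorm k x (w + w') ≤ pairNorm k x w + pairNorm k x w' := by
  obtain ⟨v, hv⟩ := exists_unit (L := L) x
  simp only [pairNorm_eq k hv, Prod.fst_add, Prod.snd_add, map_add]
  exact norm_add_le (WithLp.toLp 2 (coordIn k v w.1, coordIn k v w.2))
    (WithLp.toLp 2 (coordIn k v w'.1, coordIn k v w'.2))

theorem pairNorm_neg (k : ℕ) {x : X} (w : LPow L k x × LPow L k x) :
    pairNorm k x (-w) = pairNorm k x w := by
  obtain ⟨v, hv⟩ := exists_unit (L := L) x
  simp only [pairNorm, powNorm_eq k hv, Prod.fst_neg, Prod.snd_neg, map_neg, norm_neg]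

theorem pairNorm_le_add (k : ℕ) {x : X} (t t' : LPow L k x) :
    pairNorm k x (t, t') ≤ powNorm k x t + powNorm k x t' := by
  have h := pairNorm_add_le k (t, 0) (0, t')
  rwa [pairNorm_zero_left, pairNorm_zero_right, Prod.mk_add_mk, add_zero, zero_add] at h

theorem eq_zero_of_pairNorm_le (k : ℕ) {x : X} {w : LPow L k x × LPow L k x}
    (h : pairNorm k x w ≤ 0) : w = 0 := by
  have h1 := Real.sqrt_eq_zero'.1 (le_antisymm h (Real.sqrt_nonneg _))
  have h2 : powNorm k x w.1 = 0 := by nlinarith [sq_nonneg (powNorm k x w.1), sq_nonneg (powNorm k x w.2)]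
  have h3 : powNorm k x w.2 = 0 := by nlinarith [sq_nonneg (powNorm k x w.1), sq_nonneg (powNorm k x w.2)]
  exact Prod.ext ((powNorm_eq_zero k).1 h2) ((powNorm_eq_zero k).1 h3)

/-- A change of the values by at most η/2 keeps the new small region inside the old one. A change of
the derivative that is small compared with η√k keeps the right inverse at the cost of a factor 2,
which is exactly the passage from η to η/2. -/
theorem IsPairTransverse.of_perturbation {k : ℕ} {η C : ℝ} (hη : 0 < η)
    {t₀ t₁ t₀' t₁' : ∀ x, LPow L k x} (h : IsPairTransverse Ω J cov η k t₀ t₁) (hC : 0 ≤ C)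
    (hval : ∀ x, pairNorm k x (t₀ x - t₀' x, t₁ x - t₁' x) ≤ η / 2)
    (hder : ∀ x u, pairNorm k x (pairNabla cov k t₀ t₁ x u - pairNabla cov k t₀' t₁' x u)
      ≤ C * gNorm Ω J x u) (hCη : C * (η * √k)⁻¹ ≤ 1 / 2) :
    IsPairTransverse Ω J cov (η / 2) k t₀' t₁' := by
  intro x hx
  obtain ⟨v, hv⟩ := exists_unit (L := L) x
  have : FiniteDimensional ℝ (LPow L k x) :=
    ((coordEquiv k hv).restrictScalars ℝ).symm.finiteDimensional
  have hx' : pairNorm k x (t₀ x, t₁ x) ≤ η := by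
    have h1 := pairNorm_add_le k (t₀ x - t₀' x, t₁ x - t₁' x) (t₀' x, t₁' x)
    rw [Prod.mk_add_mk, sub_add_cancel, sub_add_cancel] at h1
    linarith [hval x]
  obtain ⟨R, hR, hRn⟩ := h x hx'
  obtain ⟨R', hR', hRn'⟩ := exists_rightInverse_of_perturbation hR hRn (pairNorm_add_le k)
    (fun w ↦ eq_zero_of_pairNorm_le k) (by simp [pairNorm, powNorm]) (by positivity) hC (hder x) hCη
  refine ⟨R', hR', fun w ↦ (hRn' w).trans_eq ?_⟩
  congr 1
  rw [mul_inv, mul_inv, inv_div]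
  ring

/-- Adding a correction preserves asymptotic holomorphicity. -/
theorem IsCorrection.isAH_add (hL : IsSmoothHermitian L n) (hΩ : IsSymplecticForm Ω)
    (hJ : IsCompatibleComplexStructure Ω J) (hD : IsLeviCivita Ω J D)
    (hcov : IsPrequantumConnection Ω cov) {ρ : X → ℝ} (h : IsCorrection Ω J cov H s₀ s₁ ρ f)
    {s : ∀ (k : ℕ) (x : X), LPow L k x} (hs : ∀ k, IsSmoothSection n k (s k))
    (hAH : IsAH Ω J D cov s) : IsAH Ω J D cov fun k x ↦ s k x + f k x := by
  have hsm (k : ℕ) := (hs k).add (h.smooth k)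
  obtain ⟨C, hC, hb⟩ := h.bound
  obtain ⟨C₁, hC₁, h₁⟩ := hAH.hasFirstBound
  have hnab (k : ℕ) (x : X) (u : TangentSpace (𝓡 (2 * n)) x) :
      nabla cov k (fun x ↦ s k x + f k x) x u = nabla cov k (s k) x u + nabla cov k (f k) x u := by
    rw [nabla_add ((hs k).mdifferentiableAt x) ((h.smooth k).mdifferentiableAt x)]
    rfl
  have hfirst (k : ℕ) (hk : 1 ≤ k) (x : X) (u : TangentSpace (𝓡 (2 * n)) x) :
      powNorm k x (nabla cov k (fun x ↦ s k x + f k x) x u) ≤ (C₁ + C) * √k * gNorm Ω J x u := by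
    rw [hnab]
    refine (powNorm_add_le k _ _).trans ((add_le_add (h₁ k hk x u) ((hb k hk x).2 u)).trans ?_)
    have hk1 : (1 : ℝ) ≤ √k := by
      rw [Real.one_le_sqrt]
      exact_mod_cast hk
    rw [add_mul, add_mul]
    have := gNorm_nonneg (Ω := Ω) (J := J) u
    gcongr
    exact le_mul_of_one_le_right hC hk1
  -- The second-order bounds are added in the form that uses smooth fields, where additivity is
  -- immediate, and then converted back to ∇∇.
  obtain ⟨C₂, hC₂⟩ := exists_bound_nablaTwo hL hΩ hJ hD hcov hsm
    ⟨C₁ + C, by positivity, hfirst⟩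
    ((hAH.hasSecondBound hL hΩ hJ hD hcov hs).add hL hcov hs h.smooth h.second)
  obtain ⟨C₀, hC₀⟩ := hAH
  refine ⟨max (C₀ + C) (max (C₁ + C) C₂), fun k hk x ↦ ⟨fun u ↦ ?_, fun u ↦ ?_, fun u v ↦ ?_⟩⟩
  · have hg := gNorm_nonneg (Ω := Ω) (J := J) u
    have hgJ : gNorm Ω J x (J x u) = gNorm Ω J x u := (compatiblePair hΩ hJ x).norm_J u
    have h2 : dbar J cov k (fun x ↦ s k x + f k x) x u
        = dbar J cov k (s k) x u + dbar J cov k (f k) x u := by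
      simp only [dbar, hnab]
      rw [← smul_add, smul_add Complex.I]
      congr 1
      abel
    have h3 : powNorm k x (dbar J cov k (f k) x u) ≤ C * gNorm Ω J x u := by
      rw [dbar, powNorm_smul]
      have i1 := (hb k hk x).2 u
      have i2 := (hb k hk x).2 (J x u)
      have i3 := powNorm_add_le k (nabla cov k (f k) x u) (Complex.I • nabla cov k (f k) x (J x u))
      rw [powNorm_smul, Complex.norm_I, one_mul] at i3
      rw [hgJ] at i2
      rw [norm_inv, RCLike.norm_ofNat]
      linarith
    rw [h2]
    calc _ ≤ _ := powNorm_add_le k _ _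
      _ ≤ C₀ * gNorm Ω J x u + C * gNorm Ω J x u := add_le_add ((hC₀ k hk x).1 u) h3
      _ = (C₀ + C) * gNorm Ω J x u := by ring
      _ ≤ _ := by
        gcongr
        exact le_max_left _ _
  · refine (hfirst k hk x u).trans ?_
    have hg := gNorm_nonneg (Ω := Ω) (J := J) u
    gcongr
    exact (le_max_left _ _).trans (le_max_right _ _)
  · refine (hC₂ x k hk u v).trans ?_
    have hg := gNorm_nonneg (Ω := Ω) (J := J) u
    have hg' := gNorm_nonneg (Ω := Ω) (J := J) v
    gcongr
    exact (le_max_right _ _).trans (le_max_right _ _)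

end Perturbation

/-! ### The theorem: only the second section is perturbed, by a symmetric correction. -/

theorem proposition9 {n : ℕ} {X : Type*} [TopologicalSpace X] [T2Space X] [CompactSpace X]
    [ChartedSpace (RModel n) X] [IsManifold (𝓡 (2 * n)) ∞ X]
    {L : X → Type*} [TopologicalSpace (TotalSpace ℂ L)]
    [∀ x, NormedAddCommGroup (L x)] [∀ x, InnerProductSpace ℂ (L x)]
    [FiberBundle ℂ L] [VectorBundle ℂ ℂ L] [VectorBundle ℝ ℂ L]
    [ContMDiffVectorBundle ∞ ℂ L (𝓡 (2 * n))]
    (hL : IsSmoothHermitian L n)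
    -- the symplectic form, the compatible almost complex structure and the real structure
    (Ω : ∀ x : X, TangentSpace (𝓡 (2 * n)) x →L[ℝ] TangentSpace (𝓡 (2 * n)) x →L[ℝ] ℝ)
    (hΩ : IsSymplecticForm Ω)
    (J : ∀ x : X, TangentSpace (𝓡 (2 * n)) x →L[ℝ] TangentSpace (𝓡 (2 * n)) x)
    (hJ : IsCompatibleComplexStructure Ω J)
    (c : X → X) (hc : IsRealStructure Ω J c)
    -- the Levi-Civita connection of `g = Ω(·, J·)`
    (D : CovariantDerivative (𝓡 (2 * n)) (RModel n) (TangentSpace (𝓡 (2 * n)) : X → Type _))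
    (hD : IsLeviCivita Ω J D)
    -- the unitary connection of curvature `-iΩ` on `L` and the real structure of `L`
    (cov : CovariantDerivative (𝓡 (2 * n)) ℂ L) (hcov : IsPrequantumConnection Ω cov)
    (chat : ∀ x, L x →ₛₗ[starRingEnd ℂ] L (c x)) (hchat : IsRealLineStructure cov c chat)
    -- two AH sequences of symmetric sections, with `s₀ ⊕ s₁` uniformly transverse for large `k`
    (s₀ s₁ : ∀ (k : ℕ) (x : X), LPow L k x)
    (hsmooth₀ : ∀ k, IsSmoothSection n k (s₀ k)) (hsmooth₁ : ∀ k, IsSmoothSection n k (s₁ k))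
    (hsymm₀ : ∀ k, IsSymmetricSection chat k (s₀ k))
    (hsymm₁ : ∀ k, IsSymmetricSection chat k (s₁ k))
    (hAH₀ : IsAH Ω J D cov s₀) (hAH₁ : IsAH Ω J D cov s₁)
    (htrans : ∃ η : ℝ, 0 < η ∧ ∀ᶠ k : ℕ in atTop, IsPairTransverse Ω J cov η k (s₀ k) (s₁ k))
    (δ : ℝ) (hδ : 0 < δ) :
    ∃ t₀ t₁ : ∀ (k : ℕ) (x : X), LPow L k x,
      -- the perturbed sequences are again smooth, symmetric, AH and uniformly transverse
      (∀ k, IsSmoothSection n k (t₀ k)) ∧ (∀ k, IsSmoothSection n k (t₁ k)) ∧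
      (∀ k, IsSymmetricSection chat k (t₀ k)) ∧ (∀ k, IsSymmetricSection chat k (t₁ k)) ∧
      IsAH Ω J D cov t₀ ∧ IsAH Ω J D cov t₁ ∧
      (∃ η : ℝ, 0 < η ∧ ∀ᶠ k : ℕ in atTop, IsPairTransverse Ω J cov η k (t₀ k) (t₁ k)) ∧
      -- the perturbation is small
      (∃ C : ℝ, ∀ᶠ k : ℕ in atTop, ∀ x : X,
        pairNorm k x (t₀ k x - s₀ k x, t₁ k x - s₁ k x) ≤ C / Real.sqrt k ∧
        ∀ u : TangentSpace (𝓡 (2 * n)) x,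
          pairNorm k x (pairNabla cov k (t₀ k) (t₁ k) x u - pairNabla cov k (s₀ k) (s₁ k) x u)
            ≤ C * gNorm Ω J x u) ∧
      ∀ᶠ k : ℕ in atTop,
        -- it is supported near `N` and does not change `N`
        (∀ x, δ ≤ pairNorm k x (s₀ k x, s₁ k x) → t₀ k x = s₀ k x ∧ t₁ k x = s₁ k x) ∧
        (∀ x, (t₀ k x = 0 ∧ t₁ k x = 0) ↔ (s₀ k x = 0 ∧ s₁ k x = 0)) ∧
        -- `F = t₁ / t₀` is symmetric
        IsSymmetricPencil c k (t₀ k) (t₁ k) ∧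
        -- along `N`, `Ω` restricted to `N₀` is `(1,1)` and positive for `j(D)`
        (∀ x, t₀ k x = 0 ∧ t₁ k x = 0 → IsNormalPositive Ω cov k (t₀ k) (t₁ k) x) := by
  have hfin (x : X) : FiniteDimensional ℝ (TangentSpace (𝓡 (2 * n)) x) :=
    inferInstanceAs (FiniteDimensional ℝ (RModel n))
  choose H hH using fun x : X ↦ exists_hamiltonian (Φ := formAt Ω x) (hΩ.nondegenerate x)
  have hH' : ∀ x γ v, Ω x (H x γ) v = γ v := hH
  obtain ⟨f, hf, hfsymm⟩ := exists_symmetric_isCorrection hL hΩ hJ hD hcov hH' hc hchat hsmooth₀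
    hsmooth₁ hsymm₀ hsymm₁ hAH₀.hasFirstBound hAH₁.hasFirstBound
    (hAH₀.hasSecondBound hL hΩ hJ hD hcov hsmooth₀)
    (hAH₁.hasSecondBound hL hΩ hJ hD hcov hsmooth₁)
    (hasPairingBounds hΩ hJ hH' hAH₀ hAH₁ htrans)
  obtain ⟨C, hC, hb⟩ := hf.bound
  obtain ⟨η, hη, htrans⟩ := htrans
  set t₁ : ∀ (k : ℕ) (x : X), LPow L k x := fun k x ↦ s₁ k x + f k x with ht₁
  have hAHt : IsAH Ω J D cov t₁ := hf.isAH_add hL hΩ hJ hD hcov hsmooth₁ hAH₁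
  have hsub (k : ℕ) (x : X) (u : TangentSpace (𝓡 (2 * n)) x) :
      pairNabla cov k (s₀ k) (t₁ k) x u - pairNabla cov k (s₀ k) (s₁ k) x u
        = (0, nabla cov k (f k) x u) := by
    simp only [pairNabla, LinearMap.prod_apply, Function.prod_apply, Prod.mk_sub_mk, sub_self, ht₁]
    rw [nabla_add ((hsmooth₁ k).mdifferentiableAt x) ((hf.smooth k).mdifferentiableAt x),
      LinearMap.add_apply, add_sub_cancel_left]
  have hinv : Tendsto (fun k : ℕ ↦ (k : ℝ)⁻¹) atTop (𝓝 0) := tendsto_inv_atTop_nhds_zero_nat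
  have htr : ∀ᶠ k : ℕ in atTop, IsPairTransverse Ω J cov (η / 2) k (s₀ k) (t₁ k) := by
    have h1 : ∀ᶠ k : ℕ in atTop, C * (k : ℝ)⁻¹ < η / 2 := by
      have := hinv.const_mul C
      rw [mul_zero] at this
      exact this.eventually_lt_const (by positivity)
    -- √k ≥ 2C/η is the condition that the O(1) change of the derivative be at most half of η√k.
    filter_upwards [htrans, h1, eventually_ge_atTop 1,
      tendsto_sqrt_natCast.eventually_ge_atTop (2 * C / η)] with k hk hk1 hk2 hk3
    refine hk.of_perturbation hη hC (fun x ↦ ?_) (fun x u ↦ ?_) ?_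
    · have h2 : (s₀ k x - s₀ k x, s₁ k x - t₁ k x) = -((0, f k x) : LPow L k x × LPow L k x) := by
        simp [ht₁]
      rw [h2, pairNorm_neg, pairNorm_zero_left]
      exact (hb k hk2 x).1.trans hk1.le
    · rw [← neg_sub, hsub, pairNorm_neg, pairNorm_zero_left]
      exact (hb k hk2 x).2 u
    · have hk4 : 0 < √(k : ℝ) := Real.sqrt_pos.2 (by exact_mod_cast hk2)
      rw [div_le_iff₀ hη] at hk3
      rw [← div_eq_mul_inv, div_le_iff₀ (by positivity)]
      linarith
  have ht₁symm (k : ℕ) : IsSymmetricSection chat k (t₁ k) := fun x ↦ by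
    simp only [ht₁]
    rw [hsymm₁ k x, hfsymm k x, chatPow_add]
  -- The correction vanishes wherever s₀ does, so the second section is unchanged on the zeros of
  -- the first and the common zero set stays the same.
  have hz (k : ℕ) (x : X) (h : s₀ k x = 0) : t₁ k x = s₁ k x := by
    simp only [ht₁]
    rw [hf.eq_zero_of_left k x h, add_zero]
  have hzero (k : ℕ) (x : X) : (s₀ k x = 0 ∧ t₁ k x = 0) ↔ (s₀ k x = 0 ∧ s₁ k x = 0) :=
    and_congr_right fun h ↦ by rw [hz k x h]
  refine ⟨s₀, t₁, hsmooth₀, fun k ↦ (hsmooth₁ k).add (hf.smooth k), hsymm₀, ht₁symm, hAH₀, hAHt,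
    ⟨η / 2, by positivity, htr⟩, ⟨C, ?_⟩, ?_⟩
  · filter_upwards [eventually_ge_atTop 1] with k hk x
    have hk1 : (1 : ℝ) ≤ k := by exact_mod_cast hk
    have hk4 : 0 < √(k : ℝ) := Real.sqrt_pos.2 (by linarith)
    constructor
    · rw [sub_self, show t₁ k x - s₁ k x = f k x by simp [ht₁], pairNorm_zero_left, div_eq_mul_inv]
      refine (hb k hk x).1.trans ?_
      have := sqrt_natCast_le hk
      gcongr
    · intro u
      rw [hsub, pairNorm_zero_left]
      exact (hb k hk x).2 u
  · obtain ⟨C₀, hC₀, hb₀⟩ := hAH₀.exists_covForm_bounds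
    obtain ⟨C₁, hC₁, hb₁⟩ := hAHt.exists_covForm_bounds
    -- 1/k < δ² confines the support of the correction to |s| < δ. The bound √k > 4(C₀ + C₁)/η says
    -- that the defect of complex linearity, 2(C₀ + C₁), times the norm of the right inverse for
    -- transversality η/2 is less than 1.
    filter_upwards [htr, hf.pairing, eventually_ge_atTop 1, hinv.eventually_lt_const (sq_pos_of_pos hδ),
      tendsto_sqrt_natCast.eventually_gt_atTop (4 * (C₀ + C₁) / η)] with k htk hpk hk hkδ hkη
    have hk4 : 0 < √(k : ℝ) := Real.sqrt_pos.2 (by exact_mod_cast hk)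
    refine ⟨fun x hx ↦ ⟨rfl, ?_⟩, hzero k,
      isSymmetricPencil_of_symmetric hchat.isometric (hsymm₀ k) (ht₁symm k), fun x hx ↦ ?_⟩
    · have h1 := (Real.le_sqrt' hδ).1 hx
      simp only [ht₁]
      rw [hf.eq_zero k x (hkδ.le.trans h1), add_zero]
    · obtain ⟨v, hv⟩ := exists_unit (L := L) x
      obtain ⟨h0, h1⟩ := (hzero k x).1 hx
      obtain ⟨R, hR, hRn⟩ := htk x (by
        rw [hx.1, hx.2, pairNorm_zero_left, (powNorm_eq_zero k).2 rfl]
        positivity)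
      refine isNormalPositive_of_poisson hΩ hJ hH' hv ?_ hR hRn (by positivity)
        (B := 2 * (C₀ + C₁)) (fun u ↦ ?_) ?_
      · simp only [ht₁]
        rw [covForm_add (hsmooth₁ k) (hf.smooth k), poisson_add_right, hpk x h0 h1 v hv]
        simp
      · refine (pairNorm_le_add k _ _).trans ((add_le_add (hb₀ k hk x u).2 (hb₁ k hk x u).2).trans_eq ?_)
        ring
      · rw [div_lt_iff₀ hη] at hkη
        rw [inv_mul_lt_iff₀ (by positivity)]
        linarith
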